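/- Let $(\epsilon_k)_{k\in\mathbb Z}$ be i.i.d. random elements of a measurable space $S$, let $(\epsilon_k')_{k\in\mathbb Z}$ be an independent copy of this sequence on the same probability space, and let $X_k=g_k(\epsilon_k,\epsilon_{k-1},\dots)$, $k\in\mathbb Z$, with measurable functions $g_k:S^{\mathbb N_0}\to\mathbb R$, be a (strictly) stationary real-valued sequence. (The case $g_k=g$ for all $k$, a time-homogeneous Bernoulli shift, is included; it is automatically stationary.) For $l\ge 1$ put $$X_k^{(l,\prime)}=g_k(\epsilon_k,\dots,\epsilon_{k-l+1},\epsilon_{k-l}',\epsilon_{k-l-1},\dots),\qquad X_k^{(l,*)}=g_k(\epsilon_k,\dots,\epsilon_{k-l+1},\epsilon_{k-l}',\epsilon_{k-l-1}',\dots),$$ $$\vartheta_l'(p)=\sup_{k\in\mathbb Z}\|X_k-X_k^{(l,\prime)}\|_p,\qquad \vartheta_l^*(p)=\sup_{k\in\mathbb Z}\|X_k-X_k^{(l,*)}\|_p,$$ where $\|X\|_p=(\mathbb E|X|^p)^{1/p}$. Let $p>2$, $\mathfrak a>0$ and $\mathfrak b>B(p)=\frac12+\frac{p\wedge 3}{2p}-\frac1p$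 be real numbers, where $x\wedge y=\min\{x,y\}$, and assume (A1) $\|X_k\|_p<\infty$ and $\mathbb E X_k=0$; (A2) $\sum_{k\ge1}k^{\mathfrak a}\vartheta_k^*(p)<\infty$ and $\sum_{k\ge1}k^{\mathfrak b}\vartheta_k'(p)<\infty$; (A3) $s^2>0$, where $s^2=\sum_{k\in\mathbb Z}\mathbb E[X_0X_k]$. Let $S_n=\sum_{k=1}^nX_k$, let $\Phi$ be the standard normal distribution function, and let $\Delta_n=\sup_{x\in\mathbb R}\bigl|\mathbb P\bigl(S_n\le x\sqrt{ns^2}\bigr)-\Phi(x)\bigr|$. Then there is a constant $C>0$ such that $$\Delta_n\le C\,n^{-(p\wedge3)/2+1}\qquad\text{for all } n\ge1;$$ in particular $\Delta_n\le C\,n^{-1/2}$ if $p\ge3$. The constant $C$ depends only on $p$, $\mathfrak a$, $\mathfrak b$, on upper bounds for $\|X_0\|_p$ and for the two sums in (A2), and on a positive lower bound for $s^2$. -/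

import Mathlib

open MeasureTheory ProbabilityTheory
open scoped ENNReal NNReal

noncomputable section

namespace BernoulliShift

variable {Ω S : Type*}

/-- The past `θ_k = (ε_k, ε_{k-1}, …)` of the innovations, seen from time `k`. -/
def past (ε : ℤ → Ω → S) (k : ℤ) (ω : Ω) : ℕ → S :=
  fun j => ε (k - j) ω

/-- `θ_k^{(l,')}`: the past with the single innovation `ε_{k-l}` replaced by `ε'_{k-l}`. -/
def pastPrime (ε ε' : ℤ → Ω → S) (l : ℕ) (k : ℤ) (ω : Ω) : ℕ → S :=
  fun j => if j = l then ε' (k - j) ω else ε (k - j) ω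

/-- `θ_k^{(l,*)}`: the past with all the innovations `ε_{k-l}, ε_{k-l-1}, …` replaced by
`ε'_{k-l}, ε'_{k-l-1}, …`. -/
def pastStar (ε ε' : ℤ → Ω → S) (l : ℕ) (k : ℤ) (ω : Ω) : ℕ → S :=
  fun j => if j < l then ε (k - j) ω else ε' (k - j) ω

/-- The process `X_k = g_k(ε_k, ε_{k-1}, …)`. -/
def process (g : ℤ → (ℕ → S) → ℝ) (ε : ℤ → Ω → S) (k : ℤ) (ω : Ω) : ℝ :=
  g k (past ε k ω)

variable [MeasurableSpace Ω] [MeasurableSpace S]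

/-- `ε` is a sequence of i.i.d. random elements of `S`, and the sequence `ε'` is an
independent copy of the sequence `ε`. -/
structure IsIIDWithCopy (ε ε' : ℤ → Ω → S) (P : Measure Ω) : Prop where
  measurable : ∀ k, Measurable (ε k)
  indep : iIndepFun ε P
  identDistrib : ∀ k, IdentDistrib (ε k) (ε 0) P P
  measurable_copy : ∀ k, Measurable (ε' k)
  copy_identDistrib : IdentDistrib (fun ω k => ε' k ω) (fun ω k => ε k ω) P P
  copy_indep : IndepFun (fun ω k => ε k ω) (fun ω k => ε' k ω) P

/-- (Strict) stationarity: the law of `(X_{k+h})_{k ∈ ℤ}` does not depend on `h`. -/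
def IsStationary (X : ℤ → Ω → ℝ) (P : Measure Ω) : Prop :=
  ∀ h : ℤ, IdentDistrib (fun ω k => X (k + h) ω) (fun ω k => X k ω) P P

/-- `ϑ'_l(p) = sup_k ‖X_k - X_k^{(l,')}‖_p`. -/
def depPrime (g : ℤ → (ℕ → S) → ℝ) (ε ε' : ℤ → Ω → S) (P : Measure Ω) (p : ℝ) (l : ℕ) : ℝ≥0∞ :=
  ⨆ k : ℤ, eLpNorm (fun ω => g k (past ε k ω) - g k (pastPrime ε ε' l k ω)) (ENNReal.ofReal p) P

/-- `ϑ*_l(p) = sup_k ‖X_k - X_k^{(l,*)}‖_p`. -/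
def depStar (g : ℤ → (ℕ → S) → ℝ) (ε ε' : ℤ → Ω → S) (P : Measure Ω) (p : ℝ) (l : ℕ) : ℝ≥0∞ :=
  ⨆ k : ℤ, eLpNorm (fun ω => g k (past ε k ω) - g k (pastStar ε ε' l k ω)) (ENNReal.ofReal p) P

/-- `∑_{k ≥ 1} k^c d_k`, with value in `[0, ∞]`. -/
def weightedSum (c : ℝ) (d : ℕ → ℝ≥0∞) : ℝ≥0∞ :=
  ∑' k : ℕ, ENNReal.ofReal (((k + 1 : ℕ) : ℝ) ^ c) * d (k + 1)

/-- The boundary exponent `B(p) = 1/2 + (p ∧ 3)/(2p) - 1/p`. -/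
def boundary (p : ℝ) : ℝ := 1 / 2 + min p 3 / (2 * p) - 1 / p

/-- The long-run variance `∑_{k ∈ ℤ} E[X_0 X_k]`. -/
def longRunVariance (X : ℤ → Ω → ℝ) (P : Measure Ω) : ℝ :=
  ∑' k : ℤ, ∫ ω, X 0 ω * X k ω ∂P

/-- `S_n = X_1 + ⋯ + X_n`. -/
def partialSum (X : ℤ → Ω → ℝ) (n : ℕ) (ω : Ω) : ℝ :=
  ∑ k ∈ Finset.Icc 1 n, X (k : ℤ) ω

/-- The Kolmogorov distance `Δ_n = sup_x |P(S_n ≤ x √(n s²)) - Φ(x)|`, where `s²` is the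
long-run variance. -/
def kolmogorovDist (X : ℤ → Ω → ℝ) (P : Measure Ω) (n : ℕ) : ℝ :=
  ⨆ x : ℝ, |P.real {ω | partialSum X n ω ≤ x * √(n * longRunVariance X P)}
    - cdf (gaussianReal 0 1) x|

end BernoulliShift

end

open MeasureTheory ProbabilityTheory
open scoped ENNReal NNReal

noncomputable section

set_option linter.unusedSectionVars false

namespace BernoulliShift

open Filter Topology

/-! Write `q = min p 3`, `α = (q - 2) / 2` and `τ = |ξ| √n`. The proof compares the characteristic
function `φ_n(ξ)` of `S_n` with `exp (-ξ² n s² / 2)` and feeds the result into Esseen's smoothing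
inequality (`abs_cdf_sub_le`). Nothing is normalised: the cut-off frequency is a constant `c₀`, and
since the comparison law `N(0, n s²)` has density of order `n^{-1/2}`, the truncation costs
`n^{-1/2}`, which is at most `n^{-α}`. It therefore suffices to bound the difference by `C n^{-α} τ
(1 + τ)^{-(1+δ)}` for `0 ≤ ξ ≤ c₀` (`Regular.exists_norm_cf_sub_le`): after division by `ξ` this
weight is integrable, with integral of order `n^{-α}`.

Dependence is measured by influences: the `L^p` distance between a function of the innovations and
the same function with the coordinates in a set `A` resampled. Because `L^p` is two-smooth, squared
influences are subadditive up to a constant (`infl_sq_le_sum`). Hence a sum of the `X_k` over times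
at distance at least `g` from the past feels the whole past only at order `g^{1/2-b}`, and feels a
finite set `A` of past coordinates only at order `√|A| g^{-b}`. These bounds, together with
covariance estimates, form the structure `Regular`, from which everything else follows. The
coefficients `ϑ*` serve only to pass from finite to infinite sets of coordinates.

Low frequencies, `τ ≤ K`: the sum is halved. Resampling the past of the second half in two stages,
separated by a short buffer, gives `φ_{m+m'} = φ_m φ_{m'} - ξ² Cov + O(|ξ|^q m^{1-δ})`. The Gaussian
with the exact variance of the block satisfies the same relation, so the errors add up over the
dyadic recursion (`gdist_le`) to `|ξ|^q n`, which is of order `n^{-α}`.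

High frequencies, `τ ≥ K`: a cruder factorisation is enough if its error is `O(m^{-α} τ^{-δ})`,
since both halves already have small characteristic functions and the recursion contracts
(`exists_norm_cf_sub_high_le`). To factorise, a sparse set of coordinates is resampled in the first
half: about `τ^κ` blocks of length about `K / ξ²`, one in each of as many long windows. The second
half hardly feels these coordinates, so the character of the first half may be averaged over them.
The average is dominated by a product of independent factors, one per window, each of mean at most
`1/2` because `φ` of a block of length `K / ξ²` is small by the low frequency estimate. The product
has mean at most `2^{-N}` for `N` windows, which beats every power of `τ`. What fails to be local to
a window has `L^p` norm of order `G^{1/2-b}` for gaps of length `G`, and is paid for with a `p`-th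
moment. Making this cost at most `m^{-α} τ^{-δ}` requires `b > 1/2 + α/p`, which is exactly `B(p)`
(`window_error_power_le`). -/

section

/-! ### Resampling coordinates: averages and influences. -/

variable {S : Type*} [MeasurableSpace S]
variable {V : Type*} [NormedAddCommGroup V] [NormedSpace ℝ V]

open Classical in
/-- The sequence that agrees with `y` on `A` and with `x` off `A`. -/
def mix {S : Type*} (A : Set ℤ) (x y : ℤ → S) : ℤ → S := fun j => if j ∈ A then y j else x j

section mixBasic

variable {S : Type*} {A B : Set ℤ} {x y z : ℤ → S} {j : ℤ}

theorem mix_of_mem (h : j ∈ A) : mix A x y j = y j := if_pos h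

theorem mix_of_notMem (h : j ∉ A) : mix A x y j = x j := if_neg h

theorem mix_univ : mix Set.univ x y = y := by funext j; simp [mix]

theorem mix_empty : mix ∅ x y = x := by funext j; simp [mix]

theorem mix_compl : mix Aᶜ x y = mix A y x := by
  funext j; by_cases hA : j ∈ A <;> simp [mix, hA]

/-- A function of the coordinates in `B` does not feel changes of coordinates off `B`. -/
theorem DependsOn.mix_inter {W : Type*} {f : (ℤ → S) → W} (hf : DependsOn f B) :
    f (mix A x y) = f (mix (A ∩ B) x y) :=
  hf fun j hj => by by_cases hA : j ∈ A <;> simp [mix, hA, hj]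

theorem DependsOn.mix_eq {W : Type*} {f : (ℤ → S) → W} (hf : DependsOn f B)
    (h : Disjoint A B) : f (mix A x y) = f x :=
  hf fun _ hj => mix_of_notMem (Set.disjoint_right.1 h hj)

theorem DependsOn.mono_set {W : Type*} {f : (ℤ → S) → W} (hf : DependsOn f B)
    (h : B ⊆ A) : DependsOn f A := fun _ _ hxy => hf fun i hi => hxy i (h hi)

end mixBasic

theorem measurable_mix (A : Set ℤ) :
    Measurable fun z : (ℤ → S) × (ℤ → S) => mix A z.1 z.2 := by
  refine measurable_pi_lambda _ fun j => ?_
  by_cases h : j ∈ A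
  · simp only [mix, h, if_true]; fun_prop
  · simp only [mix, h, if_false]; fun_prop

@[fun_prop]
theorem Measurable.mix {Z : Type*} [MeasurableSpace Z] (A : Set ℤ) {f g : Z → ℤ → S}
    (hf : Measurable f) (hg : Measurable g) : Measurable fun z => mix A (f z) (g z) :=
  (measurable_mix A).comp (hf.prodMk hg)

/-- Exchanging the coordinates in `A` of two independent sequences does not change their law. -/
def SwapInvariant (μ : Measure (ℤ → S)) : Prop :=
  ∀ A : Set ℤ, MeasurePreserving
    (fun z : (ℤ → S) × (ℤ → S) => (mix A z.1 z.2, mix A z.2 z.1)) (μ.prod μ) (μ.prod μ)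

/-- The average of `f` over the coordinates in `A`. -/
def avg (μ : Measure (ℤ → S)) (A : Set ℤ) (f : (ℤ → S) → V) (x : ℤ → S) : V :=
  ∫ y, f (mix A x y) ∂μ

/-- The `L^p` influence of the coordinates in `A` on `f`. -/
def infl (μ : Measure (ℤ → S)) (p : ℝ≥0∞) (f : (ℤ → S) → V) (A : Set ℤ) : ℝ≥0∞ :=
  eLpNorm (fun z : (ℤ → S) × (ℤ → S) => f z.1 - f (mix A z.1 z.2)) p (μ.prod μ)

/-- Averaging over one variable is a contraction of `L^p`. -/
theorem eLpNorm_integral_prod_le {Z W : Type*} [MeasurableSpace Z] [MeasurableSpace W]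
    {κ : Measure Z} {μ : Measure W} [SFinite κ] [IsProbabilityMeasure μ] {p : ℝ≥0∞} (hp : 1 ≤ p)
    (hp' : p ≠ ∞) {F : Z × W → V} (hF : StronglyMeasurable F) :
    eLpNorm (fun x => ∫ y, F (x, y) ∂μ) p κ ≤ eLpNorm F p (κ.prod μ) := by
  have h0 : p ≠ 0 := (zero_lt_one.trans_le hp).ne'
  have hpos : 0 < p.toReal := ENNReal.toReal_pos h0 hp'
  rw [eLpNorm_eq_lintegral_rpow_enorm_toReal h0 hp', eLpNorm_eq_lintegral_rpow_enorm_toReal h0 hp']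
  gcongr
  rw [lintegral_prod _ (by fun_prop)]
  refine lintegral_mono fun x => ?_
  have h1 : ‖∫ y, F (x, y) ∂μ‖ₑ ≤ eLpNorm (fun y => F (x, y)) p μ := by
    refine (enorm_integral_le_lintegral_enorm _).trans ?_
    rw [← eLpNorm_one_eq_lintegral_enorm]
    exact eLpNorm_le_eLpNorm_of_exponent_le hp
      (hF.comp_measurable measurable_prodMk_left).aestronglyMeasurable
  calc ‖∫ y, F (x, y) ∂μ‖ₑ ^ p.toReal ≤ (eLpNorm (fun y => F (x, y)) p μ) ^ p.toReal := by
        gcongr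
    _ = _ := by
        rw [eLpNorm_eq_lintegral_rpow_enorm_toReal h0 hp', ← ENNReal.rpow_mul]
        simp [hpos.ne']

section general

variable {μ : Measure (ℤ → S)} [IsProbabilityMeasure μ] {p : ℝ≥0∞} {A B : Set ℤ}
  {f g : (ℤ → S) → V}

theorem SwapInvariant.mix (hμ : SwapInvariant μ) (A : Set ℤ) :
    MeasurePreserving (fun z : (ℤ → S) × (ℤ → S) => mix A z.1 z.2) (μ.prod μ) μ :=
  measurePreserving_fst.comp (hμ A)

/-- Resampling the coordinates in `A` of the first of two independent sequences. -/
theorem SwapInvariant.mix_prod (hμ : SwapInvariant μ) (A : Set ℤ) :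
    MeasurePreserving (fun z : ((ℤ → S) × (ℤ → S)) × (ℤ → S) => (BernoulliShift.mix A z.1.1 z.1.2, z.2))
      ((μ.prod μ).prod μ) (μ.prod μ) :=
  (hμ.mix A).prod (MeasurePreserving.id μ)

theorem SwapInvariant.mix_prod' (hμ : SwapInvariant μ) (A : Set ℤ) :
    MeasurePreserving
      (fun t : ((ℤ → S) × (ℤ → S)) × (ℤ → S) => (BernoulliShift.mix A t.1.1 t.2, t.1.2))
      ((μ.prod μ).prod μ) (μ.prod μ) := by
  have h1 := measurePreserving_prodAssoc μ μ μ
  have h2 : MeasurePreserving (Prod.map (id : (ℤ → S) → _) (Prod.swap (α := ℤ → S) (β := ℤ → S)))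
    (μ.prod (μ.prod μ)) (μ.prod (μ.prod μ)) :=
    (MeasurePreserving.id μ).prod Measure.measurePreserving_swap
  have h3 := (measurePreserving_prodAssoc μ μ μ).symm
  exact (hμ.mix_prod A).comp (h3.comp (h2.comp h1))

theorem stronglyMeasurable_avg (hf : StronglyMeasurable f) : StronglyMeasurable (avg μ A f) :=
  StronglyMeasurable.integral_prod_right'
    (f := fun z : (ℤ → S) × (ℤ → S) => f (mix A z.1 z.2)) (hf.comp_measurable (measurable_mix A))

theorem dependsOn_avg (hf : DependsOn f B) : DependsOn (avg μ A f) (B \ A) := by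
  intro x y hxy
  unfold avg
  congr 1
  funext z
  refine hf fun j hj => ?_
  by_cases hA : j ∈ A
  · rw [mix_of_mem hA, mix_of_mem hA]
  · rw [mix_of_notMem hA, mix_of_notMem hA, hxy j ⟨hj, hA⟩]

theorem dependsOn_avg_compl : DependsOn (avg μ A f) Aᶜ := by
  have := dependsOn_avg (μ := μ) (A := A) (f := f) (B := Set.univ) (dependsOn_univ f)
  rwa [← Set.compl_eq_univ_sdiff] at this

theorem ae_integrable_mix (hμ : SwapInvariant μ) (hf : Integrable f μ) (A : Set ℤ) :
    ∀ᵐ x ∂μ, Integrable (fun y => f (mix A x y)) μ :=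
  ((hμ.mix A).integrable_comp_of_integrable hf).prod_right_ae

theorem integral_avg (hμ : SwapInvariant μ) (hf : Integrable f μ) (A : Set ℤ) :
    ∫ x, avg μ A f x ∂μ = ∫ x, f x ∂μ := by
  unfold avg
  rw [← integral_prod (fun z : (ℤ → S) × (ℤ → S) => f (mix A z.1 z.2))
    ((hμ.mix A).integrable_comp_of_integrable hf)]
  conv_rhs => rw [← (hμ.mix A).map_eq]
  rw [integral_map (hμ.mix A).measurable.aemeasurable]
  rw [(hμ.mix A).map_eq]; exact hf.aestronglyMeasurable

theorem eLpNorm_avg_le (hμ : SwapInvariant μ) (hp : 1 ≤ p) (hp' : p ≠ ∞)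
    (hf : StronglyMeasurable f) (A : Set ℤ) : eLpNorm (avg μ A f) p μ ≤ eLpNorm f p μ := by
  refine (eLpNorm_integral_prod_le hp hp'
    (F := fun z : (ℤ → S) × (ℤ → S) => f (mix A z.1 z.2))
    (hf.comp_measurable (measurable_mix A))).trans_eq ?_
  exact eLpNorm_comp_measurePreserving hf.aestronglyMeasurable (hμ.mix A)

/-- The difference is itself an average over the second sequence of the increment that defines
`infl`, and averaging contracts `L^p`. -/
theorem eLpNorm_sub_avg_le (hμ : SwapInvariant μ) (hp : 1 ≤ p) (hp' : p ≠ ∞)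
    (hf : StronglyMeasurable f) (hfi : Integrable f μ) (A : Set ℤ) [CompleteSpace V] :
    eLpNorm (fun x => f x - avg μ A f x) p μ ≤ infl μ p f A := by
  refine le_trans (le_of_eq (eLpNorm_congr_ae ?_)) (eLpNorm_integral_prod_le hp hp'
    (F := fun z : (ℤ → S) × (ℤ → S) => f z.1 - f (mix A z.1 z.2))
    ((hf.comp_measurable measurable_fst).sub (hf.comp_measurable (measurable_mix A))))
  filter_upwards [ae_integrable_mix hμ hfi A] with x hx
  rw [integral_sub (integrable_const _) hx]
  simp [avg]

/-- Since `g` is blind to `A`, resampling `A` produces the same increment for `f` and for `f - g`,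
and both terms of the latter have the norm of `f - g`. Together with `eLpNorm_sub_avg_le` this makes
the influence of `A` comparable to the distance from the functions that do not see `A`. -/
theorem infl_le_two_mul_eLpNorm_sub (hμ : SwapInvariant μ) (hp : 1 ≤ p)
    (hf : StronglyMeasurable f) (hg : StronglyMeasurable g) (hgA : DependsOn g Aᶜ) :
    infl μ p f A ≤ 2 * eLpNorm (fun x => f x - g x) p μ := by
  obtain ⟨F, hF⟩ : ∃ F : (ℤ → S) → V, F = fun x => f x - g x := ⟨_, rfl⟩
  have hFm : StronglyMeasurable F := hF ▸ hf.sub hg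
  have h1 : (fun z : (ℤ → S) × (ℤ → S) => f z.1 - f (mix A z.1 z.2)) =
      F ∘ Prod.fst - F ∘ fun z => mix A z.1 z.2 := by
    funext z
    simp only [hF, Pi.sub_apply, Function.comp]
    rw [DependsOn.mix_eq hgA disjoint_compl_right]; abel
  rw [infl, h1, ← hF, two_mul]
  refine (eLpNorm_sub_le (hFm.comp_measurable measurable_fst).aestronglyMeasurable
    (hFm.comp_measurable (measurable_mix A)).aestronglyMeasurable hp).trans_eq ?_
  rw [eLpNorm_comp_measurePreserving hFm.aestronglyMeasurable measurePreserving_fst,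
    eLpNorm_comp_measurePreserving hFm.aestronglyMeasurable (hμ.mix A)]

/-- A function blind to `B` is blind to the smaller set `A`, so `avg μ B f` is an admissible
approximation for both. The factor 2 is the price of monotonicity. -/
theorem infl_le_two_mul (hμ : SwapInvariant μ) (hp : 1 ≤ p) (hp' : p ≠ ∞)
    (hf : StronglyMeasurable f) (hfi : Integrable f μ) [CompleteSpace V] (h : A ⊆ B) :
    infl μ p f A ≤ 2 * infl μ p f B := by
  refine (infl_le_two_mul_eLpNorm_sub hμ hp hf (stronglyMeasurable_avg hf)
    (g := avg μ B f) ?_).trans ?_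
  · exact DependsOn.mono_set dependsOn_avg_compl (Set.compl_subset_compl.2 h)
  · gcongr
    exact eLpNorm_sub_avg_le hμ hp hp' hf hfi B

/-- Resample `A` first, then `B`. After the coordinates in `A` have been exchanged the pair of
sequences has the same law as before, so the second increment has the norm `infl μ p f B`. -/
theorem infl_union_le (hμ : SwapInvariant μ) (hp : 1 ≤ p) (hf : StronglyMeasurable f)
    (h : Disjoint A B) : infl μ p f (A ∪ B) ≤ infl μ p f A + infl μ p f B := by
  have h1 : (fun z : (ℤ → S) × (ℤ → S) => f z.1 - f (mix (A ∪ B) z.1 z.2)) =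
      (fun z => f z.1 - f (mix A z.1 z.2)) +
      (fun z : (ℤ → S) × (ℤ → S) => f z.1 - f (mix B z.1 z.2)) ∘
        fun z => (mix A z.1 z.2, mix A z.2 z.1) := by
    funext z
    have : mix B (mix A z.1 z.2) (mix A z.2 z.1) = mix (A ∪ B) z.1 z.2 := by
      funext j
      by_cases hA : j ∈ A
      · have hB : j ∉ B := Set.disjoint_left.1 h hA
        simp [mix, hA, hB]
      · by_cases hB : j ∈ B <;> simp [mix, hA, hB]
    simp [this]
  have hm : ∀ C : Set ℤ, AEStronglyMeasurable
      (fun z : (ℤ → S) × (ℤ → S) => f z.1 - f (mix C z.1 z.2)) (μ.prod μ) := fun C =>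
    ((hf.comp_measurable measurable_fst).sub
      (hf.comp_measurable (measurable_mix C))).aestronglyMeasurable
  rw [infl, h1]
  refine (eLpNorm_add_le (hm A) ((hm B).comp_measurePreserving (hμ A)) hp).trans_eq ?_
  rw [eLpNorm_comp_measurePreserving (hm B) (hμ A), infl, infl]

theorem infl_inter (hf : DependsOn f B) : infl μ p f A = infl μ p f (A ∩ B) := by
  unfold infl
  congr 1
  funext z
  rw [DependsOn.mix_inter hf]

/-- Under the average over `B`, the increment along `A` is the increment of `f` along `A \ B` at the
point whose `B`-coordinates are the averaged ones. -/
theorem infl_avg_le (hμ : SwapInvariant μ) (hp : 1 ≤ p) (hp' : p ≠ ∞)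
    (hf : StronglyMeasurable f) (hfi : Integrable f μ) :
    infl μ p (avg μ B f) A ≤ infl μ p f (A \ B) := by
  have hm : StronglyMeasurable fun z : (ℤ → S) × (ℤ → S) => f z.1 - f (mix (A \ B) z.1 z.2) :=
    (hf.comp_measurable measurable_fst).sub (hf.comp_measurable (measurable_mix _))
  -- the three variables are `x`, the resampled coordinates `y`, and the averaged ones `w`
  let Ψ : ((ℤ → S) × (ℤ → S)) × (ℤ → S) → ((ℤ → S) × (ℤ → S)) :=
    fun t => (mix B t.1.1 t.2, t.1.2)
  have hΨ : MeasurePreserving Ψ ((μ.prod μ).prod μ) (μ.prod μ) := hμ.mix_prod' B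
  let F : ((ℤ → S) × (ℤ → S)) × (ℤ → S) → V := fun t =>
    f (mix B t.1.1 t.2) - f (mix B (mix A t.1.1 t.1.2) t.2)
  have key : F = (fun z : (ℤ → S) × (ℤ → S) => f z.1 - f (mix (A \ B) z.1 z.2)) ∘ Ψ := by
    funext t
    simp only [Ψ, F, Function.comp]
    congr 2
    funext j
    by_cases hA : j ∈ A <;> by_cases hB : j ∈ B <;> simp [mix, hA, hB]
  have h1 : eLpNorm (fun z : (ℤ → S) × (ℤ → S) => ∫ w, F (z, w) ∂μ) p (μ.prod μ) ≤
      infl μ p f (A \ B) := by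
    have hF : StronglyMeasurable F := by rw [key]; exact hm.comp_measurable hΨ.measurable
    refine (eLpNorm_integral_prod_le hp hp' hF).trans_eq ?_
    rw [key, eLpNorm_comp_measurePreserving hm.aestronglyMeasurable hΨ, infl]
  refine le_trans (le_of_eq (eLpNorm_congr_ae ?_)) h1
  have i1 := ae_integrable_mix hμ hfi B
  filter_upwards [(measurePreserving_fst (μ := μ) (ν := μ)).quasiMeasurePreserving.ae i1,
    (hμ.mix A).quasiMeasurePreserving.ae i1] with z hz1 hz2
  rw [integral_sub hz1 hz2]
  rfl

theorem infl_mono_exponent {q : ℝ≥0∞} (hf : StronglyMeasurable f) (h : q ≤ p) :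
    infl μ q f A ≤ infl μ p f A :=
  eLpNorm_le_eLpNorm_of_exponent_le h ((hf.comp_measurable measurable_fst).sub
      (hf.comp_measurable (measurable_mix A))).aestronglyMeasurable

/-- A function of the coordinates in `A` is independent of the resampling of `A`. -/
theorem integral_mul_mix {𝕜 : Type*} [RCLike 𝕜] (hμ : SwapInvariant μ) {f g : (ℤ → S) → 𝕜} (hf : DependsOn f A)
    (hfm : Measurable f) (hgm : Measurable g) :
    ∫ z, f z.1 * g (mix A z.1 z.2) ∂(μ.prod μ) = (∫ x, f x ∂μ) * ∫ x, g x ∂μ := by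
  rw [← integral_prod_mul]
  conv_lhs => rw [← (hμ Aᶜ).map_eq]
  rw [integral_map (hμ Aᶜ).measurable.aemeasurable]
  · congr 1
    funext z
    simp only
    rw [DependsOn.mix_eq hf disjoint_compl_left]
    congr 2
    funext j
    by_cases hA : j ∈ A <;> simp [mix, hA]
  · exact ((hfm.comp measurable_fst).mul
      (hgm.comp (measurable_mix A))).aestronglyMeasurable

theorem integral_mul_of_disjoint {𝕜 : Type*} [RCLike 𝕜] (hμ : SwapInvariant μ) {f g : (ℤ → S) → 𝕜} (hf : DependsOn f A)
    (hg : DependsOn g B) (h : Disjoint A B) (hfm : Measurable f) (hgm : Measurable g) :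
    ∫ x, f x * g x ∂μ = (∫ x, f x ∂μ) * ∫ x, g x ∂μ := by
  rw [← integral_mul_mix hμ hf hfm hgm]
  have : ∀ z : (ℤ → S) × (ℤ → S), f z.1 * g (mix A z.1 z.2) = f z.1 * g z.1 := fun z => by
    rw [DependsOn.mix_eq hg h]
  simp_rw [this]
  rw [integral_fun_fst (μ := μ) (ν := μ) (fun x => f x * g x)]
  simp

/-- If `Q` does not depend on the coordinates in `J` of its first argument, then `f` may be
averaged over these coordinates. -/
theorem integral_mul_eq_integral_avg_mul (hμ : SwapInvariant μ) {f : (ℤ → S) → ℂ}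
    {Q : (ℤ → S) × (ℤ → S) → ℂ} {J : Set ℤ} (hfm : Measurable f) (hQm : Measurable Q)
    (hi : Integrable (fun z : (ℤ → S) × (ℤ → S) => f z.1 * Q z) (μ.prod μ))
    (hQ : ∀ x w y, Q (mix J x w, y) = Q (x, y)) :
    ∫ z, f z.1 * Q z ∂(μ.prod μ) = ∫ z, avg μ J f z.1 * Q z ∂(μ.prod μ) := by
  let Ψ : ((ℤ → S) × (ℤ → S)) × (ℤ → S) → ((ℤ → S) × (ℤ → S)) :=
    fun t => (mix J t.1.1 t.2, t.1.2)
  have hΨ : MeasurePreserving Ψ ((μ.prod μ).prod μ) (μ.prod μ) := hμ.mix_prod' J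
  have hm : Measurable fun z : (ℤ → S) × (ℤ → S) => f z.1 * Q z := by fun_prop
  have key : ∀ t, (fun z : (ℤ → S) × (ℤ → S) => f z.1 * Q z) (Ψ t) =
      f (mix J t.1.1 t.2) * Q t.1 := fun t => by
    simp only [Ψ]
    rw [hQ]
  conv_lhs => rw [← hΨ.map_eq]
  rw [integral_map hΨ.measurable.aemeasurable hm.aestronglyMeasurable]
  have hi2 : Integrable (fun t => f (Ψ t).1 * Q (Ψ t)) ((μ.prod μ).prod μ) :=
    hΨ.integrable_comp_of_integrable hi
  rw [integral_prod _ hi2]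
  congr 1
  funext z
  have : ∀ y, f (Ψ (z, y)).1 * Q (Ψ (z, y)) = f (mix J z.1 y) * Q z := fun y => key (z, y)
  simp_rw [this]
  rw [integral_mul_const]
  rfl

theorem avg_mul_of_dependsOn {f g : (ℤ → S) → ℂ} (hf : DependsOn f Aᶜ) (x : ℤ → S) :
    avg μ A (fun x => f x * g x) x = f x * avg μ A g x := by
  unfold avg
  simp_rw [DependsOn.mix_eq hf disjoint_compl_right]
  rw [integral_const_mul]

theorem norm_avg_le_one {f : (ℤ → S) → ℂ} (hf : ∀ x, ‖f x‖ ≤ 1) (x : ℤ → S) :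
    ‖avg μ A f x‖ ≤ 1 := by
  unfold avg
  refine (norm_integral_le_of_norm_le_const (C := 1) (ae_of_all _ fun y => hf _)).trans ?_
  simp

/-- The tower property: resampling `B` inside the already fresh coordinates `A` does not change
their law. -/
theorem avg_avg (hμ : SwapInvariant μ) {f : (ℤ → S) → ℂ} (hfm : Measurable f)
    (hf : ∀ x, ‖f x‖ ≤ 1) (h : B ⊆ A) : avg μ A (avg μ B f) = avg μ A f := by
  funext x
  unfold avg
  have hm : Measurable fun z : (ℤ → S) × (ℤ → S) => f (mix A x (mix B z.1 z.2)) := by fun_prop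
  rw [← integral_prod (fun z : (ℤ → S) × (ℤ → S) => f (mix B (mix A x z.1) z.2))]
  · have : ∀ z : (ℤ → S) × (ℤ → S), f (mix B (mix A x z.1) z.2) =
        (fun y => f (mix A x y)) (mix B z.1 z.2) := fun z => by
      simp only
      congr 1
      funext j
      by_cases hB : j ∈ B
      · simp [mix, hB, h hB]
      · by_cases hA : j ∈ A <;> simp [mix, hA, hB]
    simp_rw [this]
    conv_rhs => rw [← (hμ.mix B).map_eq]
    rw [integral_map (hμ.mix B).measurable.aemeasurable]
    exact Measurable.aestronglyMeasurable (by fun_prop)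
  · refine Integrable.of_bound (C := 1) (Measurable.aestronglyMeasurable (by fun_prop))
      (ae_of_all _ fun z => hf _)

end general

end

/-! ### Two-smoothness of `L^p`. -/

section

theorem abs_rpow_one_add_sub_one_le {r s : ℝ} (hr : 1 ≤ r) (hs : |s| ≤ 1 / 2) :
    |(1 + s) ^ r - 1| ≤ r * 2 ^ r * |s| := by
  have hs' := abs_le.1 hs
  have h1 : 1 + r * s ≤ (1 + s) ^ r := one_add_mul_self_le_rpow_one_add (by linarith) hr
  have hpos : 0 < 1 + s := by linarith
  -- the reverse bound is Bernoulli's inequality at the point `1 / (1 + s)`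
  have h2 : 1 + r * (-s / (1 + s)) ≤ (1 + -s / (1 + s)) ^ r :=
    one_add_mul_self_le_rpow_one_add (by rw [le_div_iff₀ hpos]; linarith) hr
  have h3 : 1 + -s / (1 + s) = (1 + s)⁻¹ := by field_simp; ring
  rw [h3, Real.inv_rpow hpos.le] at h2
  have hP : 0 < (1 + s) ^ r := Real.rpow_pos_of_pos hpos r
  have hP2 : (1 + s) ^ r ≤ 2 ^ r :=
    Real.rpow_le_rpow hpos.le (by linarith) (by linarith)
  have h4 : (1 + s) ^ r - 1 ≤ r * s * (1 + s) ^ (r - 1) := by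
    have := mul_le_mul_of_nonneg_left h2 hP.le
    rw [mul_inv_cancel₀ hP.ne'] at this
    rw [Real.rpow_sub_one hpos.ne']
    have e : (1 + s) ^ r * (1 + r * (-s / (1 + s))) =
      (1 + s) ^ r - r * s * ((1 + s) ^ r / (1 + s)) := by ring
    linarith
  have hP3 : (1 + s) ^ (r - 1) ≤ 2 ^ r :=
    (Real.rpow_le_rpow hpos.le (by linarith) (by linarith)).trans
      (Real.rpow_le_rpow_of_exponent_le (by norm_num : (1 : ℝ) ≤ 2) (by linarith))
  have hP4 : 0 ≤ (1 + s) ^ (r - 1) := Real.rpow_nonneg hpos.le _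
  have h2r : (1 : ℝ) ≤ 2 ^ r := Real.one_le_rpow (by norm_num) (by linarith)
  rw [abs_le]
  constructor
  · have : r * |s| ≤ r * 2 ^ r * |s| := by
      have : r * 1 ≤ r * 2 ^ r := by gcongr
      nlinarith [abs_nonneg s]
    nlinarith [neg_abs_le s]
  · calc _ ≤ r * s * (1 + s) ^ (r - 1) := h4
      _ ≤ r * |s| * (2 : ℝ) ^ r := by
        have : r * s ≤ r * |s| := by gcongr; exact le_abs_self s
        have h0 : 0 ≤ r * |s| := by positivity
        exact (mul_le_mul_of_nonneg_right this hP4).trans (mul_le_mul_of_nonneg_left hP3 h0)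
      _ = _ := by ring

theorem rpow_one_add_le {p s : ℝ} (hp : 2 ≤ p) (hs : |s| ≤ 1 / 2) :
    (1 + s) ^ p ≤ 1 + p * s + p * p * 2 ^ p * s ^ 2 := by
  have hs' := abs_le.1 hs
  have hpos : 0 < 1 + s := by linarith
  have h2 : 1 + p * (-s / (1 + s)) ≤ (1 + -s / (1 + s)) ^ p :=
    one_add_mul_self_le_rpow_one_add (by rw [le_div_iff₀ hpos]; linarith) (by linarith)
  have h3 : 1 + -s / (1 + s) = (1 + s)⁻¹ := by field_simp; ring
  rw [h3, Real.inv_rpow hpos.le] at h2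
  have hP : 0 < (1 + s) ^ p := Real.rpow_pos_of_pos hpos p
  have h4 : (1 + s) ^ p - 1 ≤ p * s * (1 + s) ^ (p - 1) := by
    have := mul_le_mul_of_nonneg_left h2 hP.le
    rw [mul_inv_cancel₀ hP.ne'] at this
    rw [Real.rpow_sub_one hpos.ne']
    have e : (1 + s) ^ p * (1 + p * (-s / (1 + s))) =
      (1 + s) ^ p - p * s * ((1 + s) ^ p / (1 + s)) := by ring
    linarith
  have h5 := abs_rpow_one_add_sub_one_le (r := p - 1) (s := s) (by linarith) hs
  have h6 : s * ((1 + s) ^ (p - 1) - 1) ≤ p * 2 ^ p * s ^ 2 := by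
    calc s * ((1 + s) ^ (p - 1) - 1) ≤ |s * ((1 + s) ^ (p - 1) - 1)| := le_abs_self _
      _ = |s| * |(1 + s) ^ (p - 1) - 1| := abs_mul _ _
      _ ≤ |s| * ((p - 1) * 2 ^ (p - 1) * |s|) := by gcongr
      _ = ((p - 1) * 2 ^ (p - 1)) * (|s| * |s|) := by ring
      _ ≤ (p * 2 ^ p) * (|s| * |s|) := by
        gcongr
        · linarith
        · norm_num
        · linarith
      _ = _ := by rw [abs_mul_abs_self]; ring
  nlinarith

/-- Second order Taylor bound for `|·|^p`. -/
theorem abs_add_rpow_le {p : ℝ} (hp : 2 < p) (w u : ℝ) :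
    |w + u| ^ p ≤ |w| ^ p + p * (|w| ^ (p - 2) * w) * u +
      (3 ^ p + p * p * 2 ^ p) * (|w| ^ (p - 2) * u ^ 2 + |u| ^ p) := by
  have h2p : (0 : ℝ) < 2 ^ p := by positivity
  have h3p : (0 : ℝ) < 3 ^ p := by positivity
  -- If `|w| ≤ 2 |u|`, every term is at most a multiple of `|u| ^ p` and no expansion is needed.
  -- Otherwise `w` is factored out and `rpow_one_add_le` applies to `u / w`.
  rcases le_or_gt |w| (2 * |u|) with h | h
  · have h1 : |w + u| ^ p ≤ 3 ^ p * |u| ^ p := by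
      rw [← Real.mul_rpow (by norm_num) (abs_nonneg _)]
      refine Real.rpow_le_rpow (abs_nonneg _) ?_ (by linarith)
      linarith [abs_add_le w u]
    have h2 : -(p * p * 2 ^ p * |u| ^ p) ≤ p * (|w| ^ (p - 2) * w) * u := by
      have e : |p * (|w| ^ (p - 2) * w) * u| ≤ p * p * 2 ^ p * |u| ^ p := by
        rw [abs_mul, abs_mul, abs_mul, abs_of_pos (by linarith : 0 < p),
          abs_of_nonneg (Real.rpow_nonneg (abs_nonneg w) _)]
        rcases (abs_nonneg u).eq_or_lt with h0 | h0
        · rw [← h0]; simp; positivity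
        have e1 : |w| ^ (p - 2) * |w| ≤ (2 * |u|) ^ (p - 2) * (2 * |u|) := by
          gcongr
        have e2 : (2 * |u|) ^ (p - 2) * (2 * |u|) = (2 * |u|) ^ (p - 1) := by
          rw [← Real.rpow_add_one (by positivity)]; congr 1; ring
        have e3 : (2 * |u|) ^ (p - 1) * |u| = 2 ^ (p - 1) * |u| ^ p := by
          rw [Real.mul_rpow (by norm_num) h0.le, mul_assoc, ← Real.rpow_add_one h0.ne']
          congr 2; ring
        have e4 : (2 : ℝ) ^ (p - 1) ≤ p * 2 ^ p := by
          have : (2 : ℝ) ^ (p - 1) ≤ 2 ^ p :=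
            Real.rpow_le_rpow_of_exponent_le (by norm_num) (by linarith)
          nlinarith
        calc p * (|w| ^ (p - 2) * |w|) * |u| ≤ p * ((2 * |u|) ^ (p - 1)) * |u| := by
              rw [← e2]; gcongr
          _ = p * (2 ^ (p - 1) * |u| ^ p) := by rw [mul_assoc, e3]
          _ ≤ p * ((p * 2 ^ p) * |u| ^ p) := by gcongr
          _ = _ := by ring
      exact (abs_le.1 e).1
    have h3 : 0 ≤ |w| ^ p := by positivity
    have h4 : 0 ≤ (3 ^ p + p * p * 2 ^ p) * (|w| ^ (p - 2) * u ^ 2) := by positivity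
    nlinarith
  · have hw : 0 < |w| := lt_of_le_of_lt (by positivity) h
    have hw0 : w ≠ 0 := abs_pos.1 hw
    have hs : |u / w| ≤ 1 / 2 := by
      rw [abs_div, div_le_iff₀ hw]; linarith
    have h1 := rpow_one_add_le hp.le hs
    have hs' := abs_le.1 hs
    have e1 : |w + u| ^ p = |w| ^ p * (1 + u / w) ^ p := by
      have : w + u = w * (1 + u / w) := by field_simp
      rw [this, abs_mul, Real.mul_rpow hw.le (abs_nonneg _),
        abs_of_pos (by linarith : 0 < 1 + u / w)]
    have e2 : |w| ^ p = |w| ^ (p - 2) * w ^ 2 := by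
      rw [← sq_abs w, ← Real.rpow_natCast, ← Real.rpow_add hw]; congr 1; norm_num
    have e3 : |w| ^ p * (1 + p * (u / w) + p * p * 2 ^ p * (u / w) ^ 2) =
        |w| ^ p + p * (|w| ^ (p - 2) * w) * u + p * p * 2 ^ p * (|w| ^ (p - 2) * u ^ 2) := by
      rw [e2]; field_simp
    have e4 : 0 ≤ 3 ^ p * (|w| ^ (p - 2) * u ^ 2) + (3 ^ p + p * p * 2 ^ p) * |u| ^ p := by
      positivity
    calc |w + u| ^ p ≤ |w| ^ p * (1 + p * (u / w) + p * p * 2 ^ p * (u / w) ^ 2) := by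
          rw [e1]; gcongr
      _ ≤ _ := by rw [e3]; linarith

section holder

variable {Z : Type*} [MeasurableSpace Z] {κ : Measure Z} {p : ℝ} {u v w : Z → ℝ}

theorem eLpNorm_ofReal_eq (hp : 0 < p) (w : Z → ℝ) :
    eLpNorm w (ENNReal.ofReal p) κ = (∫⁻ z, ‖w z‖ₑ ^ p ∂κ) ^ (1 / p) := by
  rw [eLpNorm_eq_lintegral_rpow_enorm_toReal (by simpa using hp) ENNReal.ofReal_ne_top,
    ENNReal.toReal_ofReal hp.le]

/-- Hölder's inequality for three functions in `L^p`. -/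
theorem lintegral_mul_mul_rpow_le (hp : 0 < p) (hw : AEStronglyMeasurable w κ)
    (hu : AEStronglyMeasurable u κ) (hv : AEStronglyMeasurable v κ) {a b c : ℝ}
    (ha : 0 ≤ a) (hb : 0 ≤ b) (hc : 0 ≤ c) (h : a + b + c = p) :
    ∫⁻ z, ‖w z‖ₑ ^ a * ‖u z‖ₑ ^ b * ‖v z‖ₑ ^ c ∂κ ≤
      eLpNorm w (ENNReal.ofReal p) κ ^ a * eLpNorm u (ENNReal.ofReal p) κ ^ b *
        eLpNorm v (ENNReal.ofReal p) κ ^ c := by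
  have key := ENNReal.lintegral_prod_norm_pow_le (μ := κ) (Finset.univ : Finset (Fin 3))
    (f := ![fun z => ‖w z‖ₑ ^ p, fun z => ‖u z‖ₑ ^ p, fun z => ‖v z‖ₑ ^ p])
    (p := ![a / p, b / p, c / p]) (by
      intro i _
      fin_cases i
      · exact hw.enorm.pow_const _
      · exact hu.enorm.pow_const _
      · exact hv.enorm.pow_const _)
    (by simp [Fin.sum_univ_three]; field_simp; exact h)
    (by intro i _; fin_cases i <;> simp <;> positivity)
  simp only [Fin.prod_univ_three] at key
  have e : ∀ (t : ℝ≥0∞) (d : ℝ), (t ^ p) ^ (d / p) = t ^ d := fun t d => by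
    rw [← ENNReal.rpow_mul]; congr 1; field_simp
  have e' : ∀ (t : ℝ≥0∞) (d : ℝ), (t ^ (1 / p)) ^ d = t ^ (d / p) := fun t d => by
    rw [← ENNReal.rpow_mul]; congr 1; field_simp
  simp only [Matrix.cons_val_zero, Matrix.cons_val_one, Matrix.cons_val, e] at key
  simpa only [eLpNorm_ofReal_eq hp, e'] using key

/-- The form of Hölder's inequality used throughout: exponents may be zero, so the same statement
gives moments of one function, products of two, and products with a third factor to a fractional
power. -/
theorem integral_mul_mul_rpow_le (hp : 0 < p) (hw : AEStronglyMeasurable w κ)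
    (hu : AEStronglyMeasurable u κ) (hv : AEStronglyMeasurable v κ) {a b c : ℝ}
    (ha : 0 ≤ a) (hb : 0 ≤ b) (hc : 0 ≤ c) (h : a + b + c = p) {x y z : ℝ}
    (hx : 0 ≤ x) (hy : 0 ≤ y) (hz : 0 ≤ z)
    (hwx : eLpNorm w (ENNReal.ofReal p) κ ≤ ENNReal.ofReal x)
    (huy : eLpNorm u (ENNReal.ofReal p) κ ≤ ENNReal.ofReal y)
    (hvz : eLpNorm v (ENNReal.ofReal p) κ ≤ ENNReal.ofReal z) :
    Integrable (fun t => |w t| ^ a * |u t| ^ b * |v t| ^ c) κ ∧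
      ∫ t, |w t| ^ a * |u t| ^ b * |v t| ^ c ∂κ ≤ x ^ a * y ^ b * z ^ c := by
  have e : ∀ t, ‖|w t| ^ a * |u t| ^ b * |v t| ^ c‖ₑ = ‖w t‖ₑ ^ a * ‖u t‖ₑ ^ b * ‖v t‖ₑ ^ c := by
    intro t
    rw [enorm_mul, enorm_mul, Real.enorm_rpow_of_nonneg (abs_nonneg _) ha,
      Real.enorm_rpow_of_nonneg (abs_nonneg _) hb, Real.enorm_rpow_of_nonneg (abs_nonneg _) hc]
    simp
  have hle : ∫⁻ t, ‖|w t| ^ a * |u t| ^ b * |v t| ^ c‖ₑ ∂κ ≤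
      ENNReal.ofReal (x ^ a * y ^ b * z ^ c) := by
    simp_rw [e]
    refine (lintegral_mul_mul_rpow_le hp hw hu hv ha hb hc h).trans ?_
    rw [ENNReal.ofReal_mul (by positivity), ENNReal.ofReal_mul (by positivity),
      ← ENNReal.ofReal_rpow_of_nonneg hx ha, ← ENNReal.ofReal_rpow_of_nonneg hy hb,
      ← ENNReal.ofReal_rpow_of_nonneg hz hc]
    gcongr
  have hm : AEStronglyMeasurable (fun t => |w t| ^ a * |u t| ^ b * |v t| ^ c) κ := by
    have : ∀ {g : Z → ℝ} (d : ℝ), AEStronglyMeasurable g κ →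
        AEStronglyMeasurable (fun t => |g t| ^ d) κ := fun d hg =>
      ((hg.norm.aemeasurable).pow_const d).aestronglyMeasurable
    exact ((this a hw).mul (this b hu)).mul (this c hv)
  refine ⟨⟨hm, lt_of_le_of_lt hle ENNReal.ofReal_lt_top⟩, ?_⟩
  rw [integral_eq_lintegral_of_nonneg_ae (ae_of_all _ fun t => by positivity) hm]
  refine ENNReal.toReal_le_of_le_ofReal (by positivity) ?_
  refine le_trans (le_of_eq (lintegral_congr fun t => ?_)) hle
  rw [Real.enorm_of_nonneg (by positivity)]

theorem integral_abs_rpow_eq (hp : 0 < p) (hw : MemLp w (ENNReal.ofReal p) κ) :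
    ∫ t, |w t| ^ p ∂κ = (eLpNorm w (ENNReal.ofReal p) κ).toReal ^ p := by
  rw [hw.eLpNorm_eq_integral_rpow_norm (by simpa using hp) ENNReal.ofReal_ne_top,
    ENNReal.toReal_ofReal hp.le, ENNReal.toReal_ofReal (by positivity),
    ← Real.rpow_mul (by positivity)]
  simp [hp.ne']

/-- The constant in the two-smoothness inequality of `L^p`. -/
def smoothConst (p : ℝ) : ℝ := 2 * (3 ^ p + p * p * 2 ^ p)

theorem one_le_smoothConst (hp : 2 < p) : 1 ≤ smoothConst p := by
  have : (1 : ℝ) ≤ 3 ^ p := Real.one_le_rpow (by norm_num) (by linarith)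
  have : (0 : ℝ) ≤ p * p * 2 ^ p := by positivity
  unfold smoothConst; linarith

/-- Write the right side as `Q * (W ^ 2 + C * U ^ 2)` with `Q` the power `p / 2 - 1`. Then `Q`
dominates both `W ^ (p - 2)` and `U ^ (p - 2)`. The factor 2 in `smoothConst` provides one half of
`C` for each of the two error terms. -/
theorem rpow_add_le_smooth (hp : 2 < p) {W U : ℝ} (hW : 0 ≤ W) (hU : 0 ≤ U) :
    W ^ p + (3 ^ p + p * p * 2 ^ p) * (W ^ (p - 2) * U ^ 2 + U ^ p) ≤
      (W ^ 2 + smoothConst p * U ^ 2) ^ (p / 2) := by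
  set C := smoothConst p with hC
  have hC1 : 1 ≤ C := one_le_smoothConst hp
  have hCe : 3 ^ p + p * p * 2 ^ p = C / 2 := by rw [hC, smoothConst]; ring
  rcases hU.eq_or_lt with h0 | h0
  · rw [← h0, Real.zero_rpow (by linarith)]
    simp only [ne_eq, OfNat.ofNat_ne_zero, not_false_eq_true, zero_pow, mul_zero, add_zero]
    rw [← Real.rpow_natCast, ← Real.rpow_mul hW]
    apply le_of_eq; congr 1; push_cast; ring
  have hQ : 0 < W ^ 2 + C * U ^ 2 := by positivity
  have e1 : (W ^ 2 + C * U ^ 2) ^ (p / 2) =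
      (W ^ 2 + C * U ^ 2) ^ (p / 2 - 1) * (W ^ 2 + C * U ^ 2) := by
    rw [← Real.rpow_add_one hQ.ne']; congr 1; ring
  have hexp : 0 ≤ p / 2 - 1 := by linarith
  have a1 : W ^ (p - 2) ≤ (W ^ 2 + C * U ^ 2) ^ (p / 2 - 1) := by
    have : W ^ (p - 2) = (W ^ 2) ^ (p / 2 - 1) := by
      rw [← Real.rpow_natCast, ← Real.rpow_mul hW]; congr 1; push_cast; ring
    rw [this]
    refine Real.rpow_le_rpow (by positivity) ?_ hexp
    nlinarith [sq_nonneg U]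
  have a2 : U ^ (p - 2) ≤ (W ^ 2 + C * U ^ 2) ^ (p / 2 - 1) := by
    have : U ^ (p - 2) = (U ^ 2) ^ (p / 2 - 1) := by
      rw [← Real.rpow_natCast, ← Real.rpow_mul hU]; congr 1; push_cast; ring
    rw [this]
    refine Real.rpow_le_rpow (by positivity) ?_ hexp
    nlinarith [sq_nonneg U, sq_nonneg W]
  have e2 : W ^ p ≤ W ^ (p - 2) * W ^ 2 := by
    rcases hW.eq_or_lt with h | h
    · rw [← h, Real.zero_rpow (by linarith)]; positivity
    · rw [← Real.rpow_natCast W 2, ← Real.rpow_add h]; apply le_of_eq; congr 1; norm_num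
  have e3 : U ^ p = U ^ (p - 2) * U ^ 2 := by
    rw [← Real.rpow_natCast U 2, ← Real.rpow_add h0]; congr 1; norm_num
  rw [e1, hCe, e3]
  set Q := (W ^ 2 + C * U ^ 2) ^ (p / 2 - 1)
  have b1 : W ^ (p - 2) * W ^ 2 ≤ Q * W ^ 2 := by gcongr
  have b2 : W ^ (p - 2) * U ^ 2 ≤ Q * U ^ 2 := by gcongr
  have b3 : U ^ (p - 2) * U ^ 2 ≤ Q * U ^ 2 := by gcongr
  nlinarith

/-- Two-smoothness of `L^p`: an increment that is orthogonal to the duality map of `w` adds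
at most a multiple of its squared norm. -/
theorem eLpNorm_add_sq_le (hp : 2 < p) (hw : MemLp w (ENNReal.ofReal p) κ)
    (hu : MemLp u (ENNReal.ofReal p) κ) (h0 : ∫ t, (|w t| ^ (p - 2) * w t) * u t ∂κ = 0) :
    eLpNorm (fun t => w t + u t) (ENNReal.ofReal p) κ ^ 2 ≤
      eLpNorm w (ENNReal.ofReal p) κ ^ 2 +
        ENNReal.ofReal (smoothConst p) * eLpNorm u (ENNReal.ofReal p) κ ^ 2 := by
  have hp0 : 0 < p := by linarith
  set W := (eLpNorm w (ENNReal.ofReal p) κ).toReal with hW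
  set U := (eLpNorm u (ENNReal.ofReal p) κ).toReal with hU
  have hWe : eLpNorm w (ENNReal.ofReal p) κ = ENNReal.ofReal W :=
    (ENNReal.ofReal_toReal hw.eLpNorm_ne_top).symm
  have hUe : eLpNorm u (ENNReal.ofReal p) κ = ENNReal.ofReal U :=
    (ENNReal.ofReal_toReal hu.eLpNorm_ne_top).symm
  have hW0 : 0 ≤ W := ENNReal.toReal_nonneg
  have hU0 : 0 ≤ U := ENNReal.toReal_nonneg
  have hwu : MemLp (fun t => w t + u t) (ENNReal.ofReal p) κ := hw.add hu
  set Y := (eLpNorm (fun t => w t + u t) (ENNReal.ofReal p) κ).toReal with hY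
  have hYe : eLpNorm (fun t => w t + u t) (ENNReal.ofReal p) κ = ENNReal.ofReal Y :=
    (ENNReal.ofReal_toReal hwu.eLpNorm_ne_top).symm
  have hY0 : 0 ≤ Y := ENNReal.toReal_nonneg
  obtain ⟨i1, b1⟩ := integral_mul_mul_rpow_le hp0 hw.1 hu.1 hu.1 (a := p - 2) (b := 2) (c := 0)
    (by linarith) (by norm_num) le_rfl (by ring) hW0 hU0 hU0 hWe.le hUe.le hUe.le
  obtain ⟨i2, -⟩ := integral_mul_mul_rpow_le hp0 hw.1 hu.1 hu.1 (a := p - 1) (b := 1) (c := 0)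
    (by linarith) (by norm_num) le_rfl (by ring) hW0 hU0 hU0 hWe.le hUe.le hUe.le
  simp only [Real.rpow_zero, mul_one, Real.rpow_one, Real.rpow_ofNat, sq_abs] at i1 b1 i2
  have iw : Integrable (fun t => |w t| ^ p) κ := by
    simpa [ENNReal.toReal_ofReal hp0.le] using
      hw.integrable_norm_rpow (by simpa using hp0) ENNReal.ofReal_ne_top
  have iu : Integrable (fun t => |u t| ^ p) κ := by
    simpa [ENNReal.toReal_ofReal hp0.le] using
      hu.integrable_norm_rpow (by simpa using hp0) ENNReal.ofReal_ne_top
  have iwu : Integrable (fun t => |w t + u t| ^ p) κ := by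
    simpa [ENNReal.toReal_ofReal hp0.le] using
      hwu.integrable_norm_rpow (by simpa using hp0) ENNReal.ofReal_ne_top
  have i3 : Integrable (fun t => p * ((|w t| ^ (p - 2) * w t) * u t)) κ := by
    refine Integrable.const_mul (i2.mono ?_ (ae_of_all _ fun t => ?_)) _
    · exact (((hw.1.norm.aemeasurable.pow_const _).aestronglyMeasurable.mul hw.1).mul hu.1)
    · rw [norm_mul, norm_mul, Real.norm_of_nonneg (Real.rpow_nonneg (abs_nonneg _) _),
        Real.norm_of_nonneg (by positivity : 0 ≤ |w t| ^ (p - 1) * |u t|)]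
      refine mul_le_mul_of_nonneg_right ?_ (abs_nonneg _)
      rcases (abs_nonneg (w t)).eq_or_lt with h | h
      · rw [Real.norm_eq_abs, ← h, mul_zero]; positivity
      · rw [Real.norm_eq_abs, ← Real.rpow_add_one h.ne']; apply le_of_eq; congr 1; ring
  have i4 : Integrable (fun t => |w t| ^ p + p * ((|w t| ^ (p - 2) * w t) * u t)) κ := iw.add i3
  have i5 : Integrable (fun t => |w t| ^ (p - 2) * u t ^ 2 + |u t| ^ p) κ := i1.add iu
  have key : Y ^ p ≤ (W ^ 2 + smoothConst p * U ^ 2) ^ (p / 2) := by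
    refine le_trans ?_ (rpow_add_le_smooth hp hW0 hU0)
    rw [hY, ← integral_abs_rpow_eq hp0 hwu]
    calc ∫ t, |w t + u t| ^ p ∂κ
        ≤ ∫ t, (|w t| ^ p + p * ((|w t| ^ (p - 2) * w t) * u t) +
          (3 ^ p + p * p * 2 ^ p) * (|w t| ^ (p - 2) * u t ^ 2 + |u t| ^ p)) ∂κ := by
          refine integral_mono iwu (i4.add (i5.const_mul _)) fun t => ?_
          have := abs_add_rpow_le hp (w t) (u t)
          simp only
          linarith
      _ = W ^ p + (3 ^ p + p * p * 2 ^ p) * ((∫ t, |w t| ^ (p - 2) * u t ^ 2 ∂κ) + U ^ p) := by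
          rw [integral_add i4 (i5.const_mul _), integral_add iw i3,
            integral_const_mul, integral_const_mul, h0, integral_add i1 iu,
            integral_abs_rpow_eq hp0 hw, integral_abs_rpow_eq hp0 hu]
          ring
      _ ≤ _ := by gcongr
  have hQ : 0 ≤ W ^ 2 + smoothConst p * U ^ 2 := by
    have := one_le_smoothConst hp; positivity
  have key2 : Y ^ 2 ≤ W ^ 2 + smoothConst p * U ^ 2 := by
    have e : Y ^ p = (Y ^ 2) ^ (p / 2) := by
      rw [← Real.rpow_natCast, ← Real.rpow_mul hY0]; congr 1; push_cast; ring
    rw [e] at key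
    exact (Real.rpow_le_rpow_iff (by positivity) hQ (by linarith)).1 key
  rw [hWe, hUe, hYe, ← ENNReal.ofReal_pow hY0, ← ENNReal.ofReal_pow hW0,
    ← ENNReal.ofReal_pow hU0, ← ENNReal.ofReal_mul (by linarith [one_le_smoothConst hp]),
    ← ENNReal.ofReal_add (by positivity) (by have := one_le_smoothConst hp; positivity)]
  exact ENNReal.ofReal_le_ofReal key2

end holder

/-! ### The square function bound for influences. -/

section influence

variable {S : Type*} [MeasurableSpace S] {μ : Measure (ℤ → S)} [IsProbabilityMeasure μ] {p : ℝ}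

theorem memLp_avg (hμ : SwapInvariant μ) (hp : 1 ≤ p) {f : (ℤ → S) → ℝ} (hf : Measurable f)
    (hfp : MemLp f (ENNReal.ofReal p) μ) (A : Set ℤ) :
    MemLp (avg μ A f) (ENNReal.ofReal p) μ :=
  ⟨(stronglyMeasurable_avg hf.stronglyMeasurable).aestronglyMeasurable,
    (eLpNorm_avg_le hμ (by simpa using hp) ENNReal.ofReal_ne_top hf.stronglyMeasurable A).trans_lt
      hfp.eLpNorm_lt_top⟩

/-- A square function bound for the influence of finitely many coordinates. -/
theorem exists_eLpNorm_sub_sq_le (hμ : SwapInvariant μ) (hp : 2 < p) {f : (ℤ → S) → ℝ}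
    (hf : Measurable f) (hfp : MemLp f (ENNReal.ofReal p) μ) (A : Finset ℤ) :
    ∃ g : (ℤ → S) → ℝ, Measurable g ∧ MemLp g (ENNReal.ofReal p) μ ∧
      DependsOn g (A : Set ℤ)ᶜ ∧
      eLpNorm (fun x => f x - g x) (ENNReal.ofReal p) μ ^ 2 ≤
        ENNReal.ofReal (smoothConst p) *
          ∑ j ∈ A, infl μ (ENNReal.ofReal p) f {j} ^ 2 := by
  have hp1 : (1 : ℝ≥0∞) ≤ ENNReal.ofReal p := by simp; linarith
  induction A using Finset.induction_on with
  | empty =>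
    refine ⟨f, hf, hfp, ?_, by simp⟩
    simpa using dependsOn_univ f
  | insert j A hj ih =>
    obtain ⟨g, hg, hgp, hgA, hle⟩ := ih
    have hgm := stronglyMeasurable_avg (μ := μ) (A := {j}) hg.stronglyMeasurable
    have hfm := stronglyMeasurable_avg (μ := μ) (A := {j}) hf.stronglyMeasurable
    have hafp := memLp_avg hμ (by linarith : 1 ≤ p) hf hfp {j}
    have hagp := memLp_avg hμ (by linarith : 1 ≤ p) hg hgp {j}
    have hfi : Integrable f μ := hfp.integrable hp1
    have hgi : Integrable g μ := hgp.integrable hp1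
    refine ⟨avg μ {j} g, hgm.measurable, hagp, ?_, ?_⟩
    · refine DependsOn.mono_set (dependsOn_avg (A := {j}) hgA) ?_
      intro i hi
      simp at hi ⊢
      tauto
    -- The new error `f - avg μ {j} g` is `w + u`. Here `w`, an average of the old error, is blind
    -- to coordinate `j`, while `u` has mean zero in that coordinate. Hence `u` is orthogonal to
    -- `|w| ^ (p - 2) * w` and two-smoothness applies: the old error contributes with constant one,
    -- and `u` contributes the squared influence of `j`.
    · let w : (ℤ → S) → ℝ := fun x => avg μ {j} f x - avg μ {j} g x
      let u : (ℤ → S) → ℝ := fun x => f x - avg μ {j} f x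
      have hwp : MemLp w (ENNReal.ofReal p) μ := hafp.sub hagp
      have hup : MemLp u (ENNReal.ofReal p) μ := hfp.sub hafp
      have hwj : DependsOn w ({j}ᶜ : Set ℤ) := fun x y hxy => by
        simp only [w]
        rw [dependsOn_avg_compl hxy, dependsOn_avg_compl hxy]
      have hwm : Measurable w := hfm.measurable.sub hgm.measurable
      have hum : Measurable u := hf.sub hfm.measurable
      have hi : Integrable (fun x => (|w x| ^ (p - 2) * w x) * u x) μ := by
        obtain ⟨i2, -⟩ := integral_mul_mul_rpow_le (by linarith : 0 < p) hwp.1 hup.1 hup.1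
          (a := p - 1) (b := 1) (c := 0) (by linarith) (by norm_num) le_rfl (by ring)
          ENNReal.toReal_nonneg ENNReal.toReal_nonneg ENNReal.toReal_nonneg
          (ENNReal.ofReal_toReal hwp.eLpNorm_ne_top).ge
          (ENNReal.ofReal_toReal hup.eLpNorm_ne_top).ge
          (ENNReal.ofReal_toReal hup.eLpNorm_ne_top).ge
        refine i2.mono (Measurable.aestronglyMeasurable (by fun_prop)) (ae_of_all _ fun t => ?_)
        simp only [Real.rpow_zero, mul_one, Real.rpow_one]
        rw [norm_mul, norm_mul, Real.norm_of_nonneg (Real.rpow_nonneg (abs_nonneg _) _),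
          Real.norm_of_nonneg (by positivity : 0 ≤ |w t| ^ (p - 1) * |u t|)]
        refine mul_le_mul_of_nonneg_right ?_ (abs_nonneg _)
        rcases (abs_nonneg (w t)).eq_or_lt with h | h
        · rw [Real.norm_eq_abs, ← h, mul_zero]; positivity
        · rw [Real.norm_eq_abs, ← Real.rpow_add_one h.ne']; apply le_of_eq; congr 1; ring
      have hui : Integrable u μ := hup.integrable hp1
      have h0 : ∫ x, (|w x| ^ (p - 2) * w x) * u x ∂μ = 0 := by
        rw [← integral_avg hμ hi {j}]
        refine integral_eq_zero_of_ae ?_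
        filter_upwards [ae_integrable_mix hμ hfi {j}] with x hx
        unfold avg
        have e : ∀ y, (|w (mix {j} x y)| ^ (p - 2) * w (mix {j} x y)) * u (mix {j} x y) =
            (|w x| ^ (p - 2) * w x) * (f (mix {j} x y) - avg μ {j} f x) := fun y => by
          rw [DependsOn.mix_eq hwj disjoint_compl_right]
          simp only [u]
          rw [DependsOn.mix_eq dependsOn_avg_compl disjoint_compl_right]
        simp_rw [e]
        rw [integral_const_mul, integral_sub hx (integrable_const _)]
        simp [avg]
      have hsum := eLpNorm_add_sq_le hp hwp hup h0
      have e1 : (fun t => w t + u t) = fun x => f x - avg μ {j} g x := by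
        funext x; simp only [w, u]; ring
      have hw1 : eLpNorm w (ENNReal.ofReal p) μ ≤
          eLpNorm (fun x => f x - g x) (ENNReal.ofReal p) μ := by
        refine le_trans (le_of_eq (eLpNorm_congr_ae ?_)) (eLpNorm_avg_le hμ hp1
          ENNReal.ofReal_ne_top (hf.sub hg).stronglyMeasurable {j})
        filter_upwards [ae_integrable_mix hμ hfi {j}, ae_integrable_mix hμ hgi {j}] with x h1 h2
        simp only [w, avg]
        exact (integral_sub h1 h2).symm
      have hu1 : eLpNorm u (ENNReal.ofReal p) μ ≤ infl μ (ENNReal.ofReal p) f {j} :=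
        eLpNorm_sub_avg_le hμ hp1 ENNReal.ofReal_ne_top hf.stronglyMeasurable hfi {j}
      rw [e1] at hsum
      rw [Finset.sum_insert hj, mul_add, add_comm]
      refine hsum.trans ?_
      gcongr
      exact (pow_le_pow_left' hw1 2).trans hle

/-- This replaces Burkholder's inequality: many small influences add up in square, not linearly. The
factor 4 is the square of the 2 in `infl_le_two_mul_eLpNorm_sub`. -/
theorem infl_sq_le_sum (hμ : SwapInvariant μ) (hp : 2 < p) {f : (ℤ → S) → ℝ}
    (hf : Measurable f) (hfp : MemLp f (ENNReal.ofReal p) μ) (A : Finset ℤ) :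
    infl μ (ENNReal.ofReal p) f A ^ 2 ≤
      ENNReal.ofReal (4 * smoothConst p) * ∑ j ∈ A, infl μ (ENNReal.ofReal p) f {j} ^ 2 := by
  have hp1 : (1 : ℝ≥0∞) ≤ ENNReal.ofReal p := by simp; linarith
  obtain ⟨g, hg, hgp, hgA, hle⟩ := exists_eLpNorm_sub_sq_le hμ hp hf hfp A
  calc infl μ (ENNReal.ofReal p) f A ^ 2
      ≤ (2 * eLpNorm (fun x => f x - g x) (ENNReal.ofReal p) μ) ^ 2 := by
        gcongr
        exact infl_le_two_mul_eLpNorm_sub hμ hp1 hf.stronglyMeasurable hg.stronglyMeasurable hgA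
    _ = 4 * eLpNorm (fun x => f x - g x) (ENNReal.ofReal p) μ ^ 2 := by ring
    _ ≤ 4 * (ENNReal.ofReal (smoothConst p) *
          ∑ j ∈ A, infl μ (ENNReal.ofReal p) f {j} ^ 2) := by gcongr
    _ = _ := by
        rw [ENNReal.ofReal_mul (by norm_num), mul_assoc]; simp

end influence

end

/-! ### The abstract model and the influences of its partial sums. -/

section

variable {S : Type*} [MeasurableSpace S]

/-- The sum of the `X k` over a finite set of times. -/
def psum {S : Type*} (X : ℤ → (ℤ → S) → ℝ) (I : Finset ℤ) (x : ℤ → S) : ℝ := ∑ k ∈ I, X k x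

/-- A centred stationary process driven by independent innovations, with influence coefficients
`θ` that have a summable weighted sequence. -/
structure Model (μ : Measure (ℤ → S)) (X : ℤ → (ℤ → S) → ℝ) (θ : ℤ → ℝ) (p b Θ : ℝ) : Prop where
  swap : SwapInvariant μ
  measurable : ∀ k, Measurable (X k)
  adapted : ∀ k, DependsOn (X k) (Set.Iic k)
  norm_le : ∀ k, eLpNorm (X k) (ENNReal.ofReal p) μ ≤ ENNReal.ofReal Θ
  mean : ∀ k, ∫ x, X k x ∂μ = 0
  theta_nonneg : ∀ k, 0 ≤ θ k
  theta_neg : ∀ k < 0, θ k = 0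
  theta_zero : θ 0 ≤ Θ
  infl_le : ∀ k j, infl μ (ENNReal.ofReal p) (X k) {j} ≤ ENNReal.ofReal (θ (k - j))
  theta_tail : ∀ (r : ℤ) (u : Finset ℤ), 1 ≤ r → (∀ k ∈ u, r ≤ k) →
    ∑ k ∈ u, θ k ≤ Θ * (r : ℝ) ^ (-b)
  star : ∀ k, Tendsto (fun l : ℕ => infl μ (ENNReal.ofReal p) (X k) (Set.Iic (k - l)))
    atTop (𝓝 0)
  stat : ∀ (c : ℤ) (n : ℕ), μ.map (psum X (Finset.Ioc c (c + n))) = μ.map (psum X (Finset.Ioc 0 n))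
  cov : ∀ i j, ∫ x, X i x * X j x ∂μ = ∫ x, X 0 x * X (j - i) x ∂μ

/-- Three-function Hölder with the constant 1 carrying the remaining exponent `p - 2`. -/
theorem abs_integral_mul_le {Z : Type*} [MeasurableSpace Z] {κ : Measure Z}
    [IsProbabilityMeasure κ] {p : ℝ} (hp : 2 < p) {f g : Z → ℝ} (hf : AEStronglyMeasurable f κ)
    (hg : AEStronglyMeasurable g κ) {a c : ℝ} (ha : 0 ≤ a) (hc : 0 ≤ c)
    (hfa : eLpNorm f (ENNReal.ofReal p) κ ≤ ENNReal.ofReal a)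
    (hgc : eLpNorm g (ENNReal.ofReal p) κ ≤ ENNReal.ofReal c) :
    Integrable (fun z => f z * g z) κ ∧ |∫ z, f z * g z ∂κ| ≤ a * c := by
  have h1 : eLpNorm (fun _ : Z => (1 : ℝ)) (ENNReal.ofReal p) κ ≤ ENNReal.ofReal 1 := by
    rw [eLpNorm_const _ (by simp; linarith) (IsProbabilityMeasure.ne_zero κ)]; simp
  obtain ⟨i, hle⟩ := integral_mul_mul_rpow_le (by linarith : 0 < p) hf hg
    (aestronglyMeasurable_const (b := (1 : ℝ))) (a := 1) (b := 1) (c := p - 2) (by norm_num)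
    (by norm_num) (by linarith) (by ring) ha hc zero_le_one hfa hgc h1
  simp only [Real.rpow_one, abs_one, Real.one_rpow, mul_one] at i hle
  refine ⟨i.mono (hf.mul hg) (ae_of_all _ fun z => by simp), ?_⟩
  refine (abs_integral_le_integral_abs).trans (le_trans (le_of_eq ?_) hle)
  simp [abs_mul]

/-- Comparison of a hyperharmonic sum with its first term. -/
theorem sum_rpow_le {s : ℝ} (hs : 0 < s) (hs1 : s ≤ 1) {g : ℝ} (hg : 1 ≤ g) (N : ℕ) :
    ∑ i ∈ Finset.range N, (g + i) ^ (-s - 1) ≤ 2 / s * g ^ (-s) := by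
  have step : ∀ t : ℝ, 1 ≤ t → t ^ (-s - 1) ≤ 2 / s * (t ^ (-s) - (t + 1) ^ (-s)) := by
    intro t ht
    have ht0 : 0 < t := by linarith
    have h1 : (1 + -1 / (t + 1)) ^ s ≤ 1 + s * (-1 / (t + 1)) :=
      rpow_one_add_le_one_add_mul_self
        (by rw [le_div_iff₀ (by linarith)]; linarith) hs.le hs1
    have h2 : 1 + -1 / (t + 1) = t / (t + 1) := by field_simp; ring
    rw [h2, Real.div_rpow ht0.le (by linarith)] at h1
    have e1 : t ^ (-s) * (t ^ s / (t + 1) ^ s) = (t + 1) ^ (-s) := by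
      rw [Real.rpow_neg ht0.le, Real.rpow_neg (by linarith)]
      have := (Real.rpow_pos_of_pos ht0 s).ne'
      field_simp
    have hpos : 0 < t ^ (-s) := Real.rpow_pos_of_pos ht0 _
    have h3 := mul_le_mul_of_nonneg_left h1 hpos.le
    rw [e1] at h3
    have e2 : t ^ (-s - 1) = t ^ (-s) / t := Real.rpow_sub_one ht0.ne' _
    have h4 : 1 / t ≤ 2 * (1 / (t + 1)) := by
      rw [mul_one_div, div_le_div_iff₀ ht0 (by linarith)]; linarith
    have h5 : t ^ (-s) * (s * (1 / (t + 1))) ≤ t ^ (-s) - (t + 1) ^ (-s) := by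
      have : t ^ (-s) * (1 + s * (-1 / (t + 1))) = t ^ (-s) - t ^ (-s) * (s * (1 / (t + 1))) := by
        ring
      linarith
    calc t ^ (-s - 1) = t ^ (-s) * (1 / t) := by rw [e2]; ring
      _ ≤ t ^ (-s) * (2 * (1 / (t + 1))) := by gcongr
      _ = 2 / s * (t ^ (-s) * (s * (1 / (t + 1)))) := by field_simp
      _ ≤ _ := by gcongr
  have hsum : ∑ i ∈ Finset.range N, (g + i) ^ (-s - 1) ≤
      2 / s * (g ^ (-s) - (g + N) ^ (-s)) := by
    induction N with
    | zero => simp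
    | succ N ih =>
      rw [Finset.sum_range_succ]
      have := step (g + N) (by have : (0 : ℝ) ≤ N := N.cast_nonneg
                               linarith)
      push_cast
      rw [← add_assoc]
      calc _ ≤ 2 / s * (g ^ (-s) - (g + N) ^ (-s)) +
            2 / s * ((g + N) ^ (-s) - (g + N + 1) ^ (-s)) := add_le_add ih this
        _ = _ := by ring
  refine hsum.trans ?_
  gcongr
  have : 0 ≤ (g + N) ^ (-s) := by positivity
  linarith

/-- Concavity of `t ↦ t ^ (1 - b)`, in the form of Bernoulli's inequality at `n / (n + 1)`, bounds
each summand by an increment of the right side. -/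
theorem sum_rpow_neg_le {b : ℝ} (hb : 0 ≤ b) (hb1 : b < 1) (n : ℕ) :
    ∑ i ∈ Finset.range n, ((i : ℝ) + 1) ^ (-b) ≤ (n : ℝ) ^ (1 - b) / (1 - b) := by
  have h1b : 0 < 1 - b := by linarith
  induction n with
  | zero => simp [Real.zero_rpow h1b.ne']
  | succ n ih =>
    rw [Finset.sum_range_succ]
    have hpos : (0 : ℝ) < n + 1 := by positivity
    have h1 : (1 + -1 / ((n : ℝ) + 1)) ^ (1 - b) ≤ 1 + (1 - b) * (-1 / ((n : ℝ) + 1)) :=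
      rpow_one_add_le_one_add_mul_self
        (by rw [le_div_iff₀ hpos]; have : (0 : ℝ) ≤ n := n.cast_nonneg
            linarith) h1b.le (by linarith)
    have h2 : 1 + -1 / ((n : ℝ) + 1) = n / (n + 1) := by field_simp; ring
    rw [h2, Real.div_rpow n.cast_nonneg hpos.le] at h1
    have hP : (0 : ℝ) < ((n : ℝ) + 1) ^ (1 - b) := by positivity
    rw [div_le_iff₀ hP] at h1
    have e : ((n : ℝ) + 1) ^ (-b) = ((n : ℝ) + 1) ^ (1 - b) / (n + 1) := by
      rw [← Real.rpow_sub_one hpos.ne']; congr 1; ring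
    rw [e]
    push_cast
    have : (1 + (1 - b) * (-1 / ((n : ℝ) + 1))) * ((n : ℝ) + 1) ^ (1 - b) =
      ((n : ℝ) + 1) ^ (1 - b) - (1 - b) * (((n : ℝ) + 1) ^ (1 - b) / (n + 1)) := by ring
    rw [this] at h1
    calc _ ≤ (n : ℝ) ^ (1 - b) / (1 - b) + ((n : ℝ) + 1) ^ (1 - b) / (n + 1) := by gcongr
      _ = ((n : ℝ) ^ (1 - b) + (1 - b) * (((n : ℝ) + 1) ^ (1 - b) / (n + 1))) / (1 - b) := by
        field_simp
      _ ≤ _ := by gcongr; linarith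

namespace Model

variable {μ : Measure (ℤ → S)} [IsProbabilityMeasure μ] {X : ℤ → (ℤ → S) → ℝ} {θ : ℤ → ℝ}
  {p b Θ : ℝ}

theorem measurable_psum (h : Model μ X θ p b Θ) (I : Finset ℤ) : Measurable (psum X I) := by
  unfold psum
  exact Finset.measurable_sum _ fun k _ => h.measurable k

theorem Theta_nonneg (h : Model μ X θ p b Θ) : 0 ≤ Θ := (h.theta_nonneg 0).trans h.theta_zero

theorem memLp (h : Model μ X θ p b Θ) (k : ℤ) : MemLp (X k) (ENNReal.ofReal p) μ :=
  ⟨(h.measurable k).aestronglyMeasurable, (h.norm_le k).trans_lt ENNReal.ofReal_lt_top⟩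

theorem memLp_psum (h : Model μ X θ p b Θ) (I : Finset ℤ) : MemLp (psum X I) (ENNReal.ofReal p) μ :=
  memLp_finsetSum _ fun k _ => h.memLp k

theorem dependsOn_psum (h : Model μ X θ p b Θ) {I : Finset ℤ} {c : ℤ} (hI : ∀ k ∈ I, k ≤ c) :
    DependsOn (psum X I) (Set.Iic c) := fun _ _ hxy =>
  Finset.sum_congr rfl fun k hk => h.adapted k fun i hi => hxy i (le_trans hi (hI k hk))

theorem sum_theta_le (h : Model μ X θ p b Θ) (u : Finset ℤ) : ∑ k ∈ u, θ k ≤ 2 * Θ := by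
  have h1 : ∑ k ∈ u, θ k ≤ ∑ k ∈ insert 0 (u.filter (1 ≤ ·)), θ k := by
    rw [← Finset.sum_filter_ne_zero]
    refine Finset.sum_le_sum_of_subset_of_nonneg (fun k hk => ?_) fun k _ _ => h.theta_nonneg k
    obtain ⟨hk, hk0⟩ := Finset.mem_filter.1 hk
    rcases lt_trichotomy k 0 with h0 | h0 | h0
    · exact absurd (h.theta_neg k h0) hk0
    · simp [h0]
    · exact Finset.mem_insert_of_mem (Finset.mem_filter.2 ⟨hk, by omega⟩)
  have h2 : ∑ k ∈ u.filter (1 ≤ ·), θ k ≤ Θ := by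
    have := h.theta_tail 1 (u.filter (1 ≤ ·)) le_rfl fun k hk => (Finset.mem_filter.1 hk).2
    simpa using this
  rw [Finset.sum_insert (by simp)] at h1
  linarith [h.theta_zero]

theorem infl_psum_le (h : Model μ X θ p b Θ) (hp : 1 ≤ p) (I : Finset ℤ) (A : Set ℤ) :
    infl μ (ENNReal.ofReal p) (psum X I) A ≤ ∑ k ∈ I, infl μ (ENNReal.ofReal p) (X k) A := by
  unfold infl
  have e : (fun z : (ℤ → S) × (ℤ → S) => psum X I z.1 - psum X I (mix A z.1 z.2)) =
      ∑ k ∈ I, fun z : (ℤ → S) × (ℤ → S) => X k z.1 - X k (mix A z.1 z.2) := by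
    funext z
    simp [psum, Finset.sum_sub_distrib]
  rw [e]
  refine eLpNorm_sum_le (fun k _ => ?_) (by simpa using hp)
  exact (((h.measurable k).comp measurable_fst).sub
    ((h.measurable k).comp (measurable_mix A))).aestronglyMeasurable

theorem infl_psum_singleton_le (h : Model μ X θ p b Θ) (hp : 1 ≤ p) (I : Finset ℤ) (j : ℤ) :
    infl μ (ENNReal.ofReal p) (psum X I) {j} ≤ ENNReal.ofReal (∑ k ∈ I, θ (k - j)) := by
  rw [ENNReal.ofReal_sum_of_nonneg fun k _ => h.theta_nonneg _]
  exact (h.infl_psum_le hp I {j}).trans (Finset.sum_le_sum fun k _ => h.infl_le k j)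

theorem sum_theta_sub_le (h : Model μ X θ p b Θ) (I : Finset ℤ) (j : ℤ) : ∑ k ∈ I, θ (k - j) ≤ 2 * Θ := by
  have := h.sum_theta_le (I.image (· - j))
  rwa [Finset.sum_image fun a _ c _ hac => by simpa using hac] at this

theorem sum_theta_sub_le' (h : Model μ X θ p b Θ) (A : Finset ℤ) (k : ℤ) : ∑ j ∈ A, θ (k - j) ≤ 2 * Θ := by
  have := h.sum_theta_le (A.image (k - ·))
  rwa [Finset.sum_image fun a _ c _ hac => by simpa using hac] at this

theorem sum_theta_sub_tail_le (h : Model μ X θ p b Θ) {I : Finset ℤ} {j r : ℤ} (hr : 1 ≤ r) (hI : ∀ k ∈ I, j + r ≤ k) :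
    ∑ k ∈ I, θ (k - j) ≤ Θ * (r : ℝ) ^ (-b) := by
  have := h.theta_tail r (I.image (· - j)) hr (by
    intro k hk
    obtain ⟨i, hi, rfl⟩ := Finset.mem_image.1 hk
    have := hI i hi
    omega)
  rwa [Finset.sum_image fun a _ c _ hac => by simpa using hac] at this

/-- The influence of an infinite set of coordinates is controlled by its finite subsets. -/
theorem infl_psum_le_of_finset (h : Model μ X θ p b Θ) (hp : 2 < p) {I : Finset ℤ} {A : Set ℤ} {c : ℤ}
    (hA : A ⊆ Set.Iic c) {B : ℝ} (hB : 0 ≤ B)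
    (hle : ∀ A' : Finset ℤ, (A' : Set ℤ) ⊆ A → ∑ j ∈ A', (∑ k ∈ I, θ (k - j)) ^ 2 ≤ B) :
    infl μ (ENNReal.ofReal p) (psum X I) A ≤ ENNReal.ofReal (√(4 * smoothConst p) * √B) := by
  have hp1 : (1 : ℝ≥0∞) ≤ ENNReal.ofReal p := by simp; linarith
  have hC := one_le_smoothConst hp
  have hfin : ∀ A' : Finset ℤ, (A' : Set ℤ) ⊆ A →
      infl μ (ENNReal.ofReal p) (psum X I) A' ≤ ENNReal.ofReal (√(4 * smoothConst p) * √B) := by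
    intro A' hA'
    have h1 := infl_sq_le_sum h.swap hp (h.measurable_psum I) (h.memLp_psum I) A'
    have h2 : ∑ j ∈ A', infl μ (ENNReal.ofReal p) (psum X I) {j} ^ 2 ≤ ENNReal.ofReal B := by
      refine le_trans (Finset.sum_le_sum fun j _ => pow_le_pow_left'
        (h.infl_psum_singleton_le (by linarith) I j) 2) ?_
      have hn : ∀ j, 0 ≤ ∑ k ∈ I, θ (k - j) := fun j =>
        Finset.sum_nonneg fun k _ => h.theta_nonneg _
      simp_rw [← ENNReal.ofReal_pow (hn _)]
      rw [← ENNReal.ofReal_sum_of_nonneg fun j _ => by positivity]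
      exact ENNReal.ofReal_le_ofReal (hle A' hA')
    have h3 : infl μ (ENNReal.ofReal p) (psum X I) A' ^ 2 ≤
        ENNReal.ofReal (√(4 * smoothConst p) * √B) ^ 2 := by
      rw [← ENNReal.ofReal_pow (by positivity), mul_pow, Real.sq_sqrt (by linarith),
        Real.sq_sqrt hB, ENNReal.ofReal_mul (by linarith)]
      exact h1.trans (by gcongr)
    exact (ENNReal.pow_le_pow_left_iff (by norm_num)).1 h3
  -- Coordinates above `c - N` form a finite set, for which the square function bound holds. The
  -- deeper ones are charged to each `X k` separately and vanish as `N → ∞` by `star`; the factor 2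
  -- comes from `infl_le_two_mul`.
  have hdec : ∀ N : ℕ, infl μ (ENNReal.ofReal p) (psum X I) A ≤
      ENNReal.ofReal (√(4 * smoothConst p) * √B) +
        ∑ k ∈ I, 2 * infl μ (ENNReal.ofReal p) (X k) (Set.Iic (k - (k - c + N).toNat)) := by
    intro N
    have e : A = (A ∩ Set.Icc (c - N + 1) c) ∪ (A ∩ Set.Iic (c - N)) := by
      ext j
      simp only [Set.mem_union, Set.mem_inter_iff, Set.mem_Icc, Set.mem_Iic]
      constructor
      · intro hj
        have := hA hj
        simp only [Set.mem_Iic] at this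
        by_cases h' : j ≤ c - N
        · exact Or.inr ⟨hj, h'⟩
        · exact Or.inl ⟨hj, by omega, this⟩
      · tauto
    have hd : Disjoint (A ∩ Set.Icc (c - N + 1) c) (A ∩ Set.Iic (c - N)) := by
      rw [Set.disjoint_left]
      rintro j ⟨_, h1⟩ ⟨_, h2⟩
      simp only [Set.mem_Icc, Set.mem_Iic] at h1 h2
      omega
    have hf : (A ∩ Set.Icc (c - N + 1) c).Finite := (Set.finite_Icc _ _).inter_of_right _
    rw [e]
    refine (infl_union_le h.swap hp1 (h.measurable_psum I).stronglyMeasurable hd).trans ?_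
    refine add_le_add ?_ ?_
    · have := hfin hf.toFinset (by simp)
      simpa using this
    · refine (h.infl_psum_le (by linarith) I _).trans (Finset.sum_le_sum fun k _ => ?_)
      rw [infl_inter (h.adapted k)]
      refine infl_le_two_mul h.swap hp1 ENNReal.ofReal_ne_top (h.measurable k).stronglyMeasurable
        ((h.memLp k).integrable hp1) ?_
      rintro j ⟨⟨_, hj⟩, hj'⟩
      simp only [Set.mem_Iic] at hj hj' ⊢
      omega
  have hlim : Tendsto (fun N : ℕ => ENNReal.ofReal (√(4 * smoothConst p) * √B) +
      ∑ k ∈ I, 2 * infl μ (ENNReal.ofReal p) (X k) (Set.Iic (k - (k - c + N).toNat))) atTop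
      (𝓝 (ENNReal.ofReal (√(4 * smoothConst p) * √B) + ∑ k ∈ I, 2 * 0)) := by
    refine Tendsto.add tendsto_const_nhds (tendsto_finsetSum _ fun k _ => ?_)
    refine ENNReal.Tendsto.const_mul ?_ (Or.inr (by norm_num))
    refine (h.star k).comp (tendsto_atTop_atTop.2 fun n => ⟨(n - (k - c)).toNat, fun N hN => ?_⟩)
    omega
  simp only [mul_zero, Finset.sum_const_zero, add_zero] at hlim
  exact ge_of_tendsto' hlim hdec

/-- The influence of the coordinates up to `c` on sums over times after `c + g`. -/
theorem infl_past_le (h : Model μ X θ p b Θ) (hp : 2 < p) (hb : 1 / 2 < b) (hb1 : b < 1) {I : Finset ℤ} {A : Set ℤ}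
    {c : ℤ} {g : ℕ} (hg : 1 ≤ g) (hA : A ⊆ Set.Iic c) (hI : ∀ k ∈ I, c + g ≤ k) :
    infl μ (ENNReal.ofReal p) (psum X I) A ≤
      ENNReal.ofReal (√(4 * smoothConst p) * √(2 / (2 * b - 1)) * Θ * (g : ℝ) ^ (1 / 2 - b)) := by
  have hΘ := h.Theta_nonneg
  have hg1 : (1 : ℝ) ≤ g := by exact_mod_cast hg
  have h2b : 0 < 2 * b - 1 := by linarith
  refine (h.infl_psum_le_of_finset hp hA (I := I)
    (B := Θ ^ 2 * (2 / (2 * b - 1) * (g : ℝ) ^ (-(2 * b - 1)))) (by positivity) ?_).trans_eq ?_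
  · intro A' hA'
    -- A coordinate at depth `i = c - j` acts on all later terms with total weight at most `Θ (g +
    -- i)^{-b}`. The exponent `-(2b - 1) - 1` is `-2b`, written in the shape required by
    -- `sum_rpow_le`; summation over `i` gives order `g^{1-2b}`, whose square root is the claim.
    have h1 : ∀ j ∈ A', (∑ k ∈ I, θ (k - j)) ^ 2 ≤
        Θ ^ 2 * ((g : ℝ) + (c - j).toNat) ^ (-(2 * b - 1) - 1) := by
      intro j hj
      have hjc : j ≤ c := hA (hA' hj)
      have h2 := h.sum_theta_sub_tail_le (I := I) (j := j) (r := g + (c - j).toNat) (by omega)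
        (fun k hk => by have := hI k hk; omega)
      have hn : 0 ≤ ∑ k ∈ I, θ (k - j) := Finset.sum_nonneg fun k _ => h.theta_nonneg _
      refine (pow_le_pow_left₀ hn h2 2).trans_eq ?_
      rw [mul_pow, ← Real.rpow_natCast (_ ^ (-b)), ← Real.rpow_mul (by positivity)]
      push_cast
      congr 2
      ring
    refine (Finset.sum_le_sum h1).trans ?_
    rw [← Finset.mul_sum]
    refine mul_le_mul_of_nonneg_left ?_ (by positivity)
    have hinj : Set.InjOn (fun j : ℤ => (c - j).toNat) A' := by
      intro i hi j hj hij
      have h1 : i ≤ c := hA (hA' hi)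
      have h2 : j ≤ c := hA (hA' hj)
      simp only at hij
      omega
    rw [← Finset.sum_image (f := fun i : ℕ => ((g : ℝ) + i) ^ (-(2 * b - 1) - 1)) hinj]
    obtain ⟨N, hN⟩ := (A'.image fun j : ℤ => (c - j).toNat).exists_nat_subset_range
    refine (Finset.sum_le_sum_of_subset_of_nonneg hN fun i _ _ => by positivity).trans ?_
    exact sum_rpow_le h2b (by linarith) hg1 N
  · congr 1
    generalize √(4 * smoothConst p) = D
    rw [Real.sqrt_mul (by positivity), Real.sqrt_sq hΘ, Real.sqrt_mul (by positivity),
      Real.sqrt_eq_rpow ((g : ℝ) ^ (-(2 * b - 1))), ← Real.rpow_mul (by positivity)]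
    have : -(2 * b - 1) * (1 / 2) = 1 / 2 - b := by ring
    rw [this]; ring

/-- Each of finitely many coordinates has total weight at most `Θ g^{-b}`, so their squares are
simply counted. This improves on `infl_past_le` when `A` is much smaller than the gap, as for the
sparse blocks used at high frequencies. -/
theorem infl_finset_le (h : Model μ X θ p b Θ) (hp : 2 < p) {I A : Finset ℤ}
    {c : ℤ} {g : ℕ} (hg : 1 ≤ g) (hA : ∀ j ∈ A, j ≤ c) (hI : ∀ k ∈ I, c + g ≤ k) :
    infl μ (ENNReal.ofReal p) (psum X I) A ≤
      ENNReal.ofReal (√(4 * smoothConst p) * Θ * (√A.card * (g : ℝ) ^ (-b))) := by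
  have hΘ := h.Theta_nonneg
  refine (h.infl_psum_le_of_finset hp (A := A) (c := c) (fun j hj => hA j hj) (I := I)
    (B := A.card * (Θ * (g : ℝ) ^ (-b)) ^ 2) (by positivity) ?_).trans_eq ?_
  · intro A' hA'
    have h1 : ∀ j ∈ A', (∑ k ∈ I, θ (k - j)) ^ 2 ≤ (Θ * (g : ℝ) ^ (-b)) ^ 2 := by
      intro j hj
      have hjc : j ≤ c := hA j (hA' hj)
      have h2 := h.sum_theta_sub_tail_le (I := I) (j := j) (r := g) (by omega)
        (fun k hk => by have := hI k hk; omega)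
      have hn : 0 ≤ ∑ k ∈ I, θ (k - j) := Finset.sum_nonneg fun k _ => h.theta_nonneg _
      exact_mod_cast pow_le_pow_left₀ hn h2 2
    refine (Finset.sum_le_sum h1).trans ?_
    rw [Finset.sum_const, nsmul_eq_mul]
    have : A'.card ≤ A.card := Finset.card_le_card (by exact_mod_cast hA')
    gcongr
  · congr 1
    generalize √(4 * smoothConst p) = D
    rw [Real.sqrt_mul (by positivity), Real.sqrt_sq (by positivity)]
    ring

/-- The average over all coordinates is the mean, which vanishes, so the norm is at most the
influence of everything. In the sum of squares one factor is bounded by `2 Θ` and the other is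
summed first over `j`, which leaves `|I| (2 Θ) ^ 2`. -/
theorem eLpNorm_psum_le (h : Model μ X θ p b Θ) (hp : 2 < p) (I : Finset ℤ) :
    eLpNorm (psum X I) (ENNReal.ofReal p) μ ≤
      ENNReal.ofReal (√(4 * smoothConst p) * (2 * Θ) * √I.card) := by
  have hp1 : (1 : ℝ≥0∞) ≤ ENNReal.ofReal p := by simp; linarith
  have hΘ := h.Theta_nonneg
  obtain ⟨c, hc⟩ : ∃ c : ℤ, ∀ k ∈ I, k ≤ c := I.exists_le
  have h1 := eLpNorm_sub_avg_le h.swap hp1 ENNReal.ofReal_ne_top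
    (h.measurable_psum I).stronglyMeasurable ((h.memLp_psum I).integrable hp1) Set.univ
  have h0 : ∫ x, psum X I x ∂μ = 0 := by
    unfold psum
    rw [integral_finsetSum _ fun k _ => (h.memLp k).integrable hp1]
    simp [h.mean]
  have e : (fun x => psum X I x - avg μ Set.univ (psum X I) x) = psum X I := by
    funext x; simp [avg, mix_univ, h0]
  rw [e, infl_inter (h.dependsOn_psum hc), Set.univ_inter] at h1
  refine h1.trans ((h.infl_psum_le_of_finset hp (A := Set.Iic c) (c := c) le_rfl
    (B := I.card * (2 * Θ) ^ 2) (by positivity) ?_).trans_eq ?_)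
  · intro A' _
    calc ∑ j ∈ A', (∑ k ∈ I, θ (k - j)) ^ 2
        ≤ ∑ j ∈ A', 2 * Θ * ∑ k ∈ I, θ (k - j) := by
          refine Finset.sum_le_sum fun j _ => ?_
          rw [sq]
          exact mul_le_mul_of_nonneg_right (h.sum_theta_sub_le I j)
            (Finset.sum_nonneg fun k _ => h.theta_nonneg _)
      _ = 2 * Θ * ∑ k ∈ I, ∑ j ∈ A', θ (k - j) := by rw [← Finset.mul_sum, Finset.sum_comm]
      _ ≤ 2 * Θ * ∑ k ∈ I, 2 * Θ := by
          gcongr with k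
          exact h.sum_theta_sub_le' A' k
      _ = _ := by rw [Finset.sum_const, nsmul_eq_mul]; ring
  · congr 1
    generalize √(4 * smoothConst p) = D
    rw [Real.sqrt_mul (by positivity), Real.sqrt_sq (by positivity)]
    ring

end Model

end

/-! ### Covariances and the variance of partial sums. -/

section

variable {S : Type*} [MeasurableSpace S]

namespace Model

variable {μ : Measure (ℤ → S)} [IsProbabilityMeasure μ] {X : ℤ → (ℤ → S) → ℝ} {θ : ℤ → ℝ}
  {p b Θ : ℝ}

/-- The autocovariance. -/
def gam (μ : Measure (ℤ → S)) (X : ℤ → (ℤ → S) → ℝ) (k : ℤ) : ℝ := ∫ x, X 0 x * X k x ∂μ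

theorem memLp_mix (h : Model μ X θ p b Θ) (k : ℤ) (A : Set ℤ) :
    MemLp (fun z : (ℤ → S) × (ℤ → S) => X k (mix A z.1 z.2)) (ENNReal.ofReal p) (μ.prod μ) :=
  (h.memLp k).comp_measurePreserving (h.swap.mix A)

theorem eLpNorm_mix (h : Model μ X θ p b Θ) (k : ℤ) (A : Set ℤ) :
    eLpNorm (fun z : (ℤ → S) × (ℤ → S) => X k (mix A z.1 z.2)) (ENNReal.ofReal p) (μ.prod μ) ≤
      ENNReal.ofReal Θ :=
  (eLpNorm_comp_measurePreserving (h.memLp k).1 (h.swap.mix A)).trans_le (h.norm_le k)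

theorem eLpNorm_mix_sub (h : Model μ X θ p b Θ) {A B : Set ℤ} (hAB : Disjoint A B) (k : ℤ) :
    eLpNorm (fun z : (ℤ → S) × (ℤ → S) => X k (mix A z.1 z.2) - X k (mix (A ∪ B) z.1 z.2))
      (ENNReal.ofReal p) (μ.prod μ) = infl μ (ENNReal.ofReal p) (X k) B := by
  have hm : StronglyMeasurable fun z : (ℤ → S) × (ℤ → S) => X k z.1 - X k (mix B z.1 z.2) :=
    (((h.measurable k).comp measurable_fst).sub
      ((h.measurable k).comp (measurable_mix B))).stronglyMeasurable
  have e : (fun z : (ℤ → S) × (ℤ → S) => X k (mix A z.1 z.2) - X k (mix (A ∪ B) z.1 z.2)) =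
      (fun z : (ℤ → S) × (ℤ → S) => X k z.1 - X k (mix B z.1 z.2)) ∘
        fun z => (mix A z.1 z.2, mix A z.2 z.1) := by
    funext z
    have : mix B (mix A z.1 z.2) (mix A z.2 z.1) = mix (A ∪ B) z.1 z.2 := by
      funext j
      by_cases hA : j ∈ A
      · have hB : j ∉ B := Set.disjoint_left.1 hAB hA
        simp [mix, hA, hB]
      · by_cases hB : j ∈ B <;> simp [mix, hA, hB]
    simp [this]
  rw [e, eLpNorm_comp_measurePreserving hm.aestronglyMeasurable (h.swap A), infl]

/-- The contribution of a single coordinate to the covariance. -/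
theorem abs_integral_mul_mix_sub_le (h : Model μ X θ p b Θ) (hp : 2 < p) {A : Set ℤ} {j : ℤ} (hj : j ∉ A) (i k : ℤ) :
    |∫ z : (ℤ → S) × (ℤ → S), X i z.1 * (X k (mix A z.1 z.2) - X k (mix (A ∪ {j}) z.1 z.2))
      ∂(μ.prod μ)| ≤ 1 / 2 * (θ (i - j) * θ (k - j)) := by
  have hd : Disjoint A {j} := Set.disjoint_singleton_right.2 hj
  let D : (ℤ → S) × (ℤ → S) → ℝ := fun z => X k (mix A z.1 z.2) - X k (mix (A ∪ {j}) z.1 z.2)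
  have hDm : Measurable D := ((h.measurable k).comp (measurable_mix _)).sub
    ((h.measurable k).comp (measurable_mix _))
  have hD : eLpNorm D (ENNReal.ofReal p) (μ.prod μ) ≤ ENNReal.ofReal (θ (k - j)) :=
    (h.eLpNorm_mix_sub hd k).trans_le (h.infl_le k j)
  have hX : eLpNorm (fun z : (ℤ → S) × (ℤ → S) => X i z.1) (ENNReal.ofReal p) (μ.prod μ) ≤
      ENNReal.ofReal Θ :=
    (eLpNorm_comp_measurePreserving (h.memLp i).1 measurePreserving_fst).trans_le (h.norm_le i)
  have hX' := h.eLpNorm_mix i {j}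
  have hXm : Measurable fun z : (ℤ → S) × (ℤ → S) => X i z.1 := (h.measurable i).comp measurable_fst
  have hXm' : Measurable fun z : (ℤ → S) × (ℤ → S) => X i (mix {j} z.1 z.2) :=
    (h.measurable i).comp (measurable_mix _)
  have hΘ := h.Theta_nonneg
  obtain ⟨i1, -⟩ := abs_integral_mul_le hp hXm.aestronglyMeasurable hDm.aestronglyMeasurable hΘ
    (h.theta_nonneg _) hX hD
  obtain ⟨i2, -⟩ := abs_integral_mul_le hp hXm'.aestronglyMeasurable hDm.aestronglyMeasurable hΘ
    (h.theta_nonneg _) hX' hD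
  obtain ⟨i3, b3⟩ := abs_integral_mul_le hp (hXm.sub hXm').aestronglyMeasurable
    hDm.aestronglyMeasurable (h.theta_nonneg (i - j)) (h.theta_nonneg _) (h.infl_le i j) hD
  -- Exchanging coordinate `j` between the two sequences turns `D` into `-D` and resamples `j` in `X
  -- i`. The integral is therefore half of the one with the increment of `X i`, so that both factors
  -- are small; this is the source of `1 / 2`.
  have hsw : ∫ z, X i z.1 * D z ∂(μ.prod μ) = -∫ z, X i (mix {j} z.1 z.2) * D z ∂(μ.prod μ) := by
    conv_lhs => rw [← (h.swap {j}).map_eq]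
    have hXD : Measurable fun z => X i z.1 * D z := hXm.mul hDm
    rw [integral_map (h.swap {j}).measurable.aemeasurable hXD.aestronglyMeasurable,
      ← integral_neg]
    congr 1
    funext z
    have e1 : mix A (mix {j} z.1 z.2) (mix {j} z.2 z.1) = mix (A ∪ {j}) z.1 z.2 := by
      funext l
      by_cases hl : l = j
      · subst hl; simp [mix, hj]
      · by_cases hA : l ∈ A <;> simp [mix, hA, hl]
    have e2 : mix (A ∪ {j}) (mix {j} z.1 z.2) (mix {j} z.2 z.1) = mix A z.1 z.2 := by
      funext l
      by_cases hl : l = j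
      · subst hl; simp [mix, hj]
      · by_cases hA : l ∈ A <;> simp [mix, hA, hl]
    simp only [D, e1, e2]
    ring
  have e3 : ∫ z, X i z.1 * D z ∂(μ.prod μ) =
      1 / 2 * ∫ z, (X i z.1 - X i (mix {j} z.1 z.2)) * D z ∂(μ.prod μ) := by
    have : ∫ z, (X i z.1 - X i (mix {j} z.1 z.2)) * D z ∂(μ.prod μ) =
        ∫ z, X i z.1 * D z ∂(μ.prod μ) - ∫ z, X i (mix {j} z.1 z.2) * D z ∂(μ.prod μ) := by
      rw [← integral_sub i1 i2]; congr 1; funext z; ring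
    rw [this, hsw]; ring
  change |∫ z, X i z.1 * D z ∂(μ.prod μ)| ≤ _
  rw [e3, abs_mul, abs_of_pos (by norm_num : (0 : ℝ) < 1 / 2)]
  gcongr
  exact b3

/-- The coordinates `0, -1, …, -N+1` are resampled in `X k` one at a time, then all the remaining
ones below. At the end `X k` is independent of `X 0` and the integral vanishes, so the covariance is
the sum of the changes made on the way. -/
theorem abs_gam_le (h : Model μ X θ p b Θ) (hp : 2 < p) (k : ℤ) (N : ℕ) :
    |gam μ X k| ≤ 1 / 2 * ∑ i ∈ Finset.range N, θ i * θ (k + i) +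
      Θ * (2 * infl μ (ENNReal.ofReal p) (X k) (Set.Iic (-N))).toReal := by
  have hp1 : (1 : ℝ≥0∞) ≤ ENNReal.ofReal p := by simp; linarith
  have hΘ := h.Theta_nonneg
  let A : ℕ → Set ℤ := fun i => Set.Ioc (-(i : ℤ)) 0
  let Y : Set ℤ → (ℤ → S) × (ℤ → S) → ℝ := fun B z => X k (mix B z.1 z.2)
  have hXm : Measurable fun z : (ℤ → S) × (ℤ → S) => X 0 z.1 := (h.measurable 0).comp measurable_fst
  have hX : eLpNorm (fun z : (ℤ → S) × (ℤ → S) => X 0 z.1) (ENNReal.ofReal p) (μ.prod μ) ≤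
      ENNReal.ofReal Θ :=
    (eLpNorm_comp_measurePreserving (h.memLp 0).1 measurePreserving_fst).trans_le (h.norm_le 0)
  have hYm : ∀ B, Measurable (Y B) := fun B => (h.measurable k).comp (measurable_mix _)
  have hi : ∀ B, Integrable (fun z => X 0 z.1 * Y B z) (μ.prod μ) := fun B =>
    (abs_integral_mul_le hp hXm.aestronglyMeasurable (hYm B).aestronglyMeasurable hΘ hΘ hX
      (h.eLpNorm_mix k B)).1
  have h0 : gam μ X k = ∫ z, X 0 z.1 * Y (A 0) z ∂(μ.prod μ) := by
    have : ∀ z : (ℤ → S) × (ℤ → S), X 0 z.1 * Y (A 0) z = (fun x => X 0 x * X k x) z.1 := fun z => by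
      simp [Y, A, mix_empty]
    simp_rw [this]
    rw [integral_fun_fst (μ := μ) (ν := μ) (fun x => X 0 x * X k x)]
    simp [gam]
  have hstep : ∀ n : ℕ, |gam μ X k - ∫ z, X 0 z.1 * Y (A n) z ∂(μ.prod μ)| ≤
      1 / 2 * ∑ i ∈ Finset.range n, θ i * θ (k + i) := by
    intro n
    induction n with
    | zero => simp [h0]
    | succ n ih =>
      rw [Finset.sum_range_succ, mul_add]
      have hA : A (n + 1) = A n ∪ {-(n : ℤ)} := by
        ext j; simp only [A, Set.mem_Ioc, Set.mem_union, Set.mem_singleton_iff]; push_cast; omega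
      have hb := h.abs_integral_mul_mix_sub_le hp (A := A n) (j := -(n : ℤ)) (by simp [A]) 0 k
      have e : ∫ z : (ℤ → S) × (ℤ → S), X 0 z.1 * (X k (mix (A n) z.1 z.2) -
          X k (mix (A n ∪ {-(n : ℤ)}) z.1 z.2)) ∂(μ.prod μ) =
          ∫ z, X 0 z.1 * Y (A n) z ∂(μ.prod μ) - ∫ z, X 0 z.1 * Y (A (n + 1)) z ∂(μ.prod μ) := by
        rw [← integral_sub (hi _) (hi _), hA]; congr 1; funext z; simp only [Y]; ring
      rw [e] at hb
      simp only [zero_add, sub_neg_eq_add] at hb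
      refine le_trans ?_ (add_le_add ih hb)
      refine le_trans (le_of_eq ?_) (abs_add_le _ _)
      congr 1; ring
  have hlast : |∫ z, X 0 z.1 * Y (A N) z ∂(μ.prod μ)| ≤
      Θ * (2 * infl μ (ENNReal.ofReal p) (X k) (Set.Iic (-N))).toReal := by
    have hz : ∫ z, X 0 z.1 * Y (Set.Iic 0) z ∂(μ.prod μ) = 0 := by
      have := integral_mul_mix h.swap (h.adapted 0) (h.measurable 0) (h.measurable k)
      rwa [h.mean, zero_mul] at this
    have hA : Set.Iic 0 = A N ∪ Set.Iic (-(N : ℤ)) := by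
      ext j; simp only [A, Set.mem_Ioc, Set.mem_union, Set.mem_Iic]; omega
    have hd : Disjoint (A N) (Set.Iic (-(N : ℤ))) := by
      rw [Set.disjoint_left]; intro j h1 h2; simp [A] at h1 h2; omega
    have hn := h.eLpNorm_mix_sub hd k
    have hfin : infl μ (ENNReal.ofReal p) (X k) (Set.Iic (-(N : ℤ))) ≠ ∞ := by
      have : MemLp (fun z : (ℤ → S) × (ℤ → S) => X k z.1 - X k (mix (Set.Iic (-(N : ℤ))) z.1 z.2))
        (ENNReal.ofReal p) (μ.prod μ) :=
        ((h.memLp k).comp_measurePreserving measurePreserving_fst).sub (h.memLp_mix k _)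
      exact this.eLpNorm_ne_top
    have hle : infl μ (ENNReal.ofReal p) (X k) (Set.Iic (-(N : ℤ))) ≤
        ENNReal.ofReal (2 * infl μ (ENNReal.ofReal p) (X k) (Set.Iic (-N))).toReal := by
      rw [ENNReal.ofReal_toReal (ENNReal.mul_ne_top (by norm_num) hfin), two_mul]
      exact le_add_self
    have hb := (abs_integral_mul_le hp hXm.aestronglyMeasurable
      ((hYm (A N)).sub (hYm (A N ∪ Set.Iic (-(N : ℤ))))).aestronglyMeasurable hΘ
      ENNReal.toReal_nonneg hX (hn.trans_le hle)).2
    have e : ∫ z, X 0 z.1 * (Y (A N) - Y (A N ∪ Set.Iic (-(N : ℤ)))) z ∂(μ.prod μ) =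
        ∫ z, X 0 z.1 * Y (A N) z ∂(μ.prod μ) -
        ∫ z, X 0 z.1 * Y (A N ∪ Set.Iic (-(N : ℤ))) z ∂(μ.prod μ) := by
      rw [← integral_sub (hi _) (hi _)]; congr 1; funext z; simp only [Pi.sub_apply]; ring
    rw [e, ← hA, hz, sub_zero] at hb
    exact hb
  have := hstep N
  calc |gam μ X k| = |(gam μ X k - ∫ z, X 0 z.1 * Y (A N) z ∂(μ.prod μ)) +
        ∫ z, X 0 z.1 * Y (A N) z ∂(μ.prod μ)| := by congr 1; ring
    _ ≤ _ := (abs_add_le _ _).trans (add_le_add this hlast)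

theorem gam_neg (h : Model μ X θ p b Θ) (k : ℤ) : gam μ X (-k) = gam μ X k := by
  have := h.cov k 0
  simp only [zero_sub] at this
  unfold gam
  rw [← this]
  congr 1; funext x; ring

/-- In the bound of `abs_gam_le` the sum over `k ≥ r` is taken first: for each `i ≥ 0` it is a tail
of `θ` starting at `r + i ≥ r`. Then `N → ∞`, where `star` removes the remainder. The covariances
thus inherit the tail decay of `θ`. -/
theorem sum_abs_gam_le (h : Model μ X θ p b Θ) (hp : 2 < p) {u : Finset ℤ} {r : ℤ} (hr : 1 ≤ r)
    (hu : ∀ k ∈ u, r ≤ k) : ∑ k ∈ u, |gam μ X k| ≤ Θ ^ 2 * (r : ℝ) ^ (-b) := by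
  have hΘ := h.Theta_nonneg
  have hr0 : (0 : ℝ) < r := by exact_mod_cast hr
  have hN : ∀ N : ℕ, ∑ k ∈ u, |gam μ X k| ≤ Θ ^ 2 * (r : ℝ) ^ (-b) +
      ∑ k ∈ u, Θ * (2 * infl μ (ENNReal.ofReal p) (X k) (Set.Iic (-N))).toReal := by
    intro N
    refine (Finset.sum_le_sum fun k _ => h.abs_gam_le hp k N).trans ?_
    rw [Finset.sum_add_distrib]
    gcongr
    rw [← Finset.mul_sum, Finset.sum_comm]
    calc 1 / 2 * ∑ i ∈ Finset.range N, ∑ k ∈ u, θ i * θ (k + i)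
        ≤ 1 / 2 * ∑ i ∈ Finset.range N, θ i * (Θ * (r : ℝ) ^ (-b)) := by
          gcongr with i
          rw [← Finset.mul_sum]
          refine mul_le_mul_of_nonneg_left ?_ (h.theta_nonneg _)
          have := h.sum_theta_sub_tail_le (I := u) (j := -(i : ℤ)) hr
            (fun k hk => by have := hu k hk; omega)
          simpa using this
      _ = 1 / 2 * (∑ i ∈ Finset.range N, θ i) * (Θ * (r : ℝ) ^ (-b)) := by
          rw [← Finset.sum_mul]; ring
      _ ≤ 1 / 2 * (2 * Θ) * (Θ * (r : ℝ) ^ (-b)) := by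
          gcongr
          have := h.sum_theta_le ((Finset.range N).image fun i : ℕ => (i : ℤ))
          rwa [Finset.sum_image fun a _ c _ hac => by simpa using hac] at this
      _ = _ := by ring
  have hlim : Tendsto (fun N : ℕ => Θ ^ 2 * (r : ℝ) ^ (-b) +
      ∑ k ∈ u, Θ * (2 * infl μ (ENNReal.ofReal p) (X k) (Set.Iic (-N))).toReal) atTop
      (𝓝 (Θ ^ 2 * (r : ℝ) ^ (-b) + ∑ k ∈ u, Θ * (2 * 0 : ℝ≥0∞).toReal)) := by
    refine Tendsto.add tendsto_const_nhds (tendsto_finsetSum _ fun k hk => ?_)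
    refine Tendsto.const_mul _ ((ENNReal.tendsto_toReal (by simp)).comp ?_)
    refine ENNReal.Tendsto.const_mul ?_ (Or.inr (by norm_num))
    have h1 : Tendsto (fun N : ℕ => k.toNat + N) atTop atTop :=
      tendsto_atTop_mono (fun N => Nat.le_add_left _ _) tendsto_id
    refine ((h.star k).comp h1).congr fun N => ?_
    have : k - ((k.toNat + N : ℕ) : ℤ) = -(N : ℤ) := by
      have := hu k hk
      push_cast; omega
    simp only [Function.comp, this]
  simp only [mul_zero, ENNReal.toReal_zero, Finset.sum_const_zero, add_zero] at hlim
  exact ge_of_tendsto' hlim hN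

theorem sum_abs_gam_neg_le (h : Model μ X θ p b Θ) (hp : 2 < p) {u : Finset ℤ} {r : ℤ} (hr : 1 ≤ r)
    (hu : ∀ k ∈ u, k ≤ -r) : ∑ k ∈ u, |gam μ X k| ≤ Θ ^ 2 * (r : ℝ) ^ (-b) := by
  have := h.sum_abs_gam_le hp (u := u.image fun k => -k) hr (by
    intro k hk
    obtain ⟨j, hj, rfl⟩ := Finset.mem_image.1 hk
    have := hu j hj
    omega)
  rw [Finset.sum_image fun a _ c _ hac => by simpa using hac] at this
  simpa [h.gam_neg] using this

theorem summable_gam (h : Model μ X θ p b Θ) (hp : 2 < p) : Summable (gam μ X) := by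
  refine Summable.of_abs (summable_of_sum_le (c := |gam μ X 0| + 2 * Θ ^ 2) (fun _ => abs_nonneg _)
    fun u => ?_)
  have h1 := h.sum_abs_gam_le hp (u := u.filter (1 ≤ ·)) le_rfl
    fun k hk => (Finset.mem_filter.1 hk).2
  have h2 := h.sum_abs_gam_neg_le hp (u := u.filter (· ≤ -1)) le_rfl
    fun k hk => (Finset.mem_filter.1 hk).2
  have h3 : ∑ k ∈ u, |gam μ X k| ≤
      ∑ k ∈ insert 0 (u.filter (1 ≤ ·) ∪ u.filter (· ≤ -1)), |gam μ X k| := by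
    refine Finset.sum_le_sum_of_subset_of_nonneg (fun k hk => ?_) fun _ _ _ => abs_nonneg _
    simp only [Finset.mem_insert, Finset.mem_union, Finset.mem_filter, hk, true_and]
    omega
  rw [Finset.sum_insert (by simp), Finset.sum_union (by
    rw [Finset.disjoint_left]; intro k; simp only [Finset.mem_filter]; omega)] at h3
  simp at h1 h2
  linarith

theorem abs_sub_sum_gam_le (h : Model μ X θ p b Θ) (hp : 2 < p) {u₀ : Finset ℤ} {r s : ℤ} (hr : 1 ≤ r)
    (hs : 1 ≤ s) (hu : ∀ k ∉ u₀, k ≤ -r ∨ s ≤ k) :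
    |(∑' k, gam μ X k) - ∑ k ∈ u₀, gam μ X k| ≤
      Θ ^ 2 * (r : ℝ) ^ (-b) + Θ ^ 2 * (s : ℝ) ^ (-b) := by
  have hlim := (h.summable_gam hp).hasSum
  have hlim2 : Tendsto (fun u : Finset ℤ => |(∑ k ∈ u, gam μ X k) - ∑ k ∈ u₀, gam μ X k|) atTop
      (𝓝 |(∑' k, gam μ X k) - ∑ k ∈ u₀, gam μ X k|) := (hlim.sub_const _).abs
  refine le_of_tendsto hlim2 (eventually_atTop.2 ⟨u₀, fun u hu₀ => ?_⟩)
  have e : (∑ k ∈ u, gam μ X k) - ∑ k ∈ u₀, gam μ X k = ∑ k ∈ u \ u₀, gam μ X k := by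
    rw [← Finset.sum_sdiff hu₀]; ring
  rw [e]
  refine (Finset.abs_sum_le_sum_abs _ _).trans ?_
  have h1 := h.sum_abs_gam_neg_le hp (u := (u \ u₀).filter (· ≤ -r)) hr
    fun k hk => (Finset.mem_filter.1 hk).2
  have h2 := h.sum_abs_gam_le hp (u := (u \ u₀).filter (fun k => ¬ k ≤ -r)) hs
    fun k hk => by
      obtain ⟨h1, h2⟩ := Finset.mem_filter.1 hk
      exact (hu k (Finset.mem_sdiff.1 h1).2).resolve_left h2
  rw [← Finset.sum_filter_add_sum_filter_not (u \ u₀) (· ≤ -r)]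
  exact add_le_add h1 h2

theorem integrable_mul (h : Model μ X θ p b Θ) (hp : 2 < p) (i j : ℤ) : Integrable (fun x => X i x * X j x) μ :=
  (abs_integral_mul_le hp (h.measurable i).aestronglyMeasurable
    (h.measurable j).aestronglyMeasurable h.Theta_nonneg h.Theta_nonneg (h.norm_le i)
    (h.norm_le j)).1

theorem integral_psum_mul_psum (h : Model μ X θ p b Θ) (hp : 2 < p) (I J : Finset ℤ) :
    ∫ x, psum X I x * psum X J x ∂μ = ∑ i ∈ I, ∑ j ∈ J, gam μ X (j - i) := by
  unfold psum
  simp_rw [Finset.sum_mul_sum]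
  rw [integral_finsetSum _ fun i _ => integrable_finsetSum _ fun j _ => h.integrable_mul hp i j]
  refine Finset.sum_congr rfl fun i _ => ?_
  rw [integral_finsetSum _ fun j _ => h.integrable_mul hp i j]
  exact Finset.sum_congr rfl fun j _ => h.cov i j

theorem sum_Ioc_rpow_le (hb : 0 ≤ b) (hb1 : b < 1) (n : ℕ) :
    ∑ i ∈ Finset.Ioc (0 : ℤ) n, (i : ℝ) ^ (-b) ≤ (n : ℝ) ^ (1 - b) / (1 - b) := by
  refine le_trans (le_of_eq ?_) (sum_rpow_neg_le hb hb1 n)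
  symm
  refine Finset.sum_bij (fun (i : ℕ) _ => (i : ℤ) + 1) ?_ ?_ ?_ ?_
  · intro i hi; simp at hi ⊢; omega
  · intro i _ j _ hij; omega
  · intro j hj
    simp at hj
    exact ⟨(j - 1).toNat, by simp; omega, by omega⟩
  · intro i _; push_cast; rfl

theorem sum_Ioc_rpow_reflect_le (hb : 0 ≤ b) (hb1 : b < 1) (n : ℕ) :
    ∑ i ∈ Finset.Ioc (0 : ℤ) n, ((n + 1 - i : ℤ) : ℝ) ^ (-b) ≤ (n : ℝ) ^ (1 - b) / (1 - b) := by
  refine le_trans (le_of_eq ?_) (sum_Ioc_rpow_le hb hb1 n)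
  refine Finset.sum_bij (fun (i : ℤ) _ => n + 1 - i) ?_ ?_ ?_ ?_
  · intro i hi; simp at hi ⊢; omega
  · intro i _ j _ hij; omega
  · intro j hj
    simp at hj
    exact ⟨n + 1 - j, by simp; omega, by omega⟩
  · intro i _; rfl

/-- The covariance of two adjacent blocks. -/
theorem abs_integral_adjacent_le (h : Model μ X θ p b Θ) (hp : 2 < p) (hb : 0 ≤ b) (hb1 : b < 1) (m m' : ℕ) :
    |∫ x, psum X (Finset.Ioc 0 m) x * psum X (Finset.Ioc (m : ℤ) (m + m')) x ∂μ| ≤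
      Θ ^ 2 / (1 - b) * (m : ℝ) ^ (1 - b) := by
  rw [h.integral_psum_mul_psum hp]
  refine (Finset.abs_sum_le_sum_abs _ _).trans ?_
  calc ∑ i ∈ Finset.Ioc (0 : ℤ) m, |∑ j ∈ Finset.Ioc (m : ℤ) (m + m'), gam μ X (j - i)|
      ≤ ∑ i ∈ Finset.Ioc (0 : ℤ) m, Θ ^ 2 * ((m + 1 - i : ℤ) : ℝ) ^ (-b) := by
        refine Finset.sum_le_sum fun i hi => (Finset.abs_sum_le_sum_abs _ _).trans ?_
        simp only [Finset.mem_Ioc] at hi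
        have := h.sum_abs_gam_le hp (u := (Finset.Ioc (m : ℤ) (m + m')).image (· - i))
          (r := m + 1 - i) (by omega) (by
            intro k hk
            obtain ⟨j, hj, rfl⟩ := Finset.mem_image.1 hk
            simp only [Finset.mem_Ioc] at hj
            omega)
        rwa [Finset.sum_image fun a _ c _ hac => by simpa using hac] at this
    _ ≤ _ := by
        rw [← Finset.mul_sum, div_mul_eq_mul_div, mul_div_assoc]
        gcongr
        exact sum_Ioc_rpow_reflect_le hb hb1 m

/-- Row `i` of the covariance matrix misses exactly the lags `≤ -i` and `≥ n + 1 - i`. The two tails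
are of order `i^{-b}` and `(n + 1 - i)^{-b}`, and each sums to order `n^{1-b}`. -/
theorem abs_variance_sub_le (h : Model μ X θ p b Θ) (hp : 2 < p) (hb : 0 ≤ b) (hb1 : b < 1) (n : ℕ) :
    |∫ x, psum X (Finset.Ioc 0 n) x ^ 2 ∂μ - n * ∑' k, gam μ X k| ≤
      2 * Θ ^ 2 / (1 - b) * (n : ℝ) ^ (1 - b) := by
  simp_rw [sq]
  rw [h.integral_psum_mul_psum hp]
  have e : (n : ℝ) * ∑' k, gam μ X k = ∑ i ∈ Finset.Ioc (0 : ℤ) n, ∑' k, gam μ X k := by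
    rw [Finset.sum_const, nsmul_eq_mul]; simp
  rw [e, ← Finset.sum_sub_distrib]
  refine (Finset.abs_sum_le_sum_abs _ _).trans ?_
  calc ∑ i ∈ Finset.Ioc (0 : ℤ) n,
        |∑ j ∈ Finset.Ioc (0 : ℤ) n, gam μ X (j - i) - ∑' k, gam μ X k|
      ≤ ∑ i ∈ Finset.Ioc (0 : ℤ) n, (Θ ^ 2 * (i : ℝ) ^ (-b) +
          Θ ^ 2 * ((n + 1 - i : ℤ) : ℝ) ^ (-b)) := by
        refine Finset.sum_le_sum fun i hi => ?_
        simp only [Finset.mem_Ioc] at hi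
        have := h.abs_sub_sum_gam_le hp (u₀ := (Finset.Ioc (0 : ℤ) n).image (· - i))
          (r := i) (s := n + 1 - i) (by omega) (by omega) (by
            intro k hk
            by_contra hcon
            push Not at hcon
            exact hk (Finset.mem_image.2 ⟨k + i, by simp only [Finset.mem_Ioc]; omega, by omega⟩))
        rwa [Finset.sum_image fun a _ c _ hac => by simpa using hac, abs_sub_comm] at this
    _ ≤ Θ ^ 2 * ((n : ℝ) ^ (1 - b) / (1 - b)) + Θ ^ 2 * ((n : ℝ) ^ (1 - b) / (1 - b)) := by
        rw [Finset.sum_add_distrib, ← Finset.mul_sum, ← Finset.mul_sum]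
        gcongr
        · exact sum_Ioc_rpow_le hb hb1 n
        · exact sum_Ioc_rpow_reflect_le hb hb1 n
    _ = _ := by ring

end Model

end

/-! ### Regular sequences, and increments of characters. -/

section

variable {S : Type*} [MeasurableSpace S]

/-- The consequences of `Model` on which the analysis of characteristic functions rests, with
one constant `M`. -/
structure Regular (μ : Measure (ℤ → S)) (X : ℤ → (ℤ → S) → ℝ) (p b M s2 : ℝ) : Prop where
  swap : SwapInvariant μ
  measurable : ∀ k, Measurable (X k)
  adapted : ∀ k, DependsOn (X k) (Set.Iic k)
  mean : ∀ I, ∫ x, psum X I x ∂μ = 0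
  infl_past : ∀ (I : Finset ℤ) (A : Set ℤ) (c : ℤ) (g : ℕ), 1 ≤ g → A ⊆ Set.Iic c →
    (∀ k ∈ I, c + g ≤ k) →
    infl μ (ENNReal.ofReal p) (psum X I) A ≤ ENNReal.ofReal (M * (g : ℝ) ^ (1 / 2 - b))
  infl_finset : ∀ (I A : Finset ℤ) (c : ℤ) (g : ℕ), 1 ≤ g → (∀ j ∈ A, j ≤ c) →
    (∀ k ∈ I, c + g ≤ k) →
    infl μ (ENNReal.ofReal p) (psum X I) A ≤ ENNReal.ofReal (M * (√A.card * (g : ℝ) ^ (-b)))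
  norm_psum : ∀ I : Finset ℤ,
    eLpNorm (psum X I) (ENNReal.ofReal p) μ ≤ ENNReal.ofReal (M * √I.card)
  stat : ∀ (c : ℤ) (n : ℕ), μ.map (psum X (Finset.Ioc c (c + n))) = μ.map (psum X (Finset.Ioc 0 n))
  adjacent : ∀ m m' : ℕ,
    |∫ x, psum X (Finset.Ioc 0 m) x * psum X (Finset.Ioc (m : ℤ) (m + m')) x ∂μ| ≤
      M * (m : ℝ) ^ (1 - b)
  variance : ∀ n : ℕ, |∫ x, psum X (Finset.Ioc 0 n) x ^ 2 ∂μ - n * s2| ≤ M * (n : ℝ) ^ (1 - b)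
  one_le : 1 ≤ M

/-- The constant of `Model.regular`. -/
def regConst (p b Θ : ℝ) : ℝ :=
  1 + √(4 * smoothConst p) * √(2 / (2 * b - 1)) * Θ + √(4 * smoothConst p) * (2 * Θ) +
    2 * Θ ^ 2 / (1 - b)

theorem Model.regular {μ : Measure (ℤ → S)} [IsProbabilityMeasure μ] {X : ℤ → (ℤ → S) → ℝ}
    {θ : ℤ → ℝ} {p b Θ : ℝ} (h : Model μ X θ p b Θ) (hp : 2 < p) (hb : 1 / 2 < b) (hb1 : b < 1) :
    Regular μ X p b (regConst p b Θ) (∑' k, Model.gam μ X k) := by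
  have hΘ := h.Theta_nonneg
  have h2b : 0 < 2 * b - 1 := by linarith
  have h1b : 0 < 1 - b := by linarith
  have a1 : 0 ≤ √(4 * smoothConst p) * √(2 / (2 * b - 1)) * Θ := by positivity
  have a2 : 0 ≤ √(4 * smoothConst p) * (2 * Θ) := by positivity
  have a3 : 0 ≤ 2 * Θ ^ 2 / (1 - b) := by positivity
  have a4 : 0 ≤ √(4 * smoothConst p) * Θ := by positivity
  have hp1 : (1 : ℝ≥0∞) ≤ ENNReal.ofReal p := by simp; linarith
  refine ⟨h.swap, h.measurable, h.adapted, ?_, ?_, ?_, ?_, h.stat, ?_, ?_, ?_⟩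
  · intro I
    unfold psum
    rw [integral_finsetSum _ fun k _ => (h.memLp k).integrable hp1]
    simp [h.mean]
  · intro I A c g hg hA hI
    refine (h.infl_past_le hp hb hb1 hg hA hI).trans (ENNReal.ofReal_le_ofReal ?_)
    gcongr
    unfold regConst; linarith
  · intro I A c g hg hA hI
    refine (h.infl_finset_le hp hg hA hI).trans (ENNReal.ofReal_le_ofReal ?_)
    gcongr
    unfold regConst; linarith
  · intro I
    refine (h.eLpNorm_psum_le hp I).trans (ENNReal.ofReal_le_ofReal ?_)
    gcongr
    unfold regConst; linarith
  · intro m m'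
    refine (h.abs_integral_adjacent_le hp (by linarith) hb1 m m').trans ?_
    gcongr
    have : Θ ^ 2 / (1 - b) ≤ 2 * Θ ^ 2 / (1 - b) := by gcongr; nlinarith [sq_nonneg Θ]
    unfold regConst; linarith
  · intro n
    refine (h.abs_variance_sub_le hp (by linarith) hb1 n).trans ?_
    gcongr
    unfold regConst; linarith
  · unfold regConst; linarith

/-- The character `t ↦ e^{it}`. -/
def ee (t : ℝ) : ℂ := Complex.exp (t * Complex.I)

@[simp] theorem norm_ee (t : ℝ) : ‖ee t‖ = 1 := Complex.norm_exp_ofReal_mul_I t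

theorem ee_add (s t : ℝ) : ee (s + t) = ee s * ee t := by
  unfold ee; rw [← Complex.exp_add]; congr 1; push_cast; ring

@[simp] theorem ee_zero : ee 0 = 1 := by simp [ee]

@[fun_prop]
theorem measurable_ee : Measurable ee := by unfold ee; fun_prop

theorem norm_ee_sub_one_le (t : ℝ) : ‖ee t - 1‖ ≤ |t| := by
  have := Real.norm_exp_I_mul_ofReal_sub_one_le (x := t)
  rwa [mul_comm, Real.norm_eq_abs] at this

theorem norm_ee_sub_le (s t : ℝ) : ‖ee s - ee t‖ ≤ |s - t| := by
  have : ee s - ee t = ee t * (ee (s - t) - 1) := by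
    rw [mul_sub, ← ee_add]; simp
  rw [this, norm_mul, norm_ee, one_mul]
  exact norm_ee_sub_one_le _

/-- For `|s| + |t| ≥ 1` both differences are trivially at most `|s - t|`. Below 1 the second order
estimate holds with exponent one, which is weaker with exponent `r ≤ 1`. It is used with `r = q -
2`, so that only `q` moments are needed. -/
theorem norm_ee_sub_sub_le {r : ℝ} (hr : 0 < r) (hr1 : r ≤ 1) (s t : ℝ) :
    ‖ee s - ee t - Complex.I * (s - t : ℝ)‖ ≤ 2 * |s - t| * (|s| + |t|) ^ r := by
  have hd : |s - t| ≤ |s| + |t| := abs_sub _ _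
  rcases le_or_gt 1 (|s| + |t|) with h1 | h1
  · have h2 : 1 ≤ (|s| + |t|) ^ r := Real.one_le_rpow h1 hr.le
    calc ‖ee s - ee t - Complex.I * (s - t : ℝ)‖ ≤ ‖ee s - ee t‖ + ‖Complex.I * (s - t : ℝ)‖ :=
          norm_sub_le _ _
      _ ≤ |s - t| + |s - t| := by
          gcongr
          · exact norm_ee_sub_le s t
          · rw [norm_mul, Complex.norm_I, one_mul, Complex.norm_real, Real.norm_eq_abs]
      _ ≤ _ := by nlinarith [abs_nonneg (s - t)]
  · have h2 : |s| + |t| ≤ (|s| + |t|) ^ r := by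
      have := Real.rpow_le_rpow_of_exponent_ge' (by positivity) h1.le hr.le hr1
      rwa [Real.rpow_one] at this
    have e : ee s - ee t - Complex.I * (s - t : ℝ) =
        ee t * (ee (s - t) - 1 - (s - t : ℝ) * Complex.I) +
          (s - t : ℝ) * Complex.I * (ee t - 1) := by
      have : ee s = ee t * ee (s - t) := by rw [← ee_add]; congr 1; ring
      rw [this]; ring
    have h3 : ‖ee (s - t) - 1 - (s - t : ℝ) * Complex.I‖ ≤ |s - t| ^ 2 := by
      have hn : ‖((s - t : ℝ) : ℂ) * Complex.I‖ = |s - t| := by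
        rw [norm_mul, Complex.norm_I, mul_one, Complex.norm_real, Real.norm_eq_abs]
      have := Complex.norm_exp_sub_one_sub_id_le (x := (s - t : ℝ) * Complex.I)
        (by rw [hn]; linarith)
      rwa [hn] at this
    rw [e]
    refine (norm_add_le _ _).trans ?_
    rw [norm_mul, norm_mul, norm_mul, norm_ee, one_mul, Complex.norm_I, mul_one,
      Complex.norm_real, Real.norm_eq_abs]
    have h4 := norm_ee_sub_one_le t
    have h5 : |s - t| * ‖ee t - 1‖ ≤ |s - t| * (|s| + |t|) := by
      gcongr; linarith [abs_nonneg s]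
    have h6 : |s - t| ^ 2 ≤ |s - t| * (|s| + |t|) := by rw [sq]; gcongr
    have h7 : |s - t| * (|s| + |t|) ≤ |s - t| * (|s| + |t|) ^ r := by gcongr
    linarith

/-- Second order expansion of a product of increments of the character. -/
theorem norm_ee_sub_mul_ee_sub_add_le {r : ℝ} (hr : 0 < r) (hr1 : r ≤ 1) (s s' t t' : ℝ) :
    ‖(ee s - ee s') * (ee t - ee t') + ((s - s') * (t - t') : ℝ)‖ ≤
      2 * (|s - s'| * |t - t'| * (|s| + |s'|) ^ r) + 2 * (|s - s'| * |t - t'| * (|t| + |t'|) ^ r) := by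
  have e : (ee s - ee s') * (ee t - ee t') + ((s - s') * (t - t') : ℝ) =
      (ee s - ee s' - Complex.I * (s - s' : ℝ)) * (ee t - ee t') +
        Complex.I * (s - s' : ℝ) * (ee t - ee t' - Complex.I * (t - t' : ℝ)) := by
    push_cast
    linear_combination ((s - s') * (t - t') : ℂ) * Complex.I_mul_I
  rw [e]
  refine (norm_add_le _ _).trans ?_
  rw [norm_mul, norm_mul, norm_mul, Complex.norm_I, one_mul, Complex.norm_real, Real.norm_eq_abs]
  have h1 := norm_ee_sub_sub_le hr hr1 s s'
  have h2 := norm_ee_sub_sub_le hr hr1 t t'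
  have h3 := norm_ee_sub_le t t'
  have := mul_le_mul h1 h3 (norm_nonneg _) (by positivity)
  have := mul_le_mul_of_nonneg_left h2 (abs_nonneg (s - s'))
  nlinarith

section pair

variable {Z : Type*} [MeasurableSpace Z] {κ : Measure Z} [IsProbabilityMeasure κ] {q : ℝ}

theorem integrable_of_norm_le {f : Z → ℂ} (hf : Measurable f) (C : ℝ) (h : ∀ z, ‖f z‖ ≤ C) :
    Integrable f κ :=
  Integrable.of_bound hf.aestronglyMeasurable C (ae_of_all _ h)

/-- To leading order a product of two increments of characters is `-ξ²` times the product of the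
increments. In the remainder, Hölder gives exponent one to each increment and `q - 2` to the sizes,
so the smallness of both increments is kept. -/
theorem norm_integral_pair_le (hq : 2 < q) (hq3 : q ≤ 3) {A A' B B' : Z → ℝ} (hA : Measurable A)
    (hA' : Measurable A') (hB : Measurable B) (hB' : Measurable B') {a d c : ℝ} (ha : 0 ≤ a)
    (hd : 0 ≤ d) (hc : 0 ≤ c)
    (nAA : eLpNorm (fun z => A z - A' z) (ENNReal.ofReal q) κ ≤ ENNReal.ofReal a)
    (nBB : eLpNorm (fun z => B z - B' z) (ENNReal.ofReal q) κ ≤ ENNReal.ofReal d)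
    (nA : eLpNorm A (ENNReal.ofReal q) κ ≤ ENNReal.ofReal c)
    (nA' : eLpNorm A' (ENNReal.ofReal q) κ ≤ ENNReal.ofReal c)
    (nB : eLpNorm B (ENNReal.ofReal q) κ ≤ ENNReal.ofReal c)
    (nB' : eLpNorm B' (ENNReal.ofReal q) κ ≤ ENNReal.ofReal c) (ξ : ℝ) :
    ‖∫ z, (ee (ξ * A z) - ee (ξ * A' z)) * (ee (ξ * B z) - ee (ξ * B' z)) ∂κ +
      (ξ ^ 2 * ∫ z, (A z - A' z) * (B z - B' z) ∂κ : ℝ)‖ ≤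
      4 * |ξ| ^ q * (a * d * (2 * c) ^ (q - 2)) := by
  have hq1 : (1 : ℝ≥0∞) ≤ ENNReal.ofReal q := by simp; linarith
  have hsum : ∀ {F G : Z → ℝ}, Measurable F → Measurable G →
      eLpNorm F (ENNReal.ofReal q) κ ≤ ENNReal.ofReal c →
      eLpNorm G (ENNReal.ofReal q) κ ≤ ENNReal.ofReal c →
      eLpNorm (fun z => |F z| + |G z|) (ENNReal.ofReal q) κ ≤ ENNReal.ofReal (2 * c) := by
    intro F G hF hG h1 h2
    refine (eLpNorm_add_le hF.abs.aestronglyMeasurable hG.abs.aestronglyMeasurable hq1).trans ?_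
    rw [two_mul, ENNReal.ofReal_add hc hc]
    refine add_le_add ?_ ?_
    · exact (eLpNorm_norm F).trans_le h1
    · exact (eLpNorm_norm G).trans_le h2
  obtain ⟨i1, b1⟩ := integral_mul_mul_rpow_le (by linarith : 0 < q)
    (hA.sub hA').aestronglyMeasurable (hB.sub hB').aestronglyMeasurable
    (hA.abs.add hA'.abs).aestronglyMeasurable (a := 1) (b := 1) (c := q - 2) zero_le_one
    zero_le_one (by linarith) (by ring) ha hd (by linarith : 0 ≤ 2 * c) nAA nBB
    (hsum hA hA' nA nA')
  obtain ⟨i2, b2⟩ := integral_mul_mul_rpow_le (by linarith : 0 < q)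
    (hA.sub hA').aestronglyMeasurable (hB.sub hB').aestronglyMeasurable
    (hB.abs.add hB'.abs).aestronglyMeasurable (a := 1) (b := 1) (c := q - 2) zero_le_one
    zero_le_one (by linarith) (by ring) ha hd (by linarith : 0 ≤ 2 * c) nAA nBB
    (hsum hB hB' nB nB')
  simp only [Real.rpow_one, Pi.sub_apply, Pi.add_apply] at i1 b1 i2 b2
  have i3 := (abs_integral_mul_le hq (hA.sub hA').aestronglyMeasurable
    (hB.sub hB').aestronglyMeasurable ha hd nAA nBB).1
  simp only [Pi.sub_apply] at i3
  have i4 : Integrable (fun z => (ee (ξ * A z) - ee (ξ * A' z)) *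
      (ee (ξ * B z) - ee (ξ * B' z))) κ := by
    refine integrable_of_norm_le (by fun_prop) 4 fun z => ?_
    rw [norm_mul]
    have h1 := (norm_sub_le (ee (ξ * A z)) (ee (ξ * A' z)))
    have h2 := (norm_sub_le (ee (ξ * B z)) (ee (ξ * B' z)))
    simp only [norm_ee] at h1 h2
    nlinarith [norm_nonneg (ee (ξ * A z) - ee (ξ * A' z)),
      norm_nonneg (ee (ξ * B z) - ee (ξ * B' z))]
  have i5 : Integrable (fun z => (((ξ * A z - ξ * A' z) * (ξ * B z - ξ * B' z) : ℝ) : ℂ)) κ := by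
    have i5' : Integrable (fun z => (ξ * A z - ξ * A' z) * (ξ * B z - ξ * B' z)) κ :=
      (i3.const_mul (ξ ^ 2)).congr (ae_of_all _ fun z => by ring)
    exact i5'.ofReal
  have e : ∫ z, (ee (ξ * A z) - ee (ξ * A' z)) * (ee (ξ * B z) - ee (ξ * B' z)) ∂κ +
      (ξ ^ 2 * ∫ z, (A z - A' z) * (B z - B' z) ∂κ : ℝ) =
      ∫ z, ((ee (ξ * A z) - ee (ξ * A' z)) * (ee (ξ * B z) - ee (ξ * B' z)) +
        ((ξ * A z - ξ * A' z) * (ξ * B z - ξ * B' z) : ℝ)) ∂κ := by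
    rw [integral_add i4 i5, integral_complex_ofReal, ← integral_const_mul]
    congr 3
    funext z; ring
  rw [e]
  refine (norm_integral_le_of_norm_le (g := fun z =>
    2 * |ξ| ^ q * (|A z - A' z| * |B z - B' z| * |(|A z| + |A' z|)| ^ (q - 2)) +
    2 * |ξ| ^ q * (|A z - A' z| * |B z - B' z| * |(|B z| + |B' z|)| ^ (q - 2)))
    ((i1.const_mul _).add (i2.const_mul _)) (ae_of_all _ fun z => ?_)).trans ?_
  · refine (norm_ee_sub_mul_ee_sub_add_le (r := q - 2) (by linarith) (by linarith) _ _ _ _).trans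
      (le_of_eq ?_)
    have hx : |ξ| * |ξ| * |ξ| ^ (q - 2) = |ξ| ^ q := by
      rcases (abs_nonneg ξ).eq_or_lt with h0 | h0
      · rw [← h0, Real.zero_rpow (ne_of_gt (by linarith) : q ≠ 0)]; ring
      · rw [← sq, ← Real.rpow_natCast, ← Real.rpow_add h0]; congr 1; push_cast; ring
    have hab : ∀ s t : ℝ, |ξ * s - ξ * t| = |ξ| * |s - t| := fun s t => by
      rw [← mul_sub, abs_mul]
    have hsm : ∀ s t : ℝ, (|ξ * s| + |ξ * t|) ^ (q - 2) =
        |ξ| ^ (q - 2) * |(|s| + |t|)| ^ (q - 2) := fun s t => by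
      rw [abs_mul, abs_mul, ← mul_add, Real.mul_rpow (abs_nonneg _) (by positivity),
        abs_of_nonneg (by positivity : 0 ≤ |s| + |t|)]
    rw [hab, hab, hsm, hsm, ← hx]
    ring
  · rw [integral_add (i1.const_mul _) (i2.const_mul _), integral_const_mul, integral_const_mul]
    have : 0 ≤ 2 * |ξ| ^ q := by positivity
    nlinarith

end pair

end

/-! ### Factorisation over adjacent blocks with an explicit covariance term. -/

section

variable {S : Type*} [MeasurableSpace S]

/-- The characteristic function of `X_1 + ⋯ + X_n` at `ξ`. -/
def cf (μ : Measure (ℤ → S)) (X : ℤ → (ℤ → S) → ℝ) (n : ℕ) (ξ : ℝ) : ℂ :=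
  ∫ x, ee (ξ * psum X (Finset.Ioc 0 (n : ℤ)) x) ∂μ

theorem norm_cf_le_one {μ : Measure (ℤ → S)} [IsProbabilityMeasure μ] (X : ℤ → (ℤ → S) → ℝ) (n : ℕ)
    (ξ : ℝ) : ‖cf μ X n ξ‖ ≤ 1 := by
  unfold cf
  refine (norm_integral_le_of_norm_le_const (C := 1) (ae_of_all _ fun y => (norm_ee _).le)).trans ?_
  simp

theorem integral_sub_sub_sub {Z V : Type*} [MeasurableSpace Z] {κ : Measure Z}
    [NormedAddCommGroup V] [NormedSpace ℝ V] {f g k l : Z → V} (hf : Integrable f κ)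
    (hg : Integrable g κ) (hk : Integrable k κ) (hl : Integrable l κ) :
    ∫ z, f z - g z - (k z - l z) ∂κ =
      ∫ z, f z ∂κ - ∫ z, g z ∂κ - (∫ z, k z ∂κ - ∫ z, l z ∂κ) := by
  have h1 := integral_sub (hf.sub hg) (hk.sub hl)
  simp only [Pi.sub_apply] at h1
  rw [h1, integral_sub hf hg, integral_sub hk hl]

namespace Regular

variable {μ : Measure (ℤ → S)} [IsProbabilityMeasure μ] {X : ℤ → (ℤ → S) → ℝ} {p b M s2 q : ℝ}

@[fun_prop]
theorem measurable_psum (h : Regular μ X p b M s2) (I : Finset ℤ) : Measurable (psum X I) := by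
  have := h.measurable
  unfold psum; fun_prop

theorem dependsOn_psum (h : Regular μ X p b M s2) {I : Finset ℤ} {c : ℤ} (hI : ∀ k ∈ I, k ≤ c) :
    DependsOn (psum X I) (Set.Iic c) := by
  intro x y hxy
  unfold psum
  exact Finset.sum_congr rfl fun k hk => h.adapted k fun j hj => hxy j (le_trans hj (hI k hk))

theorem M_pos (h : Regular μ X p b M s2) : 0 < M := lt_of_lt_of_le one_pos h.one_le

theorem norm_psum_q (h : Regular μ X p b M s2) (hqp : q ≤ p) (I : Finset ℤ) :
    eLpNorm (psum X I) (ENNReal.ofReal q) μ ≤ ENNReal.ofReal (M * √I.card) :=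
  (eLpNorm_le_eLpNorm_of_exponent_le (ENNReal.ofReal_le_ofReal hqp)
    (h.measurable_psum I).aestronglyMeasurable).trans (h.norm_psum I)

theorem memLp_psum (h : Regular μ X p b M s2) (I : Finset ℤ) :
    MemLp (psum X I) (ENNReal.ofReal p) μ :=
  ⟨(h.measurable_psum I).aestronglyMeasurable, (h.norm_psum I).trans_lt ENNReal.ofReal_lt_top⟩

theorem cf_eq (h : Regular μ X p b M s2) (c : ℤ) (n : ℕ) (ξ : ℝ) :
    ∫ x, ee (ξ * psum X (Finset.Ioc c (c + n)) x) ∂μ = cf μ X n ξ := by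
  unfold cf
  have hm : Measurable fun t : ℝ => ee (ξ * t) := by fun_prop
  have e := h.stat c n
  have h1 := integral_map (μ := μ) (h.measurable_psum (Finset.Ioc c (c + n))).aemeasurable
    (f := fun t : ℝ => ee (ξ * t)) hm.aestronglyMeasurable
  have h2 := integral_map (μ := μ) (h.measurable_psum (Finset.Ioc 0 (n : ℤ))).aemeasurable
    (f := fun t : ℝ => ee (ξ * t)) hm.aestronglyMeasurable
  rw [← h1, ← h2, e]

theorem psum_union {I J : Finset ℤ} (hd : Disjoint I J) (x : ℤ → S) :
    psum X (I ∪ J) x = psum X I x + psum X J x := by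
  unfold psum; rw [Finset.sum_union hd]

theorem psum_Ioc_add (a c d : ℤ) (h1 : a ≤ c) (h2 : c ≤ d) (x : ℤ → S) :
    psum X (Finset.Ioc a d) x = psum X (Finset.Ioc a c) x + psum X (Finset.Ioc c d) x := by
  rw [← psum_union, Finset.Ioc_union_Ioc_eq_Ioc h1 h2]
  rw [Finset.disjoint_left]; intro k; simp; omega

/-- Approximate factorisation of the characteristic function over two adjacent blocks, with the
second order term made explicit. -/
theorem norm_cf_add_sub_mul_add_le (h : Regular μ X p b M s2) (hq : 2 < q) (hq3 : q ≤ 3)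
    (hqp : q ≤ p) {m m' L : ℕ} (hm : 1 ≤ m) (hm' : m' ≤ 2 * m) (hL : 1 ≤ L) (hLm : L ≤ m) (ξ : ℝ) :
    ‖cf μ X (m + m') ξ - cf μ X m ξ * cf μ X m' ξ +
      (ξ ^ 2 * ∫ x, psum X (Finset.Ioc 0 m) x * psum X (Finset.Ioc (m : ℤ) (m + m')) x ∂μ : ℝ)‖ ≤
      4 * |ξ| ^ q * (M * √m * (M * (L : ℝ) ^ (1 / 2 - b)) * (2 * (2 * M * √m)) ^ (q - 2)) +
      4 * |ξ| ^ q * (M * √L * (2 * M) * (2 * (2 * M * √m)) ^ (q - 2)) := by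
  have hM := h.M_pos
  have hsw := h.swap
  have hp : 2 < p := by linarith
  have hq1 : (1 : ℝ≥0∞) ≤ ENNReal.ofReal q := by simp; linarith
  have hqp' : ENNReal.ofReal q ≤ ENNReal.ofReal p := ENNReal.ofReal_le_ofReal hqp
  set U := psum X (Finset.Ioc 0 (m : ℤ)) with hU
  set U0 := psum X (Finset.Ioc 0 ((m : ℤ) - L)) with hU0
  set T := psum X (Finset.Ioc (m : ℤ) (m + m')) with hT
  set A0 : Set ℤ := Set.Iic ((m : ℤ) - L) with hA0
  set A1 : Set ℤ := Set.Iic (m : ℤ) with hA1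
  have mU : Measurable U := h.measurable_psum _
  have mU0 : Measurable U0 := h.measurable_psum _
  have mT : Measurable T := h.measurable_psum _
  have dU : DependsOn U A1 := h.dependsOn_psum (by simp)
  have dU0 : DependsOn U0 A0 := h.dependsOn_psum (by simp)
  have dU0' : DependsOn U0 A1 := h.dependsOn_psum (by simp; omega)
  have iT : infl μ (ENNReal.ofReal q) T A0 ≤ ENNReal.ofReal (M * (L : ℝ) ^ (1 / 2 - b)) := by
    refine (infl_mono_exponent mT.stronglyMeasurable hqp').trans (h.infl_past _ _ _ L hL subset_rfl ?_)
    simp; omega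
  have iT1 : ∀ A : Set ℤ, A ⊆ A1 → infl μ (ENNReal.ofReal q) T A ≤ ENNReal.ofReal M := by
    intro A hA
    refine (infl_mono_exponent mT.stronglyMeasurable hqp').trans
      ((h.infl_past _ _ _ 1 le_rfl hA ?_).trans_eq (by simp))
    simp; omega
  have nU : eLpNorm U (ENNReal.ofReal q) μ ≤ ENNReal.ofReal (M * √m) := by
    simpa using h.norm_psum_q hqp (Finset.Ioc 0 (m : ℤ))
  have hsm : √(m' : ℝ) ≤ 2 * √m := by
    rw [Real.sqrt_le_left (by positivity), mul_pow, Real.sq_sqrt (by positivity)]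
    have : (m' : ℝ) ≤ 2 * m := by exact_mod_cast hm'
    nlinarith
  have nT : eLpNorm T (ENNReal.ofReal q) μ ≤ ENNReal.ofReal (2 * M * √m) := by
    refine (h.norm_psum_q hqp (Finset.Ioc (m : ℤ) (m + m'))).trans (ENNReal.ofReal_le_ofReal ?_)
    simp; nlinarith
  have nU' : eLpNorm U (ENNReal.ofReal q) μ ≤ ENNReal.ofReal (2 * M * √m) := by
    refine nU.trans (ENNReal.ofReal_le_ofReal ?_); nlinarith [Real.sqrt_nonneg m]
  have nU0 : eLpNorm U0 (ENNReal.ofReal q) μ ≤ ENNReal.ofReal (2 * M * √m) := by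
    refine (h.norm_psum_q hqp _).trans (ENNReal.ofReal_le_ofReal ?_)
    have : √(((Finset.Ioc 0 ((m : ℤ) - L)).card : ℕ) : ℝ) ≤ √m := by
      apply Real.sqrt_le_sqrt
      have : (Finset.Ioc 0 ((m : ℤ) - L)).card ≤ m := by simp
      exact_mod_cast this
    nlinarith [Real.sqrt_nonneg m]
  have lift1 : ∀ {F : (ℤ → S) → ℝ}, Measurable F →
      eLpNorm (fun z : (ℤ → S) × (ℤ → S) => F z.1) (ENNReal.ofReal q) (μ.prod μ) =
        eLpNorm F (ENNReal.ofReal q) μ := fun {F} hF =>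
    eLpNorm_comp_measurePreserving (f := Prod.fst) (g := F) hF.aestronglyMeasurable
      measurePreserving_fst
  have lift2 : ∀ {F : (ℤ → S) → ℝ} (A : Set ℤ), Measurable F →
      eLpNorm (fun z : (ℤ → S) × (ℤ → S) => F (mix A z.1 z.2)) (ENNReal.ofReal q) (μ.prod μ) =
        eLpNorm F (ENNReal.ofReal q) μ := fun {F} A hF =>
    eLpNorm_comp_measurePreserving (g := F) hF.aestronglyMeasurable (hsw.mix A)
  have nU0d : eLpNorm (fun z : (ℤ → S) × (ℤ → S) => U z.1 - U0 z.1) (ENNReal.ofReal q) (μ.prod μ)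
      ≤ ENNReal.ofReal (M * √L) := by
    have e : (fun z : (ℤ → S) × (ℤ → S) => U z.1 - U0 z.1) =
        fun z => psum X (Finset.Ioc ((m : ℤ) - L) m) z.1 := by
      funext z
      rw [hU, hU0, psum_Ioc_add 0 ((m : ℤ) - L) m (by omega) (by omega)]; ring
    rw [e, lift1 (h.measurable_psum _)]
    simpa using h.norm_psum_q hqp (Finset.Ioc ((m : ℤ) - L) m)
  have nTd : eLpNorm (fun z : (ℤ → S) × (ℤ → S) => T (mix A0 z.1 z.2) - T (mix A1 z.1 z.2))
      (ENNReal.ofReal q) (μ.prod μ) ≤ ENNReal.ofReal (2 * M) := by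
    have e : (fun z : (ℤ → S) × (ℤ → S) => T (mix A0 z.1 z.2) - T (mix A1 z.1 z.2)) =
        (fun z => T z.1 - T (mix A1 z.1 z.2)) - (fun z => T z.1 - T (mix A0 z.1 z.2)) := by
      funext z; simp
    rw [e]
    refine (eLpNorm_sub_le (by fun_prop) (by fun_prop) hq1).trans ?_
    rw [two_mul, ENNReal.ofReal_add hM.le hM.le]
    exact add_le_add (iT1 A1 subset_rfl) (iT1 A0 (Set.Iic_subset_Iic.2 (by omega)))
  -- The past of the second block is resampled in two stages: up to time `m - L` (`A0`), then up to
  -- `m` (`A1`). In the first stage `T` changes little. In the second, `U` may be replaced by its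
  -- last `L` terms: `U0` depends only on coordinates in `A0`, hence is independent of both
  -- resampled versions of `T`, and its contributions cancel. The two leading terms telescope to
  -- `φ_{m+m'} - φ_m φ_{m'}` and the two covariances to `E[U T]`.
  have P1 := norm_integral_pair_le (κ := μ.prod μ) hq hq3 (A := fun z => U z.1) (A' := fun _ => 0)
    (B := fun z => T z.1) (B' := fun z => T (mix A0 z.1 z.2)) (by fun_prop) (by fun_prop)
    (by fun_prop) (by fun_prop) (a := M * √m) (d := M * (L : ℝ) ^ (1 / 2 - b))
    (c := 2 * M * √m) (by positivity) (by positivity) (by positivity)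
    (by simpa [lift1 mU] using nU) iT (by rw [lift1 mU]; exact nU') (by simp)
    (by rw [lift1 mT]; exact nT) (by rw [lift2 A0 mT]; exact nT) ξ
  have P2 := norm_integral_pair_le (κ := μ.prod μ) hq hq3 (A := fun z => U z.1)
    (A' := fun z => U0 z.1)
    (B := fun z => T (mix A0 z.1 z.2)) (B' := fun z => T (mix A1 z.1 z.2)) (by fun_prop)
    (by fun_prop) (by fun_prop) (by fun_prop) (a := M * √L) (d := 2 * M)
    (c := 2 * M * √m) (by positivity) (by positivity) (by positivity)
    nU0d nTd (by rw [lift1 mU]; exact nU') (by rw [lift1 mU0]; exact nU0)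
    (by rw [lift2 A0 mT]; exact nT) (by rw [lift2 A1 mT]; exact nT) ξ
  refine le_trans (le_of_eq ?_) ((norm_add_le _ _).trans (add_le_add P1 P2))
  congr 1
  have bd : ∀ {f : (ℤ → S) × (ℤ → S) → ℂ}, Measurable f → (∀ z, ‖f z‖ ≤ 1) →
      Integrable f (μ.prod μ) := fun hf h1 => integrable_of_norm_le hf 1 h1
  have Lq : ∀ {F : (ℤ → S) → ℝ}, Measurable F →
      eLpNorm F (ENNReal.ofReal q) μ ≤ ENNReal.ofReal (2 * M * √m) →
      ∀ {G : (ℤ → S) → ℝ}, Measurable G →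
      eLpNorm G (ENNReal.ofReal q) μ ≤ ENNReal.ofReal (2 * M * √m) → ∀ A : Set ℤ,
      Integrable (fun z : (ℤ → S) × (ℤ → S) => F z.1 * G (mix A z.1 z.2)) (μ.prod μ) := by
    intro F hF nF G hG nG A
    refine (abs_integral_mul_le hq (f := fun z : (ℤ → S) × (ℤ → S) => F z.1)
      (g := fun z => G (mix A z.1 z.2)) (Measurable.aestronglyMeasurable (by fun_prop))
      (Measurable.aestronglyMeasurable (by fun_prop))
      (a := 2 * M * √m) (c := 2 * M * √m) (by positivity) (by positivity) ?_ ?_).1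
    · rw [lift1 hF]; exact nF
    · rw [lift2 A hG]; exact nG
  have mean0 : ∫ x, T x ∂μ = 0 := h.mean _
  have z1 : ∫ z, U z.1 * T (mix A1 z.1 z.2) ∂(μ.prod μ) = 0 := by
    rw [integral_mul_mix hsw dU mU mT, mean0, mul_zero]
  have z2 : ∫ z, U0 z.1 * T (mix A1 z.1 z.2) ∂(μ.prod μ) = 0 := by
    rw [integral_mul_mix hsw dU0' mU0 mT, mean0, mul_zero]
  have z3 : ∫ z, U0 z.1 * T (mix A0 z.1 z.2) ∂(μ.prod μ) = 0 := by
    rw [integral_mul_mix hsw dU0 mU0 mT, mean0, mul_zero]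
  have i0 : Integrable (fun z : (ℤ → S) × (ℤ → S) => U z.1 * T z.1) (μ.prod μ) := by
    have := Lq mU nU' mT nT ∅
    simpa only [mix_empty] using this
  have i1 := Lq mU nU' mT nT A0
  have i2 := Lq mU nU' mT nT A1
  have i3 := Lq mU0 nU0 mT nT A0
  have i4 := Lq mU0 nU0 mT nT A1
  have v1 : ∫ z, (U z.1 - 0) * (T z.1 - T (mix A0 z.1 z.2)) ∂(μ.prod μ) =
      ∫ x, U x * T x ∂μ - ∫ z, U z.1 * T (mix A0 z.1 z.2) ∂(μ.prod μ) := by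
    simp only [sub_zero, mul_sub]
    rw [integral_sub i0 i1, integral_fun_fst (μ := μ) (ν := μ) (fun x => U x * T x)]
    simp
  have v2 : ∫ z, (U z.1 - U0 z.1) * (T (mix A0 z.1 z.2) - T (mix A1 z.1 z.2)) ∂(μ.prod μ) =
      ∫ z, U z.1 * T (mix A0 z.1 z.2) ∂(μ.prod μ) := by
    have : ∀ z : (ℤ → S) × (ℤ → S), (U z.1 - U0 z.1) * (T (mix A0 z.1 z.2) - T (mix A1 z.1 z.2)) =
        (U z.1 * T (mix A0 z.1 z.2) - U z.1 * T (mix A1 z.1 z.2)) -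
        (U0 z.1 * T (mix A0 z.1 z.2) - U0 z.1 * T (mix A1 z.1 z.2)) := fun z => by ring
    simp_rw [this]
    rw [integral_sub_sub_sub i1 i2 i3 i4, z1, z2, z3]
    ring
  rw [v1, v2]
  set u : (ℤ → S) → ℂ := fun x => ee (ξ * U x) with hu
  set u0 : (ℤ → S) → ℂ := fun x => ee (ξ * U0 x) with hu0
  set t : (ℤ → S) → ℂ := fun x => ee (ξ * T x) with ht
  have mu' : Measurable u := by fun_prop
  have mu0 : Measurable u0 := by fun_prop
  have mt : Measurable t := by fun_prop
  have w1 : ∫ z, u z.1 * t (mix A1 z.1 z.2) ∂(μ.prod μ) = (∫ x, u x ∂μ) * ∫ x, t x ∂μ :=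
    integral_mul_mix hsw (fun x y hxy => by simp only [hu, dU hxy]) mu' mt
  have w2 : ∫ z, u0 z.1 * t (mix A1 z.1 z.2) ∂(μ.prod μ) = (∫ x, u0 x ∂μ) * ∫ x, t x ∂μ :=
    integral_mul_mix hsw (fun x y hxy => by simp only [hu0, dU0' hxy]) mu0 mt
  have w3 : ∫ z, u0 z.1 * t (mix A0 z.1 z.2) ∂(μ.prod μ) = (∫ x, u0 x ∂μ) * ∫ x, t x ∂μ :=
    integral_mul_mix hsw (fun x y hxy => by simp only [hu0, dU0 hxy]) mu0 mt
  have w4 : ∫ z, t (mix A0 z.1 z.2) ∂(μ.prod μ) = ∫ x, t x ∂μ := by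
    conv_rhs => rw [← (hsw.mix A0).map_eq]
    rw [integral_map (hsw.mix A0).measurable.aemeasurable mt.aestronglyMeasurable]
  have w5 : ∫ z, t z.1 ∂(μ.prod μ) = ∫ x, t x ∂μ := by
    rw [integral_fun_fst (μ := μ) (ν := μ) t]; simp
  have w6 : ∫ z, u z.1 * t z.1 ∂(μ.prod μ) = cf μ X (m + m') ξ := by
    rw [integral_fun_fst (μ := μ) (ν := μ) fun x => u x * t x]
    simp only [probReal_univ, one_smul, cf, hu, ht, ← ee_add, ← mul_add, hU, hT]
    congr 1; funext x
    rw [Nat.cast_add, psum_Ioc_add 0 (m : ℤ) (m + m') (by omega) (by omega)]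
  have hcu : ∫ x, u x ∂μ = cf μ X m ξ := rfl
  have hct : ∫ x, t x ∂μ = cf μ X m' ξ := h.cf_eq m m' ξ
  have nu : ∀ x, ‖u x‖ = 1 := fun x => norm_ee _
  have nu0 : ∀ x, ‖u0 x‖ = 1 := fun x => norm_ee _
  have nt : ∀ x, ‖t x‖ = 1 := fun x => norm_ee _
  have j1 : Integrable (fun z : (ℤ → S) × (ℤ → S) => u z.1 * t z.1) (μ.prod μ) :=
    bd (by fun_prop) (by simp [nu, nt])
  have j2 : Integrable (fun z : (ℤ → S) × (ℤ → S) => u z.1 * t (mix A0 z.1 z.2)) (μ.prod μ) :=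
    bd (by fun_prop) (by simp [nu, nt])
  have j3 : Integrable (fun z : (ℤ → S) × (ℤ → S) => u z.1 * t (mix A1 z.1 z.2)) (μ.prod μ) :=
    bd (by fun_prop) (by simp [nu, nt])
  have j4 : Integrable (fun z : (ℤ → S) × (ℤ → S) => u0 z.1 * t (mix A0 z.1 z.2)) (μ.prod μ) :=
    bd (by fun_prop) (by simp [nu0, nt])
  have j5 : Integrable (fun z : (ℤ → S) × (ℤ → S) => u0 z.1 * t (mix A1 z.1 z.2)) (μ.prod μ) :=
    bd (by fun_prop) (by simp [nu0, nt])
  have j6 : Integrable (fun z : (ℤ → S) × (ℤ → S) => t z.1) (μ.prod μ) :=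
    bd (by fun_prop) (by simp [nt])
  have j7 : Integrable (fun z : (ℤ → S) × (ℤ → S) => t (mix A0 z.1 z.2)) (μ.prod μ) :=
    bd (by fun_prop) (by simp [nt])
  have x1 : ∫ z, (ee (ξ * U z.1) - ee (ξ * 0)) * (ee (ξ * T z.1) - ee (ξ * T (mix A0 z.1 z.2)))
      ∂(μ.prod μ) = cf μ X (m + m') ξ - ∫ z, u z.1 * t (mix A0 z.1 z.2) ∂(μ.prod μ) := by
    have : ∀ z : (ℤ → S) × (ℤ → S), (ee (ξ * U z.1) - ee (ξ * 0)) *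
        (ee (ξ * T z.1) - ee (ξ * T (mix A0 z.1 z.2))) =
        (u z.1 * t z.1 - u z.1 * t (mix A0 z.1 z.2)) - (t z.1 - t (mix A0 z.1 z.2)) := fun z => by
      simp only [hu, ht, mul_zero, ee_zero]; ring
    simp_rw [this]
    rw [integral_sub_sub_sub j1 j2 j6 j7, w6, w5, w4]
    ring
  have x2 : ∫ z, (ee (ξ * U z.1) - ee (ξ * U0 z.1)) *
      (ee (ξ * T (mix A0 z.1 z.2)) - ee (ξ * T (mix A1 z.1 z.2)))
      ∂(μ.prod μ) = ∫ z, u z.1 * t (mix A0 z.1 z.2) ∂(μ.prod μ) - cf μ X m ξ * cf μ X m' ξ := by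
    have : ∀ z : (ℤ → S) × (ℤ → S), (ee (ξ * U z.1) - ee (ξ * U0 z.1)) *
        (ee (ξ * T (mix A0 z.1 z.2)) - ee (ξ * T (mix A1 z.1 z.2))) =
        (u z.1 * t (mix A0 z.1 z.2) - u z.1 * t (mix A1 z.1 z.2)) -
        (u0 z.1 * t (mix A0 z.1 z.2) - u0 z.1 * t (mix A1 z.1 z.2)) := fun z => by
      simp only [hu, hu0, ht]; ring
    simp_rw [this]
    rw [integral_sub_sub_sub j2 j3 j4 j5, w1, w2, w3,
      hcu, hct]
    ring
  rw [x1, x2]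
  push_cast
  ring

end Regular

end

/-! ### Low frequencies: dyadic recursion against the Gaussian. -/

section

variable {S : Type*} [MeasurableSpace S]

/-- The Gaussian counterpart of the block factorisation: with `2x` equal to `ξ²` times the sum of
the block variances and `y` equal to `ξ²` times their covariance, the Gaussian factors satisfy the
same second order relation as the characteristic functions. -/
theorem abs_exp_neg_sub_sub_exp_le {x y : ℝ} (hx : 0 ≤ x) (hxy : 0 ≤ x + y) :
    |Real.exp (-x) - y - Real.exp (-(x + y))| ≤ 3 * y ^ 2 + |y| * x := by
  have hg0 := Real.exp_pos (-x)
  have hg1 : Real.exp (-x) ≤ 1 := Real.exp_le_one_iff.2 (by linarith)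
  have hgx : 1 - x ≤ Real.exp (-x) := by linarith [Real.add_one_le_exp (-x)]
  rcases le_or_gt |y| 1 with h | h
  · have h1 : |Real.exp (-y) - 1 - (-y)| ≤ y ^ 2 := by
      simpa using Real.abs_exp_sub_one_sub_id_le (x := -y) (by simpa using h)
    have e : Real.exp (-x) - y - Real.exp (-(x + y)) =
        -(Real.exp (-x) * (Real.exp (-y) - 1 - (-y))) - y * (1 - Real.exp (-x)) := by
      rw [neg_add, Real.exp_add]; ring
    rw [e]
    refine (abs_sub _ _).trans ?_
    rw [abs_neg, abs_mul, abs_mul, abs_of_pos hg0, abs_of_nonneg (by linarith : 0 ≤ 1 - Real.exp (-x))]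
    have := mul_le_mul hg1 h1 (abs_nonneg _) zero_le_one
    have := mul_le_mul_of_nonneg_left (by linarith : 1 - Real.exp (-x) ≤ x) (abs_nonneg y)
    nlinarith [sq_nonneg y]
  · have h2 : Real.exp (-(x + y)) ≤ 1 := Real.exp_le_one_iff.2 (by linarith)
    have h3 := Real.exp_pos (-(x + y))
    have h4 : |Real.exp (-x) - y - Real.exp (-(x + y))| ≤ 1 + |y| := by
      rw [abs_le]; constructor <;> cases abs_cases y <;> linarith
    have : |y| ^ 2 = y ^ 2 := sq_abs y
    have : 0 ≤ |y| * x := by positivity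
    nlinarith

/-- Subadditivity of `t ↦ t ^ s` with a quantitative gain. For `s = 1 - δ` the gain is `δ x^{1-δ}`,
which absorbs the error of one halving in `Regular.gdist_le`. -/
theorem add_rpow_add_le {s x y : ℝ} (hs0 : 0 ≤ s) (hs : s ≤ 1) (hx : 0 < x) (hxy : x ≤ y) :
    (x + y) ^ s + (1 - s) * x ^ s ≤ x ^ s + y ^ s := by
  have hy : 0 < y := hx.trans_le hxy
  have h1 : (x + y) ^ s = y ^ s * (1 + x / y) ^ s := by
    rw [← Real.mul_rpow hy.le (by positivity)]; congr 1; field_simp; ring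
  have h2 : (1 + x / y) ^ s ≤ 1 + s * (x / y) :=
    rpow_one_add_le_one_add_mul_self (by have := div_nonneg hx.le hy.le; linarith) hs0 hs
  have h3 : y ^ s * (x / y) ≤ x ^ s := by
    have e1 : y ^ s * (x / y) = y ^ (s - 1) * x := by
      rw [Real.rpow_sub_one hy.ne']; ring
    have e2 : x ^ s = x ^ (s - 1) * x := by rw [Real.rpow_sub_one hx.ne']; field_simp
    rw [e1, e2]
    exact mul_le_mul_of_nonneg_right (Real.rpow_le_rpow_of_nonpos hx hxy (sub_nonpos.2 hs)) hx.le
  have h4 : 0 < y ^ s := Real.rpow_pos_of_pos hy s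
  have := mul_le_mul_of_nonneg_left h2 h4.le
  rw [h1]
  nlinarith [mul_le_mul_of_nonneg_left h3 hs0]

theorem norm_ee_sub_taylor_le {q : ℝ} (hq : 2 ≤ q) (hq3 : q ≤ 3) (x : ℝ) :
    ‖ee x - 1 - x * Complex.I + (x ^ 2 / 2 : ℝ)‖ ≤ 4 * |x| ^ q := by
  rcases le_or_gt |x| 1 with h | h
  · have hn : ‖(x : ℂ) * Complex.I‖ = |x| := by simp
    have h1 := Complex.exp_bound (x := x * Complex.I) (by rw [hn]; exact h) (n := 3) (by norm_num)
    rw [hn] at h1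
    have e : ee x - 1 - x * Complex.I + (x ^ 2 / 2 : ℝ) = Complex.exp (x * Complex.I) -
        ∑ m ∈ Finset.range 3, (x * Complex.I) ^ m / (m.factorial : ℂ) := by
      simp only [ee, Finset.sum_range_succ, Finset.sum_range_zero]
      have : (x * Complex.I : ℂ) ^ 2 = - (x : ℂ) ^ 2 := by rw [mul_pow, Complex.I_sq]; ring
      simp only [this]
      push_cast
      simp [Nat.factorial]
      ring
    rw [e]
    refine h1.trans ?_
    have h2 : |x| ^ 3 ≤ |x| ^ q := by
      rw [← Real.rpow_natCast]
      exact Real.rpow_le_rpow_of_exponent_ge' (abs_nonneg x) h (by linarith) (by simpa using hq3)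
    have h3 : ((Nat.succ 3 : ℕ) : ℝ) * (((Nat.factorial 3 : ℕ) : ℝ) * ((3 : ℕ) : ℝ))⁻¹ ≤ 4 := by
      norm_num [Nat.factorial]
    calc _ ≤ |x| ^ q * 4 := mul_le_mul h2 h3 (by positivity) (by positivity)
      _ = _ := by ring
  · have h2 : |x| ^ 2 ≤ |x| ^ q := by
      rw [← Real.rpow_natCast]
      exact Real.rpow_le_rpow_of_exponent_le h.le (by simpa using hq)
    have h3 : ‖ee x - 1 - x * Complex.I + (x ^ 2 / 2 : ℝ)‖ ≤ 1 + 1 + |x| + |x| ^ 2 / 2 := by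
      refine (norm_add_le _ _).trans (add_le_add ((norm_sub_le _ _).trans (add_le_add
        ((norm_sub_le _ _).trans (by simp)) (by simp))) ?_)
      rw [Complex.norm_real, Real.norm_eq_abs, abs_of_nonneg (by positivity), sq_abs]
    nlinarith

theorem abs_exp_neg_sub_one_add_le {r x : ℝ} (hr : 1 ≤ r) (hr2 : r ≤ 2) (hx : 0 ≤ x) :
    |Real.exp (-x) - 1 + x| ≤ x ^ r := by
  have h0 : 0 ≤ Real.exp (-x) - 1 + x := by linarith [Real.add_one_le_exp (-x)]
  rw [abs_of_nonneg h0]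
  rcases le_or_gt x 1 with h | h
  · have h1 : |Real.exp (-x) - 1 - (-x)| ≤ (-x) ^ 2 :=
      Real.abs_exp_sub_one_sub_id_le (by rw [abs_neg, abs_of_nonneg hx]; exact h)
    have h2 : x ^ (2 : ℝ) ≤ x ^ r :=
      Real.rpow_le_rpow_of_exponent_ge' hx h (by linarith) hr2
    rw [Real.rpow_two] at h2
    have := le_abs_self (Real.exp (-x) - 1 - (-x))
    nlinarith
  · have h2 : x ^ (1 : ℝ) ≤ x ^ r := Real.rpow_le_rpow_of_exponent_le h.le hr
    rw [Real.rpow_one] at h2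
    have : Real.exp (-x) ≤ 1 := Real.exp_le_one_iff.2 (by linarith)
    linarith

theorem abs_exp_neg_sub_exp_neg_le {x y : ℝ} (hx : 0 ≤ x) (hy : 0 ≤ y) :
    |Real.exp (-x) - Real.exp (-y)| ≤ |x - y| := by
  wlog h : x ≤ y generalizing x y
  · rw [abs_sub_comm, abs_sub_comm x]; exact this hy hx (le_of_not_ge h)
  have e : Real.exp (-x) - Real.exp (-y) = Real.exp (-x) * (1 - Real.exp (-(y - x))) := by
    rw [mul_sub, mul_one, ← Real.exp_add]; congr 2; ring
  have h1 : 1 - Real.exp (-(y - x)) ≤ y - x := by linarith [Real.add_one_le_exp (-(y - x))]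
  have h2 : 0 ≤ 1 - Real.exp (-(y - x)) := by
    have : Real.exp (-(y - x)) ≤ 1 := Real.exp_le_one_iff.2 (by linarith)
    linarith
  have h3 : Real.exp (-x) ≤ 1 := Real.exp_le_one_iff.2 (by linarith)
  rw [e, abs_of_nonneg (by positivity), abs_sub_comm, abs_of_nonneg (by linarith)]
  nlinarith

/-- The left side is `(|ξ| √m)^{4-q} |ξ|^q m^{q/2-b}`. The first factor is bounded at low
frequencies, and `q ≤ 3` gives `q/2 - b ≤ 1 - δ`. -/
theorem pow_four_mul_rpow_le {q b δ K ξ m : ℝ} (hq : 2 < q) (hq3 : q ≤ 3) (hm1 : 1 ≤ m)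
    (hK : 1 ≤ K) (hξ : |ξ| * √m ≤ K) (hδ : δ ≤ b - 1 / 2) :
    ξ ^ 4 * m ^ (2 - b) ≤ K ^ 2 * (|ξ| ^ q * m ^ (1 - δ)) := by
  have hm0 : 0 < m := by linarith
  rcases (abs_nonneg ξ).eq_or_lt with h0 | h0
  · have : ξ = 0 := abs_eq_zero.1 h0.symm
    rw [this]; simp; positivity
  have e1 : ξ ^ 4 * m ^ (2 - b) = (|ξ| * √m) ^ (4 - q) * (|ξ| ^ q * m ^ (q / 2 - b)) := by
    rw [Real.mul_rpow h0.le (by positivity), Real.sqrt_eq_rpow, ← Real.rpow_mul hm0.le]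
    have : ξ ^ 4 = |ξ| ^ (4 - q) * |ξ| ^ q := by
      rw [← Real.rpow_add h0, sub_add_cancel, ← Even.pow_abs (by decide : Even 4)]
      exact_mod_cast (Real.rpow_natCast |ξ| 4).symm
    have h2 : m ^ (2 - b) = m ^ (1 / 2 * (4 - q)) * m ^ (q / 2 - b) := by
      rw [← Real.rpow_add hm0]; congr 1; ring
    rw [this, h2]; ring
  rw [e1]
  have e2 : (|ξ| * √m) ^ (4 - q) ≤ K ^ 2 := by
    calc _ ≤ K ^ (4 - q) := by gcongr; linarith
      _ ≤ K ^ (2 : ℝ) := Real.rpow_le_rpow_of_exponent_le hK (by linarith)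
      _ = K ^ 2 := Real.rpow_two K
  have e3 : m ^ (q / 2 - b) ≤ m ^ (1 - δ) :=
    Real.rpow_le_rpow_of_exponent_le hm1 (by linarith)
  gcongr

namespace Regular

variable {μ : Measure (ℤ → S)} [IsProbabilityMeasure μ] {X : ℤ → (ℤ → S) → ℝ} {p b M s2 q : ℝ}

/-- The variance of `X_1 + ⋯ + X_n`. -/
def var (μ : Measure (ℤ → S)) (X : ℤ → (ℤ → S) → ℝ) (n : ℕ) : ℝ :=
  ∫ x, psum X (Finset.Ioc 0 (n : ℤ)) x ^ 2 ∂μ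

theorem var_nonneg (n : ℕ) : 0 ≤ var μ X n := integral_nonneg fun _ => sq_nonneg _

theorem integral_psum_sq_le (h : Regular μ X p b M s2) (hp : 2 < p) (I : Finset ℤ) :
    Integrable (fun x => psum X I x ^ 2) μ ∧ ∫ x, psum X I x ^ 2 ∂μ ≤ M ^ 2 * I.card := by
  have hM := h.M_pos
  have := abs_integral_mul_le hp (h.measurable_psum I).aestronglyMeasurable
    (h.measurable_psum I).aestronglyMeasurable (by positivity) (by positivity)
    (h.norm_psum I) (h.norm_psum I)
  simp only [← sq] at this
  refine ⟨this.1, (le_abs_self _).trans (this.2.trans_eq ?_)⟩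
  rw [mul_pow, Real.sq_sqrt (by positivity)]

theorem var_le (h : Regular μ X p b M s2) (hp : 2 < p) (n : ℕ) : var μ X n ≤ M ^ 2 * n := by
  unfold var; simpa using (h.integral_psum_sq_le hp (Finset.Ioc 0 (n : ℤ))).2

theorem var_add (h : Regular μ X p b M s2) (hp : 2 < p) (m m' : ℕ) :
    var μ X (m + m') = var μ X m + var μ X m' +
      2 * ∫ x, psum X (Finset.Ioc 0 m) x * psum X (Finset.Ioc (m : ℤ) (m + m')) x ∂μ := by
  have hM := h.M_pos
  have e1 : var μ X m' = ∫ x, psum X (Finset.Ioc (m : ℤ) (m + m')) x ^ 2 ∂μ := by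
    have hm : Measurable fun t : ℝ => t ^ 2 := by fun_prop
    have h1 := integral_map (μ := μ) (h.measurable_psum (Finset.Ioc (m : ℤ) (m + m'))).aemeasurable
      (f := fun t : ℝ => t ^ 2) hm.aestronglyMeasurable
    have h2 := integral_map (μ := μ) (h.measurable_psum (Finset.Ioc 0 (m' : ℤ))).aemeasurable
      (f := fun t : ℝ => t ^ 2) hm.aestronglyMeasurable
    unfold var
    rw [← h1, ← h2, h.stat]
  have i1 := (h.integral_psum_sq_le hp (Finset.Ioc 0 (m : ℤ))).1
  have i2 := (h.integral_psum_sq_le hp (Finset.Ioc (m : ℤ) (m + m'))).1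
  have i3 := (abs_integral_mul_le hp (h.measurable_psum (Finset.Ioc 0 (m : ℤ))).aestronglyMeasurable
    (h.measurable_psum (Finset.Ioc (m : ℤ) (m + m'))).aestronglyMeasurable (by positivity)
    (by positivity) (h.norm_psum _) (h.norm_psum _)).1
  rw [e1, ← integral_const_mul]
  have e2 := integral_add (i1.add i2) (i3.const_mul 2)
  simp only [Pi.add_apply] at e2
  have e3 := integral_add i1 i2
  unfold var
  rw [← e3, ← e2]
  congr 1; funext x
  rw [Nat.cast_add, psum_Ioc_add 0 (m : ℤ) (m + m') (by omega) (by omega)]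
  ring

/-- The characteristic function of one block against its Gaussian counterpart. -/
def gdist (μ : Measure (ℤ → S)) (X : ℤ → (ℤ → S) → ℝ) (n : ℕ) (ξ : ℝ) : ℝ :=
  ‖cf μ X n ξ - (Real.exp (-(ξ ^ 2 * var μ X n / 2)) : ℝ)‖

theorem gdist_one_le (h : Regular μ X p b M s2) (hq : 2 < q) (hq3 : q ≤ 3) (hqp : q ≤ p) (ξ : ℝ) :
    gdist μ X 1 ξ ≤ 5 * M ^ 3 * |ξ| ^ q := by
  have hM := h.M_pos
  have hM1 := h.one_le
  have hp : 2 < p := by linarith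
  have hp1 : (1 : ℝ≥0∞) ≤ ENNReal.ofReal p := by simp; linarith
  set Y := psum X (Finset.Ioc 0 ((1 : ℕ) : ℤ)) with hY
  have mY : Measurable Y := h.measurable_psum _
  have nY : eLpNorm Y (ENNReal.ofReal q) μ ≤ ENNReal.ofReal M := by
    rw [hY]; simpa using h.norm_psum_q hqp (Finset.Ioc 0 ((1 : ℕ) : ℤ))
  have hMq : M ^ q ≤ M ^ 3 := by
    rw [← Real.rpow_natCast]; exact Real.rpow_le_rpow_of_exponent_le hM1 (by simpa using hq3)
  obtain ⟨iq, bq⟩ := integral_mul_mul_rpow_le (by linarith : 0 < q) mY.aestronglyMeasurable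
    mY.aestronglyMeasurable mY.aestronglyMeasurable (a := q) (b := 0) (c := 0) (by linarith)
    le_rfl le_rfl (by ring) hM.le hM.le hM.le nY nY nY
  simp only [Real.rpow_zero, mul_one] at iq bq
  have iY : Integrable Y μ := (h.memLp_psum _).integrable hp1
  obtain ⟨i2, -⟩ := h.integral_psum_sq_le hp (Finset.Ioc 0 ((1 : ℕ) : ℤ))
  have ie : Integrable (fun x => ee (ξ * Y x)) μ :=
    integrable_of_norm_le (by fun_prop) 1 (fun x => (norm_ee _).le)
  have iYc : Integrable (fun x => ((ξ * Y x : ℝ) : ℂ) * Complex.I) μ :=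
    ((iY.const_mul ξ).ofReal).mul_const _
  have i2c : Integrable (fun x => (((ξ * Y x) ^ 2 / 2 : ℝ) : ℂ)) μ := by
    have : Integrable (fun x => (ξ * Y x) ^ 2 / 2) μ :=
      (i2.const_mul (ξ ^ 2 / 2)).congr (ae_of_all _ fun x => by simp only; ring)
    exact this.ofReal
  have e : cf μ X 1 ξ - 1 + ((ξ ^ 2 * var μ X 1 / 2 : ℝ) : ℂ) =
      ∫ x, (ee (ξ * Y x) - 1 - ((ξ * Y x : ℝ) : ℂ) * Complex.I + ((ξ * Y x) ^ 2 / 2 : ℝ)) ∂μ := by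
    have e1 := integral_add ((ie.sub (integrable_const 1)).sub iYc) i2c
    have e2 := integral_sub (ie.sub (integrable_const 1)) iYc
    have e3 := integral_sub ie (integrable_const (μ := μ) (1 : ℂ))
    simp only [Pi.sub_apply] at e1 e2
    rw [e1, e2, e3, integral_mul_const, integral_complex_ofReal, integral_complex_ofReal,
      integral_const_mul, h.mean]
    have : ∫ x, (ξ * Y x) ^ 2 / 2 ∂μ = ξ ^ 2 * var μ X 1 / 2 := by
      unfold var; rw [← integral_const_mul, ← integral_div]; congr 1; funext x; ring
    rw [this]
    simp [cf, hY]
  have h1 : ‖cf μ X 1 ξ - 1 + ((ξ ^ 2 * var μ X 1 / 2 : ℝ) : ℂ)‖ ≤ 4 * |ξ| ^ q * M ^ 3 := by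
    rw [e]
    refine (norm_integral_le_of_norm_le (iq.const_mul (4 * |ξ| ^ q))
      (ae_of_all _ fun x => ?_)).trans ?_
    · refine (norm_ee_sub_taylor_le hq.le hq3 _).trans_eq ?_
      rw [abs_mul, Real.mul_rpow (abs_nonneg _) (abs_nonneg _)]; ring
    · rw [integral_const_mul]
      gcongr
      exact bq.trans hMq
  have hv0 : 0 ≤ var μ X 1 := var_nonneg 1
  have hx0 : 0 ≤ ξ ^ 2 * var μ X 1 / 2 := by positivity
  have h2 : |Real.exp (-(ξ ^ 2 * var μ X 1 / 2)) - 1 + ξ ^ 2 * var μ X 1 / 2| ≤ |ξ| ^ q * M ^ 3 := by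
    refine (abs_exp_neg_sub_one_add_le (r := q / 2) (by linarith) (by linarith) hx0).trans ?_
    have hv1 : var μ X 1 ≤ M ^ 2 := by simpa using h.var_le hp 1
    have : ξ ^ 2 * var μ X 1 / 2 ≤ (|ξ| * M) ^ (2 : ℝ) := by
      rw [Real.rpow_two, mul_pow, sq_abs]; nlinarith [sq_nonneg ξ]
    calc _ ≤ ((|ξ| * M) ^ (2 : ℝ)) ^ (q / 2) := by gcongr
      _ = |ξ| ^ q * M ^ q := by
          rw [← Real.rpow_mul (by positivity), ← Real.mul_rpow (abs_nonneg _) hM.le]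
          congr 1; ring
      _ ≤ _ := by gcongr
  unfold gdist
  have e3 : cf μ X 1 ξ - (Real.exp (-(ξ ^ 2 * var μ X 1 / 2)) : ℝ) =
      (cf μ X 1 ξ - 1 + ((ξ ^ 2 * var μ X 1 / 2 : ℝ) : ℂ)) -
      ((Real.exp (-(ξ ^ 2 * var μ X 1 / 2)) - 1 + ξ ^ 2 * var μ X 1 / 2 : ℝ) : ℂ) := by
    push_cast; ring
  rw [e3]
  refine (norm_sub_le _ _).trans ?_
  rw [Complex.norm_real, Real.norm_eq_abs]
  linarith

/-- Both the characteristic functions and the Gaussian factors split with the same term `ξ²` times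
the covariance, so this term cancels and only second order errors remain. For this the Gaussian must
carry the exact variance of each block, not `n s2`. -/
theorem gdist_add_le (h : Regular μ X p b M s2) (hq : 2 < q) (hq3 : q ≤ 3) (hqp : q ≤ p)
    (hb : 1 / 2 < b) (hb1 : b < 1) {K : ℝ} (hK : 1 ≤ K) {m m' : ℕ} (hm : 1 ≤ m) (hm' : m' ≤ 2 * m)
    {ξ : ℝ} (hξ : |ξ| * √m ≤ K) :
    gdist μ X (m + m') ξ ≤ gdist μ X m ξ + gdist μ X m' ξ +
      85 * M ^ 3 * K ^ 2 * (|ξ| ^ q * (m : ℝ) ^ (1 - (b - 1 / 2) / 2)) := by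
  have hM := h.M_pos
  have hM1 := h.one_le
  have hp : 2 < p := by linarith
  have hm0 : (0 : ℝ) < m := by exact_mod_cast hm
  have hm1 : (1 : ℝ) ≤ m := by exact_mod_cast hm
  set δ := (b - 1 / 2) / 2 with hδ
  set L := ⌈√(m : ℝ)⌉₊ with hLdef
  have hs1 : 1 ≤ √(m : ℝ) := Real.one_le_sqrt.2 hm1
  have hLge : √(m : ℝ) ≤ L := Nat.le_ceil _
  have hL1 : 1 ≤ L := by exact_mod_cast hs1.trans hLge
  have hLm : L ≤ m := by
    rw [hLdef, Nat.ceil_le]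
    rw [Real.sqrt_le_left (by positivity)]; nlinarith
  have hL2 : (L : ℝ) ≤ 2 * √m := by
    have := Nat.ceil_lt_add_one (Real.sqrt_nonneg (m : ℝ)); rw [← hLdef] at this; linarith
  have hsq : √(m : ℝ) = (m : ℝ) ^ (1 / 2 : ℝ) := Real.sqrt_eq_rpow _
  have b1 : (L : ℝ) ^ (1 / 2 - b) ≤ (m : ℝ) ^ (-δ) := by
    calc (L : ℝ) ^ (1 / 2 - b) ≤ (√m) ^ (1 / 2 - b) :=
          Real.rpow_le_rpow_of_nonpos (by positivity) hLge (by linarith)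
      _ = _ := by rw [hsq, ← Real.rpow_mul hm0.le]; congr 1; rw [hδ]; ring
  have b2 : √(L : ℝ) ≤ 2 * (m : ℝ) ^ (1 / 2 - δ) := by
    have : √(L : ℝ) ≤ 2 * (m : ℝ) ^ (1 / 4 : ℝ) := by
      rw [Real.sqrt_le_left (by positivity), mul_pow, ← Real.rpow_natCast, ← Real.rpow_natCast,
        ← Real.rpow_mul hm0.le]
      norm_num
      rw [← Real.sqrt_eq_rpow]
      linarith
    refine this.trans ?_
    gcongr
    rw [hδ]; linarith
  have b3 : (2 * (2 * M * √(m : ℝ))) ^ (q - 2) ≤ 4 * M * (m : ℝ) ^ (1 / 2 : ℝ) := by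
    have : 1 ≤ 2 * (2 * M * √(m : ℝ)) := by nlinarith
    calc _ ≤ (2 * (2 * M * √(m : ℝ))) ^ (1 : ℝ) :=
          Real.rpow_le_rpow_of_exponent_le this (by linarith)
      _ = _ := by rw [Real.rpow_one, hsq]; ring
  have hstep := h.norm_cf_add_sub_mul_add_le hq hq3 hqp hm hm' hL1 hLm ξ
  have c1 : M * √(m : ℝ) * (M * (L : ℝ) ^ (1 / 2 - b)) * (2 * (2 * M * √m)) ^ (q - 2) ≤
      4 * M ^ 3 * (m : ℝ) ^ (1 - δ) := by
    calc _ ≤ M * √(m : ℝ) * (M * (m : ℝ) ^ (-δ)) * (4 * M * (m : ℝ) ^ (1 / 2 : ℝ)) := by gcongr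
      _ = 4 * M ^ 3 * ((m : ℝ) ^ (1 / 2 : ℝ) * (m : ℝ) ^ (-δ) * (m : ℝ) ^ (1 / 2 : ℝ)) := by
          rw [hsq]; ring
      _ = _ := by
          rw [← Real.rpow_add hm0, ← Real.rpow_add hm0]; congr 2; ring
  have c2 : M * √(L : ℝ) * (2 * M) * (2 * (2 * M * √m)) ^ (q - 2) ≤
      16 * M ^ 3 * (m : ℝ) ^ (1 - δ) := by
    calc _ ≤ M * (2 * (m : ℝ) ^ (1 / 2 - δ)) * (2 * M) * (4 * M * (m : ℝ) ^ (1 / 2 : ℝ)) := by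
          gcongr
      _ = 16 * M ^ 3 * ((m : ℝ) ^ (1 / 2 - δ) * (m : ℝ) ^ (1 / 2 : ℝ)) := by ring
      _ = _ := by
          rw [← Real.rpow_add hm0]; congr 2; ring
  set I := ∫ x, psum X (Finset.Ioc 0 m) x * psum X (Finset.Ioc (m : ℤ) (m + m')) x ∂μ with hI
  have hIb : |I| ≤ M * (m : ℝ) ^ (1 - b) := h.adjacent m m'
  have hv := h.var_add hp m m'
  rw [← hI] at hv
  set x := ξ ^ 2 * (var μ X m + var μ X m') / 2 with hx
  set y := ξ ^ 2 * I with hy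
  have hvm : 0 ≤ var μ X m := var_nonneg m
  have hvm' : 0 ≤ var μ X m' := var_nonneg m'
  have hvmm : 0 ≤ var μ X (m + m') := var_nonneg _
  have hx0 : 0 ≤ x := by positivity
  have hxye : x + y = ξ ^ 2 * var μ X (m + m') / 2 := by rw [hx, hy, hv]; ring
  have hxy0 : 0 ≤ x + y := by rw [hxye]; positivity
  have hthird := abs_exp_neg_sub_sub_exp_le hx0 hxy0
  have hyb : |y| ≤ M * ξ ^ 2 * (m : ℝ) ^ (1 - b) := by
    rw [hy, abs_mul, abs_of_nonneg (sq_nonneg ξ)]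
    have := mul_le_mul_of_nonneg_left hIb (sq_nonneg ξ)
    linarith
  have hmm' : (m' : ℝ) ≤ 2 * m := by exact_mod_cast hm'
  have hxb : x ≤ 2 * M ^ 2 * ξ ^ 2 * m := by
    have h1 := h.var_le hp m
    have h2 := h.var_le hp m'
    have h3 : M ^ 2 * (m' : ℝ) ≤ M ^ 2 * (2 * m) := by gcongr
    have h4 : var μ X m + var μ X m' ≤ 4 * M ^ 2 * m := by
      have : 0 ≤ M ^ 2 * (m : ℝ) := by positivity
      linarith
    have := mul_le_mul_of_nonneg_left h4 (sq_nonneg ξ)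
    rw [hx]; linarith
  have hpow : ξ ^ 4 * (m : ℝ) ^ (2 - b) ≤ K ^ 2 * (|ξ| ^ q * (m : ℝ) ^ (1 - δ)) :=
    pow_four_mul_rpow_le hq hq3 hm1 hK hξ (by rw [hδ]; linarith)
  have hmb : (m : ℝ) ^ (1 - b) * m = (m : ℝ) ^ (2 - b) := by
    nth_rewrite 2 [← Real.rpow_one (m : ℝ)]
    rw [← Real.rpow_add hm0]; congr 1; ring
  have hmb2 : (m : ℝ) ^ (1 - b) * (m : ℝ) ^ (1 - b) ≤ (m : ℝ) ^ (2 - b) := by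
    rw [← Real.rpow_add hm0]; exact Real.rpow_le_rpow_of_exponent_le hm1 (by linarith)
  have hthird2 : 3 * y ^ 2 + |y| * x ≤ 5 * M ^ 3 * (ξ ^ 4 * (m : ℝ) ^ (2 - b)) := by
    have t1 : y ^ 2 ≤ M ^ 2 * (ξ ^ 4 * (m : ℝ) ^ (2 - b)) := by
      rw [← sq_abs]
      calc |y| ^ 2 ≤ (M * ξ ^ 2 * (m : ℝ) ^ (1 - b)) ^ 2 := by gcongr
        _ = M ^ 2 * ξ ^ 4 * ((m : ℝ) ^ (1 - b) * (m : ℝ) ^ (1 - b)) := by ring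
        _ ≤ M ^ 2 * ξ ^ 4 * (m : ℝ) ^ (2 - b) := by gcongr
        _ = _ := by ring
    have t2 : |y| * x ≤ 2 * M ^ 3 * (ξ ^ 4 * (m : ℝ) ^ (2 - b)) := by
      calc |y| * x ≤ (M * ξ ^ 2 * (m : ℝ) ^ (1 - b)) * (2 * M ^ 2 * ξ ^ 2 * m) := by gcongr
        _ = 2 * M ^ 3 * (ξ ^ 4 * ((m : ℝ) ^ (1 - b) * m)) := by ring
        _ = _ := by rw [hmb]
    have t3 : M ^ 2 * (ξ ^ 4 * (m : ℝ) ^ (2 - b)) ≤ M ^ 3 * (ξ ^ 4 * (m : ℝ) ^ (2 - b)) := by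
      gcongr
      norm_num
    linarith
  have g1 : Real.exp (-(ξ ^ 2 * var μ X m / 2)) * Real.exp (-(ξ ^ 2 * var μ X m' / 2)) =
      Real.exp (-x) := by rw [← Real.exp_add]; congr 1; rw [hx]; ring
  set gm := Real.exp (-(ξ ^ 2 * var μ X m / 2)) with hgm
  set gm' := Real.exp (-(ξ ^ 2 * var μ X m' / 2)) with hgm'
  have key : cf μ X (m + m') ξ - (Real.exp (-(ξ ^ 2 * var μ X (m + m') / 2)) : ℝ) =
      (cf μ X (m + m') ξ - cf μ X m ξ * cf μ X m' ξ + (y : ℝ)) +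
      (cf μ X m ξ * (cf μ X m' ξ - gm') + (cf μ X m ξ - gm) * gm') +
      ((Real.exp (-x) - y - Real.exp (-(x + y)) : ℝ) : ℂ) := by
    rw [← hxye, ← g1]; push_cast; ring
  have hgm1 : gm' ≤ 1 := Real.exp_le_one_iff.2 (by have : 0 ≤ ξ ^ 2 * var μ X m' / 2 := by positivity
                                                   linarith)
  unfold gdist
  rw [key, ← hgm, ← hgm']
  refine (norm_add_le _ _).trans ?_
  rw [Complex.norm_real, Real.norm_eq_abs]
  have n1 : ‖cf μ X m ξ * (cf μ X m' ξ - gm') + (cf μ X m ξ - gm) * gm'‖ ≤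
      ‖cf μ X m' ξ - gm'‖ + ‖cf μ X m ξ - gm‖ := by
    refine (norm_add_le _ _).trans (add_le_add ?_ ?_)
    · rw [norm_mul]
      exact mul_le_of_le_one_left (norm_nonneg _) (norm_cf_le_one _ _ _)
    · rw [norm_mul, Complex.norm_real, Real.norm_eq_abs, abs_of_pos (Real.exp_pos _)]
      exact mul_le_of_le_one_right (norm_nonneg _) hgm1
  refine (add_le_add ((norm_add_le _ _).trans (add_le_add hstep n1))
    (hthird.trans hthird2)).trans ?_
  have hξq : 0 ≤ |ξ| ^ q := by positivity
  have s1 := mul_le_mul_of_nonneg_left c1 (by positivity : 0 ≤ 4 * |ξ| ^ q)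
  have s2' := mul_le_mul_of_nonneg_left c2 (by positivity : 0 ≤ 4 * |ξ| ^ q)
  have s3 := mul_le_mul_of_nonneg_left hpow (by positivity : 0 ≤ 5 * M ^ 3)
  have hK2 : 1 ≤ K ^ 2 := one_le_pow₀ hK
  -- The constant 85 is `4·4 + 4·16` from the two resampling stages plus 5 from the Gaussian side.
  have s4 : 80 * M ^ 3 * (|ξ| ^ q * (m : ℝ) ^ (1 - δ)) * 1 ≤
      80 * M ^ 3 * (|ξ| ^ q * (m : ℝ) ^ (1 - δ)) * K ^ 2 := by gcongr
  linarith

/-- The negative term makes the induction close: at each halving, the gain of `add_rpow_add_le`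
equals the new error. Its coefficient `B` is fixed by `B δ = 85 M³ K²` with `δ = (b - 1/2) / 2`, and
the linear coefficient by the case `n = 1`. -/
theorem gdist_le (h : Regular μ X p b M s2) (hq : 2 < q) (hq3 : q ≤ 3) (hqp : q ≤ p)
    (hb : 1 / 2 < b) (hb1 : b < 1) {K : ℝ} (hK : 1 ≤ K) {ξ : ℝ} {n : ℕ} (hn : 1 ≤ n)
    (hξ : |ξ| * √n ≤ K) :
    gdist μ X n ξ ≤ |ξ| ^ q * ((5 * M ^ 3 + 170 * M ^ 3 * K ^ 2 / (b - 1 / 2)) * n -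
      170 * M ^ 3 * K ^ 2 / (b - 1 / 2) * (n : ℝ) ^ (1 - (b - 1 / 2) / 2)) := by
  have hM := h.M_pos
  have hβ : 0 < b - 1 / 2 := by linarith
  induction n using Nat.strong_induction_on with
  | _ n ih =>
  rcases hn.eq_or_lt with h1 | h1
  · subst h1
    refine (h.gdist_one_le hq hq3 hqp ξ).trans_eq ?_
    simp; ring
  set m := n / 2 with hmdef
  set m' := n - m with hm'def
  have hn' : n = m + m' := by omega
  have hm : 1 ≤ m := by omega
  have hmm' : m ≤ m' := by omega
  have hm2 : m' ≤ 2 * m := by omega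
  have mono : ∀ k : ℕ, k ≤ n → |ξ| * √k ≤ K := fun k hk => by
    refine le_trans ?_ hξ
    gcongr
  have i1 := ih m (by omega) hm (mono m (by omega))
  have i2 := ih m' (by omega) (by omega) (mono m' (by omega))
  have st := h.gdist_add_le hq hq3 hqp hb hb1 hK hm hm2 (mono m (by omega))
  rw [hn']
  refine (st.trans (add_le_add_left (add_le_add i1 i2) _)).trans ?_
  set B := 170 * M ^ 3 * K ^ 2 / (b - 1 / 2) with hB
  set δ := (b - 1 / 2) / 2 with hδ
  have hB0 : 0 ≤ B := by positivity
  have hE : 85 * M ^ 3 * K ^ 2 = B * δ := by 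
    have : ∀ c β : ℝ, β ≠ 0 → c = 2 * c / β * (β / 2) := fun c β hβ => by field_simp
    rw [hB, hδ, this (85 * M ^ 3 * K ^ 2) _ hβ.ne']; ring
  have hc := add_rpow_add_le (s := 1 - δ) (by rw [hδ]; linarith) (by rw [hδ]; linarith)
    (by exact_mod_cast hm : (0 : ℝ) < m) (by exact_mod_cast hmm' : (m : ℝ) ≤ m')
  have hq0 : 0 ≤ |ξ| ^ q := by positivity
  rw [hE]
  push_cast
  have : 0 ≤ |ξ| ^ q * (B * ((m : ℝ) ^ (1 - δ) + (m' : ℝ) ^ (1 - δ) -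
    ((m + m' : ℝ) ^ (1 - δ) + (1 - (1 - δ)) * (m : ℝ) ^ (1 - δ)))) := by
    apply mul_nonneg hq0 (mul_nonneg hB0 (by linarith))
  nlinarith

/-- Closeness to the Gaussian characteristic function at frequencies of order `n^{-1/2}`. -/
theorem norm_cf_sub_low_le (h : Regular μ X p b M s2) (hq : 2 < q) (hq3 : q ≤ 3) (hqp : q ≤ p)
    (hb : 1 / 2 < b) (hb1 : b < 1) (hs : 0 ≤ s2) {K : ℝ} (hK : 1 ≤ K) {ξ : ℝ} {n : ℕ} (hn : 1 ≤ n)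
    (hξ : |ξ| * √n ≤ K) :
    ‖cf μ X n ξ - (Real.exp (-(ξ ^ 2 * (n * s2) / 2)) : ℝ)‖ ≤
      (M + (5 * M ^ 3 + 170 * M ^ 3 * K ^ 2 / (b - 1 / 2)) * K) *
        ((ξ ^ 2 * n) * (n : ℝ) ^ (-(q - 2) / 2)) := by
  have hM := h.M_pos
  have hβ : 0 < b - 1 / 2 := by linarith
  have hn0 : (0 : ℝ) < n := by exact_mod_cast hn
  have hn1 : (1 : ℝ) ≤ n := by exact_mod_cast hn
  have h1 := h.gdist_le hq hq3 hqp hb hb1 hK hn hξ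
  set B := 170 * M ^ 3 * K ^ 2 / (b - 1 / 2) with hB
  have hB0 : 0 ≤ B := by positivity
  have hv0 : 0 ≤ var μ X n := var_nonneg n
  have h2 : |Real.exp (-(ξ ^ 2 * var μ X n / 2)) - Real.exp (-(ξ ^ 2 * (n * s2) / 2))| ≤
      M * (ξ ^ 2 * n) * (n : ℝ) ^ (-(q - 2) / 2) := by
    refine (abs_exp_neg_sub_exp_neg_le (by positivity) (by positivity)).trans ?_
    have e : ξ ^ 2 * var μ X n / 2 - ξ ^ 2 * (n * s2) / 2 = ξ ^ 2 / 2 * (var μ X n - n * s2) := by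
      ring
    rw [e, abs_mul, abs_of_nonneg (by positivity)]
    have hv := h.variance n
    have e2 : (n : ℝ) ^ (1 - b) ≤ n * (n : ℝ) ^ (-(q - 2) / 2) := by
      nth_rewrite 2 [← Real.rpow_one (n : ℝ)]
      rw [← Real.rpow_add hn0]
      exact Real.rpow_le_rpow_of_exponent_le hn1 (by linarith)
    calc ξ ^ 2 / 2 * |var μ X n - n * s2| ≤ ξ ^ 2 / 2 * (M * (n : ℝ) ^ (1 - b)) := by
          gcongr; exact hv
      _ ≤ ξ ^ 2 * (M * (n * (n : ℝ) ^ (-(q - 2) / 2))) := by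
          gcongr
          · have := sq_nonneg ξ; linarith
      _ = _ := by ring
  -- In terms of `τ = |ξ| √n` the left side is `τ^{q-2} · τ² · n^{-(q-2)/2}`, and `τ^{q-2} ≤ K`
  -- because `q ≤ 3`.
  have h3 : |ξ| ^ q * n ≤ K * ((ξ ^ 2 * n) * (n : ℝ) ^ (-(q - 2) / 2)) := by
    rcases (abs_nonneg ξ).eq_or_lt with h0 | h0
    · rw [← h0, Real.zero_rpow (by linarith)]; simp; positivity
    have e1 : |ξ| ^ q * n = (|ξ| * √n) ^ (q - 2) * ((ξ ^ 2 * n) * (n : ℝ) ^ (-(q - 2) / 2)) := by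
      rw [Real.mul_rpow h0.le (by positivity), Real.sqrt_eq_rpow, ← Real.rpow_mul hn0.le]
      have a1 : |ξ| ^ q = |ξ| ^ (q - 2) * ξ ^ 2 := by
        rw [← sq_abs, ← Real.rpow_natCast, ← Real.rpow_add h0]; congr 1; push_cast; ring
      have a2 : (n : ℝ) ^ (1 / 2 * (q - 2)) * (n : ℝ) ^ (-(q - 2) / 2) = 1 := by
        rw [← Real.rpow_add hn0, show 1 / 2 * (q - 2) + -(q - 2) / 2 = 0 by ring, Real.rpow_zero]
      rw [a1]
      linear_combination -(|ξ| ^ (q - 2) * ξ ^ 2 * n) * a2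
    rw [e1]
    gcongr
    calc (|ξ| * √n) ^ (q - 2) ≤ K ^ (q - 2) := by gcongr
      _ ≤ K ^ (1 : ℝ) := Real.rpow_le_rpow_of_exponent_le hK (by linarith)
      _ = K := Real.rpow_one K
  have e : cf μ X n ξ - (Real.exp (-(ξ ^ 2 * (n * s2) / 2)) : ℝ) =
      (cf μ X n ξ - (Real.exp (-(ξ ^ 2 * var μ X n / 2)) : ℝ)) +
      ((Real.exp (-(ξ ^ 2 * var μ X n / 2)) - Real.exp (-(ξ ^ 2 * (n * s2) / 2)) : ℝ) : ℂ) := by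
    push_cast; ring
  rw [e]
  refine (norm_add_le _ _).trans ?_
  rw [Complex.norm_real, Real.norm_eq_abs]
  change gdist μ X n ξ + _ ≤ _
  have h4 : 0 ≤ |ξ| ^ q * (B * (n : ℝ) ^ (1 - (b - 1 / 2) / 2)) := by positivity
  have h5 := mul_le_mul_of_nonneg_left h3 (by positivity : 0 ≤ 5 * M ^ 3 + B)
  nlinarith

end Regular

end

/-! ### Averages of products over disjoint windows. -/

section

variable {S : Type*} [MeasurableSpace S]

section averages

variable {μ : Measure (ℤ → S)} [IsProbabilityMeasure μ]

theorem infl_ee_le {r : ℝ≥0∞} {f : (ℤ → S) → ℝ} (ξ : ℝ) (A : Set ℤ) :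
    infl μ r (fun x => ee (ξ * f x)) A ≤ ENNReal.ofReal |ξ| * infl μ r f A := by
  unfold infl
  refine eLpNorm_le_mul_eLpNorm_of_ae_le_mul (ae_of_all _ fun z => ?_) r
  refine (norm_ee_sub_le _ _).trans_eq ?_
  rw [← mul_sub, abs_mul, Real.norm_eq_abs]

theorem avg_mix (J : Set ℤ) {V : Type*} [NormedAddCommGroup V] [NormedSpace ℝ V]
    (h : (ℤ → S) → V) (x y : ℤ → S) : avg μ J h (mix J x y) = avg μ J h x :=
  DependsOn.mix_eq dependsOn_avg_compl disjoint_compl_right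

theorem measurable_avg (J : Set ℤ) {h : (ℤ → S) → ℂ} (hm : Measurable h) :
    Measurable (avg μ J h) := (stronglyMeasurable_avg hm.stronglyMeasurable).measurable

theorem measurable_avg_real (J : Set ℤ) {h : (ℤ → S) → ℝ} (hm : Measurable h) :
    Measurable (avg μ J h) := (stronglyMeasurable_avg hm.stronglyMeasurable).measurable

/-- The average over `J` of a product almost factorises if the second factor, once averaged
over the coordinates `J'` not seen by the first one, feels little of `J`. -/
theorem norm_avg_mul_le (hμ : SwapInvariant μ) {J J' : Set ℤ} (hJ : J' ⊆ J) {f h : (ℤ → S) → ℂ}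
    (hfm : Measurable f) (hhm : Measurable h) (hf : ∀ x, ‖f x‖ ≤ 1) (hh : ∀ x, ‖h x‖ ≤ 1)
    (hd : DependsOn f J'ᶜ) (x : ℤ → S) :
    ‖avg μ J (fun x => f x * h x) x‖ ≤ ‖avg μ J f x‖ * ‖avg μ J h x‖ +
      avg μ J (fun x => ‖avg μ J' h x - avg μ J h x‖) x := by
  have hfh : ∀ x, ‖f x * h x‖ ≤ 1 := fun x => by
    rw [norm_mul]; exact mul_le_one₀ (hf x) (norm_nonneg _) (hh x)
  have e1 : avg μ J (fun x => f x * h x) = avg μ J (fun x => f x * avg μ J' h x) := by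
    rw [← avg_avg hμ (f := fun x => f x * h x) (hfm.mul hhm) hfh hJ]
    congr 1; funext x
    exact avg_mul_of_dependsOn hd x
  have m1 := measurable_avg (μ := μ) J hhm
  have m2 := measurable_avg (μ := μ) J' hhm
  have b1 := norm_avg_le_one (μ := μ) (A := J) hh
  have b2 := norm_avg_le_one (μ := μ) (A := J') hh
  have hb3 : ∀ x, ‖avg μ J' h x - avg μ J h x‖ ≤ 2 := fun x =>
    (norm_sub_le _ _).trans (by linarith [b1 x, b2 x])
  have i1 : Integrable (fun y => f (mix J x y) * avg μ J h x) μ :=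
    integrable_of_norm_le (by fun_prop) 1 fun y => by
      rw [norm_mul]; exact mul_le_one₀ (hf _) (norm_nonneg _) (b1 _)
  have i2 : Integrable (fun y => f (mix J x y) *
      (avg μ J' h (mix J x y) - avg μ J h (mix J x y))) μ :=
    integrable_of_norm_le (by fun_prop) 2 fun y => by
      rw [norm_mul]
      calc _ ≤ 1 * 2 := mul_le_mul (hf _) (hb3 _) (norm_nonneg _) zero_le_one
        _ = 2 := by ring
  have e2 : avg μ J (fun x => f x * avg μ J' h x) x = avg μ J f x * avg μ J h x +
      ∫ y, f (mix J x y) * (avg μ J' h (mix J x y) - avg μ J h (mix J x y)) ∂μ := by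
    have e3 : avg μ J f x * avg μ J h x = ∫ y, f (mix J x y) * avg μ J h x ∂μ := by
      rw [integral_mul_const]; rfl
    rw [e3, ← integral_add i1 i2]
    unfold avg
    congr 1; funext y
    have := avg_mix (μ := μ) J h x y
    unfold avg at this
    rw [this]; ring
  rw [e1, e2]
  refine (norm_add_le _ _).trans (add_le_add (norm_mul _ _).le ?_)
  refine norm_integral_le_of_norm_le ?_ (ae_of_all _ fun y => ?_)
  · refine Integrable.of_bound (C := 2) (Measurable.aestronglyMeasurable (by fun_prop))
      (ae_of_all _ fun y => ?_)
    rw [norm_norm]; exact hb3 _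
  · rw [norm_mul]; exact mul_le_of_le_one_left (norm_nonneg _) (hf _)

/-- The factors are peeled off from the last one. All earlier factors are blind to its own block `J'
n`, so averaging over that block acts on the last factor alone, and the other resampled coordinates
affect it only through the error term. -/
theorem norm_avg_prod_le (hμ : SwapInvariant μ) {J : Set ℤ} {J' : ℕ → Set ℤ} {h : ℕ → (ℤ → S) → ℂ}
    (hJ : ∀ i, J' i ⊆ J) (hhm : ∀ i, Measurable (h i)) (hh : ∀ i x, ‖h i x‖ ≤ 1)
    (hd : ∀ i k, i < k → DependsOn (h i) (J' k)ᶜ) (n : ℕ) (x : ℤ → S) :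
    ‖avg μ J (fun x => ∏ i ∈ Finset.range n, h i x) x‖ ≤ ∏ i ∈ Finset.range n, ‖avg μ J (h i) x‖ +
      ∑ i ∈ Finset.range n, avg μ J (fun x => ‖avg μ (J' i) (h i) x - avg μ J (h i) x‖) x := by
  induction n with
  | zero => simp [avg]
  | succ n ih =>
    simp only [Finset.prod_range_succ, Finset.sum_range_succ]
    have h1 := norm_avg_mul_le hμ (hJ n) (f := fun x => ∏ i ∈ Finset.range n, h i x) (h := h n)
      (by fun_prop) (hhm n)
      (fun x => by
        rw [norm_prod]; exact Finset.prod_le_one (fun _ _ => norm_nonneg _) fun i _ => hh i x)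
      (hh n)
      (fun x y hxy => Finset.prod_congr rfl fun i hi => hd i n (Finset.mem_range.1 hi) hxy) x
    have b1 := norm_avg_le_one (μ := μ) (A := J) (hh n) x
    have hs : 0 ≤ ∑ i ∈ Finset.range n,
        avg μ J (fun x => ‖avg μ (J' i) (h i) x - avg μ J (h i) x‖) x :=
      Finset.sum_nonneg fun i _ => integral_nonneg fun y => norm_nonneg _
    have h2 := mul_le_mul_of_nonneg_right ih (norm_nonneg (avg μ J (h n) x))
    have h3 := mul_le_mul_of_nonneg_left b1 hs
    linarith

/-- By the tower property `avg μ J h` is the average over `J` of `avg μ J' h`, and this function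
feels only `J \ J'`. -/
theorem integral_avg_norm_sub_le (hμ : SwapInvariant μ) {J J' : Set ℤ} (hJ : J' ⊆ J)
    {h : (ℤ → S) → ℂ} (hhm : Measurable h) (hh : ∀ x, ‖h x‖ ≤ 1) {r : ℝ≥0∞} (hr : 1 ≤ r)
    {c : ℝ} (hc : 0 ≤ c) (hi : infl μ r h (J \ J') ≤ ENNReal.ofReal c) :
    Integrable (avg μ J (fun x => ‖avg μ J' h x - avg μ J h x‖)) μ ∧
      ∫ x, avg μ J (fun x => ‖avg μ J' h x - avg μ J h x‖) x ∂μ ≤ c := by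
  have m1 := measurable_avg (μ := μ) J hhm
  have m2 := measurable_avg (μ := μ) J' hhm
  have b1 := norm_avg_le_one (μ := μ) (A := J) hh
  have b2 := norm_avg_le_one (μ := μ) (A := J') hh
  have hb3 : ∀ x, ‖avg μ J' h x - avg μ J h x‖ ≤ 2 := fun x =>
    (norm_sub_le _ _).trans (by linarith [b1 x, b2 x])
  have i0 : Integrable (fun x => avg μ J' h x - avg μ J h x) μ :=
    integrable_of_norm_le (by fun_prop) 2 hb3
  have i1 : Integrable (fun x => ‖avg μ J' h x - avg μ J h x‖) μ := i0.norm
  refine ⟨((hμ.mix J).integrable_comp_of_integrable i1).integral_prod_left, ?_⟩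
  rw [integral_avg hμ i1]
  have iJ' : Integrable (avg μ J' h) μ := integrable_of_norm_le m2 1 b2
  have ih : Integrable h μ := integrable_of_norm_le hhm 1 hh
  have h1 := eLpNorm_sub_avg_le hμ (p := 1) le_rfl (by simp) m2.stronglyMeasurable iJ' J
  rw [avg_avg hμ hhm hh hJ] at h1
  have h2 := infl_avg_le hμ (p := 1) (A := J) (B := J') le_rfl (by simp) hhm.stronglyMeasurable ih
  have h3 := h1.trans (h2.trans ((infl_mono_exponent hhm.stronglyMeasurable hr).trans hi))
  rw [eLpNorm_one_eq_lintegral_enorm, ← ofReal_integral_norm_eq_lintegral_enorm i0] at h3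
  exact (ENNReal.ofReal_le_ofReal_iff hc).1 h3

/-- Products of bounded functions of successive disjoint windows integrate to products. -/
theorem integral_prod_windows (hμ : SwapInvariant μ) {u : ℕ → ℤ} (hu : Monotone u)
    {g : ℕ → (ℤ → S) → ℝ} (hgm : ∀ i, Measurable (g i))
    (hd : ∀ i, DependsOn (g i) (Set.Ioc (u i) (u (i + 1)))) (n : ℕ) :
    ∫ x, ∏ i ∈ Finset.range n, g i x ∂μ = ∏ i ∈ Finset.range n, ∫ x, g i x ∂μ := by
  induction n with
  | zero => simp
  | succ n ih =>
    simp only [Finset.prod_range_succ]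
    rw [← ih]
    refine integral_mul_of_disjoint hμ (f := fun x => ∏ i ∈ Finset.range n, g i x) (g := g n)
      (A := Set.Iic (u n)) (B := Set.Ioc (u n) (u (n + 1))) ?_ (hd n) ?_ (by fun_prop) (hgm n)
    · intro x y hxy
      refine Finset.prod_congr rfl fun i hi => hd i fun j hj => hxy j ?_
      exact hj.2.trans (hu (Finset.mem_range.1 hi))
    · rw [Set.disjoint_left]
      intro j h1 h2
      exact absurd h2.1 (not_lt.2 h1)

end averages

/-- Either all corrections are at most `1/8` and are absorbed into the factors, or some `8 * v k`
exceeds 1 and its `p`-th power alone dominates the product, which is at most 1. This pointwise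
Markov inequality is what allows the full `p`-th moment of the corrections to be used. -/
theorem prod_le_prod_min_add_sum {p : ℝ} (hp : 0 ≤ p) (n : ℕ) {a A v : ℕ → ℝ}
    (ha0 : ∀ i, 0 ≤ a i) (ha1 : ∀ i, a i ≤ 1) (hv : ∀ i, 0 ≤ v i)
    (h : ∀ i < n, a i ≤ A i + v i) :
    ∏ i ∈ Finset.range n, a i ≤
      ∏ i ∈ Finset.range n, min 1 (|A i| + 1 / 8) + ∑ i ∈ Finset.range n, (8 * v i) ^ p := by
  by_cases hall : ∀ i < n, v i ≤ 1 / 8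
  · have h1 : ∏ i ∈ Finset.range n, a i ≤ ∏ i ∈ Finset.range n, min 1 (|A i| + 1 / 8) := by
      refine Finset.prod_le_prod (fun i _ => ha0 i) fun i hi => le_min (ha1 i) ?_
      have := h i (Finset.mem_range.1 hi)
      have := hall i (Finset.mem_range.1 hi)
      linarith [le_abs_self (A i)]
    have h2 : 0 ≤ ∑ i ∈ Finset.range n, (8 * v i) ^ p :=
      Finset.sum_nonneg fun i _ => by have := hv i; positivity
    linarith
  · push Not at hall
    obtain ⟨k, hk, hvk⟩ := hall
    have h1 : ∏ i ∈ Finset.range n, a i ≤ 1 := Finset.prod_le_one (fun i _ => ha0 i) fun i _ => ha1 i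
    have h2 : (1 : ℝ) ≤ (8 * v k) ^ p := Real.one_le_rpow (by linarith) hp
    have h3 : (8 * v k) ^ p ≤ ∑ i ∈ Finset.range n, (8 * v i) ^ p :=
      Finset.single_le_sum (f := fun i => (8 * v i) ^ p)
        (fun i _ => by have := hv i; positivity) (Finset.mem_range.2 hk)
    have h4 : 0 ≤ ∏ i ∈ Finset.range n, min 1 (|A i| + 1 / 8) :=
      Finset.prod_nonneg fun i _ => by positivity
    linarith

namespace Regular

variable {μ : Measure (ℤ → S)} [IsProbabilityMeasure μ] {X : ℤ → (ℤ → S) → ℝ} {p b M s2 q : ℝ}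

/-- The characteristic function of one window, averaged over the block `(c + G, c + G + ℓ]`
and over coordinates far away, is bounded by that of the block up to local corrections. -/
theorem exists_window_bound (h : Regular μ X p b M s2) (hp : 2 < p) {c : ℤ} {w G ℓ : ℕ} (hG : 1 ≤ G)
    (hw : G + ℓ + G ≤ w) {J : Set ℤ} (hJ : Set.Ioc (c + G) (c + G + ℓ) ⊆ J)
    (hJ' : ∀ j ∈ J, j ≤ c + w → j ≤ c - G ∨ (c + G < j ∧ j ≤ c + G + ℓ)) (ξ : ℝ) :
    ∃ Y v : (ℤ → S) → ℝ, Measurable Y ∧ Measurable v ∧ (∀ x, 0 ≤ Y x) ∧ (∀ x, 0 ≤ v x) ∧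
      DependsOn Y (Set.Ioc c (c + w)) ∧
      eLpNorm Y (ENNReal.ofReal p) μ ≤ ENNReal.ofReal (2 * M) ∧
      eLpNorm v (ENNReal.ofReal p) μ ≤ ENNReal.ofReal (5 * (M * (G : ℝ) ^ (1 / 2 - b))) ∧
      ∀ᵐ x ∂μ, ‖avg μ J (fun x => ee (ξ * psum X (Finset.Ioc c (c + w)) x)) x‖ ≤
        ‖cf μ X ℓ ξ‖ + |ξ| * Y x + |ξ| * v x := by
  have hM := h.M_pos
  have hsw := h.swap
  have hp1 : (1 : ℝ≥0∞) ≤ ENNReal.ofReal p := by simp; linarith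
  have hpt : ENNReal.ofReal p ≠ ∞ := ENNReal.ofReal_ne_top
  -- The window consists of a lead of length `G`, the sum over the times of the block, and the rest.
  -- Resampling `J` hardly moves the lead, since the coordinates of `J` that it can see lie at
  -- distance `G` before the window. It makes the block sum nearly a fresh copy, and moves the rest
  -- by a bounded amount in `L^p`.
  set pre := psum X (Finset.Ioc c (c + G)) with hpre
  set sj := psum X (Finset.Ioc (c + G) (c + G + ℓ)) with hsj
  set bey := psum X (Finset.Ioc (c + G + ℓ) (c + w)) with hbey
  set A : Set ℤ := Set.Iic c with hA
  set ε := M * (G : ℝ) ^ (1 / 2 - b) with hε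
  have hε0 : 0 ≤ ε := by positivity
  have mpre : Measurable pre := h.measurable_psum _
  have msj : Measurable sj := h.measurable_psum _
  have mbey : Measurable bey := h.measurable_psum _
  have isj : Integrable sj μ := (h.memLp_psum _).integrable hp1
  have ibey : Integrable bey μ := (h.memLp_psum _).integrable hp1
  have dpre : DependsOn pre (Set.Iic (c + G)) := h.dependsOn_psum (by simp)
  have dsj : DependsOn sj (Set.Iic (c + G + ℓ)) := h.dependsOn_psum (by simp)
  have dbey : DependsOn bey (Set.Iic (c + w)) := h.dependsOn_psum (by simp)
  -- Averaging out the coordinates before the window makes the order-one fluctuations `D1`, `D2`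
  -- functions of the window only. The replacement costs `ε`, because the times of `sj` and `bey`
  -- start at distance `G` from `c`.
  set sj0 := avg μ A sj with hsj0
  set bey0 := avg μ A bey with hbey0
  have msj0 : Measurable sj0 := measurable_avg_real A msj
  have mbey0 : Measurable bey0 := measurable_avg_real A mbey
  have hwz : (G : ℤ) + ℓ + G ≤ w := by exact_mod_cast hw
  have n1 : infl μ (ENNReal.ofReal p) pre J ≤ ENNReal.ofReal ε := by
    rw [infl_inter dpre]
    refine h.infl_past _ _ (c - G) G hG ?_ ?_
    · rintro j ⟨hj1, hj2⟩
      simp only [Set.mem_Iic] at hj2 ⊢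
      rcases hJ' j hj1 (by omega) with h1 | h1 <;> omega
    · simp; omega
  have n2 : infl μ (ENNReal.ofReal p) bey0 J ≤ ENNReal.ofReal M := by
    refine (infl_avg_le hsw hp1 hpt mbey.stronglyMeasurable ibey).trans ?_
    rw [infl_inter dbey]
    refine (h.infl_past _ _ (c + G + ℓ) 1 le_rfl ?_ ?_).trans_eq (by simp)
    · rintro j ⟨⟨hj1, hj3⟩, hj2⟩
      simp only [Set.mem_Iic] at hj2 ⊢
      rcases hJ' j hj1 (by omega) with h1 | h1 <;> omega
    · simp; omega
  have n3 : infl μ (ENNReal.ofReal p) sj0 Jᶜ ≤ ENNReal.ofReal M := by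
    refine (infl_avg_le hsw hp1 hpt msj.stronglyMeasurable isj).trans ?_
    rw [infl_inter dsj]
    refine (h.infl_past _ _ (c + G) 1 le_rfl ?_ ?_).trans_eq (by simp)
    · rintro j ⟨⟨hj1, hj3⟩, hj2⟩
      simp only [Set.mem_Iic] at hj2 ⊢
      by_contra hcon
      exact hj1 (hJ ⟨by omega, hj2⟩)
    · simp; omega
  have n4 : eLpNorm (fun x => sj x - sj0 x) (ENNReal.ofReal p) μ ≤ ENNReal.ofReal ε := by
    refine (eLpNorm_sub_avg_le hsw hp1 hpt msj.stronglyMeasurable isj A).trans ?_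
    refine h.infl_past _ _ c G hG subset_rfl ?_
    simp; omega
  have n5 : eLpNorm (fun x => bey x - bey0 x) (ENNReal.ofReal p) μ ≤ ENNReal.ofReal ε := by
    refine (eLpNorm_sub_avg_le hsw hp1 hpt mbey.stronglyMeasurable ibey A).trans ?_
    refine h.infl_past _ _ c G hG subset_rfl ?_
    simp; omega
  have dsj0 : DependsOn sj0 (Set.Ioc c (c + w)) := by
    refine DependsOn.mono_set (dependsOn_avg dsj) ?_
    rintro j ⟨hj1, hj2⟩
    simp only [hA, Set.mem_Iic, Set.mem_Ioc] at *; omega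
  have dbey0 : DependsOn bey0 (Set.Ioc c (c + w)) := by
    refine DependsOn.mono_set (dependsOn_avg dbey) ?_
    rintro j ⟨hj1, hj2⟩
    simp only [hA, Set.mem_Iic, Set.mem_Ioc] at *; omega
  -- the local and the negligible part of the fluctuation
  set D1 : (ℤ → S) × (ℤ → S) → ℝ := fun z => sj0 z.2 - sj0 (mix J z.1 z.2) with hD1
  set D2 : (ℤ → S) × (ℤ → S) → ℝ := fun z => bey0 z.1 - bey0 (mix J z.1 z.2) with hD2
  set D : (ℤ → S) × (ℤ → S) → ℝ := fun z => |D1 z| + |D2 z| with hD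
  set V1 : (ℤ → S) × (ℤ → S) → ℝ := fun z => pre z.1 - pre (mix J z.1 z.2) with hV1
  set V2 : (ℤ → S) × (ℤ → S) → ℝ := fun z => sj (mix J z.1 z.2) - sj0 (mix J z.1 z.2) with hV2
  set V3 : (ℤ → S) × (ℤ → S) → ℝ := fun z => sj z.2 - sj0 z.2 with hV3
  set V4 : (ℤ → S) × (ℤ → S) → ℝ := fun z => bey (mix J z.1 z.2) - bey0 (mix J z.1 z.2) with hV4
  set V5 : (ℤ → S) × (ℤ → S) → ℝ := fun z => bey z.1 - bey0 z.1 with hV5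
  set V : (ℤ → S) × (ℤ → S) → ℝ := fun z => |V1 z| + (|V2 z| + (|V3 z| + (|V4 z| + |V5 z|)))
    with hV
  have mD1 : Measurable D1 := by fun_prop
  have mD2 : Measurable D2 := by fun_prop
  have mV1 : Measurable V1 := by fun_prop
  have mV2 : Measurable V2 := by fun_prop
  have mV3 : Measurable V3 := by fun_prop
  have mV4 : Measurable V4 := by fun_prop
  have mV5 : Measurable V5 := by fun_prop
  have mD : Measurable D := (continuous_abs.measurable.comp mD1).add
    (continuous_abs.measurable.comp mD2)
  have mV : Measurable V := (continuous_abs.measurable.comp mV1).add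
    ((continuous_abs.measurable.comp mV2).add ((continuous_abs.measurable.comp mV3).add
      ((continuous_abs.measurable.comp mV4).add (continuous_abs.measurable.comp mV5))))
  have addabs : ∀ {F H : (ℤ → S) × (ℤ → S) → ℝ} {s t : ℝ}, Measurable F → Measurable H → 0 ≤ s →
      0 ≤ t → eLpNorm F (ENNReal.ofReal p) (μ.prod μ) ≤ ENNReal.ofReal s →
      eLpNorm H (ENNReal.ofReal p) (μ.prod μ) ≤ ENNReal.ofReal t →
      eLpNorm (fun z => |F z| + H z) (ENNReal.ofReal p) (μ.prod μ) ≤ ENNReal.ofReal (s + t) := by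
    intro F H s t hF hH hs ht nF nH
    refine (eLpNorm_add_le (continuous_abs.measurable.comp hF).aestronglyMeasurable
      hH.aestronglyMeasurable hp1).trans ?_
    rw [ENNReal.ofReal_add hs ht]
    exact add_le_add ((eLpNorm_norm F).trans_le nF) nH
  have absn : ∀ {F : (ℤ → S) × (ℤ → S) → ℝ} {s : ℝ},
      eLpNorm F (ENNReal.ofReal p) (μ.prod μ) ≤ ENNReal.ofReal s →
      eLpNorm (fun z => |F z|) (ENNReal.ofReal p) (μ.prod μ) ≤ ENNReal.ofReal s :=
    fun {F s} hF => (eLpNorm_norm F).trans_le hF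
  have nD1 : eLpNorm D1 (ENNReal.ofReal p) (μ.prod μ) ≤ ENNReal.ofReal M := by
    refine le_trans (le_of_eq ?_) n3
    unfold infl
    rw [← eLpNorm_comp_measurePreserving (f := Prod.swap) (ν := μ.prod μ)
      (g := fun z : (ℤ → S) × (ℤ → S) => sj0 z.1 - sj0 (mix Jᶜ z.1 z.2))
      (Measurable.aestronglyMeasurable (by fun_prop)) Measure.measurePreserving_swap]
    congr 1; funext z
    simp only [hD1, Function.comp, Prod.fst_swap, Prod.snd_swap, mix_compl]
  have nD : eLpNorm D (ENNReal.ofReal p) (μ.prod μ) ≤ ENNReal.ofReal (2 * M) := by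
    rw [two_mul]
    exact addabs mD1 (continuous_abs.measurable.comp mD2) hM.le hM.le nD1 (absn n2)
  have c1 : ∀ {F : (ℤ → S) → ℝ} {s : ℝ}, Measurable F →
      eLpNorm F (ENNReal.ofReal p) μ ≤ ENNReal.ofReal s →
      eLpNorm (F ∘ fun z : (ℤ → S) × (ℤ → S) => mix J z.1 z.2) (ENNReal.ofReal p) (μ.prod μ) ≤
        ENNReal.ofReal s := fun {F s} hF hs => by
    rwa [eLpNorm_comp_measurePreserving hF.aestronglyMeasurable (hsw.mix J)]
  have c2 : ∀ {F : (ℤ → S) → ℝ} {s : ℝ}, Measurable F →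
      eLpNorm F (ENNReal.ofReal p) μ ≤ ENNReal.ofReal s →
      eLpNorm (F ∘ (Prod.fst : (ℤ → S) × (ℤ → S) → _)) (ENNReal.ofReal p) (μ.prod μ) ≤
        ENNReal.ofReal s := fun {F s} hF hs => by
    rwa [eLpNorm_comp_measurePreserving hF.aestronglyMeasurable measurePreserving_fst]
  have c3 : ∀ {F : (ℤ → S) → ℝ} {s : ℝ}, Measurable F →
      eLpNorm F (ENNReal.ofReal p) μ ≤ ENNReal.ofReal s →
      eLpNorm (F ∘ (Prod.snd : (ℤ → S) × (ℤ → S) → _)) (ENNReal.ofReal p) (μ.prod μ) ≤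
        ENNReal.ofReal s := fun {F s} hF hs => by
    rwa [eLpNorm_comp_measurePreserving hF.aestronglyMeasurable measurePreserving_snd]
  have nV2 : eLpNorm V2 (ENNReal.ofReal p) (μ.prod μ) ≤ ENNReal.ofReal ε :=
    c1 (F := fun x => sj x - sj0 x) (msj.sub msj0) n4
  have nV3 : eLpNorm V3 (ENNReal.ofReal p) (μ.prod μ) ≤ ENNReal.ofReal ε :=
    c3 (F := fun x => sj x - sj0 x) (msj.sub msj0) n4
  have nV4 : eLpNorm V4 (ENNReal.ofReal p) (μ.prod μ) ≤ ENNReal.ofReal ε :=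
    c1 (F := fun x => bey x - bey0 x) (mbey.sub mbey0) n5
  have nV5 : eLpNorm V5 (ENNReal.ofReal p) (μ.prod μ) ≤ ENNReal.ofReal ε :=
    c2 (F := fun x => bey x - bey0 x) (mbey.sub mbey0) n5
  have nV : eLpNorm V (ENNReal.ofReal p) (μ.prod μ) ≤ ENNReal.ofReal (5 * ε) := by
    have e : 5 * ε = ε + (ε + (ε + (ε + ε))) := by ring
    rw [e]
    have a5 := absn nV5
    have a4 := addabs mV4 mV5.abs hε0 hε0 nV4 a5
    have a3 := addabs mV3 (mV4.abs.add mV5.abs) hε0 (by positivity) nV3 a4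
    have a2 := addabs mV2 (mV3.abs.add (mV4.abs.add mV5.abs)) hε0 (by positivity) nV2 a3
    exact addabs mV1 (mV2.abs.add (mV3.abs.add (mV4.abs.add mV5.abs))) hε0 (by positivity) n1 a2
  have iD : Integrable D (μ.prod μ) := MemLp.integrable hp1
    ⟨mD.aestronglyMeasurable, nD.trans_lt ENNReal.ofReal_lt_top⟩
  have iV : Integrable V (μ.prod μ) := MemLp.integrable hp1
    ⟨mV.aestronglyMeasurable, nV.trans_lt ENNReal.ofReal_lt_top⟩
  have D0 : ∀ z, 0 ≤ D z := fun z => by positivity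
  have V0 : ∀ z, 0 ≤ V z := fun z => by positivity
  refine ⟨fun x => ∫ y, D (x, y) ∂μ, fun x => ∫ y, V (x, y) ∂μ,
    (StronglyMeasurable.integral_prod_right' mD.stronglyMeasurable).measurable,
    (StronglyMeasurable.integral_prod_right' mV.stronglyMeasurable).measurable,
    fun x => integral_nonneg fun y => D0 _, fun x => integral_nonneg fun y => V0 _, ?_,
    (eLpNorm_integral_prod_le hp1 hpt mD.stronglyMeasurable).trans nD,
    (eLpNorm_integral_prod_le hp1 hpt mV.stronglyMeasurable).trans nV, ?_⟩
  · intro x x' hx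
    have hmix : ∀ (y : ℤ → S), ∀ j ∈ Set.Ioc c (c + w), mix J x y j = mix J x' y j := by
      intro y j hj
      by_cases hj' : j ∈ J
      · rw [mix_of_mem hj', mix_of_mem hj']
      · rw [mix_of_notMem hj', mix_of_notMem hj', hx j hj]
    simp only [hD, hD1, hD2]
    congr 1; funext y
    rw [dsj0 (hmix y), dbey0 (hmix y), dbey0 hx]
  · filter_upwards [iD.prod_right_ae, iV.prod_right_ae] with x hDx hVx
    have hsum : ∀ x, psum X (Finset.Ioc c (c + w)) x = pre x + sj x + bey x := fun x => by
      rw [psum_Ioc_add c (c + G) (c + w) (by omega) (by omega),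
        psum_Ioc_add (c + G) (c + G + ℓ) (c + w) (by omega) (by omega)]
      ring
    -- The reference value: if the block sum were an independent copy and nothing else moved, the
    -- average would be a unimodular factor times the characteristic function of one block.
    have e1 : ∫ y, ee (ξ * (pre x + sj y + bey x)) ∂μ = ee (ξ * (pre x + bey x)) * cf μ X ℓ ξ := by
      rw [← h.cf_eq (c + G) ℓ ξ, ← integral_const_mul]
      congr 1; funext y
      rw [← ee_add]; congr 1; ring
    have i1 : Integrable (fun y => ee (ξ * (pre x + sj y + bey x))) μ :=
      integrable_of_norm_le (by fun_prop) 1 fun y => (norm_ee _).le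
    have i2 : Integrable (fun y => ee (ξ * psum X (Finset.Ioc c (c + w)) (mix J x y))) μ := by
      have := h.measurable_psum (Finset.Ioc c (c + w))
      exact integrable_of_norm_le (by fun_prop) 1 fun y => (norm_ee _).le
    have e2 : avg μ J (fun x => ee (ξ * psum X (Finset.Ioc c (c + w)) x)) x =
        ee (ξ * (pre x + bey x)) * cf μ X ℓ ξ +
        ∫ y, (ee (ξ * psum X (Finset.Ioc c (c + w)) (mix J x y)) -
          ee (ξ * (pre x + sj y + bey x))) ∂μ := by
      rw [integral_sub i2 i1, e1]; unfold avg; ring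
    rw [e2, add_assoc]
    refine (norm_add_le _ _).trans (add_le_add (by simp) ?_)
    rw [← mul_add, ← integral_add hDx hVx, ← integral_const_mul]
    refine norm_integral_le_of_norm_le ((hDx.add hVx).const_mul _) (ae_of_all _ fun y => ?_)
    refine (norm_ee_sub_le _ _).trans ?_
    rw [hsum, ← mul_sub, abs_mul]
    gcongr
    have e3 : pre (mix J x y) + sj (mix J x y) + bey (mix J x y) - (pre x + sj y + bey x) =
        -V1 (x, y) + V2 (x, y) - V3 (x, y) + V4 (x, y) - V5 (x, y) - D1 (x, y) - D2 (x, y) := by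
      simp only [hV1, hV2, hV3, hV4, hV5, hD1, hD2]; ring
    rw [e3]
    simp only [hD, hV]
    rw [abs_le]
    constructor <;>
    linarith [neg_abs_le (V1 (x, y)), le_abs_self (V1 (x, y)), neg_abs_le (V2 (x, y)),
      le_abs_self (V2 (x, y)), neg_abs_le (V3 (x, y)), le_abs_self (V3 (x, y)),
      neg_abs_le (V4 (x, y)), le_abs_self (V4 (x, y)), neg_abs_le (V5 (x, y)),
      le_abs_self (V5 (x, y)), neg_abs_le (D1 (x, y)), le_abs_self (D1 (x, y)),
      neg_abs_le (D2 (x, y)), le_abs_self (D2 (x, y))]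

end Regular

end

/-! ### Factorisation at high frequencies by resampling sparse blocks. -/

section

variable {S : Type*} [MeasurableSpace S]

theorem integral_abs_le_of_eLpNorm_le {Z V : Type*} [MeasurableSpace Z] {κ : Measure Z}
    [IsProbabilityMeasure κ] [NormedAddCommGroup V] {r : ℝ≥0∞} (hr : 1 ≤ r) {f : Z → V}
    (hf : AEStronglyMeasurable f κ) {c : ℝ} (hc : 0 ≤ c) (h : eLpNorm f r κ ≤ ENNReal.ofReal c) :
    Integrable f κ ∧ ∫ z, ‖f z‖ ∂κ ≤ c := by
  have h1 := (eLpNorm_le_eLpNorm_of_exponent_le hr hf).trans h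
  have hi : Integrable f κ := memLp_one_iff_integrable.1 ⟨hf, h1.trans_lt ENNReal.ofReal_lt_top⟩
  rw [eLpNorm_one_eq_lintegral_enorm, ← ofReal_integral_norm_eq_lintegral_enorm hi] at h1
  exact ⟨hi, (ENNReal.ofReal_le_ofReal_iff hc).1 h1⟩

theorem integral_rpow_le_of_eLpNorm_le {Z : Type*} [MeasurableSpace Z] {κ : Measure Z}
    [IsProbabilityMeasure κ] {p : ℝ} (hp : 0 < p) {f : Z → ℝ}
    (hf : Measurable f) (h0 : ∀ z, 0 ≤ f z) {c : ℝ} (hc : 0 ≤ c)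
    (h : eLpNorm f (ENNReal.ofReal p) κ ≤ ENNReal.ofReal c) :
    Integrable (fun z => f z ^ p) κ ∧ ∫ z, f z ^ p ∂κ ≤ c ^ p := by
  have := integral_mul_mul_rpow_le hp hf.aestronglyMeasurable
    hf.aestronglyMeasurable hf.aestronglyMeasurable (a := p) (b := 0) (c := 0) hp.le
    le_rfl le_rfl (by ring) hc hc hc h h h
  simpa only [Real.rpow_zero, mul_one, abs_of_nonneg (h0 _)] using this

namespace Regular

variable {μ : Measure (ℤ → S)} [IsProbabilityMeasure μ] {X : ℤ → (ℤ → S) → ℝ} {p b M s2 q : ℝ}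

/-- The start of the `i`-th window. -/
def wst (w i : ℕ) : ℤ := i * w

theorem wst_succ (w i : ℕ) : wst w (i + 1) = wst w i + w := by unfold wst; push_cast; ring

theorem wst_mono (w : ℕ) : Monotone (wst w) :=
  monotone_nat_of_le_succ fun i => by rw [wst_succ]; omega

theorem wst_add_le {w i k : ℕ} (h : i < k) : wst w i + w ≤ wst w k := by
  rw [← wst_succ]; exact wst_mono w h

/-- The block of coordinates resampled in the `i`-th window. -/
def blk (w G ℓ i : ℕ) : Finset ℤ := Finset.Ioc (wst w i + G) (wst w i + G + ℓ)

theorem mem_blk {w G ℓ i : ℕ} {j : ℤ} :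
    j ∈ blk w G ℓ i ↔ wst w i + G < j ∧ j ≤ wst w i + G + ℓ := by simp [blk]

/-- All resampled coordinates. -/
def blks (N w G ℓ : ℕ) : Finset ℤ := (Finset.range N).biUnion (blk w G ℓ)

theorem mem_blks {N w G ℓ : ℕ} {j : ℤ} :
    j ∈ blks N w G ℓ ↔ ∃ i < N, wst w i + G < j ∧ j ≤ wst w i + G + ℓ := by
  simp [blks, mem_blk]

theorem card_blks_le (N w G ℓ : ℕ) : (blks N w G ℓ).card ≤ N * ℓ := by
  refine (Finset.card_biUnion_le).trans ?_
  simp [blk]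

theorem infl_psum_blks_le (h : Regular μ X p b M s2) {N w G ℓ : ℕ} (hG : 1 ≤ G) {I A : Finset ℤ}
    (hA : A ⊆ blks N w G ℓ) {c : ℤ} (hAc : ∀ j ∈ A, j ≤ c) (hI : ∀ k ∈ I, c + G ≤ k) :
    infl μ (ENNReal.ofReal p) (psum X I) A ≤
      ENNReal.ofReal (M * (√(N * ℓ) * (G : ℝ) ^ (-b))) := by
  have hM := h.M_pos
  refine (h.infl_finset I A c G hG hAc hI).trans (ENNReal.ofReal_le_ofReal ?_)
  gcongr
  exact_mod_cast (Finset.card_le_card hA).trans (card_blks_le N w G ℓ)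

/-- Blocks in later windows are invisible by adaptedness. Blocks in earlier windows end at least `G`
before this window begins, because each window keeps a margin `G` after its block. -/
theorem infl_window_le (h : Regular μ X p b M s2) {N w G ℓ : ℕ} (hG : 1 ≤ G) (hw : G + ℓ + G ≤ w)
    (k : ℕ) :
    infl μ (ENNReal.ofReal p) (psum X (Finset.Ioc (wst w k) (wst w k + w)))
      ((blks N w G ℓ : Set ℤ) \ blk w G ℓ k) ≤
      ENNReal.ofReal (M * (√(N * ℓ) * (G : ℝ) ^ (-b))) := by
  have hd : DependsOn (psum X (Finset.Ioc (wst w k) (wst w k + w))) (Set.Iic (wst w k + w)) :=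
    h.dependsOn_psum (by simp)
  rw [infl_inter hd]
  have e : ((blks N w G ℓ : Set ℤ) \ blk w G ℓ k) ∩ Set.Iic (wst w k + w) =
      (((blks N w G ℓ \ blk w G ℓ k).filter fun j => j ≤ wst w k + w : Finset ℤ) : Set ℤ) := by
    ext j; simp
  rw [e]
  refine h.infl_psum_blks_le (w := w) hG ?_ (c := wst w k - G) ?_ ?_
  · exact (Finset.filter_subset _ _).trans Finset.sdiff_subset
  · intro j hj
    simp only [Finset.mem_filter, Finset.mem_sdiff, mem_blks, mem_blk] at hj
    obtain ⟨⟨⟨i, hi, h1⟩, h2⟩, h3⟩ := hj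
    rcases lt_trichotomy i k with hik | hik | hik
    · have := wst_add_le (w := w) hik; omega
    · subst hik; exact absurd h1 h2
    · have := wst_add_le (w := w) hik; omega
  · simp; omega

theorem ee_psum_windows (w n : ℕ) (ξ : ℝ) (x : ℤ → S) :
    ee (ξ * psum X (Finset.Ioc 0 (wst w n)) x) =
      ∏ i ∈ Finset.range n, ee (ξ * psum X (Finset.Ioc (wst w i) (wst w i + w)) x) := by
  induction n with
  | zero => simp [wst, psum]
  | succ n ih =>
    have h0 : 0 ≤ wst w n := by unfold wst; positivity
    rw [Finset.prod_range_succ, ← ih, wst_succ, ← ee_add,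
      psum_Ioc_add 0 (wst w n) (wst w n + w) h0 (by omega)]
    congr 1; ring

/-- Exact factorisation up to a term in which the first block may be averaged over the resampled
coordinates. -/
theorem norm_cf_add_sub_mul_le_integral (h : Regular μ X p b M s2) (hp : 2 < p) {N w G ℓ m m' : ℕ}
    (hG : 1 ≤ G) (hw : G + ℓ + G ≤ w) (hNw : N * w ≤ m) (ξ : ℝ) :
    ∃ R : (ℤ → S) × (ℤ → S) → ℝ, Integrable (fun z => R z ^ 2) (μ.prod μ) ∧
      ∫ z, R z ^ 2 ∂(μ.prod μ) ≤ 4 * M ^ 2 ∧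
      ‖cf μ X (m + m') ξ - cf μ X m ξ * cf μ X m' ξ‖ ≤
        |ξ| * (M * (√(N * ℓ) * (G : ℝ) ^ (-b))) +
        ∫ z, ‖avg μ (blks N w G ℓ : Set ℤ) (fun x => ee (ξ * psum X (Finset.Ioc 0 (m : ℤ)) x)) z.1‖ *
          min 2 (|ξ| * |R z|) ∂(μ.prod μ) := by
  have hM := h.M_pos
  have hsw := h.swap
  have hp1 : (1 : ℝ≥0∞) ≤ ENNReal.ofReal p := by simp; linarith
  set J : Set ℤ := (blks N w G ℓ : Set ℤ) with hJ
  set U := psum X (Finset.Ioc 0 (m : ℤ)) with hU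
  set T := psum X (Finset.Ioc (m : ℤ) (m + m')) with hT
  set A : Set ℤ := Set.Iic (m : ℤ) with hA
  have mU : Measurable U := h.measurable_psum _
  have mT : Measurable T := h.measurable_psum _
  have hNw' : wst w N ≤ m := by unfold wst; exact_mod_cast hNw
  have hJc : ∀ j ∈ blks N w G ℓ, j ≤ m - G := by
    intro j hj
    obtain ⟨i, hi, h1, h2⟩ := mem_blks.1 hj
    have := wst_add_le (w := w) hi; omega
  have hJA : J ⊆ A := fun j hj => by
    have := hJc j hj; simp only [hA, Set.mem_Iic]; omega
  have dU : DependsOn U A := h.dependsOn_psum (by simp)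
  set η := M * (√(N * ℓ) * (G : ℝ) ^ (-b)) with hη
  have hη0 : 0 ≤ η := by positivity
  have iTJ : infl μ (ENNReal.ofReal p) T J ≤ ENNReal.ofReal η :=
    h.infl_psum_blks_le hG subset_rfl hJc (by simp; omega)
  have iTM : ∀ B : Set ℤ, B ⊆ A → infl μ (ENNReal.ofReal p) T B ≤ ENNReal.ofReal M := by
    intro B hB
    refine (h.infl_past _ _ _ 1 le_rfl hB ?_).trans_eq (by simp)
    simp; omega
  set t : (ℤ → S) → ℂ := fun x => ee (ξ * T x) with ht
  set u : (ℤ → S) → ℂ := fun x => ee (ξ * U x) with hu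
  have mt : Measurable t := by fun_prop
  have mu' : Measurable u := by fun_prop
  have nt : ∀ x, ‖t x‖ = 1 := fun x => norm_ee _
  have nu : ∀ x, ‖u x‖ = 1 := fun x => norm_ee _
  set R : (ℤ → S) × (ℤ → S) → ℝ := fun z => T (mix J z.1 z.2) - T (mix A z.1 z.2) with hR
  set Q : (ℤ → S) × (ℤ → S) → ℂ := fun z => t (mix J z.1 z.2) - t (mix A z.1 z.2) with hQ
  have mR : Measurable R := by fun_prop
  have mQ : Measurable Q := by fun_prop
  have nR : eLpNorm R (ENNReal.ofReal p) (μ.prod μ) ≤ ENNReal.ofReal (2 * M) := by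
    have e : R = (fun z => T z.1 - T (mix A z.1 z.2)) - (fun z => T z.1 - T (mix J z.1 z.2)) := by
      funext z; simp [hR]
    rw [e]
    refine (eLpNorm_sub_le (Measurable.aestronglyMeasurable (by fun_prop))
      (Measurable.aestronglyMeasurable (by fun_prop)) hp1).trans ?_
    rw [two_mul, ENNReal.ofReal_add hM.le hM.le]
    exact add_le_add (iTM A subset_rfl) (iTM J hJA)
  have hR2 := abs_integral_mul_le hp mR.aestronglyMeasurable mR.aestronglyMeasurable
    (by positivity) (by positivity) nR nR
  simp only [← sq] at hR2
  refine ⟨R, hR2.1, (le_abs_self _).trans (hR2.2.trans_eq (by ring)), ?_⟩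
  have hQ2 : ∀ z, ‖Q z‖ ≤ min 2 (|ξ| * |R z|) := fun z => by
    refine le_min ((norm_sub_le _ _).trans (by rw [nt, nt]; norm_num)) ?_
    refine (norm_ee_sub_le _ _).trans_eq ?_
    rw [← mul_sub, abs_mul]
  have w1 : ∫ z, u z.1 * t (mix A z.1 z.2) ∂(μ.prod μ) = cf μ X m ξ * cf μ X m' ξ := by
    have e1 : ∫ x, t x ∂μ = cf μ X m' ξ := h.cf_eq m m' ξ
    have e2 : ∫ x, u x ∂μ = cf μ X m ξ := rfl
    rw [← e1, ← e2]
    exact integral_mul_mix hsw (fun x y hxy => by simp only [hu, dU hxy]) mu' mt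
  have w2 : ∫ z, u z.1 * t z.1 ∂(μ.prod μ) = cf μ X (m + m') ξ := by
    rw [integral_fun_fst (μ := μ) (ν := μ) fun x => u x * t x]
    simp only [probReal_univ, one_smul, cf, hu, ht, ← ee_add, ← mul_add, hU, hT]
    congr 1; funext x
    rw [Nat.cast_add, psum_Ioc_add 0 (m : ℤ) (m + m') (by omega) (by omega)]
  have j1 : Integrable (fun z : (ℤ → S) × (ℤ → S) => u z.1 * t z.1) (μ.prod μ) :=
    integrable_of_norm_le (by fun_prop) 1 (by simp [nu, nt])
  have j2 : Integrable (fun z : (ℤ → S) × (ℤ → S) => u z.1 * t (mix A z.1 z.2)) (μ.prod μ) :=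
    integrable_of_norm_le (by fun_prop) 1 (by simp [nu, nt])
  have j3 : Integrable (fun z : (ℤ → S) × (ℤ → S) => u z.1 * (t z.1 - t (mix J z.1 z.2)))
      (μ.prod μ) := by
    refine integrable_of_norm_le (by fun_prop) 2 fun z => ?_
    rw [norm_mul, nu, one_mul]
    exact (norm_sub_le _ _).trans (by rw [nt, nt]; norm_num)
  have j4 : Integrable (fun z : (ℤ → S) × (ℤ → S) => u z.1 * Q z) (μ.prod μ) := by
    refine integrable_of_norm_le (by fun_prop) 2 fun z => ?_
    rw [norm_mul, nu, one_mul]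
    exact (hQ2 z).trans (min_le_left _ _)
  -- The increment of `t` under resampling the whole past is split at the intermediate resampling of
  -- `J` alone. The first part is small because `T` hardly feels `J`. The second, `Q`, reads the
  -- coordinates in `J` only from the second sequence, so `u` may be averaged over them.
  have e : cf μ X (m + m') ξ - cf μ X m ξ * cf μ X m' ξ =
      ∫ z, u z.1 * (t z.1 - t (mix J z.1 z.2)) ∂(μ.prod μ) + ∫ z, u z.1 * Q z ∂(μ.prod μ) := by
    rw [← w1, ← w2, ← integral_sub j1 j2, ← integral_add j3 j4]
    congr 1; funext z; simp only [hQ]; ring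
  rw [e]
  refine (norm_add_le _ _).trans (add_le_add ?_ ?_)
  · have hi : eLpNorm (fun z : (ℤ → S) × (ℤ → S) => t z.1 - t (mix J z.1 z.2)) (ENNReal.ofReal p)
        (μ.prod μ) ≤ ENNReal.ofReal (|ξ| * η) := by
      refine (infl_ee_le ξ J).trans ?_
      rw [ENNReal.ofReal_mul (abs_nonneg _)]
      gcongr
    have := integral_abs_le_of_eLpNorm_le hp1 (Measurable.aestronglyMeasurable (by fun_prop))
      (by positivity) hi
    refine le_trans (norm_integral_le_of_norm_le this.1.norm (ae_of_all _ fun z => ?_)) this.2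
    rw [norm_mul, nu, one_mul]
  · rw [integral_mul_eq_integral_avg_mul hsw mu' mQ j4 (J := J)]
    · have ma := measurable_avg (μ := μ) J mu'
      have na := norm_avg_le_one (μ := μ) (A := J) (fun x => (nu x).le)
      refine norm_integral_le_of_norm_le ?_ (ae_of_all _ fun z => ?_)
      · refine Integrable.of_bound (C := 2) (Measurable.aestronglyMeasurable (by fun_prop))
          (ae_of_all _ fun z => ?_)
        rw [Real.norm_eq_abs, abs_of_nonneg (by positivity)]
        calc _ ≤ 1 * 2 := mul_le_mul (na _) (min_le_left _ _) (by positivity) zero_le_one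
          _ = 2 := by ring
      · rw [norm_mul]
        gcongr
        exact hQ2 z
    · intro x v y
      have e1 : mix J (mix J x v) y = mix J x y := by
        funext j; by_cases hj : j ∈ J <;> simp [mix, hj]
      have e2 : mix A (mix J x v) y = mix A x y := by
        funext j
        by_cases hj : j ∈ A
        · simp [mix, hj]
        · have : j ∉ J := fun hj' => hj (hJA hj')
          simp [mix, hj, this]
      simp only [hQ, e1, e2]

/-- Three errors: the weak dependence between the blocks and everything else, linear in `|ξ|`; the
mean of the product over windows, exponentially small in `N`; and the non-local corrections, with
their `p`-th moment. The coefficient `2N + 3` counts the second half once and, with weight 2, the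
`N` windows and the rest of the first half. -/
theorem norm_cf_add_sub_mul_le_of_windows (h : Regular μ X p b M s2) (hp : 2 < p)
    {N w G ℓ m m' : ℕ} (hG : 1 ≤ G) (hw : G + ℓ + G ≤ w) (hNw : N * w ≤ m) {ξ : ℝ}
    (hφ : ‖cf μ X ℓ ξ‖ ≤ 1 / 8) (hξ : |ξ| * (2 * M) ≤ 1 / 4) :
    ‖cf μ X (m + m') ξ - cf μ X m ξ * cf μ X m' ξ‖ ≤
      (2 * N + 3) * (|ξ| * (M * (√(N * ℓ) * (G : ℝ) ^ (-b)))) +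
      |ξ| * ((1 + 4 * M ^ 2) / 2 / √2 ^ N) +
      2 * (N * (8 * |ξ| * (5 * (M * (G : ℝ) ^ (1 / 2 - b)))) ^ p) := by
  have hM := h.M_pos
  have hsw := h.swap
  have hp0 : 0 < p := by linarith
  have hp1 : (1 : ℝ≥0∞) ≤ ENNReal.ofReal p := by simp; linarith
  obtain ⟨R, iR, bR, hmain⟩ := h.norm_cf_add_sub_mul_le_integral hp hG hw hNw (m' := m') ξ
  set J : Set ℤ := (blks N w G ℓ : Set ℤ) with hJ
  set η := M * (√(N * ℓ) * (G : ℝ) ^ (-b)) with hη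
  set ε := 5 * (M * (G : ℝ) ^ (1 / 2 - b)) with hε
  have hη0 : 0 ≤ η := by positivity
  have hε0 : 0 ≤ ε := by positivity
  have hN0 : 0 ≤ wst w N := by unfold wst; positivity
  have hNw' : wst w N ≤ m := by unfold wst; exact_mod_cast hNw
  set f : ℕ → (ℤ → S) → ℂ := fun i x => ee (ξ * psum X (Finset.Ioc (wst w i) (wst w i + w)) x)
    with hf
  set r : (ℤ → S) → ℂ := fun x => ee (ξ * psum X (Finset.Ioc (wst w N) m) x) with hr
  have mf : ∀ i, Measurable (f i) := fun i => by
    have := h.measurable_psum (Finset.Ioc (wst w i) (wst w i + w)); fun_prop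
  have mr : Measurable r := by
    have := h.measurable_psum (Finset.Ioc (wst w N) m); fun_prop
  have nf : ∀ i x, ‖f i x‖ ≤ 1 := fun i x => (norm_ee _).le
  have nr : ∀ x, ‖r x‖ ≤ 1 := fun x => (norm_ee _).le
  -- local bounds for the windows
  have hex : ∀ i : ℕ, ∃ Y v : (ℤ → S) → ℝ, Measurable Y ∧ Measurable v ∧ (∀ x, 0 ≤ Y x) ∧
      (∀ x, 0 ≤ v x) ∧ DependsOn Y (Set.Ioc (wst w i) (wst w (i + 1))) ∧
      eLpNorm Y (ENNReal.ofReal p) μ ≤ ENNReal.ofReal (2 * M) ∧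
      eLpNorm v (ENNReal.ofReal p) μ ≤ ENNReal.ofReal ε ∧
      (i < N → ∀ᵐ x ∂μ, ‖avg μ J (f i) x‖ ≤ ‖cf μ X ℓ ξ‖ + |ξ| * Y x + |ξ| * v x) := by
    intro i
    by_cases hi : i < N
    · have hJ1 : Set.Ioc (wst w i + G) (wst w i + G + ℓ) ⊆ J := fun j hj =>
        mem_blks.2 ⟨i, hi, hj.1, hj.2⟩
      have hJ2 : ∀ j ∈ J, j ≤ wst w i + w →
          j ≤ wst w i - G ∨ (wst w i + G < j ∧ j ≤ wst w i + G + ℓ) := by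
        intro j hj hjw
        obtain ⟨k, hk, h1⟩ := mem_blks.1 hj
        rcases lt_trichotomy k i with hik | hik | hik
        · have := wst_add_le (w := w) hik; left; omega
        · subst hik; exact Or.inr h1
        · have := wst_add_le (w := w) hik; omega
      obtain ⟨Y, v, a1, a2, a3, a4, a5, a6, a7, a8⟩ :=
        h.exists_window_bound hp hG hw hJ1 hJ2 ξ
      exact ⟨Y, v, a1, a2, a3, a4, by rw [wst_succ]; exact a5, a6, a7, fun _ => a8⟩
    -- Beyond the `N` windows the zero functions serve as defaults, so that `choose` yields families
    -- over all of `ℕ`.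
    · exact ⟨fun _ => 0, fun _ => 0, measurable_const, measurable_const, fun _ => le_rfl,
        fun _ => le_rfl, fun _ _ _ => rfl, by simp, by simp, fun hi' => absurd hi' hi⟩
  choose Y v mY mv Y0 v0 dY nY nv hbd using hex
  -- the independent majorants
  set g : ℕ → (ℤ → S) → ℝ := fun i x => min 1 (|‖cf μ X ℓ ξ‖ + |ξ| * Y i x| + 1 / 8) with hg
  have mg : ∀ i, Measurable (g i) := fun i => by
    have := mY i
    refine measurable_const.min (Measurable.add ?_ measurable_const)
    exact continuous_abs.measurable.comp (by fun_prop)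
  have g0 : ∀ i x, 0 ≤ g i x := fun i x => by positivity
  have g1 : ∀ i x, g i x ≤ 1 := fun i x => min_le_left _ _
  -- The mean is at most `1/8` from the block characteristic function, `1/8` from the allowance for
  -- corrections, and `1/4` from `|ξ| Y`, using `hξ`.
  have ig : ∀ i, ∫ x, g i x ∂μ ≤ 1 / 2 := by
    intro i
    obtain ⟨iY, bY⟩ := integral_abs_le_of_eLpNorm_le hp1 (mY i).aestronglyMeasurable
      (by positivity) (nY i)
    simp only [Real.norm_eq_abs, abs_of_nonneg (Y0 i _)] at bY
    have : ∫ x, g i x ∂μ ≤ ∫ x, (1 / 4 + |ξ| * Y i x) ∂μ := by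
      refine integral_mono (Integrable.of_bound (C := 1) (mg i).aestronglyMeasurable
        (ae_of_all _ fun x => ?_)) ((integrable_const _).add (iY.const_mul _)) fun x => ?_
      · rw [Real.norm_eq_abs, abs_of_nonneg (g0 i x)]; exact g1 i x
      · refine (min_le_right _ _).trans ?_
        have := Y0 i x
        rw [abs_of_nonneg (by positivity)]; linarith
    refine this.trans ?_
    rw [integral_add (integrable_const _) (iY.const_mul _), integral_const_mul]
    simp only [integral_const, probReal_univ, one_smul]
    have := mul_le_mul_of_nonneg_left bY (abs_nonneg ξ)
    linarith
  set Pr : (ℤ → S) → ℝ := fun x => ∏ i ∈ Finset.range N, g i x with hPr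
  have mPr : Measurable Pr := by fun_prop
  have Pr0 : ∀ x, 0 ≤ Pr x := fun x => Finset.prod_nonneg fun i _ => g0 i x
  have Pr1 : ∀ x, Pr x ≤ 1 := fun x => Finset.prod_le_one (fun i _ => g0 i x) fun i _ => g1 i x
  have bPr : ∫ x, Pr x ∂μ ≤ (1 / 2) ^ N := by
    rw [hPr, integral_prod_windows hsw (wst_mono w) mg]
    · calc ∏ i ∈ Finset.range N, ∫ x, g i x ∂μ ≤ ∏ _i ∈ Finset.range N, (1 / 2 : ℝ) :=
            Finset.prod_le_prod (fun i _ => integral_nonneg (g0 i)) fun i _ => ig i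
        _ = _ := by simp
    · intro i x y hxy
      simp only [hg, dY i hxy]
  have iPr : Integrable Pr μ := Integrable.of_bound (C := 1) mPr.aestronglyMeasurable
    (ae_of_all _ fun x => by rw [Real.norm_eq_abs, abs_of_nonneg (Pr0 x)]; exact Pr1 x)
  set E : ℕ → (ℤ → S) → ℝ := fun i =>
    avg μ J (fun x => ‖avg μ (blk w G ℓ i : Set ℤ) (f i) x - avg μ J (f i) x‖) with hE
  set Er : (ℤ → S) → ℝ := avg μ J (fun x => ‖avg μ ∅ r x - avg μ J r x‖) with hEr
  have eeInfl : ∀ (I : Finset ℤ) (A : Set ℤ),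
      infl μ (ENNReal.ofReal p) (psum X I) A ≤ ENNReal.ofReal η →
      infl μ (ENNReal.ofReal p) (fun x => ee (ξ * psum X I x)) A ≤ ENNReal.ofReal (|ξ| * η) := by
    intro I A hA
    refine (infl_ee_le ξ A).trans ?_
    rw [ENNReal.ofReal_mul (abs_nonneg _)]
    gcongr
  have blkJ : ∀ i < N, (blk w G ℓ i : Set ℤ) ⊆ J := fun i hi j hj =>
    mem_blks.2 ⟨i, hi, mem_blk.1 hj⟩
  have hEi : ∀ i < N, Integrable (E i) μ ∧ ∫ x, E i x ∂μ ≤ |ξ| * η := fun i hi =>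
    integral_avg_norm_sub_le hsw (blkJ i hi) (mf i) (nf i) hp1 (by positivity)
      (eeInfl _ _ (h.infl_window_le hG hw i))
  have hEri : Integrable Er μ ∧ ∫ x, Er x ∂μ ≤ |ξ| * η := by
    refine integral_avg_norm_sub_le hsw (Set.empty_subset _) mr nr hp1 (by positivity)
      (eeInfl _ _ ?_)
    rw [Set.sdiff_empty]
    refine h.infl_psum_blks_le hG subset_rfl (c := wst w N - G) ?_ (by simp; omega)
    intro j hj
    obtain ⟨i, hi, h1, h2⟩ := mem_blks.1 hj
    have := wst_add_le (w := w) hi; omega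
  have hvi : ∀ i, Integrable (fun x => (8 * (|ξ| * v i x)) ^ p) μ ∧
      ∫ x, (8 * (|ξ| * v i x)) ^ p ∂μ ≤ (8 * |ξ| * ε) ^ p := by
    intro i
    obtain ⟨j1, j2⟩ := integral_rpow_le_of_eLpNorm_le hp0 (mv i) (v0 i) hε0 (nv i)
    have e : ∀ x, (8 * (|ξ| * v i x)) ^ p = (8 * |ξ|) ^ p * v i x ^ p := fun x => by
      rw [← mul_assoc, Real.mul_rpow (by positivity) (v0 i x)]
    simp only [e]
    refine ⟨j1.const_mul _, ?_⟩
    rw [integral_const_mul, Real.mul_rpow (by positivity) hε0]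
    gcongr
  -- the pointwise bound
  have hpt : ∀ᵐ x ∂μ, ‖avg μ J (fun x => ee (ξ * psum X (Finset.Ioc 0 (m : ℤ)) x)) x‖ ≤
      Pr x + ∑ i ∈ Finset.range N, (8 * (|ξ| * v i x)) ^ p + ∑ i ∈ Finset.range N, E i x + Er x := by
    have hae : ∀ᵐ x ∂μ, ∀ i, i < N →
        ‖avg μ J (f i) x‖ ≤ ‖cf μ X ℓ ξ‖ + |ξ| * Y i x + |ξ| * v i x := by
      rw [ae_all_iff]; intro i
      by_cases hi : i < N
      · filter_upwards [hbd i hi] with x hx _ using hx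
      · exact ae_of_all _ fun x hi' => absurd hi' hi
    filter_upwards [hae] with x hx
    have efun : (fun x => ee (ξ * psum X (Finset.Ioc 0 (m : ℤ)) x)) =
        fun x => (∏ i ∈ Finset.range N, f i x) * r x := by
      funext x
      rw [psum_Ioc_add 0 (wst w N) m hN0 hNw', mul_add, ee_add, ee_psum_windows]
    rw [efun]
    have s1 := norm_avg_mul_le hsw (Set.empty_subset J)
      (f := fun x => ∏ i ∈ Finset.range N, f i x) (h := r) (by fun_prop) mr
      (fun x => by
        rw [norm_prod]; exact Finset.prod_le_one (fun _ _ => norm_nonneg _) fun i _ => nf i x)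
      nr (by rw [Set.compl_empty]; exact dependsOn_univ _) x
    have s2 : ‖avg μ J (fun x => ∏ i ∈ Finset.range N, f i x) x‖ ≤
        ∏ i ∈ Finset.range N, ‖avg μ J (f i) x‖ + ∑ i ∈ Finset.range N, E i x := by
      have := norm_avg_prod_le hsw (J := J)
        (J' := fun i => if i < N then (blk w G ℓ i : Set ℤ) else ∅) (h := f)
        (fun i => by by_cases hi : i < N <;> simp [hi, blkJ]) mf nf ?_ N x
      · refine this.trans_eq ?_
        congr 1
        refine Finset.sum_congr rfl fun i hi => ?_
        simp only [if_pos (Finset.mem_range.1 hi)]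
        rfl
      · intro i k hik
        by_cases hk : k < N
        · simp only [if_pos hk]
          have hd : DependsOn (psum X (Finset.Ioc (wst w i) (wst w i + w)))
            (Set.Iic (wst w i + w)) := h.dependsOn_psum (by simp)
          refine DependsOn.mono_set (B := Set.Iic (wst w i + w))
            (fun x y hxy => by simp only [hf, hd hxy]) ?_
          intro j hj hj'
          have h1 := (mem_blk.1 hj').1
          have := wst_add_le (w := w) hik
          simp only [Set.mem_Iic] at hj
          omega
        · simp only [if_neg hk, Set.compl_empty]; exact dependsOn_univ _
    have s3 := prod_le_prod_min_add_sum hp0.le N (a := fun i => ‖avg μ J (f i) x‖)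
      (A := fun i => ‖cf μ X ℓ ξ‖ + |ξ| * Y i x) (v := fun i => |ξ| * v i x)
      (fun i => norm_nonneg _) (fun i => norm_avg_le_one (nf i) x)
      (fun i => mul_nonneg (abs_nonneg _) (v0 i x)) hx
    have s4 : ‖avg μ J (fun x => ∏ i ∈ Finset.range N, f i x) x‖ * ‖avg μ J r x‖ ≤
        ‖avg μ J (fun x => ∏ i ∈ Finset.range N, f i x) x‖ :=
      mul_le_of_le_one_right (norm_nonneg _) (norm_avg_le_one nr x)
    linarith
  -- The weight in `Pr |R| ≤ ρ/2 Pr + R²/(2ρ)`: as `Pr` has mean at most `2^{-N}` and `R²` a bounded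
  -- mean, `ρ = 2^{N/2}` makes both terms of order `2^{-N/2}`.
  set ρ : ℝ := √2 ^ N with hρ
  have hρ0 : 0 < ρ := by positivity
  set W : (ℤ → S) → ℝ := fun x => ∑ i ∈ Finset.range N, (8 * (|ξ| * v i x)) ^ p +
    ∑ i ∈ Finset.range N, E i x + Er x with hW
  have E0 : ∀ i x, 0 ≤ E i x := fun i x => integral_nonneg fun y => norm_nonneg _
  have Er0 : ∀ x, 0 ≤ Er x := fun x => integral_nonneg fun y => norm_nonneg _
  have W0 : ∀ x, 0 ≤ W x := fun x => by
    refine add_nonneg (add_nonneg (Finset.sum_nonneg fun i _ => ?_)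
      (Finset.sum_nonneg fun i _ => E0 i x)) (Er0 x)
    have := v0 i x; positivity
  have iW1 : Integrable (fun x => ∑ i ∈ Finset.range N, (8 * (|ξ| * v i x)) ^ p) μ :=
    integrable_finsetSum _ fun i _ => (hvi i).1
  have iW2 : Integrable (fun x => ∑ i ∈ Finset.range N, E i x) μ :=
    integrable_finsetSum _ fun i hi => (hEi i (Finset.mem_range.1 hi)).1
  have iW12 : Integrable (fun x => ∑ i ∈ Finset.range N, (8 * (|ξ| * v i x)) ^ p +
    ∑ i ∈ Finset.range N, E i x) μ := iW1.add iW2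
  have iW : Integrable W μ := iW12.add hEri.1
  have bW : ∫ x, W x ∂μ ≤ N * (8 * |ξ| * ε) ^ p + N * (|ξ| * η) + |ξ| * η := by
    rw [hW, integral_add iW12 hEri.1, integral_add iW1 iW2,
      integral_finsetSum _ fun i _ => (hvi i).1,
      integral_finsetSum _ fun i hi => (hEi i (Finset.mem_range.1 hi)).1]
    refine add_le_add (add_le_add ?_ ?_) hEri.2
    · refine (Finset.sum_le_card_nsmul _ _ _ fun i _ => (hvi i).2).trans_eq (by simp)
    · refine (Finset.sum_le_card_nsmul _ _ _ fun i hi => (hEi i (Finset.mem_range.1 hi)).2).trans_eq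
        (by simp)
  have iPr' : Integrable (fun z : (ℤ → S) × (ℤ → S) => Pr z.1) (μ.prod μ) := iPr.comp_fst μ
  have iW' : Integrable (fun z : (ℤ → S) × (ℤ → S) => W z.1) (μ.prod μ) := iW.comp_fst μ
  have bound : ∫ z, ‖avg μ J (fun x => ee (ξ * psum X (Finset.Ioc 0 (m : ℤ)) x)) z.1‖ *
      min 2 (|ξ| * |R z|) ∂(μ.prod μ) ≤
      ∫ z, (|ξ| * (ρ / 2) * Pr z.1 + |ξ| * (1 / ρ / 2) * R z ^ 2 + 2 * W z.1) ∂(μ.prod μ) := by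
    refine integral_mono_of_nonneg (ae_of_all _ fun z => by positivity)
      (((iPr'.const_mul _).add (iR.const_mul _)).add (iW'.const_mul _)) ?_
    have hq := (measurePreserving_fst (μ := μ) (ν := μ)).quasiMeasurePreserving.ae hpt
    filter_upwards [hq] with z hz
    have h1 : ‖avg μ J (fun x => ee (ξ * psum X (Finset.Ioc 0 (m : ℤ)) x)) z.1‖ ≤ Pr z.1 + W z.1 := by
      simp only [hW]; linarith
    have h2 : Pr z.1 * |R z| ≤ ρ / 2 * Pr z.1 + 1 / ρ / 2 * R z ^ 2 := by
      have a1 : Pr z.1 ^ 2 ≤ Pr z.1 := by have := Pr0 z.1; have := Pr1 z.1; nlinarith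
      have a2 : 0 ≤ (ρ * Pr z.1 - |R z|) ^ 2 / ρ / 2 := by positivity
      have a3 : (ρ * Pr z.1 - |R z|) ^ 2 / ρ / 2 =
          ρ / 2 * Pr z.1 ^ 2 - Pr z.1 * |R z| + 1 / ρ / 2 * R z ^ 2 := by
        rw [← sq_abs (R z)]; field_simp; ring
      have a4 := mul_le_mul_of_nonneg_left a1 (by positivity : 0 ≤ ρ / 2)
      linarith
    -- The two bounds in the minimum are used separately: the factor `|ξ|` is needed against `Pr`,
    -- while the bound 2 suffices against `W`, which is already small in mean.
    calc _ ≤ (Pr z.1 + W z.1) * min 2 (|ξ| * |R z|) := by gcongr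
      _ = Pr z.1 * min 2 (|ξ| * |R z|) + W z.1 * min 2 (|ξ| * |R z|) := by ring
      _ ≤ Pr z.1 * (|ξ| * |R z|) + W z.1 * 2 := by
          gcongr
          · exact min_le_right _ _
          · exact W0 _
          · exact min_le_left _ _
      _ = |ξ| * (Pr z.1 * |R z|) + 2 * W z.1 := by ring
      _ ≤ |ξ| * (ρ / 2 * Pr z.1 + 1 / ρ / 2 * R z ^ 2) + 2 * W z.1 := by gcongr
      _ = _ := by ring
  have e1 : ∫ z, (|ξ| * (ρ / 2) * Pr z.1 + |ξ| * (1 / ρ / 2) * R z ^ 2 + 2 * W z.1) ∂(μ.prod μ) =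
      |ξ| * (ρ / 2) * ∫ x, Pr x ∂μ + |ξ| * (1 / ρ / 2) * ∫ z, R z ^ 2 ∂(μ.prod μ) +
        2 * ∫ x, W x ∂μ := by
    have k1 : ∫ z : (ℤ → S) × (ℤ → S), Pr z.1 ∂(μ.prod μ) = ∫ x, Pr x ∂μ := by
      rw [integral_fun_fst (μ := μ) (ν := μ) Pr]; simp
    have k2 : ∫ z : (ℤ → S) × (ℤ → S), W z.1 ∂(μ.prod μ) = ∫ x, W x ∂μ := by
      rw [integral_fun_fst (μ := μ) (ν := μ) W]; simp
    have k3 := integral_add ((iPr'.const_mul (|ξ| * (ρ / 2))).add (iR.const_mul (|ξ| * (1 / ρ / 2))))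
      (iW'.const_mul 2)
    have k4 := integral_add (iPr'.const_mul (|ξ| * (ρ / 2))) (iR.const_mul (|ξ| * (1 / ρ / 2)))
    simp only [Pi.add_apply] at k3
    rw [k3, k4, integral_const_mul, integral_const_mul, integral_const_mul, k1, k2]
  have hρ2 : ρ * (1 / 2) ^ N = 1 / ρ := by
    rw [eq_div_iff hρ0.ne', mul_right_comm, hρ, ← mul_pow, Real.mul_self_sqrt (by norm_num),
      ← mul_pow]
    norm_num
  have t1 : |ξ| * (ρ / 2) * ∫ x, Pr x ∂μ ≤ |ξ| * (1 / ρ / 2) := by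
    calc _ ≤ |ξ| * (ρ / 2) * (1 / 2) ^ N := by gcongr
      _ = |ξ| * ((ρ * (1 / 2) ^ N) / 2) := by ring
      _ = _ := by rw [hρ2]
  have t2 : |ξ| * (1 / ρ / 2) * ∫ z, R z ^ 2 ∂(μ.prod μ) ≤ |ξ| * (1 / ρ / 2) * (4 * M ^ 2) := by
    gcongr
  have t3 : |ξ| * ((1 + 4 * M ^ 2) / 2 / ρ) =
      |ξ| * (1 / ρ / 2) + |ξ| * (1 / ρ / 2) * (4 * M ^ 2) := by ring
  rw [e1] at bound
  linarith

end Regular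

end

/-! ### Choice of parameters for the windows. -/

section

universe u

section parameters

variable {α b κ δ τ m N G ξ M K p : ℝ}

/-- Frequencies are at most 1, so `τ² ≤ m`, and any decay in `m` beyond the target `α` can be traded
for decay in `τ` at the rate of two powers for one. -/
theorem rpow_neg_le_of_sq_le {s : ℝ} (hτ : 1 ≤ τ) (hm : τ ^ 2 ≤ m) (hs : α ≤ s) :
    m ^ (-s) ≤ m ^ (-α) * τ ^ (-(2 * (s - α))) := by
  have hm0 : 0 < m := by nlinarith
  have e : m ^ (-s) = m ^ (-α) * m ^ (-(s - α)) := by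
    rw [← Real.rpow_add hm0]; congr 1; ring
  rw [e]
  gcongr
  calc m ^ (-(s - α)) ≤ (τ ^ 2) ^ (-(s - α)) :=
        Real.rpow_le_rpow_of_nonpos (by positivity) hm (by linarith)
    _ = τ ^ (-(2 * (s - α))) := by
        rw [← Real.rpow_two, ← Real.rpow_mul (by linarith)]; congr 1; ring

/-- Since `|ξ| √ℓ` is bounded and `G` is at least of order `m / N`, the error is at most of order
`N³ m^{-b}`. The surplus `b > α` pays for `N³ ≤ τ^{3κ}` and for `τ^δ`. -/
theorem window_error_linear_le {ℓ : ℝ} (hτ : 1 ≤ τ) (hm : τ ^ 2 ≤ m) (hN : 1 ≤ N) (hNτ : N ≤ τ ^ κ)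
    (hG : m / (16 * N) ≤ G) (hb : 0 ≤ b) (hb1 : b ≤ 1) (hM : 0 ≤ M) (hK : 0 ≤ K) 
    (hξ : |ξ| * √ℓ ≤ 2 * K) (hα : α ≤ b) (hκ : 3 * κ + δ ≤ 2 * (b - α)) :
    (2 * N + 3) * (|ξ| * (M * (√(N * ℓ) * G ^ (-b)))) ≤ 160 * M * K * (m ^ (-α) * τ ^ (-δ)) := by
  have hm0 : 0 < m := by nlinarith
  have hτ0 : 0 < τ := by linarith
  have hG0 : 0 ≤ G := le_trans (by positivity) hG
  have h1 : G ^ (-b) ≤ 16 * N * m ^ (-b) := by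
    calc G ^ (-b) ≤ (m / (16 * N)) ^ (-b) :=
          Real.rpow_le_rpow_of_nonpos (by positivity) hG (by linarith)
      _ = (16 * N) ^ b * m ^ (-b) := by
          rw [Real.div_rpow hm0.le (by positivity), Real.rpow_neg (by positivity : 0 ≤ 16 * N)]
          field_simp
      _ ≤ (16 * N) ^ (1 : ℝ) * m ^ (-b) := by
          gcongr
          linarith
      _ = _ := by rw [Real.rpow_one]
  have h2 : √N ≤ N := by rw [Real.sqrt_le_left (by linarith)]; nlinarith
  have h3 : N ^ 3 ≤ τ ^ (3 * κ) := by
    calc N ^ 3 ≤ (τ ^ κ) ^ 3 := by gcongr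
      _ = _ := by rw [← Real.rpow_natCast, ← Real.rpow_mul hτ0.le]; congr 1; push_cast; ring
  have h4 := rpow_neg_le_of_sq_le hτ hm hα
  have h5 : τ ^ (3 * κ) * τ ^ (-(2 * (b - α))) ≤ τ ^ (-δ) := by
    rw [← Real.rpow_add hτ0]
    exact Real.rpow_le_rpow_of_exponent_le hτ (by linarith)
  calc (2 * N + 3) * (|ξ| * (M * (√(N * ℓ) * G ^ (-b))))
      = (2 * N + 3) * (M * (√N * (|ξ| * √ℓ) * G ^ (-b))) := by
        rw [Real.sqrt_mul (by linarith)]; ring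
    _ ≤ (5 * N) * (M * (N * (2 * K) * (16 * N * m ^ (-b)))) := by
        gcongr
        linarith
    _ = 160 * M * K * (N ^ 3 * m ^ (-b)) := by ring
    _ ≤ 160 * M * K * (τ ^ (3 * κ) * (m ^ (-α) * τ ^ (-(2 * (b - α))))) := by gcongr
    _ = 160 * M * K * (m ^ (-α) * (τ ^ (3 * κ) * τ ^ (-(2 * (b - α))))) := by ring
    _ ≤ _ := by gcongr

/-- This is where the boundary exponent comes from. Up to powers of `N` the error is `τ^p m^{-pb}`,
and by `τ² ≤ m` it is at most `m^{-α} τ^{p - 2(pb - α)}`. The exponent of `τ` is negative exactly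
when `b > 1/2 + α/p`. -/
theorem window_error_power_le (hp : 0 < p) (hτ : 1 ≤ τ) (hm : τ ^ 2 ≤ m) (hN : 1 ≤ N)
    (hNτ : N ≤ τ ^ κ) (hG : m / (16 * N) ≤ G) (hb : 1 / 2 ≤ b) (hb1 : b ≤ 1) (hM : 0 ≤ M)
    (hτξ : τ = |ξ| * √m) (hα : α ≤ p * b) (hκ : κ * (1 + p / 2) + δ ≤ 2 * p * b - p - 2 * α) :
    2 * (N * (8 * |ξ| * (5 * (M * G ^ (1 / 2 - b)))) ^ p) ≤
      2 * (160 * M) ^ p * (m ^ (-α) * τ ^ (-δ)) := by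
  have hm0 : 0 < m := by nlinarith
  have hτ0 : 0 < τ := by linarith
  have h1 : G ^ (1 / 2 - b) ≤ 4 * N ^ (1 / 2 : ℝ) * m ^ (1 / 2 - b) := by
    calc G ^ (1 / 2 - b) ≤ (m / (16 * N)) ^ (1 / 2 - b) :=
          Real.rpow_le_rpow_of_nonpos (by positivity) hG (by linarith)
      _ = (16 * N) ^ (b - 1 / 2) * m ^ (1 / 2 - b) := by
          rw [Real.div_rpow hm0.le (by positivity), show b - 1 / 2 = -(1 / 2 - b) by ring,
            Real.rpow_neg (by positivity : 0 ≤ 16 * N)]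
          field_simp
      _ ≤ (16 * N) ^ (1 / 2 : ℝ) * m ^ (1 / 2 - b) := by
          gcongr
          · linarith
          · linarith
      _ = _ := by
          rw [Real.mul_rpow (by norm_num) (by linarith), ← Real.sqrt_eq_rpow,
            show (16 : ℝ) = 4 ^ 2 by norm_num, Real.sqrt_sq (by norm_num)]
  have h2 : |ξ| * m ^ (1 / 2 - b) = τ * m ^ (-b) := by
    rw [hτξ, Real.sqrt_eq_rpow, mul_assoc, ← Real.rpow_add hm0]; congr 2
  have h3 : N * (N ^ (1 / 2 : ℝ)) ^ p ≤ τ ^ (κ * (1 + p / 2)) := by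
    calc N * (N ^ (1 / 2 : ℝ)) ^ p = N ^ (1 + p / 2) := by
          rw [← Real.rpow_mul (by linarith), Real.rpow_add (by linarith), Real.rpow_one]
          congr 2; ring
      _ ≤ (τ ^ κ) ^ (1 + p / 2) := by gcongr
      _ = _ := by rw [← Real.rpow_mul hτ0.le]
  have h4 := rpow_neg_le_of_sq_le hτ hm hα
  calc 2 * (N * (8 * |ξ| * (5 * (M * G ^ (1 / 2 - b)))) ^ p)
      ≤ 2 * (N * (8 * |ξ| * (5 * (M * (4 * N ^ (1 / 2 : ℝ) * m ^ (1 / 2 - b))))) ^ p) := by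
        have : 0 ≤ m / (16 * N) := by positivity
        have hG0 : 0 ≤ G := this.trans hG
        gcongr
    _ = 2 * (N * ((160 * M) * (N ^ (1 / 2 : ℝ)) * (|ξ| * m ^ (1 / 2 - b))) ^ p) := by
        congr 3; ring
    _ = 2 * (160 * M) ^ p * (N * (N ^ (1 / 2 : ℝ)) ^ p * (τ ^ p * m ^ (-(p * b)))) := by
        rw [h2, Real.mul_rpow (by positivity) (by positivity),
          Real.mul_rpow (by positivity) (by positivity), Real.mul_rpow hτ0.le (by positivity),
          ← Real.rpow_mul hm0.le, show -b * p = -(p * b) by ring]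
        ring
    _ ≤ 2 * (160 * M) ^ p * (τ ^ (κ * (1 + p / 2)) *
          (τ ^ p * (m ^ (-α) * τ ^ (-(2 * (p * b - α)))))) := by gcongr
    _ = 2 * (160 * M) ^ p * (m ^ (-α) *
          (τ ^ (κ * (1 + p / 2)) * τ ^ p * τ ^ (-(2 * (p * b - α))))) := by ring
    _ ≤ _ := by
        rw [← Real.rpow_add hτ0, ← Real.rpow_add hτ0]
        gcongr
        linarith

theorem exists_rpow_le_mul_sqrt_two_pow (s : ℝ) :
    ∃ C : ℝ, 0 ≤ C ∧ ∀ n : ℕ, 1 ≤ n → (2 * n : ℝ) ^ s ≤ C * √2 ^ n := by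
  have h2 : 1 < √(2 : ℝ) := Real.lt_sqrt_of_sq_lt (by norm_num)
  obtain ⟨B, hB⟩ := (tendsto_pow_const_div_const_pow_of_one_lt ⌈s⌉₊ h2).bddAbove_range
  have hB0 : 0 ≤ B := by
    refine le_trans ?_ (hB ⟨1, rfl⟩); positivity
  refine ⟨2 ^ ⌈s⌉₊ * B, by positivity, fun n hn => ?_⟩
  have hn1 : (1 : ℝ) ≤ n := by exact_mod_cast hn
  have h1 : (n : ℝ) ^ ⌈s⌉₊ / √2 ^ n ≤ B := hB ⟨n, rfl⟩
  rw [div_le_iff₀ (by positivity)] at h1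
  calc (2 * n : ℝ) ^ s ≤ (2 * n : ℝ) ^ ((⌈s⌉₊ : ℕ) : ℝ) :=
        Real.rpow_le_rpow_of_exponent_le (by linarith) (Nat.le_ceil s)
    _ = 2 ^ ⌈s⌉₊ * (n : ℝ) ^ ⌈s⌉₊ := by rw [Real.rpow_natCast, mul_pow]
    _ ≤ 2 ^ ⌈s⌉₊ * (B * √2 ^ n) := by gcongr
    _ = _ := by ring

/-- The factor `|ξ| = τ m^{-1/2}` supplies `m^{-α}` at the cost of one power of `τ`. The number of
windows is a power of `τ`, so the exponential repays that power and `τ^δ` besides. -/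
theorem window_error_exp_le {C : ℝ} {n : ℕ} (hκ : 0 < κ) (hδ : 0 ≤ δ) (hτ : 1 ≤ τ)
    (hm : 1 ≤ m) (hnτ : τ ^ κ ≤ 2 * n) (hC : (2 * n : ℝ) ^ ((1 + δ) / κ) ≤ C * √2 ^ n)
    (hτξ : τ = |ξ| * √m) (hα : α ≤ 1 / 2) :
    |ξ| * ((1 + 4 * M ^ 2) / 2 / √2 ^ n) ≤ (1 + 4 * M ^ 2) * C * (m ^ (-α) * τ ^ (-δ)) := by
  have hm0 : 0 < m := by linarith
  have hτ0 : 0 < τ := by linarith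
  have hs : 0 < √(2 : ℝ) ^ n := by positivity
  have h1 : τ ^ (1 + δ) ≤ C * √2 ^ n := by
    refine le_trans ?_ hC
    calc τ ^ (1 + δ) = (τ ^ κ) ^ ((1 + δ) / κ) := by
          rw [← Real.rpow_mul hτ0.le]; congr 1; field_simp
      _ ≤ _ := by gcongr
  have h2 : |ξ| ≤ τ * m ^ (-α) := by
    have : |ξ| = τ * m ^ (-(1 / 2 : ℝ)) := by
      rw [hτξ, Real.sqrt_eq_rpow, mul_assoc, ← Real.rpow_add hm0]; norm_num
    rw [this]
    gcongr
  have h3 : τ / √2 ^ n ≤ C * τ ^ (-δ) := by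
    rw [div_le_iff₀ hs]
    have h4 : τ = τ ^ (1 + δ) * τ ^ (-δ) := by
      rw [← Real.rpow_add hτ0]; norm_num
    calc τ = τ ^ (1 + δ) * τ ^ (-δ) := h4
      _ ≤ C * √2 ^ n * τ ^ (-δ) := by gcongr
      _ = _ := by ring
  calc |ξ| * ((1 + 4 * M ^ 2) / 2 / √2 ^ n) ≤ τ * m ^ (-α) * ((1 + 4 * M ^ 2) / 2 / √2 ^ n) := by
        gcongr
    _ = (1 + 4 * M ^ 2) / 2 * m ^ (-α) * (τ / √2 ^ n) := by ring
    _ ≤ (1 + 4 * M ^ 2) / 2 * m ^ (-α) * (C * τ ^ (-δ)) := by gcongr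
    _ = (1 + 4 * M ^ 2) * (C * (m ^ (-α) * τ ^ (-δ))) / 2 := by ring
    _ ≤ (1 + 4 * M ^ 2) * (C * (m ^ (-α) * τ ^ (-δ))) := by
        have hC0 : 0 ≤ C := by
          by_contra hcon
          have : C * √2 ^ n < 0 := mul_neg_of_neg_of_pos (not_le.1 hcon) hs
          have : 0 ≤ τ ^ (1 + δ) := by positivity
          linarith
        have : 0 ≤ (1 + 4 * M ^ 2) * (C * (m ^ (-α) * τ ^ (-δ))) := by positivity
        linarith
    _ = _ := by ring

end parameters

theorem exists_small_rpow {r η : ℝ} (hr : 0 < r) (hη : 0 < η) :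
    ∃ c : ℝ, 0 < c ∧ ∀ x, 0 ≤ x → x ≤ c → x ^ r ≤ η :=
  ⟨η ^ (1 / r), by positivity, fun x hx0 hx => by
    calc x ^ r ≤ (η ^ (1 / r)) ^ r := by gcongr
      _ = η := by rw [← Real.rpow_mul hη.le]; field_simp; simp⟩

/-- The shortest block, up to constants, on which `ξ` is a frequency of the critical order; `|ξ| ≤ 1
≤ K` lets the rounding be absorbed in a factor 2. -/
theorem block_length {ξ K : ℝ} (hξ0 : 0 < |ξ|) (hξ1 : |ξ| ≤ 1) (hK : 1 ≤ K) :
    1 ≤ ⌈K / ξ ^ 2⌉₊ ∧ K ≤ ξ ^ 2 * (⌈K / ξ ^ 2⌉₊ : ℕ) ∧ ξ ^ 2 * (⌈K / ξ ^ 2⌉₊ : ℕ) ≤ 2 * K ∧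
      |ξ| * √(⌈K / ξ ^ 2⌉₊ : ℕ) ≤ 2 * K := by
  have hξsq : ξ ^ 2 = |ξ| ^ 2 := (sq_abs ξ).symm
  have hξ2 : 0 < ξ ^ 2 := by rw [hξsq]; positivity
  have hξ21 : ξ ^ 2 ≤ 1 := by rw [hξsq]; exact pow_le_one₀ hξ0.le hξ1
  set ℓ := ⌈K / ξ ^ 2⌉₊ with hℓ
  have hℓ1 : K / ξ ^ 2 ≤ ℓ := Nat.le_ceil _
  have hKξ : 1 ≤ K / ξ ^ 2 := by rw [le_div_iff₀ hξ2]; linarith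
  have hℓ2 : (ℓ : ℝ) ≤ 2 * K / ξ ^ 2 := by
    have := Nat.ceil_lt_add_one (by positivity : 0 ≤ K / ξ ^ 2)
    rw [← hℓ] at this
    have e : 2 * K / ξ ^ 2 = K / ξ ^ 2 + K / ξ ^ 2 := by ring
    rw [e]; linarith
  have hℓ1' : K ≤ ξ ^ 2 * ℓ := by rw [div_le_iff₀ hξ2] at hℓ1; linarith
  have hℓ2' : ξ ^ 2 * ℓ ≤ 2 * K := by rw [le_div_iff₀ hξ2] at hℓ2; linarith
  refine ⟨by exact_mod_cast hKξ.trans hℓ1, hℓ1', hℓ2', ?_⟩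
  have : (|ξ| * √(ℓ : ℝ)) ^ 2 ≤ (2 * K) ^ 2 := by
    rw [mul_pow, Real.sq_sqrt (by positivity), ← hξsq]
    exact hℓ2'.trans (by nlinarith only [hK])
  exact le_of_sq_le_sq this (by positivity)

/-- The choice of the number and the lengths of the windows. -/
theorem window_choice {ξ K κ : ℝ} {m : ℕ} (hκ0 : 0 < κ) (hκ1 : κ ≤ 1) (hK : 1 ≤ K) (hξ0 : 0 < |ξ|)
    (hξ1 : |ξ| ≤ 1) (hτK : 32 * K ≤ |ξ| * √m) :
    ∃ N w G : ℕ, 1 ≤ N ∧ (N : ℝ) ≤ (|ξ| * √m) ^ κ ∧ (|ξ| * √m) ^ κ ≤ 2 * N ∧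
      (m : ℝ) / (16 * N) ≤ G ∧ 1 ≤ G ∧ G + ⌈K / ξ ^ 2⌉₊ + G ≤ w ∧ N * w ≤ m := by
  obtain ⟨hℓpos, -, hℓ2, -⟩ := block_length hξ0 hξ1 hK
  set ℓ := ⌈K / ξ ^ 2⌉₊ with hℓ
  set τ := |ξ| * √(m : ℝ) with hτ
  have hτ1 : 1 ≤ τ := by linarith
  have hξsq : ξ ^ 2 = |ξ| ^ 2 := (sq_abs ξ).symm
  have hξ2 : 0 < ξ ^ 2 := by rw [hξsq]; positivity
  have hξ21 : ξ ^ 2 ≤ 1 := by rw [hξsq]; exact pow_le_one₀ hξ0.le hξ1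
  have hτsq : τ ^ 2 = ξ ^ 2 * m := by
    rw [hτ, mul_pow, Real.sq_sqrt (by positivity), hξsq]
  set N := ⌊τ ^ κ⌋₊ with hN
  have hτκ1 : 1 ≤ τ ^ κ := Real.one_le_rpow hτ1 hκ0.le
  have hN1 : 1 ≤ N := Nat.one_le_floor_iff _ |>.2 hτκ1
  have hN1' : (1 : ℝ) ≤ N := by exact_mod_cast hN1
  have hNτ : (N : ℝ) ≤ τ ^ κ := Nat.floor_le (by positivity)
  have hNτ2 : τ ^ κ ≤ 2 * N := by
    have := Nat.lt_floor_add_one (τ ^ κ); rw [← hN] at this; linarith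
  have hNτ1 : (N : ℝ) ≤ τ := by
    refine hNτ.trans ?_
    calc τ ^ κ ≤ τ ^ (1 : ℝ) := Real.rpow_le_rpow_of_exponent_le hτ1 hκ1
      _ = τ := Real.rpow_one τ
  set w := m / N with hw
  set G := w / 4 with hGdef
  have hmN : τ / ξ ^ 2 ≤ m / N := by
    rw [div_le_div_iff₀ hξ2 (by linarith), mul_comm (m : ℝ), ← hτsq, sq]
    gcongr
  have hτξ : τ ≤ τ / ξ ^ 2 := by
    rw [le_div_iff₀ hξ2]; exact mul_le_of_le_one_right (by linarith) hξ21
  have hwr : (m : ℝ) / N < w + 1 := by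
    rw [div_lt_iff₀ (by linarith)]
    have := Nat.lt_div_mul_add (a := m) (show 0 < N by omega)
    have h2 : (m : ℝ) < (w : ℝ) * N + N := by exact_mod_cast this
    linarith
  have hGr : (w : ℝ) < 4 * G + 4 := by
    have : w < 4 * G + 4 := by omega
    exact_mod_cast this
  have e : (m : ℝ) / (16 * N) = m / N / 16 := by rw [mul_comm, div_div]
  have hG16 : (m : ℝ) / (16 * N) ≤ G := by rw [e]; linarith
  -- The blocks must fit between the gaps: `ℓ ≤ 2K/ξ² ≤ τ/(16 ξ²) ≤ m/(16 N)`. The middle inequality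
  -- is the reason for `32 * K` in the hypothesis.
  have hℓG : ℓ ≤ G := by
    have : (ℓ : ℝ) ≤ G := by
      have h1 : (ℓ : ℝ) ≤ 2 * K / ξ ^ 2 := by rw [le_div_iff₀ hξ2]; linarith
      have h2 : 2 * K / ξ ^ 2 ≤ τ / ξ ^ 2 / 16 := by
        rw [div_right_comm]; gcongr; linarith
      rw [e] at hG16
      linarith
    exact_mod_cast this
  exact ⟨N, w, G, hN1, hNτ, hNτ2, hG16, hℓpos.trans hℓG, by omega, Nat.mul_div_le m N⟩

/-! ### High frequencies: small blocks and the contracting recursion. -/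

namespace Regular

/-- On blocks of length `⌈K / ξ²⌉` the characteristic function is small. -/
theorem norm_cf_block_le {S : Type*} [MeasurableSpace S] {μ : Measure (ℤ → S)}
    [IsProbabilityMeasure μ] {X : ℤ → (ℤ → S) → ℝ} {p q b M s2 v K ξ : ℝ}
    (h : Regular μ X p b M s2) (hq : 2 < q) (hq3 : q ≤ 3) (hqp : q ≤ p) (hbh : 1 / 2 < b)
    (hb1 : b < 1) (hv : 0 < v) (hs2 : v ≤ s2) (hK : 1 ≤ K) (hKv : 8 ≤ K * v) (hξ0 : 0 < |ξ|)
    (hξ1 : |ξ| ≤ 1)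
    (hξc : |ξ| ^ (2 * ((q - 2) / 2)) ≤ 1 / (32 * K *
      (M + (5 * M ^ 3 + 170 * M ^ 3 * (2 * K) ^ 2 / (b - 1 / 2)) * (2 * K)))) :
    ‖cf μ X ⌈K / ξ ^ 2⌉₊ ξ‖ ≤ 1 / 8 := by
  have hM := h.M_pos
  have hβ : 0 < b - 1 / 2 := by linarith
  obtain ⟨hℓpos, hℓ1, hℓ2, hℓs⟩ := block_length hξ0 hξ1 hK
  have hℓ3 : K / ξ ^ 2 ≤ ⌈K / ξ ^ 2⌉₊ := Nat.le_ceil _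
  set ℓ := ⌈K / ξ ^ 2⌉₊ with hℓ
  set Cl := M + (5 * M ^ 3 + 170 * M ^ 3 * (2 * K) ^ 2 / (b - 1 / 2)) * (2 * K) with hCl
  have hCl0 : 0 < Cl := by positivity
  have hξsq : ξ ^ 2 = |ξ| ^ 2 := (sq_abs ξ).symm
  have hξ2 : 0 < ξ ^ 2 := by rw [hξsq]; positivity
  have low := h.norm_cf_sub_low_le hq hq3 hqp hbh hb1 (hv.le.trans hs2) (K := 2 * K)
    (by linarith) hℓpos hℓs
  rw [← hCl] at low
  -- The bound `1/8` is shared equally by the Gaussian factor, small since `K * v ≥ 8`, and the low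
  -- frequency error, small since `|ξ|` is.
  have a1 : Real.exp (-(ξ ^ 2 * (ℓ * s2) / 2)) ≤ 1 / 16 := by
    have : 4 ≤ ξ ^ 2 * (ℓ * s2) / 2 := by
      have : K * v ≤ ξ ^ 2 * ℓ * s2 := mul_le_mul hℓ1 hs2 hv.le (by positivity)
      linarith
    calc Real.exp (-(ξ ^ 2 * (ℓ * s2) / 2)) ≤ Real.exp (-4) := Real.exp_le_exp.2 (by linarith)
      _ ≤ 1 / 16 := by
          rw [Real.exp_neg, ← one_div]
          apply one_div_le_one_div_of_le (by norm_num)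
          have h1 := Real.add_one_le_exp (1 : ℝ)
          calc (16 : ℝ) = 2 ^ 4 := by norm_num
            _ ≤ Real.exp 1 ^ 4 := by gcongr; linarith
            _ = Real.exp 4 := by rw [← Real.exp_nat_mul]; norm_num
  have a2 : (ℓ : ℝ) ^ (-(q - 2) / 2) ≤ |ξ| ^ (2 * ((q - 2) / 2)) := by
    have h1 : (1 / |ξ| ^ 2) ≤ ℓ := by
      rw [← hξsq]; refine le_trans ?_ hℓ3; gcongr
    calc (ℓ : ℝ) ^ (-(q - 2) / 2) ≤ (1 / |ξ| ^ 2) ^ (-(q - 2) / 2) :=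
          Real.rpow_le_rpow_of_nonpos (by positivity) h1 (by linarith)
      _ = |ξ| ^ (2 * ((q - 2) / 2)) := by
          rw [one_div, Real.inv_rpow (by positivity), ← Real.rpow_neg (by positivity),
            ← Real.rpow_two, ← Real.rpow_mul hξ0.le]
          congr 1; ring
  have a3 : Cl * (ξ ^ 2 * ℓ * (ℓ : ℝ) ^ (-(q - 2) / 2)) ≤ 1 / 16 := by
    calc _ ≤ Cl * (2 * K * (1 / (32 * K * Cl))) := by
          gcongr
          exact a2.trans hξc
      _ = 1 / 16 := by field_simp; norm_num
  have a4 : ‖((Real.exp (-(ξ ^ 2 * (ℓ * s2) / 2)) : ℝ) : ℂ)‖ ≤ 1 / 16 := by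
    rw [Complex.norm_real, Real.norm_eq_abs, abs_of_pos (Real.exp_pos _)]; exact a1
  have a5 : cf μ X ℓ ξ = (cf μ X ℓ ξ - ((Real.exp (-(ξ ^ 2 * (ℓ * s2) / 2)) : ℝ) : ℂ)) +
    ((Real.exp (-(ξ ^ 2 * (ℓ * s2) / 2)) : ℝ) : ℂ) := by ring
  rw [a5]
  refine (norm_add_le _ _).trans ?_
  linarith

set_option maxHeartbeats 400000 in
/-- Approximate factorisation over adjacent blocks at high frequencies. -/
theorem exists_norm_cf_add_sub_mul_le {p q b M v : ℝ} (hq : 2 < q) (hq3 : q ≤ 3) (hqp : q ≤ p)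
    (hb : 1 / 2 + (q - 2) / 2 / p < b) (hb1 : b < 1) (hM : 1 ≤ M) (hv : 0 < v) :
    ∃ K0 C c0 δ : ℝ, 1 ≤ K0 ∧ 0 ≤ C ∧ 0 < c0 ∧ c0 ≤ 1 ∧ 0 < δ ∧ δ ≤ 1 ∧
      ∀ (S : Type u) [MeasurableSpace S] (μ : Measure (ℤ → S)) [IsProbabilityMeasure μ]
        (X : ℤ → (ℤ → S) → ℝ) (s2 : ℝ), Regular μ X p b M s2 → v ≤ s2 →
        ∀ (ξ : ℝ) (m m' : ℕ), |ξ| ≤ c0 → K0 ≤ |ξ| * √m →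
          ‖cf μ X (m + m') ξ - cf μ X m ξ * cf μ X m' ξ‖ ≤
            C * ((m : ℝ) ^ (-((q - 2) / 2)) * (|ξ| * √m) ^ (-δ)) := by
  have hp : 2 < p := by linarith
  have hp0 : 0 < p := by linarith
  set α := (q - 2) / 2 with hα
  have hα0 : 0 < α := by rw [hα]; linarith
  have hα2 : α ≤ 1 / 2 := by rw [hα]; linarith
  have hbh : 1 / 2 < b := by have : 0 < α / p := by positivity
                             linarith
  have e1pos : 0 < 2 * (b - α) := by linarith
  have e2pos : 0 < 2 * p * b - p - 2 * α := by
    have := mul_lt_mul_of_pos_left hb hp0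
    have e : p * (1 / 2 + α / p) = p / 2 + α := by field_simp
    rw [e] at this; linarith
  -- The slack available in the linear and in the power error. With `κ = e / (8 + p)` and `δ = e /
  -- 2`, both `3κ + δ` and `κ (1 + p/2) + δ` stay below `e`.
  set e := min (min (2 * (b - α)) (2 * p * b - p - 2 * α)) 1 with he
  have he0 : 0 < e := lt_min (lt_min e1pos e2pos) one_pos
  have he1 : e ≤ 2 * (b - α) := (min_le_left _ _).trans (min_le_left _ _)
  have he2 : e ≤ 2 * p * b - p - 2 * α := (min_le_left _ _).trans (min_le_right _ _)
  have he3 : e ≤ 1 := min_le_right _ _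
  set κ := e / (8 + p) with hκ
  set δ := e / 2 with hδ
  have hκ0 : 0 < κ := by positivity
  have hκe : κ * (8 + p) = e := by rw [hκ]; field_simp
  have hκ1 : κ ≤ 1 := by nlinarith only [hκe, he3, hκ0, hp]
  have k1 : 3 * κ + δ ≤ 2 * (b - α) := by
    rw [hδ]; nlinarith only [hκe, he1, hκ0, hp]
  have k2 : κ * (1 + p / 2) + δ ≤ 2 * p * b - p - 2 * α := by
    rw [hδ]; nlinarith only [hκe, he2, hκ0, hp]
  set K := max 1 (8 / v) with hK
  have hK1 : 1 ≤ K := le_max_left _ _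
  have hKv : 8 ≤ K * v := by
    have : 8 / v ≤ K := le_max_right _ _
    rwa [div_le_iff₀ hv] at this
  set Cl := M + (5 * M ^ 3 + 170 * M ^ 3 * (2 * K) ^ 2 / (b - 1 / 2)) * (2 * K) with hCl
  have hβ : 0 < b - 1 / 2 := by linarith
  have hCl0 : 0 < Cl := by positivity
  obtain ⟨c1, hc1, hc1'⟩ := exists_small_rpow (r := 2 * α) (η := 1 / (32 * K * Cl))
    (by linarith) (by positivity)
  obtain ⟨Cs, hCs0, hCs⟩ := exists_rpow_le_mul_sqrt_two_pow ((1 + δ) / κ)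
  refine ⟨32 * K, 160 * M * K + (1 + 4 * M ^ 2) * Cs + 2 * (160 * M) ^ p,
    min (min 1 (1 / (8 * M))) c1, δ, by linarith, by positivity, by positivity,
    (min_le_left _ _).trans (min_le_left _ _), by positivity, by rw [hδ]; linarith, ?_⟩
  intro S _ μ _ X s2 h hs2 ξ m m' hξ hτK
  have hξ1 : |ξ| ≤ 1 := hξ.trans ((min_le_left _ _).trans (min_le_left _ _))
  have hξM : |ξ| * (2 * M) ≤ 1 / 4 := by
    have : |ξ| ≤ 1 / (8 * M) := hξ.trans ((min_le_left _ _).trans (min_le_right _ _))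
    rw [le_div_iff₀ (by positivity)] at this; linarith
  have hξc : |ξ| ≤ c1 := hξ.trans (min_le_right _ _)
  set τ := |ξ| * √(m : ℝ) with hτ
  have hτ1 : 1 ≤ τ := by linarith
  have hτ0 : 0 < τ := by linarith
  have hξ0 : 0 < |ξ| := by
    rcases (abs_nonneg ξ).eq_or_lt with h0 | h0
    · rw [← h0, zero_mul] at hτ; linarith
    · exact h0
  have hξsq : ξ ^ 2 = |ξ| ^ 2 := (sq_abs ξ).symm
  have hξ2 : 0 < ξ ^ 2 := by rw [hξsq]; positivity
  have hξ21 : ξ ^ 2 ≤ 1 := by rw [hξsq]; exact pow_le_one₀ hξ0.le hξ1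
  have hτsq : τ ^ 2 = ξ ^ 2 * m := by
    rw [hτ, mul_pow, Real.sq_sqrt (by positivity), hξsq]
  have hm0 : (0 : ℝ) ≤ m := by positivity
  have hτm : τ ^ 2 ≤ m := by rw [hτsq]; exact mul_le_of_le_one_left hm0 hξ21
  have hm1 : (1 : ℝ) ≤ m := (one_le_pow₀ hτ1).trans hτm
  obtain ⟨hℓpos, hℓ1, hℓ2, hℓs⟩ := block_length hξ0 hξ1 hK1
  have hφ : ‖cf μ X ⌈K / ξ ^ 2⌉₊ ξ‖ ≤ 1 / 8 :=
    h.norm_cf_block_le hq hq3 hqp hbh hb1 hv hs2 hK1 hKv hξ0 hξ1 (hc1' _ hξ0.le hξc)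
  obtain ⟨N, w, G, hN1, hNτ, hNτ2, hG16, hG1, hww, hNw⟩ :=
    window_choice hκ0 hκ1 hK1 hξ0 hξ1 hτK
  rw [← hτ] at hNτ hNτ2
  have hN1' : (1 : ℝ) ≤ N := by exact_mod_cast hN1
  have main := h.norm_cf_add_sub_mul_le_of_windows hp hG1 hww hNw (m' := m') hφ hξM
  have b1 := window_error_linear_le (ξ := ξ) (δ := δ) (κ := κ) (α := α) (b := b) (M := M) (K := K)
    (ℓ := (⌈K / ξ ^ 2⌉₊ : ℕ)) hτ1 hτm hN1' hNτ hG16 (by linarith) hb1.le (by linarith) (by linarith)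
    hℓs (by linarith) k1
  have b2 := window_error_exp_le (ξ := ξ) (δ := δ) (κ := κ) (α := α) (M := M) (C := Cs) hκ0
    (by positivity) hτ1 hm1 hNτ2 (hCs N hN1) hτ hα2
  have b3 := window_error_power_le (ξ := ξ) (δ := δ) (κ := κ) (α := α) (b := b) (M := M) hp0 hτ1
    hτm hN1' hNτ hG16 hbh.le hb1.le (by linarith) hτ (by nlinarith only [hα2, hp, hbh]) k2
  refine main.trans ((add_le_add (add_le_add b1 b2) b3).trans_eq ?_)
  ring

set_option maxHeartbeats 400000 in
/-- Closeness to the Gaussian characteristic function at high frequencies. -/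
theorem exists_norm_cf_sub_high_le {p q b M v : ℝ} (hq : 2 < q) (hq3 : q ≤ 3) (hqp : q ≤ p)
    (hb : 1 / 2 + (q - 2) / 2 / p < b) (hb1 : b < 1) (hM : 1 ≤ M) (hv : 0 < v) :
    ∃ K0 C c0 δ : ℝ, 1 ≤ K0 ∧ 0 ≤ C ∧ 0 < c0 ∧ c0 ≤ 1 ∧ 0 < δ ∧ δ ≤ 1 ∧
      ∀ (S : Type u) [MeasurableSpace S] (μ : Measure (ℤ → S)) [IsProbabilityMeasure μ]
        (X : ℤ → (ℤ → S) → ℝ) (s2 : ℝ), Regular μ X p b M s2 → v ≤ s2 →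
        ∀ (ξ : ℝ) (n : ℕ), |ξ| ≤ c0 → K0 ≤ |ξ| * √n →
          ‖cf μ X n ξ - (Real.exp (-(ξ ^ 2 * (n * s2) / 2)) : ℝ)‖ ≤
            C * ((n : ℝ) ^ (-((q - 2) / 2)) * (|ξ| * √n) ^ (-δ)) := by
  obtain ⟨K1, C, c1, δ, hK1, hC, hc1, hc11, hδ, hδ1, H⟩ :=
    exists_norm_cf_add_sub_mul_le.{u} hq hq3 hqp hb hb1 hM hv
  have hp : 2 < p := by linarith
  have hp0 : 0 < p := by linarith
  set α := (q - 2) / 2 with hα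
  have hα0 : 0 < α := by rw [hα]; linarith
  have hα2 : α ≤ 1 / 2 := by rw [hα]; linarith
  have hbh : 1 / 2 < b := by have : 0 < α / p := by positivity
                             linarith
  have hβ : 0 < b - 1 / 2 := by linarith
  set K0 := max K1 (96 / v + 1) with hK0
  have hK01 : 1 ≤ K0 := hK1.trans (le_max_left _ _)
  have hK0v : 48 ≤ K0 ^ 2 * v / 2 := by
    have h1 : 96 / v ≤ K0 := by
      have : 96 / v + 1 ≤ K0 := le_max_right _ _
      linarith
    have h2 : K0 ≤ K0 ^ 2 := by nlinarith only [hK01]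
    have h3 : 96 ≤ K0 * v := by rwa [div_le_iff₀ hv] at h1
    nlinarith only [h2, h3, hv]
  set Cl := M + (5 * M ^ 3 + 170 * M ^ 3 * (2 * K0) ^ 2 / (b - 1 / 2)) * (2 * K0) with hCl
  have hCl0 : 0 < Cl := by positivity
  -- The last term covers the base range `τ ≤ 2 K0`; `12 * C` makes the factorisation error at most
  -- half of the bound in the inductive step; the 1 gives positivity.
  set C1 := 1 + 12 * C + 8 * K0 ^ 3 * Cl with hC1
  have hC10 : 0 < C1 := by positivity
  obtain ⟨c2, hc2, hc2'⟩ := exists_small_rpow (r := 2 * α) (η := 1 / (24 * C1))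
    (by linarith) (by positivity)
  refine ⟨K0, C1, min c1 c2, δ, hK01, hC10.le, lt_min hc1 hc2, (min_le_left _ _).trans hc11, hδ,
    hδ1, ?_⟩
  intro S _ μ _ X s2 h hs2 ξ n hξ
  have hξ1 : |ξ| ≤ 1 := hξ.trans ((min_le_left _ _).trans hc11)
  have hξc1 : |ξ| ≤ c1 := hξ.trans (min_le_left _ _)
  have hξc2 : |ξ| ≤ c2 := hξ.trans (min_le_right _ _)
  have hs0 : 0 < s2 := hv.trans_le hs2
  induction n using Nat.strong_induction_on with
  | _ n ih =>
  intro hτK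
  set τ := |ξ| * √(n : ℝ) with hτ
  have hτ1 : 1 ≤ τ := hK01.trans hτK
  have hτ0 : 0 < τ := by linarith
  have hξ0 : 0 < |ξ| := by
    rcases (abs_nonneg ξ).eq_or_lt with h0 | h0
    · rw [← h0, zero_mul] at hτ; linarith
    · exact h0
  have hξsq : ξ ^ 2 = |ξ| ^ 2 := (sq_abs ξ).symm
  have hτsq : τ ^ 2 = ξ ^ 2 * n := by
    rw [hτ, mul_pow, Real.sq_sqrt (by positivity), hξsq]
  have hn0 : (0 : ℝ) < n := by
    rcases Nat.eq_zero_or_pos n with h0 | h0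
    · rw [h0] at hτ; simp at hτ; linarith
    · exact_mod_cast h0
  have hn1 : 1 ≤ n := by exact_mod_cast hn0
  set Z := (n : ℝ) ^ (-α) * τ ^ (-δ) with hZ
  have hZ0 : 0 < Z := by positivity
  -- Up to `2 K0` the low frequency estimate applies. Beyond it both halves still satisfy `|ξ| √k ≥
  -- τ / 2 ≥ K0`, so the induction hypothesis is available for them.
  rcases le_or_gt τ (2 * K0) with hτ2 | hτ2
  · have low := h.norm_cf_sub_low_le hq hq3 hqp hbh hb1 hs0.le (K := 2 * K0) (by linarith) hn1 hτ2
    rw [← hCl, ← hτsq] at low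
    refine low.trans ?_
    have h1 : τ ^ 2 ≤ (2 * K0) ^ 2 := by gcongr
    have h2 : 1 ≤ 2 * K0 * τ ^ (-δ) := by
      have : (2 * K0)⁻¹ ≤ τ ^ (-δ) := by
        calc (2 * K0)⁻¹ = (2 * K0) ^ (-1 : ℝ) := (Real.rpow_neg_one _).symm
          _ ≤ (2 * K0) ^ (-δ) := Real.rpow_le_rpow_of_exponent_le (by linarith) (by linarith)
          _ ≤ τ ^ (-δ) := Real.rpow_le_rpow_of_nonpos hτ0 hτ2 (by linarith)
      calc (1 : ℝ) = 2 * K0 * (2 * K0)⁻¹ := by field_simp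
        _ ≤ _ := by gcongr
    have e : -(q - 2) / 2 = -α := by rw [hα]; ring
    rw [e]
    calc Cl * (τ ^ 2 * (n : ℝ) ^ (-α)) ≤ Cl * ((2 * K0) ^ 2 * (n : ℝ) ^ (-α)) * 1 := by
          rw [mul_one]; gcongr
      _ ≤ Cl * ((2 * K0) ^ 2 * (n : ℝ) ^ (-α)) * (2 * K0 * τ ^ (-δ)) := by gcongr
      _ = 8 * K0 ^ 3 * Cl * Z := by rw [hZ]; ring
      _ ≤ C1 * Z := by
          gcongr
          rw [hC1]; linarith
  -- split the block
  have hn4 : 4 < n := by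
    have h1 : (2 : ℝ) < τ := by linarith
    have h2 : τ ^ 2 ≤ n := by 
      rw [hτsq]; exact mul_le_of_le_one_left hn0.le (by rw [hξsq]; exact pow_le_one₀ hξ0.le hξ1)
    have : (4 : ℝ) < n := by nlinarith only [h1, h2]
    exact_mod_cast this
  set m := n / 2 with hm
  set m' := n - m with hm'
  have hnm : n = m + m' := by omega
  -- Passing from `n` to a half costs `3^α ≤ 3` in the length and `2^δ ≤ 2` in the frequency, hence
  -- the factor 6. It is beaten by the smallness of the other half: `6 (1/24 + 1/48 + 1/48) = 1/2`.
  have hbnd : ∀ k : ℕ, m ≤ k → k < n → K0 ≤ |ξ| * √(k : ℝ) ∧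
      (k : ℝ) ^ (-α) * (|ξ| * √(k : ℝ)) ^ (-δ) ≤ 6 * Z ∧
      Real.exp (-(ξ ^ 2 * (k * s2) / 2)) ≤ 1 / 48 ∧
      ‖cf μ X k ξ - (Real.exp (-(ξ ^ 2 * (k * s2) / 2)) : ℝ)‖ ≤ C1 * (6 * Z) ∧
      ‖cf μ X k ξ - (Real.exp (-(ξ ^ 2 * (k * s2) / 2)) : ℝ)‖ ≤ 1 / 24 := by
    intro k hk hkn
    have hk3 : (n : ℝ) / 3 ≤ k := by
      have : n ≤ 3 * k := by omega
      have : (n : ℝ) ≤ 3 * k := by exact_mod_cast this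
      linarith
    have hk0 : (0 : ℝ) < k := by linarith
    have hτk : τ / 2 ≤ |ξ| * √(k : ℝ) := by
      have : √(n : ℝ) / 2 ≤ √(k : ℝ) := by
        apply Real.le_sqrt_of_sq_le
        rw [div_pow, Real.sq_sqrt hn0.le]; linarith
      rw [hτ, mul_div_assoc]; gcongr
    have hKk : K0 ≤ |ξ| * √(k : ℝ) := by linarith
    have a1 : (k : ℝ) ^ (-α) * (|ξ| * √(k : ℝ)) ^ (-δ) ≤ 6 * Z := by
      have b1 : (k : ℝ) ^ (-α) ≤ 3 * (n : ℝ) ^ (-α) := by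
        calc (k : ℝ) ^ (-α) ≤ ((n : ℝ) / 3) ^ (-α) :=
              Real.rpow_le_rpow_of_nonpos (by positivity) hk3 (by linarith)
          _ = 3 ^ α * (n : ℝ) ^ (-α) := by
              rw [Real.div_rpow hn0.le (by norm_num), Real.rpow_neg (by norm_num : (0 : ℝ) ≤ 3)]
              field_simp
          _ ≤ 3 ^ (1 : ℝ) * (n : ℝ) ^ (-α) := by
              gcongr
              · norm_num
              · linarith
          _ = _ := by rw [Real.rpow_one]
      have b2 : (|ξ| * √(k : ℝ)) ^ (-δ) ≤ 2 * τ ^ (-δ) := by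
        calc (|ξ| * √(k : ℝ)) ^ (-δ) ≤ (τ / 2) ^ (-δ) :=
              Real.rpow_le_rpow_of_nonpos (by positivity) hτk (by linarith)
          _ = 2 ^ δ * τ ^ (-δ) := by
              rw [Real.div_rpow hτ0.le (by norm_num), Real.rpow_neg (by norm_num : (0 : ℝ) ≤ 2)]
              field_simp
          _ ≤ 2 ^ (1 : ℝ) * τ ^ (-δ) := by
              gcongr
              norm_num
          _ = _ := by rw [Real.rpow_one]
      calc _ ≤ 3 * (n : ℝ) ^ (-α) * (2 * τ ^ (-δ)) := by gcongr
        _ = _ := by rw [hZ]; ring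
    have hsq : (|ξ| * √(k : ℝ)) ^ 2 = ξ ^ 2 * k := by
      rw [mul_pow, Real.sq_sqrt hk0.le, hξsq]
    have hKk2 : K0 ^ 2 ≤ ξ ^ 2 * k := by rw [← hsq]; gcongr
    have a2 : Real.exp (-(ξ ^ 2 * (k * s2) / 2)) ≤ 1 / 48 := by
      have h1 : 48 ≤ ξ ^ 2 * (k * s2) / 2 := by
        have : K0 ^ 2 * v ≤ ξ ^ 2 * k * s2 := mul_le_mul hKk2 hs2 hv.le (by positivity)
        linarith
      rw [Real.exp_neg, ← one_div]
      apply one_div_le_one_div_of_le (by norm_num)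
      linarith [Real.add_one_le_exp (ξ ^ 2 * (k * s2) / 2)]
    have a3 := ih k hkn hKk
    refine ⟨hKk, a1, a2, a3.trans (by gcongr), a3.trans ?_⟩
    have b1 : (k : ℝ) ^ (-α) ≤ 1 / (24 * C1) := by
      refine le_trans ?_ (hc2' _ hξ0.le hξc2)
      have h1 : (1 / |ξ| ^ 2) ≤ k := by
        rw [div_le_iff₀ (by positivity), ← hξsq]
        have : 1 ≤ K0 ^ 2 := one_le_pow₀ hK01
        linarith
      calc (k : ℝ) ^ (-α) ≤ (1 / |ξ| ^ 2) ^ (-α) :=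
            Real.rpow_le_rpow_of_nonpos (by positivity) h1 (by linarith)
        _ = |ξ| ^ (2 * α) := by
            rw [one_div, Real.inv_rpow (by positivity), ← Real.rpow_neg (by positivity),
              ← Real.rpow_two, ← Real.rpow_mul hξ0.le]
            congr 1; ring
    have b2 : (|ξ| * √(k : ℝ)) ^ (-δ) ≤ 1 :=
      Real.rpow_le_one_of_one_le_of_nonpos (hK01.trans hKk) (by linarith)
    calc C1 * ((k : ℝ) ^ (-α) * (|ξ| * √(k : ℝ)) ^ (-δ)) ≤ C1 * (1 / (24 * C1) * 1) := by gcongr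
      _ = 1 / 24 := by field_simp
  obtain ⟨m1, m2, m3, m4, m5⟩ := hbnd m le_rfl (by omega)
  obtain ⟨n1, n2, n3, n4, n5⟩ := hbnd m' (by omega) (by omega)
  have Hm := H S μ X s2 h hs2 ξ m m' hξc1 ((le_max_left _ _).trans m1)
  have Hm2 : ‖cf μ X (m + m') ξ - cf μ X m ξ * cf μ X m' ξ‖ ≤ C * (6 * Z) :=
    Hm.trans (by gcongr)
  have hexp : Real.exp (-(ξ ^ 2 * (n * s2) / 2)) =
      Real.exp (-(ξ ^ 2 * (m * s2) / 2)) * Real.exp (-(ξ ^ 2 * (m' * s2) / 2)) := by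
    rw [← Real.exp_add]; congr 1
    have : (n : ℝ) = m + m' := by exact_mod_cast hnm
    rw [this]; ring
  set gm := Real.exp (-(ξ ^ 2 * (m * s2) / 2)) with hgm
  set gm' := Real.exp (-(ξ ^ 2 * (m' * s2) / 2)) with hgm'
  have key : cf μ X n ξ - (Real.exp (-(ξ ^ 2 * (n * s2) / 2)) : ℝ) =
      (cf μ X (m + m') ξ - cf μ X m ξ * cf μ X m' ξ) +
      ((cf μ X m ξ - gm) * (cf μ X m' ξ - gm') + (cf μ X m ξ - gm) * gm' +
        gm * (cf μ X m' ξ - gm')) := by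
    rw [hexp, ← hnm]; push_cast; ring
  rw [key]
  have ngm : ‖(gm : ℂ)‖ ≤ 1 / 48 := by
    rw [Complex.norm_real, Real.norm_eq_abs, abs_of_pos (Real.exp_pos _)]; exact m3
  have ngm' : ‖(gm' : ℂ)‖ ≤ 1 / 48 := by
    rw [Complex.norm_real, Real.norm_eq_abs, abs_of_pos (Real.exp_pos _)]; exact n3
  have t1 : ‖(cf μ X m ξ - gm) * (cf μ X m' ξ - gm')‖ ≤ C1 * (6 * Z) * (1 / 24) := by
    rw [norm_mul]; gcongr
  have t2 : ‖(cf μ X m ξ - gm) * gm'‖ ≤ C1 * (6 * Z) * (1 / 48) := by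
    rw [norm_mul]; gcongr
  have t3 : ‖gm * (cf μ X m' ξ - gm')‖ ≤ 1 / 48 * (C1 * (6 * Z)) := by
    rw [norm_mul]; gcongr
  refine (norm_add_le _ _).trans ((add_le_add Hm2 ((norm_add_le _ _).trans (add_le_add
    ((norm_add_le _ _).trans (add_le_add t1 t2)) t3))).trans ?_)
  have hCC : 6 * C ≤ C1 / 2 := by
    have : 0 ≤ 8 * K0 ^ 3 * Cl := by positivity
    rw [hC1]; linarith
  have := mul_le_mul_of_nonneg_right hCC hZ0.le
  linarith

end Regular

end

/-! ### The Fejér kernel. -/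

section

/-- The (unnormalised) Fejér kernel. -/
def fejer (y : ℝ) : ℝ := 2 * ∫ t in (0 : ℝ)..1, (1 - t) * Real.cos (t * y)

theorem fejer_eq {y : ℝ} (hy : y ≠ 0) : fejer y = 2 * (1 - Real.cos y) / y ^ 2 := by
  have h : ∀ t ∈ Set.uIcc (0 : ℝ) 1, HasDerivAt
      (fun t => (1 - t) * (Real.sin (t * y) / y) - Real.cos (t * y) / y ^ 2)
      ((1 - t) * Real.cos (t * y)) t := by
    intro t _
    have h1 : HasDerivAt (fun t : ℝ => t * y) y t := by
      simpa using (hasDerivAt_id t).mul_const y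
    have h2 := ((hasDerivAt_const t (1 : ℝ)).sub (hasDerivAt_id t)).mul (h1.sin.div_const y)
    have h3 := h2.sub (h1.cos.div_const (y ^ 2))
    refine h3.congr_deriv ?_
    simp only [Pi.sub_apply, id]
    field_simp
    ring
  unfold fejer
  rw [intervalIntegral.integral_eq_sub_of_hasDerivAt h
    (Continuous.intervalIntegrable (by fun_prop) _ _)]
  field_simp
  simp
  ring

theorem abs_fejer_le_two (y : ℝ) : |fejer y| ≤ 2 := by
  unfold fejer
  rw [abs_mul, abs_of_pos (by norm_num : (0 : ℝ) < 2)]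
  have := intervalIntegral.norm_integral_le_of_norm_le_const (a := (0 : ℝ)) (b := 1) (C := 1)
    (f := fun t => (1 - t) * Real.cos (t * y)) (fun t ht => by
      rw [Set.uIoc_of_le zero_le_one] at ht
      rw [norm_mul, Real.norm_eq_abs, Real.norm_eq_abs, abs_of_nonneg (by linarith [ht.2])]
      have := Real.abs_cos_le_one (t * y)
      have := ht.1
      nlinarith [abs_nonneg (Real.cos (t * y)), ht.2])
  rw [Real.norm_eq_abs] at this
  simp at this
  linarith

theorem fejer_zero : fejer 0 = 1 := by
  unfold fejer
  simp only [mul_zero, Real.cos_zero, mul_one]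
  rw [intervalIntegral.integral_sub (by simp) (by simp)]
  simp
  norm_num

theorem fejer_nonneg (y : ℝ) : 0 ≤ fejer y := by
  by_cases hy : y = 0
  · rw [hy, fejer_zero]; norm_num
  · rw [fejer_eq hy]
    have := Real.cos_le_one y
    have : 0 ≤ 1 - Real.cos y := by linarith
    positivity

theorem fejer_mul_sq_le (y : ℝ) : fejer y * y ^ 2 ≤ 4 := by
  by_cases hy : y = 0
  · rw [hy]; norm_num
  · rw [fejer_eq hy, div_mul_cancel₀ _ (by positivity)]
    linarith [Real.neg_one_le_cos y]

theorem measurable_fejer : Measurable fejer := by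
  unfold fejer
  simp only [intervalIntegral.integral_of_le zero_le_one]
  refine measurable_const.mul (StronglyMeasurable.measurable ?_)
  exact StronglyMeasurable.integral_prod_right'
    (f := fun z : ℝ × ℝ => (1 - z.2) * Real.cos (z.2 * z.1))
    (Continuous.stronglyMeasurable (by fun_prop))

theorem integrable_fejer : Integrable fejer := by
  refine (integrable_inv_one_add_sq.const_mul 6).mono' measurable_fejer.aestronglyMeasurable
    (ae_of_all _ fun y => ?_)
  rw [Real.norm_eq_abs, abs_of_nonneg (fejer_nonneg y), ← div_eq_mul_inv,
    le_div_iff₀ (by positivity)]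
  have h1 := fejer_mul_sq_le y
  have h2 := (le_abs_self _).trans (abs_fejer_le_two y)
  linarith

/-- The mass of the kernel. -/
def fejerMass : ℝ := ∫ y, fejer y

/-- Only the positivity of the mass matters; its value just enters the final constant. -/
theorem fejerMass_pos : 0 < fejerMass := by
  unfold fejerMass
  rw [integral_pos_iff_support_of_nonneg fejer_nonneg integrable_fejer]
  refine lt_of_lt_of_le (b := volume (Set.Ioo (0 : ℝ) 1)) (by simp) (measure_mono ?_)
  intro y hy
  rw [Function.mem_support, fejer_eq hy.1.ne']
  have h1 : Real.cos y < 1 := by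
    have := Real.cos_lt_cos_of_nonneg_of_le_pi le_rfl (by linarith [Real.pi_gt_three, hy.2]) hy.1
    rwa [Real.cos_zero] at this
  have h2 : 0 < 1 - Real.cos y := by linarith
  have := hy.1
  positivity

theorem integral_fejer_comp_mul {T : ℝ} (hT : 0 < T) (x : ℝ) :
    Integrable (fun z => fejer (T * (x - z))) ∧ ∫ z, fejer (T * (x - z)) = fejerMass / T := by
  constructor
  · exact ((integrable_fejer.comp_mul_left' hT.ne').comp_sub_left x)
  · rw [integral_sub_left_eq_self (fun z => fejer (T * z)) volume x,
      Measure.integral_comp_mul_left]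
    rw [abs_of_pos (by positivity), smul_eq_mul, fejerMass, div_eq_inv_mul]

theorem integral_fejer_tail_le {T r : ℝ} (hT : 0 < T) (hr : 0 < r) (x : ℝ) :
    Integrable (fun z => fejer (T * (x - z)) * (Set.indicator {w : ℝ | r ≤ |w|} 1 (x - z))) ∧
      ∫ z, fejer (T * (x - z)) * (Set.indicator {w : ℝ | r ≤ |w|} 1 (x - z)) ≤ 8 / (T ^ 2 * r) := by
  have hms : MeasurableSet {w : ℝ | r ≤ |w|} := measurableSet_le (by fun_prop) (by fun_prop)
  have hi0 : Integrable (fun w => fejer (T * w) * (Set.indicator {w : ℝ | r ≤ |w|} 1 w)) := by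
    have e : (fun w => fejer (T * w) * (Set.indicator {w : ℝ | r ≤ |w|} 1 w)) =
        Set.indicator {w : ℝ | r ≤ |w|} fun w => fejer (T * w) := by
      funext w
      by_cases hw : w ∈ {w : ℝ | r ≤ |w|} <;> simp [hw]
    rw [e]
    exact (integrable_fejer.comp_mul_left' hT.ne').indicator hms
  refine ⟨hi0.comp_sub_left x, ?_⟩
  rw [integral_sub_left_eq_self (fun w => fejer (T * w) * (Set.indicator {w : ℝ | r ≤ |w|} 1 w))
    volume x]
  -- compare with `4 / (T w)^2` on both half-lines
  have hpos : ∫ w in Set.Ioi r, w ^ (-2 : ℝ) = 1 / r := by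
    rw [integral_Ioi_rpow_of_lt (by norm_num) hr]
    norm_num
    rw [Real.rpow_neg_one]
  have ipos : IntegrableOn (fun w : ℝ => w ^ (-2 : ℝ)) (Set.Ioi r) :=
    integrableOn_Ioi_rpow_of_lt (by norm_num) hr
  set g : ℝ → ℝ := Set.indicator (Set.Ici r) fun w => w ^ (-2 : ℝ) with hg
  have ig : Integrable g := by
    rw [hg, integrable_indicator_iff measurableSet_Ici]
    rwa [integrableOn_Ici_iff_integrableOn_Ioi]
  have bg : ∫ w, g w = 1 / r := by
    rw [hg, integral_indicator measurableSet_Ici, integral_Ici_eq_integral_Ioi, hpos]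
  have ign : Integrable fun w => g (-w) := ig.comp_neg
  have bgn : ∫ w, g (-w) = 1 / r := by rw [integral_neg_eq_self, bg]
  calc ∫ w, fejer (T * w) * (Set.indicator {w : ℝ | r ≤ |w|} 1 w)
      ≤ ∫ w, (4 / T ^ 2 * g w + 4 / T ^ 2 * g (-w)) := by
        refine integral_mono hi0 ((ig.const_mul _).add (ign.const_mul _)) fun w => ?_
        have hg0 : ∀ w, 0 ≤ g w := fun w => Set.indicator_nonneg (fun w hw => by
          have : (0 : ℝ) ≤ w := hr.le.trans hw
          positivity) w
        by_cases hw : r ≤ |w|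
        · have hw0 : 0 < |w| := hr.trans_le hw
          have e1 : Set.indicator {w : ℝ | r ≤ |w|} (1 : ℝ → ℝ) w = 1 := by
            rw [Set.indicator_of_mem (show w ∈ {w : ℝ | r ≤ |w|} from hw)]; rfl
          have e2 : |w| ^ (-2 : ℝ) ≤ g w + g (-w) := by
            rcases le_total 0 w with h0 | h0
            · rw [abs_of_nonneg h0] at hw ⊢
              have : g w = w ^ (-2 : ℝ) := Set.indicator_of_mem (Set.mem_Ici.2 hw) _
              linarith [hg0 (-w)]
            · rw [abs_of_nonpos h0] at hw ⊢
              have : g (-w) = (-w) ^ (-2 : ℝ) := Set.indicator_of_mem (Set.mem_Ici.2 hw) _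
              linarith [hg0 w]
          have e3 : fejer (T * w) ≤ 4 / T ^ 2 * |w| ^ (-2 : ℝ) := by
            have h1 := fejer_mul_sq_le (T * w)
            have h2 : |w| ^ (-2 : ℝ) = (w ^ 2)⁻¹ := by
              rw [Real.rpow_neg (abs_nonneg _), Real.rpow_two, sq_abs]
            have hw2 : 0 < w ^ 2 := by rw [← sq_abs]; positivity
            rw [h2, ← div_eq_mul_inv, div_div, le_div_iff₀ (by positivity)]
            rwa [mul_pow] at h1
          simp only [e1, mul_one]
          calc fejer (T * w) ≤ 4 / T ^ 2 * |w| ^ (-2 : ℝ) := e3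
            _ ≤ 4 / T ^ 2 * (g w + g (-w)) := by gcongr
            _ = _ := by ring
        · have e1 : Set.indicator {w : ℝ | r ≤ |w|} (1 : ℝ → ℝ) w = 0 :=
            Set.indicator_of_notMem (show w ∉ {w : ℝ | r ≤ |w|} from hw) _
          simp only [e1, mul_zero]
          have := hg0 w; have := hg0 (-w)
          positivity
    _ = 8 / (T ^ 2 * r) := by
        rw [integral_add (ig.const_mul _) (ign.const_mul _), integral_const_mul,
          integral_const_mul, bg, bgn]
        field_simp
        norm_num

/-- Lower bound for the smoothed function near a point where it is large on an interval. -/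
theorem le_integral_mul_fejer {f : ℝ → ℝ} {D T r x : ℝ} (hf : Measurable f) (hD : 0 ≤ D)
    (hfD : ∀ z, |f z| ≤ D) (hT : 0 < T) (hr : 0 < r) (hx : ∀ z, |x - z| < r → D / 2 ≤ f z) :
    D / 2 * (fejerMass / T) - 3 / 2 * D * (8 / (T ^ 2 * r)) ≤ ∫ z, f z * fejer (T * (x - z)) := by
  obtain ⟨i1, e1⟩ := integral_fejer_comp_mul hT x
  obtain ⟨i2, e2⟩ := integral_fejer_tail_le hT hr x
  have i3 : Integrable fun z => f z * fejer (T * (x - z)) :=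
    i1.bdd_mul (c := D) hf.aestronglyMeasurable (ae_of_all _ fun z => hfD z)
  calc D / 2 * (fejerMass / T) - 3 / 2 * D * (8 / (T ^ 2 * r))
      ≤ D / 2 * (fejerMass / T) - 3 / 2 * D *
        ∫ z, fejer (T * (x - z)) * (Set.indicator {w : ℝ | r ≤ |w|} 1 (x - z)) := by gcongr
    _ = ∫ z, (D / 2 * fejer (T * (x - z)) - 3 / 2 * D *
        (fejer (T * (x - z)) * (Set.indicator {w : ℝ | r ≤ |w|} 1 (x - z)))) := by
        rw [integral_sub (i1.const_mul _) (i2.const_mul _), integral_const_mul,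
          integral_const_mul, e1]
    _ ≤ _ := by
        refine integral_mono ((i1.const_mul _).sub (i2.const_mul _)) i3 fun z => ?_
        have hk := fejer_nonneg (T * (x - z))
        by_cases hz : |x - z| < r
        · have e : Set.indicator {w : ℝ | r ≤ |w|} (1 : ℝ → ℝ) (x - z) = 0 :=
            Set.indicator_of_notMem (show x - z ∉ {w : ℝ | r ≤ |w|} from not_le.2 hz) _
          simp only [e, mul_zero, sub_zero]
          exact mul_le_mul_of_nonneg_right (hx z hz) hk
        · have e : Set.indicator {w : ℝ | r ≤ |w|} (1 : ℝ → ℝ) (x - z) = 1 := by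
            rw [Set.indicator_of_mem (show x - z ∈ {w : ℝ | r ≤ |w|} from not_lt.1 hz)]; rfl
          simp only [e, mul_one]
          have := (abs_le.1 (hfD z)).1
          nlinarith

/-! ### Esseen's smoothing inequality. -/

section cdfs

/-- `1_{u < y} - 1_{0 < y}`. -/
def stepDiff (u y : ℝ) : ℝ :=
  (Set.Ioc u 0).indicator 1 y - (Set.Ioc 0 u).indicator 1 y

theorem stepDiff_eq (u y : ℝ) :
    stepDiff u y = (Set.Ioi u).indicator 1 y - (Set.Ioi 0).indicator (1 : ℝ → ℝ) y := by
  unfold stepDiff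
  simp only [Set.indicator_apply, Set.mem_Ioc, Set.mem_Ioi, Pi.one_apply]
  by_cases h1 : u < y <;> by_cases h2 : 0 < y <;> simp [h1, h2, not_le.2, not_lt.1]

theorem measurable_stepDiff : Measurable fun z : ℝ × ℝ => stepDiff z.1 z.2 := by
  simp only [stepDiff_eq]
  refine Measurable.sub ?_ ?_
  · have : (fun z : ℝ × ℝ => (Set.Ioi z.1).indicator (1 : ℝ → ℝ) z.2) =
        {z : ℝ × ℝ | z.1 < z.2}.indicator 1 := by
      funext z; simp [Set.indicator_apply]
    rw [this]
    exact measurable_one.indicator (measurableSet_lt measurable_fst measurable_snd)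
  · exact (measurable_one.indicator measurableSet_Ioi).comp measurable_snd

theorem integral_stepDiff_mul {V : Type*} [NormedAddCommGroup V] [NormedSpace ℝ V]
    {g : ℝ → V} (hg : Continuous g) (u : ℝ) :
    Integrable (fun y => stepDiff u y • g y) ∧ ∫ y, stepDiff u y • g y = ∫ y in u..0, g y := by
  have e : (fun y => stepDiff u y • g y) =
      fun y => (Set.Ioc u 0).indicator g y - (Set.Ioc 0 u).indicator g y := by
    funext y
    unfold stepDiff
    by_cases h1 : y ∈ Set.Ioc u 0 <;> by_cases h2 : y ∈ Set.Ioc 0 u <;> simp [h1, h2]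
  have hi : ∀ a b : ℝ, Integrable ((Set.Ioc a b).indicator g) := fun a b => by
    rw [integrable_indicator_iff measurableSet_Ioc]
    exact (hg.integrableOn_Icc).mono_set Set.Ioc_subset_Icc_self
  rw [e]
  refine ⟨(hi _ _).sub (hi _ _), ?_⟩
  rw [integral_sub (hi _ _) (hi _ _), integral_indicator measurableSet_Ioc,
    integral_indicator measurableSet_Ioc]
  rfl

theorem integral_abs_stepDiff (u : ℝ) : ∫ y, |stepDiff u y| = |u| := by
  have e : (fun y => |stepDiff u y|) =
      fun y => (Set.Ioc u 0).indicator (1 : ℝ → ℝ) y + (Set.Ioc 0 u).indicator 1 y := by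
    funext y
    unfold stepDiff
    by_cases h1 : y ∈ Set.Ioc u 0 <;> by_cases h2 : y ∈ Set.Ioc 0 u
    · exact absurd h1.2 (not_le.2 h2.1)
    all_goals simp [h1, h2]
  have hi : ∀ a b : ℝ, Integrable ((Set.Ioc a b).indicator (1 : ℝ → ℝ)) := fun a b => by
    rw [integrable_indicator_iff measurableSet_Ioc]
    exact (continuous_one.integrableOn_Icc).mono_set Set.Ioc_subset_Icc_self
  rw [e, integral_add (hi _ _) (hi _ _), integral_indicator measurableSet_Ioc,
    integral_indicator measurableSet_Ioc]
  simp only [Pi.one_apply, setIntegral_const, Real.volume_real_Ioc, smul_eq_mul, mul_one]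
  rcases le_total 0 u with h | h
  · rw [abs_of_nonneg h, max_eq_right (by linarith), max_eq_left (by linarith)]; ring
  · rw [abs_of_nonpos h, max_eq_left (by linarith), max_eq_right (by linarith)]; ring

variable {μ ν : Measure ℝ} [IsProbabilityMeasure μ] [IsProbabilityMeasure ν]

theorem integrable_prod_stepDiff (hμ : Integrable id μ) :
    Integrable (fun z : ℝ × ℝ => stepDiff z.1 z.2) (μ.prod volume) := by
  rw [integrable_prod_iff measurable_stepDiff.aestronglyMeasurable]
  refine ⟨ae_of_all _ fun u => ?_, ?_⟩
  · have := (integral_stepDiff_mul (g := fun _ => (1 : ℝ)) continuous_const u).1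
    simpa using this
  · simp only [Real.norm_eq_abs, integral_abs_stepDiff]
    exact hμ.abs

theorem integral_stepDiff_left (y : ℝ) :
    ∫ u, stepDiff u y ∂μ = μ.real (Set.Iio y) - (Set.Ioi 0).indicator (1 : ℝ → ℝ) y := by
  have e : (fun u => stepDiff u y) = fun u => (Set.Iio y).indicator (1 : ℝ → ℝ) u -
      (Set.Ioi 0).indicator (1 : ℝ → ℝ) y := by
    funext u; rw [stepDiff_eq]; simp [Set.indicator_apply]
  rw [e, integral_sub _ (integrable_const _), integral_indicator_one measurableSet_Iio]
  · simp
  · exact (integrable_const (1 : ℝ)).indicator measurableSet_Iio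

/-- Integration by parts, done by Fubini. Subtracting the Heaviside function makes the distribution
function integrable when the first moment is finite; it cancels in the difference of two laws. -/
theorem integral_cdf_mul_ee (hμ : Integrable id μ) {s : ℝ} (hs : s ≠ 0) :
    ∫ y, (∫ u, stepDiff u y ∂μ) • ee (s * y) =
      (1 - ∫ u, ee (s * u) ∂μ) / (s * Complex.I) := by
  have hi : Integrable (fun z : ℝ × ℝ => stepDiff z.1 z.2 • ee (s * z.2)) (μ.prod volume) := by
    refine (integrable_prod_stepDiff hμ).mono
      ((measurable_stepDiff.smul (by fun_prop)).aestronglyMeasurable) (ae_of_all _ fun z => ?_)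
    rw [norm_smul, norm_ee, mul_one]
  have hce : Continuous fun y => ee (s * y) := by unfold ee; fun_prop
  have h1 : ∫ y, (∫ u, stepDiff u y ∂μ) • ee (s * y) =
      ∫ y, ∫ u, stepDiff u y • ee (s * y) ∂μ := by
    congr 1; funext y; rw [integral_smul_const]
  rw [h1, ← integral_integral_swap hi]
  have h2 : ∀ u, ∫ y, stepDiff u y • ee (s * y) = (1 - ee (s * u)) / (s * Complex.I) := by
    intro u
    rw [(integral_stepDiff_mul hce u).2]
    have hsI : (s : ℂ) * Complex.I ≠ 0 := mul_ne_zero (by exact_mod_cast hs) Complex.I_ne_zero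
    have := integral_exp_mul_complex (a := u) (b := 0) hsI
    unfold ee
    have e : ∀ y : ℝ, Complex.exp (((s * y : ℝ) : ℂ) * Complex.I) =
        Complex.exp ((s * Complex.I) * y) := fun y => by congr 1; push_cast; ring
    simp_rw [e]
    rw [this]; simp
  simp_rw [h2]
  rw [integral_div, integral_sub (integrable_const _)
    (integrable_of_norm_le (by fun_prop) 1 fun u => (norm_ee _).le)]
  simp

theorem integrable_cdf_diff (hμ : Integrable id μ) (hν : Integrable id ν) :
    Integrable fun y => μ.real (Set.Iio y) - ν.real (Set.Iio y) := by
  have h1 := (integrable_prod_stepDiff hμ).integral_prod_right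
  have h2 := (integrable_prod_stepDiff hν).integral_prod_right
  refine (h1.sub h2).congr (ae_of_all _ fun y => ?_)
  simp only [Pi.sub_apply, integral_stepDiff_left]
  ring

theorem abs_integral_cdf_diff_mul_cos_le (hμ : Integrable id μ) (hν : Integrable id ν) {s : ℝ}
    (hs : 0 < s) (x : ℝ) :
    |∫ y, (μ.real (Set.Iio y) - ν.real (Set.Iio y)) * Real.cos (s * (x - y))| ≤
      ‖∫ u, ee (s * u) ∂μ - ∫ u, ee (s * u) ∂ν‖ / s := by
  have hD := integrable_cdf_diff hμ hν
  have mD := hD.aestronglyMeasurable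
  have j : ∀ {κ : Measure ℝ} [IsProbabilityMeasure κ], Integrable id κ →
      Integrable fun y => (∫ u, stepDiff u y ∂κ) • ee (s * y) := by
    intro κ _ hκ
    have h1 := (integrable_prod_stepDiff hκ).integral_prod_right
    refine h1.norm.mono (h1.aestronglyMeasurable.smul
      (Measurable.aestronglyMeasurable (by fun_prop))) (ae_of_all _ fun y => ?_)
    rw [norm_smul, norm_ee, mul_one, norm_norm]
  have e1 : ∫ y, (μ.real (Set.Iio y) - ν.real (Set.Iio y)) • ee (s * y) =
      (∫ u, ee (s * u) ∂ν - ∫ u, ee (s * u) ∂μ) / (s * Complex.I) := by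
    have h1 := integral_sub (j hμ) (j hν)
    rw [integral_cdf_mul_ee hμ hs.ne', integral_cdf_mul_ee hν hs.ne'] at h1
    have h2 : ∀ y, (μ.real (Set.Iio y) - ν.real (Set.Iio y)) • ee (s * y) =
        (∫ u, stepDiff u y ∂μ) • ee (s * y) - (∫ u, stepDiff u y ∂ν) • ee (s * y) := fun y => by
      rw [← sub_smul, integral_stepDiff_left, integral_stepDiff_left]; congr 1; ring
    simp_rw [h2]
    rw [h1]; ring
  have e2 : ∫ y, (μ.real (Set.Iio y) - ν.real (Set.Iio y)) * Real.cos (s * (x - y)) =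
      (ee (-(s * x)) * ∫ y, (μ.real (Set.Iio y) - ν.real (Set.Iio y)) • ee (s * y)).re := by
    rw [← integral_const_mul]
    have hig : Integrable fun y => ee (-(s * x)) *
        ((μ.real (Set.Iio y) - ν.real (Set.Iio y)) • ee (s * y)) := by
      refine hD.norm.mono ((Measurable.aestronglyMeasurable (by fun_prop)).mul
        (mD.smul (Measurable.aestronglyMeasurable (by fun_prop)))) (ae_of_all _ fun y => ?_)
      rw [norm_mul, norm_smul, norm_ee, norm_ee, one_mul, mul_one, norm_norm]
    have := integral_re hig
    simp only [RCLike.re_to_complex] at this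
    rw [← this]
    congr 1; funext y
    rw [mul_smul_comm, ← ee_add, Complex.real_smul, Complex.re_ofReal_mul]
    congr 1
    unfold ee
    rw [Complex.exp_ofReal_mul_I_re, ← Real.cos_neg]
    congr 1; ring
  rw [e2]
  refine (Complex.abs_re_le_norm _).trans ?_
  rw [norm_mul, norm_ee, one_mul, e1, norm_div, norm_mul, Complex.norm_I, mul_one,
    Complex.norm_real, Real.norm_eq_abs, abs_of_pos hs, norm_sub_rev]

/-- The rescaled Fejér kernel is a superposition of cosines of frequencies at most `T`, so smoothing
with it involves the characteristic functions only up to `T`. -/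
theorem abs_integral_cdf_diff_mul_fejer_le (hμ : Integrable id μ) (hν : Integrable id ν) {T : ℝ}
    (hT : 0 < T) {h : ℝ → ℝ} (hh : IntervalIntegrable h volume 0 1)
    (hb : ∀ t, 0 < t → t ≤ 1 →
      ‖∫ u, ee (t * T * u) ∂μ - ∫ u, ee (t * T * u) ∂ν‖ ≤ t * T * h t) (x : ℝ) :
    |∫ y, (μ.real (Set.Iio y) - ν.real (Set.Iio y)) * fejer (T * (x - y))| ≤
      2 * ∫ t in (0 : ℝ)..1, h t := by
  have hD := integrable_cdf_diff hμ hν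
  set Δ : ℝ → ℝ := fun y => μ.real (Set.Iio y) - ν.real (Set.Iio y) with hΔ
  set ρ : Measure ℝ := volume.restrict (Set.Ioc (0 : ℝ) 1) with hρ
  have hi : Integrable (fun z : ℝ × ℝ => Δ z.1 * ((1 - z.2) * Real.cos (z.2 * (T * (x - z.1)))))
      ((volume : Measure ℝ).prod ρ) := by
    have h1 : Integrable (fun z : ℝ × ℝ => Δ z.1) ((volume : Measure ℝ).prod ρ) := hD.comp_fst ρ
    have h2 : Integrable (fun z : ℝ × ℝ => Δ z.1 * (1 - z.2)) ((volume : Measure ℝ).prod ρ) := by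
      refine Integrable.mul_prod (f := Δ) (g := fun t : ℝ => 1 - t) hD ?_
      exact ((continuous_const.sub continuous_id).integrableOn_Icc).mono_set
        Set.Ioc_subset_Icc_self
    have h3 := h2.mul_bdd (c := 1) (g := fun z : ℝ × ℝ => Real.cos (z.2 * (T * (x - z.1))))
      (Measurable.aestronglyMeasurable (by fun_prop))
      (ae_of_all _ fun z => Real.abs_cos_le_one _)
    refine h3.congr (ae_of_all _ fun z => ?_)
    simp only; ring
  have e1 : ∫ y, Δ y * fejer (T * (x - y)) =
      2 * ∫ t in (0 : ℝ)..1, (1 - t) * ∫ y, Δ y * Real.cos (t * T * (x - y)) := by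
    rw [intervalIntegral.integral_of_le zero_le_one]
    have h1 : ∀ y, Δ y * fejer (T * (x - y)) =
        2 * ∫ t, Δ y * ((1 - t) * Real.cos (t * (T * (x - y)))) ∂ρ := fun y => by
      unfold fejer
      rw [intervalIntegral.integral_of_le zero_le_one, integral_const_mul]; ring
    simp_rw [h1]
    rw [integral_const_mul, integral_integral_swap hi]
    congr 2; funext t
    rw [← integral_const_mul]
    congr 1; funext y
    rw [mul_assoc t T]; ring
  rw [e1, abs_mul, abs_of_pos (by norm_num : (0 : ℝ) < 2)]
  gcongr
  rw [← Real.norm_eq_abs]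
  refine intervalIntegral.norm_integral_le_of_norm_le zero_le_one (ae_of_all _ fun t ht => ?_) hh
  have ht0 := ht.1
  have hsT : 0 < t * T := by have := ht.1; positivity
  rw [norm_mul, Real.norm_eq_abs, Real.norm_eq_abs, abs_of_nonneg (by linarith [ht.2])]
  have h1 := abs_integral_cdf_diff_mul_cos_le hμ hν hsT x
  have h2 : ‖∫ u, ee (t * T * u) ∂μ - ∫ u, ee (t * T * u) ∂ν‖ / (t * T) ≤ h t := by
    rw [div_le_iff₀ hsT]; exact (hb t ht.1 ht.2).trans_eq (by ring)
  have h3 := h1.trans h2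
  refine le_trans ?_ h3
  exact mul_le_of_le_one_left (abs_nonneg _) (by linarith)

/-- Esseen's smoothing inequality. -/
theorem abs_cdf_sub_le (hμ : Integrable id μ) (hν : Integrable id ν) {L T : ℝ} (hL : 0 < L)
    (hT : 0 < T) (hLip : ∀ x y, x ≤ y → ν.real (Set.Icc x y) ≤ L * (y - x)) {h : ℝ → ℝ}
    (hh : IntervalIntegrable h volume 0 1)
    (hb : ∀ t, 0 < t → t ≤ 1 →
      ‖∫ u, ee (t * T * u) ∂μ - ∫ u, ee (t * T * u) ∂ν‖ ≤ t * T * h t) (x : ℝ) :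
    |μ.real (Set.Iic x) - ν.real (Set.Iic x)| ≤
      2 / fejerMass * (2 * T * (∫ t in (0 : ℝ)..1, h t) + 96 * L / T) := by
  have hA := fejerMass_pos
  set f : ℝ → ℝ := fun x => |μ.real (Set.Iic x) - ν.real (Set.Iic x)| with hf
  set D : ℝ := ⨆ x, f x with hDdef
  have hbdd : BddAbove (Set.range f) := by
    refine ⟨1, ?_⟩
    rintro _ ⟨x, rfl⟩
    have h1 := measureReal_le_one (μ := μ) (s := Set.Iic x)
    have h2 := measureReal_le_one (μ := ν) (s := Set.Iic x)
    have h3 : 0 ≤ μ.real (Set.Iic x) := measureReal_nonneg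
    have h4 : 0 ≤ ν.real (Set.Iic x) := measureReal_nonneg
    simp only [hf, abs_le]
    constructor <;> linarith
  have hfD : ∀ x, f x ≤ D := fun x => le_ciSup hbdd x
  have hI0 : 0 ≤ ∫ t in (0 : ℝ)..1, h t := by
    have := (abs_nonneg _).trans (abs_integral_cdf_diff_mul_fejer_le hμ hν hT hh hb 0)
    linarith
  refine (hfD x).trans ?_
  have hD0 : 0 ≤ D := (abs_nonneg _).trans (hfD x)
  rcases hD0.eq_or_lt with h0 | hDpos
  · rw [← h0]; positivity
  -- increments of the distribution functions
  have νmono : ∀ {s t : ℝ}, s ≤ t → ν.real (Set.Iic t) ≤ ν.real (Set.Iio s) + L * (t - s) := by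
    intro s t hst
    have e : Set.Iic t = Set.Iio s ∪ Set.Icc s t := by
      ext z; simp only [Set.mem_Iic, Set.mem_union, Set.mem_Iio, Set.mem_Icc]
      constructor
      · intro hz; rcases lt_or_ge z s with h | h
        · exact Or.inl h
        · exact Or.inr ⟨h, hz⟩
      · rintro (h | h)
        · linarith
        · exact h.2
    rw [e]
    exact (measureReal_union_le _ _).trans (by linarith [hLip s t hst])
  have mIio : ∀ (κ : Measure ℝ) [IsProbabilityMeasure κ] (s : ℝ),
      κ.real (Set.Iio s) ≤ κ.real (Set.Iic s) := fun κ _ s =>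
    measureReal_mono (Set.Iio_subset_Iic_self)
  have mIic : ∀ (κ : Measure ℝ) [IsProbabilityMeasure κ] {s t : ℝ}, s < t →
      κ.real (Set.Iic s) ≤ κ.real (Set.Iio t) := fun κ _ {s t} hst =>
    measureReal_mono (Set.Iic_subset_Iio.2 hst)
  have νeq : ∀ s, ν.real (Set.Iio s) = ν.real (Set.Iic s) := fun s =>
    le_antisymm (mIio ν s) (by simpa using νmono (le_refl s))
  set Δ : ℝ → ℝ := fun y => μ.real (Set.Iio y) - ν.real (Set.Iio y) with hΔ
  have mΔ : Measurable Δ := by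
    refine Measurable.sub ?_ ?_
    · exact Monotone.measurable fun s t hst => measureReal_mono (Set.Iio_subset_Iio hst)
    · exact Monotone.measurable fun s t hst => measureReal_mono (Set.Iio_subset_Iio hst)
  -- The supremum is taken over closed half-lines while the smoothing uses open ones. The lower
  -- bound is recovered from points slightly to the left, by the Lipschitz continuity of the
  -- reference law.
  have hΔD : ∀ y, |Δ y| ≤ D := by
    intro y
    rw [abs_le]
    constructor
    · refine le_of_forall_pos_le_add fun ε hε => ?_
      have h1 := (abs_le.1 (hfD (y - ε / L))).1
      have hεL : y - ε / L < y := sub_lt_self y (by positivity)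
      have h2 := mIic μ hεL
      have h3 := νmono hεL.le
      have h4 : L * (y - (y - ε / L)) = ε := by field_simp; ring
      rw [h4, νeq] at h3
      simp only [hΔ, νeq]
      linarith
    · have h1 := (abs_le.1 (hfD y)).2
      have h2 := mIio μ y
      simp only [hΔ, νeq]
      linarith
  obtain ⟨x0, hx0⟩ : ∃ x0, 3 / 4 * D < f x0 :=
    exists_lt_of_lt_ciSup (show 3 / 4 * D < ⨆ x, f x by rw [← hDdef]; linarith)
  -- Moving away from `x0` by at most `2 r`, in the direction in which monotonicity of the
  -- distribution function of `μ` helps, loses at most `L * (2 r) = D / 4`. Hence the difference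
  -- stays above `D / 2` on an interval of radius `r`, centred at `x0 + r` or `x0 - r` according to
  -- its sign.
  set r := D / (8 * L) with hr
  have hr0 : 0 < r := by positivity
  have hrL : L * (2 * r) = D / 4 := by rw [hr]; field_simp; norm_num
  have final : D / 2 * (fejerMass / T) - 3 / 2 * D * (8 / (T ^ 2 * r)) ≤
      2 * ∫ t in (0 : ℝ)..1, h t := by
    rcases abs_cases (μ.real (Set.Iic x0) - ν.real (Set.Iic x0)) with ⟨h1, -⟩ | ⟨h1, -⟩
    · refine (le_integral_mul_fejer (f := Δ) (x := x0 + r) mΔ hD0 hΔD hT hr0 ?_).trans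
        ((le_abs_self _).trans (abs_integral_cdf_diff_mul_fejer_le hμ hν hT hh hb _))
      intro z hz
      rw [abs_lt] at hz
      have h2 := mIic μ (show x0 < z by linarith)
      have h3 := νmono (show x0 ≤ z by linarith)
      have h4 : L * (z - x0) ≤ L * (2 * r) := by gcongr; linarith
      simp only [hf, h1] at hx0
      simp only [hΔ, νeq] at h3 ⊢
      linarith
    · have h5 := le_integral_mul_fejer (f := fun y => -Δ y) (x := x0 - r) mΔ.neg hD0
        (fun z => by rw [abs_neg]; exact hΔD z) hT hr0 ?_
      · refine h5.trans ?_
        simp only [neg_mul, integral_neg]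
        exact (neg_le_abs _).trans (abs_integral_cdf_diff_mul_fejer_le hμ hν hT hh hb _)
      · intro z hz
        rw [abs_lt] at hz
        have h2 : μ.real (Set.Iio z) ≤ μ.real (Set.Iic x0) :=
          (mIio μ z).trans (measureReal_mono (Set.Iic_subset_Iic.2 (by linarith)))
        have h3 := νmono (show z ≤ x0 by linarith)
        have h4 : L * (x0 - z) ≤ L * (2 * r) := by gcongr; linarith
        simp only [hf, h1] at hx0
        simp only [hΔ, νeq] at h3 ⊢
        linarith
  have e1 : 3 / 2 * D * (8 / (T ^ 2 * r)) = 96 * L / T ^ 2 := by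
    rw [hr]; field_simp; norm_num
  rw [e1] at final
  have e2 : D = 2 / fejerMass * (T * (D / 2 * (fejerMass / T))) := by field_simp
  rw [e2]
  gcongr
  have := mul_le_mul_of_nonneg_left (sub_le_iff_le_add.1 final) hT.le
  refine this.trans_eq ?_
  field_simp

end cdfs

end

/-! ### The Berry–Esseen bound for regular sequences. -/

section

variable {S : Type*} [MeasurableSpace S]

theorem integral_ee_gaussianReal (w : ℝ≥0) (t : ℝ) :
    ∫ u, ee (t * u) ∂gaussianReal 0 w = (Real.exp (-(t ^ 2 * w / 2)) : ℝ) := by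
  have h := charFun_gaussianReal (μ := 0) (v := w) t
  rw [charFun_apply_real] at h
  simp only [ee]
  push_cast
  rw [h]
  congr 1
  push_cast
  ring

theorem gaussianReal_real_Icc_le {w : ℝ≥0} (hw : w ≠ 0) {x y : ℝ} (hxy : x ≤ y) :
    (gaussianReal 0 w).real (Set.Icc x y) ≤ (√(w : ℝ))⁻¹ * (y - x) := by
  have hw0 : (0 : ℝ) < w := by positivity
  have hle : ∀ u, gaussianPDFReal 0 w u ≤ (√(w : ℝ))⁻¹ := by
    intro u
    rw [gaussianPDFReal_def]
    have h1 : (√(2 * Real.pi * w))⁻¹ ≤ (√(w : ℝ))⁻¹ := by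
      gcongr
      nlinarith only [hw0, Real.pi_gt_three]
    have h2 : Real.exp (-(u - 0) ^ 2 / (2 * w)) ≤ 1 := by
      rw [Real.exp_le_one_iff]
      exact div_nonpos_of_nonpos_of_nonneg (by nlinarith only [sq_nonneg (u - 0)]) (by positivity)
    exact (mul_le_mul h1 h2 (Real.exp_pos _).le (by positivity)).trans_eq (mul_one _)
  rw [Measure.real, gaussianReal_apply 0 hw]
  refine ENNReal.toReal_le_of_le_ofReal (by have := sub_nonneg.2 hxy; positivity) ?_
  calc ∫⁻ u in Set.Icc x y, gaussianPDF 0 w u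
      ≤ ∫⁻ u in Set.Icc x y, ENNReal.ofReal (√(w : ℝ))⁻¹ :=
        lintegral_mono fun u => ENNReal.ofReal_le_ofReal (hle u)
    _ = _ := by
        rw [setLIntegral_const, Real.volume_Icc, ENNReal.ofReal_mul (by positivity)]

theorem gaussianReal_real_Iic_mul_sqrt {w : ℝ≥0} (hw : w ≠ 0) (x : ℝ) :
    (gaussianReal 0 w).real (Set.Iic (x * √(w : ℝ))) = cdf (gaussianReal 0 1) x := by
  have hs : 0 < √(w : ℝ) := by positivity
  have h := gaussianReal_map_const_mul (μ := 0) (v := 1) (√(w : ℝ))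
  have e : gaussianReal (√(w : ℝ) * 0) (NNReal.mk (√(w : ℝ) ^ 2) (sq_nonneg _) * 1)
      = gaussianReal 0 w := by
    congr 1
    · simp
    · ext; simp
  rw [e] at h
  rw [← h, cdf_eq_real, map_measureReal_apply (by fun_prop) measurableSet_Iic]
  congr 1
  ext u
  simp only [Set.mem_preimage, Set.mem_Iic]
  rw [mul_comm, mul_le_mul_iff_left₀ hs]

theorem intervalIntegrable_one_add_mul_rpow {a δ : ℝ} (ha : 0 < a) :
    IntervalIntegrable (fun t : ℝ => (1 + a * t) ^ (-(1 + δ))) volume 0 1 := by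
  refine ContinuousOn.intervalIntegrable ?_
  intro t ht
  rw [Set.uIcc_of_le zero_le_one] at ht
  have hpos : 0 < 1 + a * t := by have := ht.1; positivity
  have h1 : ContinuousAt (fun t : ℝ => 1 + a * t) t := by fun_prop
  exact (h1.rpow_const (Or.inl hpos.ne')).continuousWithinAt

theorem integral_one_add_mul_rpow_le {a δ : ℝ} (ha : 0 < a) (hδ : 0 < δ) :
    ∫ t in (0 : ℝ)..1, (1 + a * t) ^ (-(1 + δ)) ≤ 1 / (a * δ) := by
  have hd : ∀ t ∈ Set.uIcc (0 : ℝ) 1,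
      HasDerivAt (fun t => -(1 + a * t) ^ (-δ) / (a * δ)) ((1 + a * t) ^ (-(1 + δ))) t := by
    intro t ht
    rw [Set.uIcc_of_le zero_le_one] at ht
    have hpos : 0 < 1 + a * t := by have := ht.1; positivity
    have h1 : HasDerivAt (fun t : ℝ => 1 + a * t) a t := by
      simpa using ((hasDerivAt_id t).const_mul a).const_add 1
    have h2 := ((h1.rpow_const (p := -δ) (Or.inl hpos.ne')).neg).div_const (a * δ)
    refine h2.congr_deriv ?_
    rw [show -δ - 1 = -(1 + δ) by ring]
    field_simp
  rw [intervalIntegral.integral_eq_sub_of_hasDerivAt hd (intervalIntegrable_one_add_mul_rpow ha)]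
  have h3 : 0 ≤ (1 + a * 1) ^ (-δ) / (a * δ) := by positivity
  have h4 : (1 + a * 0) ^ (-δ) = 1 := by simp
  rw [h4, neg_div, neg_div]
  linarith

theorem one_le_sq_mul_rpow {τ K δ : ℝ} (hτ : 0 ≤ τ) (hτK : τ ≤ K) (hδ : δ ≤ 1) :
    1 ≤ (1 + K) ^ 2 * (1 + τ) ^ (-(1 + δ)) := by
  rw [Real.rpow_neg (by positivity), ← div_eq_mul_inv, one_le_div (by positivity)]
  calc (1 + τ) ^ (1 + δ) ≤ (1 + τ) ^ (2 : ℝ) :=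
        Real.rpow_le_rpow_of_exponent_le (by linarith) (by linarith)
    _ = (1 + τ) ^ 2 := Real.rpow_two _
    _ ≤ _ := by gcongr

/-- Together with `one_le_sq_mul_rpow` this brings the low and high frequency bounds to the common
weight `τ (1 + τ)^{-(1+δ)}`: linear at zero, to survive division by the frequency, and integrable at
infinity after that division. -/
theorem rpow_neg_le_mul_one_add_rpow {τ δ : ℝ} (hτ : 1 ≤ τ) (hδ0 : 0 < δ) (hδ : δ ≤ 1) :
    τ ^ (-δ) ≤ 4 * (τ * (1 + τ) ^ (-(1 + δ))) := by
  have h0 : 0 < τ := by linarith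
  have h1 : τ ^ (-δ) = τ * τ ^ (-(1 + δ)) := by
    rw [← Real.rpow_one_add' h0.le (by linarith)]; congr 1; ring
  have h2 : τ ^ (-(1 + δ)) ≤ ((1 + τ) / 2) ^ (-(1 + δ)) :=
    Real.rpow_le_rpow_of_nonpos (by linarith) (by linarith) (by linarith)
  have h3 : ((1 + τ) / 2) ^ (-(1 + δ)) = (1 + τ) ^ (-(1 + δ)) * 2 ^ (1 + δ) := by
    rw [Real.div_rpow (by linarith) (by norm_num), Real.rpow_neg (by norm_num : (0 : ℝ) ≤ 2),
      div_inv_eq_mul]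
  have h4 : (2 : ℝ) ^ (1 + δ) ≤ 4 := by
    calc (2 : ℝ) ^ (1 + δ) ≤ 2 ^ (2 : ℝ) :=
          Real.rpow_le_rpow_of_exponent_le (by norm_num) (by linarith)
      _ = 4 := by norm_num
  have h5 : 0 ≤ (1 + τ) ^ (-(1 + δ)) := by positivity
  rw [h1]
  calc τ * τ ^ (-(1 + δ)) ≤ τ * ((1 + τ) ^ (-(1 + δ)) * 4) := by
        rw [h3] at h2
        gcongr
        exact h2.trans (by gcongr)
    _ = _ := by ring

universe u

/-- The characteristic function of `S_n` is compared with the Gaussian one on `|ξ| ≤ c₀`. -/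
theorem Regular.exists_norm_cf_sub_le {p q b M v : ℝ} (hq : 2 < q) (hq3 : q ≤ 3) (hqp : q ≤ p)
    (hb : 1 / 2 + (q - 2) / 2 / p < b) (hb1 : b < 1) (hM : 1 ≤ M) (hv : 0 < v) :
    ∃ C c0 δ : ℝ, 0 ≤ C ∧ 0 < c0 ∧ 0 < δ ∧
      ∀ (S : Type u) [MeasurableSpace S] (μ : Measure (ℤ → S)) [IsProbabilityMeasure μ]
        (X : ℤ → (ℤ → S) → ℝ) (s2 : ℝ), Regular μ X p b M s2 → v ≤ s2 →
        ∀ (ξ : ℝ) (n : ℕ), 0 ≤ ξ → ξ ≤ c0 → 1 ≤ n →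
          ‖cf μ X n ξ - (Real.exp (-(ξ ^ 2 * (n * s2) / 2)) : ℝ)‖ ≤
            C * ((n : ℝ) ^ (-((q - 2) / 2)) * (ξ * √n * (1 + ξ * √n) ^ (-(1 + δ)))) := by
  obtain ⟨K0, C, c0, δ, hK0, hC, hc0, -, hδ0, hδ, H⟩ :=
    Regular.exists_norm_cf_sub_high_le.{u} hq hq3 hqp hb hb1 hM hv
  have hb' : 1 / 2 < b := by
    have : 0 ≤ (q - 2) / 2 / p := div_nonneg (by linarith) (by linarith)
    linarith
  have hb2 : 0 < b - 1 / 2 := by linarith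
  set B := M + (5 * M ^ 3 + 170 * M ^ 3 * K0 ^ 2 / (b - 1 / 2)) * K0 with hB
  have hB0 : 0 ≤ B := by
    have : 0 < M := by linarith
    positivity
  refine ⟨B * (K0 * (1 + K0) ^ 2) + C * 4, c0, δ, by positivity, hc0, hδ0, ?_⟩
  intro S _ μ _ X s2 h hs ξ n hξ0 hξ hn
  have hτ : 0 ≤ ξ * √n := by positivity
  have hn0 : 0 ≤ (n : ℝ) ^ (-((q - 2) / 2)) := by positivity
  have hw : 0 ≤ (n : ℝ) ^ (-((q - 2) / 2)) * (ξ * √n * (1 + ξ * √n) ^ (-(1 + δ))) := by positivity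
  rw [add_mul]
  rcases le_total (ξ * √n) K0 with hc | hc
  · have h1 := h.norm_cf_sub_low_le hq hq3 hqp hb' hb1 (hv.le.trans hs) hK0 hn (ξ := ξ)
      (by rwa [abs_of_nonneg hξ0])
    refine (h1.trans ?_).trans (le_add_of_nonneg_right (by positivity))
    rw [← hB, mul_assoc B]
    refine mul_le_mul_of_nonneg_left ?_ hB0
    have e : ξ ^ 2 * n = (ξ * √n) ^ 2 := by rw [mul_pow, Real.sq_sqrt (by positivity)]
    rw [e, neg_div]
    generalize ξ * √n = τ at *
    have h2 := one_le_sq_mul_rpow hτ hc hδ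
    have h3 : τ ^ 2 ≤ K0 * τ * ((1 + K0) ^ 2 * (1 + τ) ^ (-(1 + δ))) := by
      calc τ ^ 2 ≤ K0 * τ * 1 := by nlinarith only [hτ, hc]
        _ ≤ _ := by gcongr
    calc τ ^ 2 * (n : ℝ) ^ (-((q - 2) / 2)) ≤
        K0 * τ * ((1 + K0) ^ 2 * (1 + τ) ^ (-(1 + δ))) * (n : ℝ) ^ (-((q - 2) / 2)) := by gcongr
      _ = _ := by ring
  · have h1 := H S μ X s2 h hs ξ n (by rwa [abs_of_nonneg hξ0]) (by rwa [abs_of_nonneg hξ0])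
    rw [abs_of_nonneg hξ0] at h1
    refine (h1.trans ?_).trans (le_add_of_nonneg_left (by positivity))
    rw [mul_assoc C 4]
    refine mul_le_mul_of_nonneg_left ?_ hC
    calc (n : ℝ) ^ (-((q - 2) / 2)) * (ξ * √n) ^ (-δ)
        ≤ (n : ℝ) ^ (-((q - 2) / 2)) * (4 * (ξ * √n * (1 + ξ * √n) ^ (-(1 + δ)))) := by
          gcongr
          exact rpow_neg_le_mul_one_add_rpow (hK0.trans hc) hδ0 hδ
      _ = _ := by ring

/-- The Berry–Esseen bound for regular sequences. -/
theorem Regular.exists_abs_sub_cdf_le {p q b M v : ℝ} (hq : 2 < q) (hq3 : q ≤ 3) (hqp : q ≤ p)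
    (hb : 1 / 2 + (q - 2) / 2 / p < b) (hb1 : b < 1) (hM : 1 ≤ M) (hv : 0 < v) :
    ∃ C : ℝ, 0 ≤ C ∧
      ∀ (S : Type u) [MeasurableSpace S] (μ : Measure (ℤ → S)) [IsProbabilityMeasure μ]
        (X : ℤ → (ℤ → S) → ℝ) (s2 : ℝ), Regular μ X p b M s2 → v ≤ s2 →
        ∀ (n : ℕ), 1 ≤ n → ∀ x : ℝ,
          |μ.real {y | psum X (Finset.Ioc 0 (n : ℤ)) y ≤ x * √(n * s2)} - cdf (gaussianReal 0 1) x|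
            ≤ C * (n : ℝ) ^ (-((q - 2) / 2)) := by
  obtain ⟨C, c0, δ, hC, hc0, hδ, H⟩ := Regular.exists_norm_cf_sub_le.{u} hq hq3 hqp hb hb1 hM hv
  have hF := fejerMass_pos
  refine ⟨2 / fejerMass * (2 * C / δ + 96 * (√v)⁻¹ / c0), by positivity, ?_⟩
  intro S _ μ _ X s2 h hs n hn x
  have hn1 : (1 : ℝ) ≤ n := by exact_mod_cast hn
  have hn0 : (0 : ℝ) < n := by linarith
  have hs0 : 0 < s2 := hv.trans_le hs
  have hm := h.measurable_psum (Finset.Ioc 0 (n : ℤ))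
  have hsn : 0 < √(n : ℝ) := by positivity
  set w : ℝ≥0 := ⟨n * s2, by positivity⟩ with hw
  have hwv : (w : ℝ) = n * s2 := rfl
  have hw0 : w ≠ 0 := by
    intro h0
    have : (w : ℝ) = 0 := by rw [h0]; rfl
    rw [hwv] at this
    exact (mul_pos hn0 hs0).ne' this
  set a := c0 * √(n : ℝ) with ha
  have ha0 : 0 < a := by positivity
  set N := (n : ℝ) ^ (-((q - 2) / 2)) with hN
  have hN0 : 0 < N := by positivity
  have : IsProbabilityMeasure (μ.map (psum X (Finset.Ioc 0 (n : ℤ)))) :=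
    Measure.isProbabilityMeasure_map hm.aemeasurable
  have i1 : Integrable id (μ.map (psum X (Finset.Ioc 0 (n : ℤ)))) := by
    rw [integrable_map_measure aestronglyMeasurable_id hm.aemeasurable]
    have h1 := h.memLp_psum (Finset.Ioc 0 (n : ℤ))
    exact h1.integrable (by rw [ENNReal.one_le_ofReal]; linarith)
  have i2 : Integrable id (gaussianReal 0 w) := (memLp_id_gaussianReal 1).integrable le_rfl
  -- The sum is not normalised, so the cut-off is the constant `c0` and the smoothness of the
  -- Gaussian of variance `n s2` supplies the small factor in `L / T`.
  have key := abs_cdf_sub_le i1 i2 (L := (√(w : ℝ))⁻¹) (T := c0) (by positivity) hc0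
    (fun x y hxy => gaussianReal_real_Icc_le hw0 hxy)
    (h := fun t => C * N * √n * (1 + a * t) ^ (-(1 + δ)))
    ((intervalIntegrable_one_add_mul_rpow ha0).const_mul _) (by
      intro t ht0 ht1
      rw [integral_map hm.aemeasurable (Measurable.aestronglyMeasurable (by fun_prop)),
        integral_ee_gaussianReal, hwv]
      have h1 := H S μ X s2 h hs (t * c0) n (by positivity) (mul_le_of_le_one_left hc0.le ht1) hn
      unfold cf at h1
      refine h1.trans (le_of_eq ?_)
      rw [show a * t = t * c0 * √n by rw [ha]; ring]
      ring) (x * √(w : ℝ))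
  rw [gaussianReal_real_Iic_mul_sqrt hw0, map_measureReal_apply hm measurableSet_Iic,
    intervalIntegral.integral_const_mul] at key
  refine key.trans ?_
  rw [mul_assoc (2 / fejerMass)]
  refine mul_le_mul_of_nonneg_left ?_ (by positivity)
  have h1 : 2 * c0 * (C * N * √n * ∫ t in (0 : ℝ)..1, (1 + a * t) ^ (-(1 + δ))) ≤
      2 * C / δ * N := by
    calc _ ≤ 2 * c0 * (C * N * √n * (1 / (a * δ))) := by
          gcongr; exact integral_one_add_mul_rpow_le ha0 hδ
      _ = _ := by rw [ha]; field_simp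
  -- The truncation term is of order `n^{-1/2}`, which is at most `N` because `q ≤ 3`.
  have h2 : (√(w : ℝ))⁻¹ ≤ (√v)⁻¹ * N := by
    have e1 : √v * √n ≤ √(w : ℝ) := by
      rw [← Real.sqrt_mul hv.le, hwv, mul_comm v]
      exact Real.sqrt_le_sqrt (by gcongr)
    calc (√(w : ℝ))⁻¹ ≤ (√v * √n)⁻¹ := by gcongr
      _ = (√v)⁻¹ * (n : ℝ) ^ (-(1 / 2) : ℝ) := by
          rw [mul_inv, Real.rpow_neg hn0.le, ← Real.sqrt_eq_rpow]
      _ ≤ _ := by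
          gcongr
          exact Real.rpow_le_rpow_of_exponent_le hn1 (by linarith)
  calc _ ≤ 2 * C / δ * N + 96 * ((√v)⁻¹ * N) / c0 := by gcongr
    _ = _ := by ring

end

/-! ### From the Bernoulli shift to the abstract model. -/

section

variable {S : Type*} [MeasurableSpace S]

/-- Two independent i.i.d. sequences as one family indexed by `Fin 2 × ℤ`. -/
theorem measurePreserving_pair_infinitePi (ρ : Measure S) [IsProbabilityMeasure ρ] :
    MeasurePreserving (fun w : Fin 2 × ℤ → S => ((fun j => w (0, j), fun j => w (1, j)) :
      (ℤ → S) × (ℤ → S))) (Measure.infinitePi fun _ => ρ)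
      ((Measure.infinitePi fun _ : ℤ => ρ).prod (Measure.infinitePi fun _ : ℤ => ρ)) := by
  have h1 : MeasurePreserving (MeasurableEquiv.curry (Fin 2) ℤ S)
      (Measure.infinitePi fun _ => ρ) (Measure.pi fun _ => Measure.infinitePi fun _ => ρ) :=
    ⟨by fun_prop, by
      rw [← Measure.infinitePi_eq_pi]
      exact Measure.infinitePi_map_curry (fun (_ : Fin 2) (_ : ℤ) => ρ)⟩
  exact (measurePreserving_finTwoArrow _).comp h1

/-- Seen as one i.i.d. family over `Fin 2 × ℤ`, the two sequences exchange coordinates by a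
permutation `τ` of the index set, and such a permutation preserves the product law. -/
theorem swapInvariant_infinitePi (ρ : Measure S) [IsProbabilityMeasure ρ] :
    SwapInvariant (Measure.infinitePi fun _ : ℤ => ρ) := by
  classical
  intro A
  refine ⟨by fun_prop, ?_⟩
  set τ : Fin 2 × ℤ → Fin 2 × ℤ := fun i => if i.2 ∈ A then (1 - i.1, i.2) else i with hτ
  have hinj : Function.Injective τ := by
    have : Function.Involutive τ := by
      rintro ⟨i, j⟩
      by_cases hj : j ∈ A <;> simp [hτ, hj]
    exact this.injective
  have h1 := measurePreserving_pair_infinitePi ρ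
  have h2 : MeasurePreserving (fun (w : Fin 2 × ℤ → S) i => w (τ i))
      (Measure.infinitePi fun _ => ρ) (Measure.infinitePi fun _ => ρ) :=
    ⟨by fun_prop, Measure.map_infinitePi_infinitePi_of_inj (P := fun _ => ρ) hinj⟩
  have h3 := (h1.comp h2).map_eq
  conv_lhs => rw [← h1.map_eq]
  rw [Measure.map_map (by fun_prop) h1.measurable, ← h3]
  congr 1
  funext w
  ext j <;> by_cases hj : j ∈ A <;> simp [hτ, hj, mix]

/-- The process `X_k` as a function of the innovations. -/
def coordProcess {S : Type*} (g : ℤ → (ℕ → S) → ℝ) (k : ℤ) (x : ℤ → S) : ℝ :=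
  g k fun j => x (k - j)

theorem measurable_coordProcess {g : ℤ → (ℕ → S) → ℝ} (hg : ∀ k, Measurable (g k)) (k : ℤ) :
    Measurable (coordProcess g k) :=
  (hg k).comp (measurable_pi_lambda _ fun _ => measurable_pi_apply _)

theorem dependsOn_coordProcess (g : ℤ → (ℕ → S) → ℝ) (k : ℤ) :
    DependsOn (coordProcess g k) (Set.Iic k) := by
  intro x y hxy
  unfold coordProcess
  congr 1
  funext j
  exact hxy _ (by simp)

variable {Ω : Type*} [MeasurableSpace Ω] {P : Measure Ω} [IsProbabilityMeasure P]
  {ε ε' : ℤ → Ω → S} {g : ℤ → (ℕ → S) → ℝ} {p a b b' : ℝ} {K A D : ℝ≥0}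

theorem IsIIDWithCopy.measurable_pi (h : IsIIDWithCopy ε ε' P) : Measurable fun ω k => ε k ω :=
  measurable_pi_lambda _ h.measurable

theorem IsIIDWithCopy.swapInvariant (h : IsIIDWithCopy ε ε' P) :
    SwapInvariant (P.map fun ω k => ε k ω) := by
  have : IsProbabilityMeasure (P.map (ε 0)) :=
    Measure.isProbabilityMeasure_map (h.measurable 0).aemeasurable
  rw [h.indep.map_fun_eq_infinitePi_map h.measurable]
  simp_rw [fun i => (h.identDistrib i).map_eq]
  exact swapInvariant_infinitePi _

theorem IsIIDWithCopy.measurePreserving_pair (h : IsIIDWithCopy ε ε' P) :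
    MeasurePreserving (fun ω => ((fun k => ε k ω, fun k => ε' k ω) : (ℤ → S) × (ℤ → S))) P
      ((P.map fun ω k => ε k ω).prod (P.map fun ω k => ε k ω)) := by
  have m1 := h.measurable_pi
  have m2 : Measurable fun ω k => ε' k ω := measurable_pi_lambda _ h.measurable_copy
  refine ⟨m1.prodMk m2, ?_⟩
  rw [(indepFun_iff_map_prod_eq_prod_map_map m1.aemeasurable m2.aemeasurable).1 h.copy_indep,
    h.copy_identDistrib.map_eq]

/-- The pair of the innovations and their copy has the product law, so influences computed on the
sequence space are norms on the original one; the two dependence coefficients are the cases of a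
single coordinate and of a half-line. -/
theorem IsIIDWithCopy.infl_eq (h : IsIIDWithCopy ε ε' P) (hg : ∀ k, Measurable (g k)) (q : ℝ≥0∞)
    (k : ℤ) (B : Set ℤ) :
    infl (P.map fun ω k => ε k ω) q (coordProcess g k) B =
      eLpNorm (fun ω => coordProcess g k (fun i => ε i ω) -
        coordProcess g k (mix B (fun i => ε i ω) (fun i => ε' i ω))) q P := by
  have hm := measurable_coordProcess hg k
  rw [infl, ← eLpNorm_comp_measurePreserving (Measurable.aestronglyMeasurable (by fun_prop))
    h.measurePreserving_pair]
  rfl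

theorem IsIIDWithCopy.infl_singleton_le (h : IsIIDWithCopy ε ε' P) (hg : ∀ k, Measurable (g k))
    (k : ℤ) (l : ℕ) :
    infl (P.map fun ω k => ε k ω) (ENNReal.ofReal p) (coordProcess g k) {k - (l : ℤ)} ≤
      depPrime g ε ε' P p l := by
  rw [h.infl_eq hg]
  refine le_of_eq_of_le ?_ (le_iSup (fun k : ℤ => eLpNorm (fun ω =>
    g k (past ε k ω) - g k (pastPrime ε ε' l k ω)) (ENNReal.ofReal p) P) k)
  congr 1
  funext ω
  simp only [coordProcess, mix, Set.mem_singleton_iff, sub_right_inj, Nat.cast_inj]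
  rfl

theorem IsIIDWithCopy.infl_Iic_le (h : IsIIDWithCopy ε ε' P) (hg : ∀ k, Measurable (g k))
    (k : ℤ) (l : ℕ) :
    infl (P.map fun ω k => ε k ω) (ENNReal.ofReal p) (coordProcess g k) (Set.Iic (k - (l : ℤ))) ≤
      depStar g ε ε' P p l := by
  rw [h.infl_eq hg]
  refine le_of_eq_of_le ?_ (le_iSup (fun k : ℤ => eLpNorm (fun ω =>
    g k (past ε k ω) - g k (pastStar ε ε' l k ω)) (ENNReal.ofReal p) P) k)
  congr 1
  funext ω
  simp only [coordProcess, mix, Set.mem_Iic, sub_le_sub_iff_left, Nat.cast_le]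
  unfold past pastStar
  congr 2
  funext j
  by_cases hj : j < l
  · rw [if_neg (by omega), if_pos hj]
  · rw [if_pos (by omega), if_neg hj]

theorem le_ofReal_rpow_mul (c : ℝ) (hc : 0 ≤ c) (d : ℕ → ℝ≥0∞) (k : ℕ) :
    d (k + 1) ≤ ENNReal.ofReal (((k + 1 : ℕ) : ℝ) ^ c) * d (k + 1) := by
  refine le_mul_of_one_le_left (zero_le) ?_
  rw [ENNReal.one_le_ofReal]
  exact Real.one_le_rpow (by push_cast; linarith [k.cast_nonneg (α := ℝ)]) hc

theorem tendsto_zero_of_weightedSum_ne_top {c : ℝ} (hc : 0 ≤ c) {d : ℕ → ℝ≥0∞}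
    (h : weightedSum c d ≠ ∞) : Tendsto d atTop (𝓝 0) := by
  rw [← tendsto_add_atTop_iff_nat 1]
  exact tendsto_of_tendsto_of_tendsto_of_le_of_le tendsto_const_nhds
    (ENNReal.tendsto_atTop_zero_of_tsum_ne_top h) (fun _ => zero_le)
    (fun k => le_ofReal_rpow_mul c hc d k)

theorem ne_top_of_weightedSum_ne_top {c : ℝ} (hc : 0 ≤ c) {d : ℕ → ℝ≥0∞}
    (h : weightedSum c d ≠ ∞) (k : ℕ) : d (k + 1) ≠ ∞ :=
  ne_top_of_le_ne_top (ENNReal.ne_top_of_tsum_ne_top h k) (le_ofReal_rpow_mul c hc d k)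

/-- The dependence coefficients as a function on `ℤ`. -/
def coefOfDep (K : ℝ) (d : ℕ → ℝ≥0∞) (k : ℤ) : ℝ :=
  if k < 0 then 0 else if k = 0 then K else (d k.toNat).toReal

/-- A Markov-type tail bound: `r^{b'} ≤ k^b` for `k ≥ r ≥ 1`. The shift `k - 1` matches the indexing
of `weightedSum`, whose term `k` carries the coefficient `k + 1`. -/
theorem sum_coefOfDep_le (K : ℝ) {d : ℕ → ℝ≥0∞} (hbb : b' ≤ b) (hb' : 0 ≤ b')
    (hd : weightedSum b d ≤ D) {r : ℤ} (hr : 1 ≤ r) (u : Finset ℤ) (hu : ∀ k ∈ u, r ≤ k) :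
    ∑ k ∈ u, coefOfDep K d k ≤ D * (r : ℝ) ^ (-b') := by
  have hr1 : (1 : ℝ) ≤ r := by exact_mod_cast hr
  have hr0 : (0 : ℝ) < r := by linarith
  have h1 : ∑ k ∈ u, (r : ℝ) ^ b' * coefOfDep K d k ≤ D := by
    have hnn : ∀ k ∈ u, 0 ≤ (r : ℝ) ^ b' * coefOfDep K d k := by
      intro k hk
      have := hu k hk
      rw [coefOfDep, if_neg (by omega), if_neg (by omega)]
      positivity
    have h2 : ENNReal.ofReal (∑ k ∈ u, (r : ℝ) ^ b' * coefOfDep K d k) ≤ D := by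
      rw [ENNReal.ofReal_sum_of_nonneg hnn]
      refine le_trans ?_ hd
      have hinj : Set.InjOn (fun k : ℤ => (k - 1).toNat) u := by
        intro i hi j hj hij
        have := hu i hi
        have := hu j hj
        simp only at hij
        omega
      refine le_trans ?_ (ENNReal.sum_le_tsum (u.image fun k : ℤ => (k - 1).toNat))
      rw [Finset.sum_image hinj]
      refine Finset.sum_le_sum fun k hk => ?_
      have hk1 := hu k hk
      have e : (k - 1).toNat + 1 = k.toNat := by omega
      have e2 : ((k.toNat : ℕ) : ℝ) = k := by
        rw [← Int.cast_natCast (R := ℝ) k.toNat, Int.toNat_of_nonneg (by omega)]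
      have hkr : (r : ℝ) ≤ k := by exact_mod_cast hk1
      rw [e, e2, coefOfDep, if_neg (by omega), if_neg (by omega),
        ENNReal.ofReal_mul (by positivity)]
      refine mul_le_mul' (ENNReal.ofReal_le_ofReal ?_) ENNReal.ofReal_toReal_le
      calc (r : ℝ) ^ b' ≤ (k : ℝ) ^ b' := by gcongr
        _ ≤ (k : ℝ) ^ b := Real.rpow_le_rpow_of_exponent_le (hr1.trans hkr) hbb
    have := ENNReal.toReal_mono ENNReal.coe_ne_top h2
    rwa [ENNReal.toReal_ofReal (Finset.sum_nonneg hnn), ENNReal.coe_toReal] at this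
  rw [← Finset.mul_sum] at h1
  rw [Real.rpow_neg hr0.le, ← div_eq_mul_inv, le_div_iff₀ (by positivity)]
  linarith

theorem IsStationary.map_psum_eq (h : IsIIDWithCopy ε ε' P) (hg : ∀ k, Measurable (g k))
    (hs : IsStationary (process g ε) P) (c : ℤ) (n : ℕ) :
    (P.map fun ω k => ε k ω).map (psum (coordProcess g) (Finset.Ioc c (c + n))) =
      (P.map fun ω k => ε k ω).map (psum (coordProcess g) (Finset.Ioc 0 n)) := by
  have hm : ∀ I, Measurable (psum (coordProcess g) I) := fun I =>
    Finset.measurable_sum _ fun k _ => measurable_coordProcess hg k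
  rw [Measure.map_map (hm _) h.measurable_pi, Measure.map_map (hm _) h.measurable_pi]
  have hF : Measurable fun y : ℤ → ℝ => ∑ k ∈ Finset.Ioc (0 : ℤ) n, y k := by fun_prop
  have key := ((hs c).comp hF).map_eq
  refine Eq.trans ?_ key
  congr 1
  funext ω
  simp only [Function.comp_apply, psum]
  rw [show Finset.Ioc c (c + n) = (Finset.Ioc (0 : ℤ) n).map (addRightEmbedding c) by
    rw [Finset.map_add_right_Ioc, zero_add, add_comm], Finset.sum_map]
  rfl

theorem IsStationary.integral_mul_eq (h : IsIIDWithCopy ε ε' P) (hg : ∀ k, Measurable (g k))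
    (hs : IsStationary (process g ε) P) (i j : ℤ) :
    ∫ x, coordProcess g i x * coordProcess g j x ∂(P.map fun ω k => ε k ω) =
      ∫ x, coordProcess g 0 x * coordProcess g (j - i) x ∂(P.map fun ω k => ε k ω) := by
  have hm := measurable_coordProcess hg
  have m1 := hm i
  have m2 := hm j
  have m3 := hm 0
  have m4 := hm (j - i)
  rw [integral_map h.measurable_pi.aemeasurable (Measurable.aestronglyMeasurable (by fun_prop)),
    integral_map h.measurable_pi.aemeasurable (Measurable.aestronglyMeasurable (by fun_prop))]
  have hF : Measurable fun y : ℤ → ℝ => y 0 * y (j - i) := by fun_prop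
  have key := ((hs i).comp hF).integral_eq
  simp only [Function.comp_def, zero_add, sub_add_cancel] at key
  exact key

theorem longRunVariance_eq (h : IsIIDWithCopy ε ε' P) (hg : ∀ k, Measurable (g k)) :
    longRunVariance (process g ε) P =
      ∑' k, Model.gam (P.map fun ω k => ε k ω) (coordProcess g) k := by
  unfold longRunVariance Model.gam
  congr 1
  funext k
  have m1 := measurable_coordProcess hg k
  have m2 := measurable_coordProcess hg 0
  rw [integral_map h.measurable_pi.aemeasurable (Measurable.aestronglyMeasurable (by fun_prop))]
  rfl

/-- The law of the innovations carries the abstract model. -/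
theorem IsIIDWithCopy.model (h : IsIIDWithCopy ε ε' P) (hg : ∀ k, Measurable (g k))
    (hs : IsStationary (process g ε) P) (hp : 1 ≤ p) (ha : 0 ≤ a) (hb' : 0 ≤ b') (hbb : b' ≤ b)
    (hK : ∀ k, eLpNorm (process g ε k) (ENNReal.ofReal p) P ≤ K)
    (hmean : ∀ k, ∫ ω, process g ε k ω ∂P = 0)
    (hA : weightedSum a (depStar g ε ε' P p) ≤ A)
    (hD : weightedSum b (depPrime g ε ε' P p) ≤ D) :
    Model (P.map fun ω k => ε k ω) (coordProcess g)
      (coefOfDep (2 * K) (depPrime g ε ε' P p)) p b' (2 * K + D) := by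
  have hm := measurable_coordProcess hg
  have hme := h.measurable_pi.aemeasurable (μ := P)
  have : IsProbabilityMeasure (P.map fun ω k => ε k ω) := Measure.isProbabilityMeasure_map hme
  have hn : ∀ k, eLpNorm (coordProcess g k) (ENNReal.ofReal p) (P.map fun ω k => ε k ω) ≤ K := by
    intro k
    rw [eLpNorm_map_measure (hm k).aestronglyMeasurable hme]
    exact hK k
  have hnonneg : ∀ k, 0 ≤ coefOfDep (2 * K) (depPrime g ε ε' P p) k := by
    intro k
    unfold coefOfDep
    split_ifs <;> positivity
  refine ⟨h.swapInvariant, hm, dependsOn_coordProcess g, ?_, ?_, hnonneg, ?_, ?_, ?_, ?_, ?_,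
    IsStationary.map_psum_eq h hg hs, IsStationary.integral_mul_eq h hg hs⟩
  · intro k
    refine (hn k).trans ?_
    rw [← ENNReal.ofReal_coe_nnreal]
    exact ENNReal.ofReal_le_ofReal (by linarith [K.coe_nonneg, D.coe_nonneg])
  · intro k
    rw [integral_map hme (hm k).aestronglyMeasurable]
    exact hmean k
  · intro k hk
    rw [coefOfDep, if_pos hk]
  · simp [coefOfDep]
  · intro k j
    rcases lt_trichotomy k j with hkj | rfl | hkj
    · have h0 : infl (P.map fun ω k => ε k ω) (ENNReal.ofReal p) (coordProcess g k) {j} = 0 := by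
        unfold infl
        have e : (fun z : (ℤ → S) × (ℤ → S) => coordProcess g k z.1 -
            coordProcess g k (mix {j} z.1 z.2)) = 0 := by
          funext z
          rw [DependsOn.mix_eq (dependsOn_coordProcess g k) (by simpa using hkj), sub_self]
          rfl
        rw [e, eLpNorm_zero]
      rw [h0]
      exact zero_le
    -- The weighted sums start at lag one and say nothing about the current innovation, so lag zero
    -- is bounded by the triangle inequality; this is the value `2 * K` of the coefficient at 0.
    · have hmix := h.swapInvariant.mix {k}
      have mp := measurePreserving_fst (μ := P.map fun ω k => ε k ω) (ν := P.map fun ω k => ε k ω)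
      have m1 := hm k
      unfold infl
      refine (eLpNorm_sub_le (Measurable.aestronglyMeasurable (by fun_prop))
        (Measurable.aestronglyMeasurable (by fun_prop)) (by rwa [ENNReal.one_le_ofReal])).trans ?_
      have e1 := eLpNorm_comp_measurePreserving (p := ENNReal.ofReal p)
        (hm k).aestronglyMeasurable hmix
      have e2 := eLpNorm_comp_measurePreserving (p := ENNReal.ofReal p)
        (hm k).aestronglyMeasurable mp
      simp only [Function.comp_def] at e1 e2
      rw [e1, e2]
      refine (add_le_add (hn k) (hn k)).trans (le_of_eq ?_)
      rw [sub_self, coefOfDep, if_neg (lt_irrefl _), if_pos rfl, ← two_mul,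
        ENNReal.ofReal_mul (by norm_num), ENNReal.ofReal_coe_nnreal]
      simp
    · obtain ⟨l, hl⟩ : ∃ l : ℕ, j = k - ((l + 1 : ℕ) : ℤ) := ⟨(k - j - 1).toNat, by omega⟩
      subst hl
      refine (h.infl_singleton_le hg k (l + 1)).trans ?_
      rw [sub_sub_cancel, coefOfDep, if_neg (by omega), if_neg (by omega), Int.toNat_natCast,
        ENNReal.ofReal_toReal (ne_top_of_weightedSum_ne_top (hb'.trans hbb)
          (ne_top_of_le_ne_top ENNReal.coe_ne_top hD) l)]
  · intro r u hr hu
    refine (sum_coefOfDep_le (2 * K) hbb hb' hD hr u hu).trans ?_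
    have : (0 : ℝ) < r := by exact_mod_cast hr
    gcongr
    linarith [K.coe_nonneg]
  · intro k
    exact tendsto_of_tendsto_of_tendsto_of_le_of_le tendsto_const_nhds
      (tendsto_zero_of_weightedSum_ne_top ha (ne_top_of_le_ne_top ENNReal.coe_ne_top hA))
      (fun _ => zero_le) (fun l => h.infl_Iic_le hg k l)

theorem one_le_regConst {Θ : ℝ} (hΘ : 0 ≤ Θ) (hb1 : b < 1) : 1 ≤ regConst p b Θ := by
  have h1b : 0 < 1 - b := by linarith
  have a1 : 0 ≤ √(4 * smoothConst p) * √(2 / (2 * b - 1)) * Θ := by positivity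
  have a2 : 0 ≤ √(4 * smoothConst p) * (2 * Θ) := by positivity
  have a3 : 0 ≤ 2 * Θ ^ 2 / (1 - b) := by positivity
  unfold regConst
  linarith

/-- The form in which the threshold arises in `window_error_power_le`: `1/2 + α/p`, where `n^{-α}`
is the rate. -/
theorem boundary_eq (hp : 0 < p) : boundary p = 1 / 2 + (min p 3 - 2) / 2 / p := by
  unfold boundary
  field_simp
  ring

theorem boundary_lt_one (hp : 2 < p) : boundary p < 1 := by
  have h : (min p 3 - 2) / 2 / p < 1 / 2 := by
    rw [div_lt_iff₀ (by linarith)]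
    linarith [min_le_left p 3]
  rw [boundary_eq (by linarith)]
  linarith

theorem partialSum_process (n : ℕ) (ω : Ω) :
    partialSum (process g ε) n ω =
      psum (coordProcess g) (Finset.Ioc 0 (n : ℤ)) fun k => ε k ω := by
  unfold partialSum psum
  refine Finset.sum_bij (fun (k : ℕ) _ => (k : ℤ)) ?_ ?_ ?_ ?_
  · intro k hk
    rw [Finset.mem_Icc] at hk
    rw [Finset.mem_Ioc]
    omega
  · intro i _ j _ hij
    exact_mod_cast hij
  · intro k hk
    rw [Finset.mem_Ioc] at hk
    exact ⟨k.toNat, by rw [Finset.mem_Icc]; omega, by omega⟩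
  · intro k _
    rfl

end

end BernoulliShift

end

/-- The constant `C` is chosen before the probability space, the innovations and the functions
`g_k`: it depends only on `p`, `a`, `b`, on bounds `K`, `A`, `D` for the `L^p` norm and the two
sums, and on a positive lower bound `v` for the long-run variance. -/
theorem theorem2p1 (p a b : ℝ) (hp : 2 < p) (ha : 0 < a)
    (hb : BernoulliShift.boundary p < b) (K A D : ℝ≥0) (v : ℝ) (hv : 0 < v) :
    ∃ C : ℝ, 0 < C ∧
      ∀ (Ω : Type*) (S : Type*) [MeasurableSpace Ω] [MeasurableSpace S]
        (P : Measure Ω) [IsProbabilityMeasure P]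
        (ε ε' : ℤ → Ω → S) (g : ℤ → (ℕ → S) → ℝ),
        BernoulliShift.IsIIDWithCopy ε ε' P →
        (∀ k, Measurable (g k)) →
        BernoulliShift.IsStationary (BernoulliShift.process g ε) P →
        (∀ k, eLpNorm (BernoulliShift.process g ε k) (ENNReal.ofReal p) P ≤ K) →
        (∀ k, ∫ ω, BernoulliShift.process g ε k ω ∂P = 0) →
        BernoulliShift.weightedSum a (BernoulliShift.depStar g ε ε' P p) ≤ A →
        BernoulliShift.weightedSum b (BernoulliShift.depPrime g ε ε' P p) ≤ D →
        v ≤ BernoulliShift.longRunVariance (BernoulliShift.process g ε) P →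
        ∀ n : ℕ, 1 ≤ n →
          BernoulliShift.kolmogorovDist (BernoulliShift.process g ε) P n
            ≤ C * (n : ℝ) ^ (-(min p 3) / 2 + 1) := by
  have hB1 := BernoulliShift.boundary_lt_one hp
  have hBeq := BernoulliShift.boundary_eq (p := p) (by linarith)
  -- The exponent is lowered, if necessary, to lie strictly between the boundary and 1: the sums of
  -- `i^{-b'}` are estimated by `n^{1-b'} / (1 - b')`, and a smaller exponent only weakens the
  -- assumption on the coefficients.
  set b' := min b ((BernoulliShift.boundary p + 1) / 2) with hb'
  have hBb : BernoulliShift.boundary p < b' := lt_min hb (by linarith)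
  have hb1 : b' < 1 := (min_le_right _ _).trans_lt (by linarith)
  have hq : 2 < min p 3 := lt_min hp (by norm_num)
  have hhalf : 1 / 2 < b' := by
    have : 0 ≤ (min p 3 - 2) / 2 / p := div_nonneg (by linarith) (by linarith)
    linarith
  obtain ⟨C, hC, H⟩ := BernoulliShift.Regular.exists_abs_sub_cdf_le (q := min p 3) (b := b')
    (M := BernoulliShift.regConst p b' (2 * K + D)) hq (min_le_right _ _) (min_le_left _ _)
    (hBeq ▸ hBb) hb1 (BernoulliShift.one_le_regConst (by positivity) hb1) hv
  refine ⟨C + 1, by linarith, ?_⟩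
  intro Ω S _ _ P _ ε ε' g h hg hs hK hmean hA hD hvs n hn
  have : IsProbabilityMeasure (P.map fun ω k => ε k ω) :=
    Measure.isProbabilityMeasure_map h.measurable_pi.aemeasurable
  have hR := (h.model hg hs (by linarith) ha.le (by linarith) (min_le_left _ _ : b' ≤ b) hK hmean
    hA hD).regular hp hhalf hb1
  rw [← BernoulliShift.longRunVariance_eq h hg] at hR
  refine ciSup_le fun x => ?_
  have key := H S _ _ _ hR hvs n hn x
  rw [map_measureReal_apply h.measurable_pi
    (measurableSet_le (hR.measurable_psum _) measurable_const)] at key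
  simp only [Set.preimage_ofPred_eq, ← BernoulliShift.partialSum_process] at key
  rw [show -(min p 3) / 2 + 1 = -((min p 3 - 2) / 2) by ring]
  refine key.trans ?_
  gcongr
  linarith
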